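/- Let $n\in\{5,6\}$, $m>0$, $s\in\mathbb R\setminus\{0\}$ and let $\kappa\in\mathrm{so}(n)$, $\kappa\neq 0$. On $T^*S^{n-1}=\{(\gamma,p)\in\mathbb R^{2n}:\langle\gamma,\gamma\rangle=1,\ \langle p,\gamma\rangle=0\}$, with the restriction of the twisted symplectic form $\sum_i dp_i\wedge d\gamma_i+\mathbf F$, $\mathbf F=s\sum_{i<j}\kappa_{ij}\,d\gamma_i\wedge d\gamma_j$, consider the magnetic geodesic flow with Hamiltonian $H=\frac1{2m}\langle p,p\rangle$, that is, $$\dot\gamma=\tfrac1m p,\qquad \dot p=\tfrac sm\kappa p+\mu\gamma,\qquad \mu=\tfrac1m\big(s\langle p,\kappa\gamma\rangle-\langle p,p\rangle\big).$$ **Liouville integrability.** The flow is Liouville integrable: there are $n-1$ smooth first integrals, $H$ among them, which Poisson commute on $T^*S^{n-1}$ and are functionally independent on an open dense subset; they can be chosen polynomial of degree at most $3$ in the momenta. Now let $\mathbf F$ be in the normal form $\mathbf F=s\sum_{i=1}^{[n/2]}\kappa_{2i-1,2i}\,d\gamma_{2i-1}\wedge d\gamma_{2i}$ with all $\kappa_{2i-1,2i}\ge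 0$ and $\kappa_{12}\ne 0$, and put $$\Phi_{2i-1,2i}=\gamma_{2i-1}p_{2i}-\gamma_{2i}p_{2i-1}+\tfrac{s\kappa_{2i-1,2i}}2(\gamma_{2i-1}^2+\gamma_{2i}^2),\qquad J=\tfrac{s^2}{m^2}\sum_{i}\kappa_{2i-1,2i}^2(p_{2i-1}^2+p_{2i}^2)-\mu^2,$$ where in $J$ one takes $\mu=\tfrac sm\sum_i\kappa_{2i-1,2i}(p_{2i-1}\gamma_{2i}-p_{2i}\gamma_{2i-1})-2H$. If $n=5$, or if $n=6$ and $\kappa_{12},\kappa_{34},\kappa_{56}$ are not all equal, then $H$, $J$ and the $\Phi_{2i-1,2i}$, $i=1,\dots,[n/2]$, are $n-1$ such commuting, functionally independent first integrals. In all cases $\Phi_{2i-1,2i}$, $H$ and $J+4H^2$ are polynomials of degrees $1$, $2$ and $3$ in the momenta. **Noncommutative integrability.** Moreover, the flow is integrable in the noncommutative sense with $r$-dimensional tori in the following cases: (i) $n=5$, $\kappa_{12}=\kappa_{34}$, with $r=3$; (ii) $n=6$, $\kappa_{12}=\kappa_{34}\neq\kappa_{56}$, with $r=4$; (iii) $n=6$,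 $\kappa_{12}=\kappa_{34}=\kappa_{56}$, with $r=2$; (iv) $n=5$, $\kappa_{34}=0$, and $n=6$, $\kappa_{34}=\kappa_{56}=0$, with $r=3$. Here this means: there is an algebra $\mathcal F$ of smooth first integrals, containing $H$ and closed under the Poisson bracket on $T^*S^{n-1}$, such that on an open dense subset the differentials of the elements of $\mathcal F$ span a space of dimension $2(n-1)-r$ on which the Poisson bracket has an $r$-dimensional kernel; and generic motions are quasi-periodic over $r$-dimensional invariant isotropic tori: every point of some open dense subset of $T^*S^{n-1}$ lies on a smoothly embedded, isotropic, flow-invariant torus $\mathbb T^r$, contained in a common level set of $\mathcal F$, on which the flow is linear, $\theta\mapsto\theta+t\omega$. -/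

import Mathlib

open scoped Matrix ContDiff

namespace MagneticSphere

/-- Points `x = (γ, p)` of `ℝ²ⁿ`: the position is `x.1 = γ` and the momentum is `x.2 = p`. -/
abbrev Phase (n : ℕ) : Type := (Fin n → ℝ) × (Fin n → ℝ)

noncomputable section

/-! ### The phase space and its twisted symplectic form -/

/-- The constraint `φ₁ = ⟨γ, γ⟩`. -/
def phi1 {n : ℕ} (x : Phase n) : ℝ := x.1 ⬝ᵥ x.1

/-- The constraint `φ₂ = ⟨p, γ⟩`. -/
def phi2 {n : ℕ} (x : Phase n) : ℝ := x.2 ⬝ᵥ x.1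

/-- The cotangent bundle `T*Sⁿ⁻¹ = {φ₁ = 1, φ₂ = 0} ⊆ ℝ²ⁿ` of the unit sphere. -/
def cotangentSphere (n : ℕ) : Set (Phase n) := {x | phi1 x = 1 ∧ phi2 x = 0}

/-- The tangent space of `T*Sⁿ⁻¹` at `x = (γ, p)`: the vectors `(u, v)` with `⟨γ, u⟩ = 0` and
`⟨p, u⟩ + ⟨γ, v⟩ = 0`. -/
def tangentSpace {n : ℕ} (x : Phase n) : Submodule ℝ (Phase n) where
  carrier := {w | x.1 ⬝ᵥ w.1 = 0 ∧ x.2 ⬝ᵥ w.1 + x.1 ⬝ᵥ w.2 = 0}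
  add_mem' := by
    rintro a b ⟨ha, ha'⟩ ⟨hb, hb'⟩
    refine ⟨by simp [ha, hb], ?_⟩
    simp only [Prod.fst_add, Prod.snd_add, dotProduct_add]
    linarith
  zero_mem' := by simp
  smul_mem' := by
    rintro c a ⟨ha, ha'⟩
    refine ⟨by simp [ha], ?_⟩
    simp only [Prod.smul_fst, Prod.smul_snd, dotProduct_smul, smul_eq_mul]
    rw [← mul_add, ha', mul_zero]

/-- The twisted symplectic form `Ω + F`, where `Ω = ∑ dpᵢ ∧ dγᵢ` and
`F = s ∑_{i<j} κᵢⱼ dγᵢ ∧ dγⱼ` (for skew-symmetric `κ`, `F(u, u') = s ⟨u, κ u'⟩`). -/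
def twistedForm {n : ℕ} (s : ℝ) (κ : Matrix (Fin n) (Fin n) ℝ) (w w' : Phase n) : ℝ :=
  (w.2 ⬝ᵥ w'.1 - w.1 ⬝ᵥ w'.2) + s * (w.1 ⬝ᵥ (κ *ᵥ w'.1))

/-- A property holds generically on `T*Sⁿ⁻¹` if it holds on a (relatively) open dense subset. -/
def Generically (n : ℕ) (P : Phase n → Prop) : Prop :=
  ∃ U : Set (Phase n), IsOpen U ∧ cotangentSphere n ⊆ closure (U ∩ cotangentSphere n) ∧
    ∀ x ∈ U ∩ cotangentSphere n, P x

/-! ### Magnetic Poisson brackets -/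

/-- The partial derivative `∂F/∂γᵢ`. -/
def dPos {n : ℕ} (F : Phase n → ℝ) (x : Phase n) (i : Fin n) : ℝ :=
  fderiv ℝ F x (Pi.single i 1, 0)

/-- The partial derivative `∂F/∂pᵢ`. -/
def dMom {n : ℕ} (F : Phase n → ℝ) (x : Phase n) (i : Fin n) : ℝ :=
  fderiv ℝ F x (0, Pi.single i 1)

/-- The magnetic Poisson bracket `{F, G}^κ` of `(ℝ²ⁿ, Ω + F)`. -/
def magneticBracket {n : ℕ} (s : ℝ) (κ : Matrix (Fin n) (Fin n) ℝ) (F G : Phase n → ℝ)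
    (x : Phase n) : ℝ :=
  ∑ i, (dPos F x i * dMom G x i - dMom F x i * dPos G x i)
    + s * ∑ i, ∑ j, κ i j * dMom F x i * dMom G x j

/-- The Dirac magnetic Poisson bracket `{F, G}_d`, defined where `φ₁ ≠ 0`. The constraints are
Casimir functions, and on `T*Sⁿ⁻¹` it is the Poisson bracket of the restricted twisted form. -/
def diracBracket {n : ℕ} (s : ℝ) (κ : Matrix (Fin n) (Fin n) ℝ) (F G : Phase n → ℝ)
    (x : Phase n) : ℝ :=
  magneticBracket s κ F G x
    - (magneticBracket s κ F phi1 x * magneticBracket s κ G phi2 x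
        - magneticBracket s κ F phi2 x * magneticBracket s κ G phi1 x)
      / magneticBracket s κ phi1 phi2 x

/-! ### The magnetic geodesic flow -/

/-- The Hamiltonian `H = ⟨p, p⟩ / (2m)`. -/
def hamiltonian {n : ℕ} (m : ℝ) (x : Phase n) : ℝ := 1 / (2 * m) * (x.2 ⬝ᵥ x.2)

/-- The Lagrange multiplier `μ = (s ⟨p, κγ⟩ - ⟨p, p⟩) / m`. -/
def multiplier {n : ℕ} (m s : ℝ) (κ : Matrix (Fin n) (Fin n) ℝ) (x : Phase n) : ℝ :=
  1 / m * (s * (x.2 ⬝ᵥ (κ *ᵥ x.1)) - x.2 ⬝ᵥ x.2)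

/-- The vector field `γ' = p / m`, `p' = (s / m) κ p + μ γ` of the magnetic geodesic flow on
`T*Sⁿ⁻¹`. -/
def flowField {n : ℕ} (m s : ℝ) (κ : Matrix (Fin n) (Fin n) ℝ) (x : Phase n) : Phase n :=
  ((1 / m) • x.2, (s / m) • (κ *ᵥ x.2) + multiplier m s κ x • x.1)

/-- Motions of the magnetic geodesic flow. -/
def IsMotion {n : ℕ} (m s : ℝ) (κ : Matrix (Fin n) (Fin n) ℝ) (c : ℝ → Phase n) : Prop :=
  ∀ t, c t ∈ cotangentSphere n ∧ HasDerivAt c (flowField m s κ (c t)) t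

/-- First integrals of the magnetic geodesic flow on `T*Sⁿ⁻¹`. -/
def IsFirstIntegral {n : ℕ} (m s : ℝ) (κ : Matrix (Fin n) (Fin n) ℝ) (f : Phase n → ℝ) : Prop :=
  ∀ x ∈ cotangentSphere n, fderiv ℝ f x (flowField m s κ x) = 0

/-! ### Liouville integrability

A smooth function on the closed submanifold `T*Sⁿ⁻¹` is represented by a smooth function on `ℝ²ⁿ`;
only its restriction matters in the conditions below. -/

/-- The differential at `x` of the restriction of `f` to `T*Sⁿ⁻¹`. -/
def differential {n : ℕ} (f : Phase n → ℝ) (x : Phase n) : Module.Dual ℝ (tangentSpace x) :=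
  (fderiv ℝ f x).toLinearMap.domRestrict (tangentSpace x)

/-- `f` is a complete involutive system for the magnetic geodesic flow: `n - 1 = dim Sⁿ⁻¹` smooth
first integrals that Poisson commute on `T*Sⁿ⁻¹` and are functionally independent on an open dense
subset of it. -/
structure IsLiouvilleSystem {n : ℕ} (m s : ℝ) (κ : Matrix (Fin n) (Fin n) ℝ) {ι : Type} [Fintype ι]
    (f : ι → Phase n → ℝ) : Prop where
  card : Fintype.card ι + 1 = n
  smooth : ∀ i, ContDiff ℝ ∞ (f i)
  integral : ∀ i, IsFirstIntegral m s κ (f i)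
  commute : ∀ i j, ∀ x ∈ cotangentSphere n, diracBracket s κ (f i) (f j) x = 0
  independent : Generically n fun x => LinearIndependent ℝ fun i => differential (f i) x

/-- `f(γ, p)` is a polynomial in `(γ, p)` whose degree in the momenta `p` is `d`: it is given by a
polynomial of total degree `d` in `p` whose coefficients are polynomials in `γ`. -/
def HasMomentumDegree {n : ℕ} (d : ℕ) (f : Phase n → ℝ) : Prop :=
  ∃ P : MvPolynomial (Fin n) (MvPolynomial (Fin n) ℝ), P.totalDegree = d ∧
    ∀ x : Phase n, f x = MvPolynomial.eval x.2 (MvPolynomial.map (MvPolynomial.eval x.1) P)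

/-- Liouville integrability by means of the Hamiltonian and further first integrals, all of them
polynomials of degree at most `3` in the momenta. -/
def IsLiouvilleIntegrable {n : ℕ} (m s : ℝ) (κ : Matrix (Fin n) (Fin n) ℝ) : Prop :=
  ∃ f : Fin (n - 1) → Phase n → ℝ, IsLiouvilleSystem m s κ f ∧ (∃ i, f i = hamiltonian m) ∧
    ∀ i, ∃ d ≤ 3, HasMomentumDegree d (f i)

/-! ### Noncommutative integrability -/

/-- The dimension of the span at `x` of the differentials of the functions in `𝓕`. -/
def ddimAt {n : ℕ} (𝓕 : Subalgebra ℝ (Phase n → ℝ)) (x : Phase n) : ℕ :=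
  Module.finrank ℝ (Submodule.span ℝ {ξ | ∃ f ∈ 𝓕, ξ = differential f x})

/-- The dimension of the kernel of the Poisson bracket on the span at `x` of the differentials of
the functions in `𝓕`. -/
def dindAt {n : ℕ} (s : ℝ) (κ : Matrix (Fin n) (Fin n) ℝ) (𝓕 : Subalgebra ℝ (Phase n → ℝ))
    (x : Phase n) : ℕ :=
  Module.finrank ℝ (Submodule.span ℝ
    {ξ | ∃ f ∈ 𝓕, (∀ g ∈ 𝓕, diracBracket s κ f g x = 0) ∧ ξ = differential f x})

/-- `𝓕` is a complete algebra of first integrals with differential index `r`: it consists of smooth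
first integrals, contains the Hamiltonian, is closed under the Poisson bracket of `T*Sⁿ⁻¹`, and
generically `dind 𝓕 = r` and `ddim 𝓕 + dind 𝓕 = dim T*Sⁿ⁻¹ = 2 (n - 1)`. -/
structure IsCompleteAlgebra {n : ℕ} (m s : ℝ) (κ : Matrix (Fin n) (Fin n) ℝ) (r : ℕ)
    (𝓕 : Subalgebra ℝ (Phase n → ℝ)) : Prop where
  smooth : ∀ f ∈ 𝓕, ContDiff ℝ ∞ f
  integral : ∀ f ∈ 𝓕, IsFirstIntegral m s κ f
  hamiltonian_mem : hamiltonian m ∈ 𝓕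
  bracket_mem : ∀ f ∈ 𝓕, ∀ g ∈ 𝓕, ∃ h ∈ 𝓕, ∀ x ∈ cotangentSphere n, diracBracket s κ f g x = h x
  complete : Generically n fun x => dindAt s κ 𝓕 x = r ∧ ddimAt 𝓕 x + dindAt s κ 𝓕 x = 2 * (n - 1)

/-- `φ` parametrizes (by angles modulo `1`) an embedded `r`-dimensional torus in `T*Sⁿ⁻¹` that is
isotropic for the twisted symplectic form and invariant under the magnetic geodesic flow, which is
on it the linear flow `θ ↦ θ + t • freq`. -/
structure IsQuasiPeriodicTorus {n : ℕ} (m s : ℝ) (κ : Matrix (Fin n) (Fin n) ℝ) {r : ℕ}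
    (φ : (Fin r → ℝ) → Phase n) (freq : Fin r → ℝ) : Prop where
  smooth : ContDiff ℝ ∞ φ
  mem : ∀ θ, φ θ ∈ cotangentSphere n
  eq_iff : ∀ θ θ', φ θ = φ θ' ↔ ∃ k : Fin r → ℤ, ∀ i, θ' i = θ i + k i
  immersion : ∀ θ, Function.Injective (fderiv ℝ φ θ)
  isotropic : ∀ θ u v, twistedForm s κ (fderiv ℝ φ θ u) (fderiv ℝ φ θ v) = 0
  linear_flow : ∀ θ, IsMotion m s κ fun t => φ (θ + t • freq)

/-- Noncommutative integrability with `r`-dimensional tori: there is a complete algebra of first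
integrals with `dind = r`, and generic points lie on invariant isotropic `r`-dimensional tori, inside
the common level sets of the first integrals, on which the motions are quasi-periodic. -/
def IsNoncommutativelyIntegrable {n : ℕ} (m s : ℝ) (κ : Matrix (Fin n) (Fin n) ℝ) (r : ℕ) : Prop :=
  ∃ 𝓕 : Subalgebra ℝ (Phase n → ℝ), IsCompleteAlgebra m s κ r 𝓕 ∧
    Generically n fun x => ∃ (φ : (Fin r → ℝ) → Phase n) (freq : Fin r → ℝ),
      IsQuasiPeriodicTorus m s κ φ freq ∧ x ∈ Set.range φ ∧ ∀ f ∈ 𝓕, ∀ θ, f (φ θ) = f x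

/-! ### Normal form of the field and the explicit integrals

Coordinates are numbered from `0`: the `i`-th block `(γ₂ᵢ₋₁, γ₂ᵢ)`, `i = 1, …, [n/2]`, of the usual
numbering is the pair of coordinates `fstIdx i`, `sndIdx i`, with `i = 0, …, [n/2] - 1`. -/

/-- The first coordinate of the `i`-th block. -/
def fstIdx {n : ℕ} (i : Fin (n / 2)) : Fin n := ⟨2 * i.val, by omega⟩

/-- The second coordinate of the `i`-th block. -/
def sndIdx {n : ℕ} (i : Fin (n / 2)) : Fin n := ⟨2 * i.val + 1, by omega⟩

/-- The skew-symmetric matrix of `κ₁₂ dγ₁ ∧ dγ₂ + κ₃₄ dγ₃ ∧ dγ₄ + ⋯`, where `k = (κ₁₂, κ₃₄, …)`. -/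
def normalForm (n : ℕ) (k : Fin (n / 2) → ℝ) : Matrix (Fin n) (Fin n) ℝ :=
  ∑ i, (Matrix.single (fstIdx i) (sndIdx i) (k i) - Matrix.single (sndIdx i) (fstIdx i) (k i))

/-- The gauge Noether integral
`Φ₂ᵢ₋₁,₂ᵢ = γ₂ᵢ₋₁ p₂ᵢ - γ₂ᵢ p₂ᵢ₋₁ + (s κ₂ᵢ₋₁,₂ᵢ / 2) (γ₂ᵢ₋₁² + γ₂ᵢ²)`. -/
def noether (n : ℕ) (s : ℝ) (k : Fin (n / 2) → ℝ) (i : Fin (n / 2)) (x : Phase n) : ℝ :=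
  x.1 (fstIdx i) * x.2 (sndIdx i) - x.1 (sndIdx i) * x.2 (fstIdx i)
    + s * k i / 2 * (x.1 (fstIdx i) ^ 2 + x.1 (sndIdx i) ^ 2)

/-- The integral `J = (s² / m²) ∑ κ₂ᵢ₋₁,₂ᵢ² (p₂ᵢ₋₁² + p₂ᵢ²) - μ²`, where
`μ = (s / m) ∑ κ₂ᵢ₋₁,₂ᵢ (p₂ᵢ₋₁ γ₂ᵢ - p₂ᵢ γ₂ᵢ₋₁) - 2H`. -/
def integralJ (n : ℕ) (m s : ℝ) (k : Fin (n / 2) → ℝ) (x : Phase n) : ℝ :=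
  s ^ 2 / m ^ 2 * ∑ i, k i ^ 2 * (x.2 (fstIdx i) ^ 2 + x.2 (sndIdx i) ^ 2)
    - (s / m * ∑ i, k i * (x.2 (fstIdx i) * x.1 (sndIdx i) - x.2 (sndIdx i) * x.1 (fstIdx i))
        - 2 * hamiltonian m x) ^ 2

/-- The family of integrals `H`, `J`, `Φ₁₂`, `Φ₃₄`, …. -/
def integrals (n : ℕ) (m s : ℝ) (k : Fin (n / 2) → ℝ) : Fin 2 ⊕ Fin (n / 2) → Phase n → ℝ :=
  Sum.elim ![hamiltonian m, integralJ n m s k] (noether n s k)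

/-- The integrals `Φ₂ᵢ₋₁,₂ᵢ`, `H` and `J + 4H²` are polynomials of degrees `1`, `2` and `3` in the
momenta. -/
def HasIntegralDegrees (n : ℕ) (m s : ℝ) (k : Fin (n / 2) → ℝ) : Prop :=
  (∀ i, HasMomentumDegree 1 (noether n s k i)) ∧
    HasMomentumDegree 2 (hamiltonian (n := n) m) ∧
    HasMomentumDegree 3 (fun x => integralJ n m s k x + 4 * hamiltonian m x ^ 2)

end

end MagneticSphere

namespace MagneticSphere

/-! ### Calculus along curves -/

section Calculus

variable {n : ℕ}

/-! The proof rests on the symmetries of the constant field. A skew-symmetric matrix `A` commuting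
with `κ` generates rotations `(γ, p) ↦ (Aγ, Ap)` which preserve both `H` and the twisted form. The
gauge term in Φ_A (`gaugeNoether`) makes this rotation its Hamiltonian vector
(`fderiv_gaugeNoether_eq_twistedForm`), so Φ_A is conserved and {Φ_B, Φ_A} is the integral of the
commutator `BA - AB`. The integral `J` (`fieldIntegral`) is conserved because |κp|² and μ² change at
proportional rates, and it is invariant under all symmetries. Hence `H`, `J` and all Φ_A generate an
algebra closed under the bracket, in which `H` and `J` are central. Brackets are computed by
`diracBracket_eq_fderiv`: on the constraint set the Dirac bracket is the derivative along the
Hamiltonian vector of the restricted form.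

All generic statements concern analytic functions. An analytic retraction of the connected set {γ ≠
0} onto T*Sⁿ⁻¹ gives an identity theorem there (`generically_ne_zero`), so each independence claim
needs only one explicit point.

For Liouville integrability, `κ` is put into normal form by maximizing |κu|² on successive
orthogonal complements (`exists_invariant_plane`). The rotations of the invariant planes commute,
and with `H` and `J` (or `J + 4H²`, whose quartic part cancels) they give n - 1 integrals. They are
independent unless n = 6 and all strengths agree. In that case `J` is a function of `H` and the Φ's
on T*S⁵, and a Casimir function of the unitary symmetries of two of the complex lines takes its
place (`IsFrame.isLiouvilleSystem_casimir`).

Completeness of the algebra is a dimension count (`dindAt_and_ddimAt`): the span of the central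
differentials cannot exceed the codimension of the full span, so enough independent integrals of
both kinds at one point each determine both dimensions.

For the tori, suppose first that κ² has two eigenvalues -ka², -kb², and let `Q` be the projection to
the first eigenspace. The quantity ρ = ⟨γ, Qγ⟩ obeys a Newton equation with cubic P, (mρ'/2)² = P(ρ)
(`IsSplitting.isCubicMotion`), so it is periodic when P has no multiple root and the radial velocity
does not vanish (`IsCubicMotion.exists_period`). One then chooses orthogonal invariant planes
adapted to the initial point, so that all Φ_A there are combinations of the Φ's of these planes.
Conservation laws force the share of every plane in the position to be a function of ρ alone, and
when the reduced state recurs the phase point recurs up to a rotation in the planes (if the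
complement is a line, possibly only after two periods). Such relative periodicity produces a torus
of dimension one more than the number of planes (`IsFrame.exists_isQuasiPeriodicTorus`). If n = 6
and all strengths agree there is no ρ to follow: every generic motion is itself an orbit of
rotations in two adapted planes, and the tori are two-dimensional
(`IsSplitting.exists_torus_of_eq_one`). -/

theorem hasDerivAt_dotProduct {f g : ℝ → Fin n → ℝ} {f' g' : Fin n → ℝ} {t : ℝ}
    (hf : HasDerivAt f f' t) (hg : HasDerivAt g g' t) :
    HasDerivAt (fun t => f t ⬝ᵥ g t) (f' ⬝ᵥ g t + f t ⬝ᵥ g') t := by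
  have h := HasDerivAt.fun_sum (u := Finset.univ) (fun i _ =>
    ((hasDerivAt_pi.1 hf i).mul (hasDerivAt_pi.1 hg i)))
  simpa [dotProduct, Finset.sum_add_distrib] using h

theorem hasDerivAt_mulVec (A : Matrix (Fin n) (Fin n) ℝ) {f : ℝ → Fin n → ℝ} {f' : Fin n → ℝ}
    {t : ℝ} (hf : HasDerivAt f f' t) : HasDerivAt (fun t => A *ᵥ f t) (A *ᵥ f') t :=
  ((LinearMap.toContinuousLinearMap A.mulVecLin).hasFDerivAt (x := f t)).comp_hasDerivAt t hf

theorem contDiff_dotProduct {E : Type*} [NormedAddCommGroup E] [NormedSpace ℝ E]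
    {k : WithTop ℕ∞} {f g : E → Fin n → ℝ} (hf : ContDiff ℝ k f) (hg : ContDiff ℝ k g) :
    ContDiff ℝ k (fun x => f x ⬝ᵥ g x) := by
  unfold dotProduct
  fun_prop

theorem contDiff_mulVec {E : Type*} [NormedAddCommGroup E] [NormedSpace ℝ E]
    {k : WithTop ℕ∞} (A : Matrix (Fin n) (Fin n) ℝ) {f : E → Fin n → ℝ} (hf : ContDiff ℝ k f) :
    ContDiff ℝ k (fun x => A *ᵥ f x) :=
  (LinearMap.toContinuousLinearMap A.mulVecLin).contDiff.comp hf

theorem hasDerivAt_line (x w : Phase n) : HasDerivAt (fun t : ℝ => x + t • w) w 0 := by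
  simpa using ((hasDerivAt_id (0 : ℝ)).smul_const w).const_add x

theorem hasDerivAt_fst {c : ℝ → Phase n} {c' : Phase n} {t : ℝ} (h : HasDerivAt c c' t) :
    HasDerivAt (fun t => (c t).1) c'.1 t :=
  (hasFDerivAt_fst (𝕜 := ℝ) (p := c t)).comp_hasDerivAt t h

theorem hasDerivAt_snd {c : ℝ → Phase n} {c' : Phase n} {t : ℝ} (h : HasDerivAt c c' t) :
    HasDerivAt (fun t => (c t).2) c'.2 t :=
  (hasFDerivAt_snd (𝕜 := ℝ) (p := c t)).comp_hasDerivAt t h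

/-- A directional derivative is the derivative along the corresponding line. -/
theorem fderiv_apply_eq_of_hasDerivAt {f : Phase n → ℝ} {x w : Phase n} {d : ℝ}
    (hf : DifferentiableAt ℝ f x) (h : HasDerivAt (fun t : ℝ => f (x + t • w)) d 0) :
    fderiv ℝ f x w = d := by
  have h0 : HasFDerivAt f (fderiv ℝ f x) (x + (0 : ℝ) • w) := by simpa using hf.hasFDerivAt
  exact (h0.comp_hasDerivAt 0 (hasDerivAt_line x w)).unique h

theorem hasDerivAt_comp_curve {f : Phase n → ℝ} {c : ℝ → Phase n} {c' : Phase n} {t : ℝ}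
    (hf : Differentiable ℝ f) (h : HasDerivAt c c' t) :
    HasDerivAt (fun t => f (c t)) (fderiv ℝ f (c t) c') t :=
  (hf (c t)).hasFDerivAt.comp_hasDerivAt t h

end Calculus

/-! ### Skew-symmetric matrices -/

section Skew

variable {n : ℕ} {A B : Matrix (Fin n) (Fin n) ℝ}

theorem dotProduct_mulVec_skew (hA : Aᵀ = -A) (u v : Fin n → ℝ) :
    u ⬝ᵥ (A *ᵥ v) = -((A *ᵥ u) ⬝ᵥ v) := by
  rw [Matrix.dotProduct_mulVec, ← Matrix.mulVec_transpose, hA, Matrix.neg_mulVec, neg_dotProduct]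

theorem dotProduct_mulVec_self_skew (hA : Aᵀ = -A) (u : Fin n → ℝ) : u ⬝ᵥ (A *ᵥ u) = 0 := by
  have h := dotProduct_mulVec_skew hA u u
  rw [dotProduct_comm (A *ᵥ u) u] at h
  linarith

theorem mulVec_comm_of_commute (h : A * B = B * A) (u : Fin n → ℝ) :
    A *ᵥ (B *ᵥ u) = B *ᵥ (A *ᵥ u) := by
  rw [Matrix.mulVec_mulVec, h, ← Matrix.mulVec_mulVec]

end Skew

/-! ### Generic properties -/

section Generic

variable {n : ℕ}

theorem Generically.mono {P Q : Phase n → Prop} (h : Generically n P)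
    (hPQ : ∀ x ∈ cotangentSphere n, P x → Q x) : Generically n Q := by
  obtain ⟨U, hU, hd, hP⟩ := h
  exact ⟨U, hU, hd, fun x hx => hPQ x hx.2 (hP x hx)⟩

theorem Generically.and {P Q : Phase n → Prop} (hP : Generically n P) (hQ : Generically n Q) :
    Generically n fun x => P x ∧ Q x := by
  obtain ⟨U, hU, hdU, hPU⟩ := hP
  obtain ⟨V, hV, hdV, hQV⟩ := hQ
  refine ⟨U ∩ V, hU.inter hV, fun x hx => ?_, fun x hx => ⟨hPU x ⟨hx.1.1, hx.2⟩, hQV x ⟨hx.1.2, hx.2⟩⟩⟩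
  rw [mem_closure_iff]
  intro W hW hxW
  obtain ⟨y, hyW, hyU, hy⟩ := mem_closure_iff.1 (hdU hx) W hW hxW
  obtain ⟨z, ⟨hzW, hzU⟩, hzV, hz⟩ := mem_closure_iff.1 (hdV hy) (W ∩ U) (hW.inter hU) ⟨hyW, hyU⟩
  exact ⟨z, hzW, ⟨hzU, hzV⟩, hz⟩

/-- The retraction `(a, b) ↦ (a / |a|, b - ⟨b, a⟩ a / |a|²)` onto `T*Sⁿ⁻¹`. -/
noncomputable def retraction (x : Phase n) : Phase n :=
  ((Real.sqrt (x.1 ⬝ᵥ x.1))⁻¹ • x.1, x.2 - ((x.2 ⬝ᵥ x.1) / (x.1 ⬝ᵥ x.1)) • x.1)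

theorem dotProduct_self_pos {v : Fin n → ℝ} (h : v ≠ 0) : 0 < v ⬝ᵥ v :=
  lt_of_le_of_ne (Finset.sum_nonneg fun _ _ => mul_self_nonneg _)
    (fun h0 => h (dotProduct_self_eq_zero.1 h0.symm))

theorem dotProduct_self_nonneg' (v : Fin n → ℝ) : 0 ≤ v ⬝ᵥ v :=
  Finset.sum_nonneg fun _ _ => mul_self_nonneg _

theorem retraction_mem {x : Phase n} (hx : x.1 ≠ 0) : retraction x ∈ cotangentSphere n := by
  have h := dotProduct_self_pos hx
  have hs := Real.sqrt_pos.2 h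
  have hss := Real.mul_self_sqrt h.le
  constructor
  · simp only [phi1, retraction, smul_dotProduct, dotProduct_smul, smul_eq_mul]
    field_simp
    rw [sq, hss]
  · simp only [phi2, retraction, sub_dotProduct, smul_dotProduct, dotProduct_smul, smul_eq_mul]
    field_simp
    ring

theorem retraction_eq_self {x : Phase n} (hx : x ∈ cotangentSphere n) : retraction x = x := by
  obtain ⟨h1, h2⟩ := hx
  simp only [phi1, phi2] at h1 h2
  ext i <;> simp [retraction, h1, h2]

theorem fst_ne_zero_of_mem {x : Phase n} (hx : x ∈ cotangentSphere n) : x.1 ≠ 0 := by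
  intro h
  have := hx.1
  simp [phi1, h] at this

/-- The order `ω` is the point here: pulling an analytic function back by the retraction leaves it
analytic, so the identity theorem can be applied on an open set of a vector space instead of on a
manifold. -/
theorem contDiffAt_retraction {x : Phase n} (hx : x.1 ≠ 0) :
    ContDiffAt ℝ ω (retraction (n := n)) x := by
  have h := dotProduct_self_pos hx
  have h1 : ContDiffAt ℝ ω (fun x : Phase n => x.1 ⬝ᵥ x.1) x :=
    (contDiff_dotProduct contDiff_fst contDiff_fst).contDiffAt
  have h2 : ContDiffAt ℝ ω (fun x : Phase n => x.2 ⬝ᵥ x.1) x :=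
    (contDiff_dotProduct contDiff_snd contDiff_fst).contDiffAt
  unfold retraction
  refine ContDiffAt.prodMk (ContDiffAt.smul (ContDiffAt.inv (h1.sqrt h.ne') ?_) contDiffAt_fst)
    (contDiffAt_snd.sub (ContDiffAt.smul (h2.div h1 h.ne') contDiffAt_fst))
  exact (Real.sqrt_pos.2 h).ne'

theorem isPreconnected_fst_ne_zero (hn : 2 ≤ n) : IsPreconnected {x : Phase n | x.1 ≠ 0} := by
  have h1 : IsPreconnected ({0}ᶜ : Set (Fin n → ℝ)) :=
    (isConnected_compl_singleton_of_one_lt_rank (by simp; omega) 0).isPreconnected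
  have h2 := h1.prod (isPreconnected_univ (α := Fin n → ℝ))
  convert h2 using 1
  ext x
  simp

/-- An analytic function which does not vanish identically on `T*Sⁿ⁻¹` is generically nonzero. -/
theorem generically_ne_zero (hn : 2 ≤ n) {f : Phase n → ℝ} (hf : ContDiff ℝ ω f) {x₀ : Phase n}
    (hx₀ : x₀ ∈ cotangentSphere n) (h₀ : f x₀ ≠ 0) : Generically n fun x => f x ≠ 0 := by
  refine ⟨{x | f x ≠ 0}, isOpen_ne_fun hf.continuous continuous_const, fun x hx => ?_,
    fun x hx => hx.1⟩
  by_contra hcl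
  have hU : {x : Phase n | x.1 ≠ 0} ∈ nhds x :=
    (isOpen_ne_fun continuous_fst continuous_const).mem_nhds (fst_ne_zero_of_mem hx)
  -- If `x` were not in the closure, `f` would vanish on T*Sⁿ⁻¹ near `x`, so its pullback would
  -- vanish on a full neighbourhood of `x`. The identity theorem then carries this to `x₀`.
  have hev : (fun y => f (retraction y)) =ᶠ[nhds x] 0 := by
    have hc : ContinuousAt (retraction (n := n)) x :=
      (contDiffAt_retraction (fst_ne_zero_of_mem hx)).continuousAt
    have : {y | y ∉ closure ({x | f x ≠ 0} ∩ cotangentSphere n)} ∈ nhds (retraction x) := by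
      rw [retraction_eq_self hx]
      exact isClosed_closure.isOpen_compl.mem_nhds hcl
    filter_upwards [hc this, hU] with y hy hy'
    by_contra hne
    exact hy (subset_closure ⟨hne, retraction_mem hy'⟩)
  have han : AnalyticOnNhd ℝ (fun y => f (retraction y)) {x : Phase n | x.1 ≠ 0} := fun y hy =>
    ContDiffAt.analyticAt (hf.contDiffAt.comp y (contDiffAt_retraction hy))
  have := han.eqOn_zero_of_preconnected_of_eventuallyEq_zero (isPreconnected_fst_ne_zero hn)
    (fst_ne_zero_of_mem hx) hev (fst_ne_zero_of_mem hx₀)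
  simp only [retraction_eq_self hx₀, Pi.zero_apply] at this
  exact h₀ this

end Generic

/-! ### The tangent spaces and generic independence -/

section Tangent

variable {n : ℕ}

theorem mem_tangentSpace {x w : Phase n} :
    w ∈ tangentSpace x ↔ x.1 ⬝ᵥ w.1 = 0 ∧ x.2 ⬝ᵥ w.1 + x.1 ⬝ᵥ w.2 = 0 := Iff.rfl

/-- The projection `(u, v) ↦ (u - ⟨γ, u⟩ γ, v - c γ)` to the tangent space at `x = (γ, p)`. -/
def tangentProj (x w : Phase n) : Phase n :=
  (w.1 - (x.1 ⬝ᵥ w.1) • x.1,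
    w.2 - (x.2 ⬝ᵥ (w.1 - (x.1 ⬝ᵥ w.1) • x.1) + x.1 ⬝ᵥ w.2) • x.1)

theorem tangentProj_mem {x : Phase n} (hx : x ∈ cotangentSphere n) (w : Phase n) :
    tangentProj x w ∈ tangentSpace x := by
  obtain ⟨h1, h2⟩ := hx
  simp only [phi1, phi2] at h1 h2
  constructor
  · simp [tangentProj, h1]
  · simp [tangentProj, h1, h2]

theorem tangentProj_eq_self {x w : Phase n} (hw : w ∈ tangentSpace x) : tangentProj x w = w := by
  obtain ⟨h1, h2⟩ := hw
  ext i <;> simp [tangentProj, h1, h2]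

theorem contDiff_tangentProj (w : Phase n) : ContDiff ℝ ω (fun x => tangentProj x w) := by
  have h1 : ContDiff ℝ ω (fun x : Phase n => w.1 - (x.1 ⬝ᵥ w.1) • x.1) :=
    contDiff_const.sub ((contDiff_dotProduct contDiff_fst contDiff_const).smul contDiff_fst)
  exact h1.prodMk (contDiff_const.sub (((contDiff_dotProduct contDiff_snd h1).add
    (contDiff_dotProduct contDiff_fst contDiff_const)).smul contDiff_fst))

/-- The joint evaluation map from `V` to ℝ^ι is onto because its transpose, which sends coefficients
to combinations of the functionals, is injective. The test vectors obtained here stay fixed while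
the base point varies. -/
theorem exists_dual_of_linearIndependent {ι : Type*} [Fintype ι] [DecidableEq ι] {V : Type*}
    [AddCommGroup V] [Module ℝ V] [FiniteDimensional ℝ V] {ξ : ι → Module.Dual ℝ V}
    (h : LinearIndependent ℝ ξ) : ∃ w : ι → V, ∀ i j, ξ i (w j) = if i = j then 1 else 0 := by
  have h1 : ∀ j, ∃ w : V, ∀ i, ξ i w = if i = j then 1 else 0 := by
    intro j
    have : Function.Surjective (LinearMap.pi ξ) := by
      rw [← LinearMap.dualMap_injective_iff]
      intro f g hfg
      have key : ∀ f : Module.Dual ℝ (ι → ℝ), (LinearMap.pi ξ).dualMap f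
          = ∑ i, f (Pi.single i 1) • ξ i := by
        intro f
        ext v
        simp only [LinearMap.dualMap_apply, LinearMap.sum_apply, LinearMap.smul_apply, smul_eq_mul]
        conv_lhs => rw [show LinearMap.pi ξ v = ∑ i, (ξ i v) • Pi.single i (1 : ℝ) by
          ext k; simp [Finset.sum_apply, Pi.single_apply]]
        rw [map_sum]
        exact Finset.sum_congr rfl fun i _ => by rw [map_smul, smul_eq_mul, mul_comm]
      rw [key, key] at hfg
      have h2 := Fintype.linearIndependent_iff.1 h (fun i => f (Pi.single i 1) - g (Pi.single i 1))
        (by simp only [sub_smul, Finset.sum_sub_distrib, hfg, sub_self])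
      refine LinearMap.pi_ext' fun i => LinearMap.ext_ring ?_
      simpa [sub_eq_zero] using h2 i
    obtain ⟨w, hw⟩ := this (fun i => if i = j then 1 else 0)
    exact ⟨w, fun i => congrFun hw i⟩
  choose w hw using h1
  exact ⟨w, fun i j => hw j i⟩

theorem linearIndependent_of_det_ne_zero {ι : Type*} [Fintype ι] [DecidableEq ι] {V : Type*}
    [AddCommGroup V] [Module ℝ V] {ξ : ι → Module.Dual ℝ V} (w : ι → V)
    (h : (Matrix.of fun i j => ξ i (w j)).det ≠ 0) : LinearIndependent ℝ ξ := by
  rw [Fintype.linearIndependent_iff]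
  intro g hg
  have : g ᵥ* (Matrix.of fun i j => ξ i (w j)) = 0 := by
    ext j
    have := LinearMap.congr_fun hg (w j)
    simpa [Matrix.vecMul, dotProduct, LinearMap.sum_apply] using this
  exact fun i => congrFun (Matrix.eq_zero_of_vecMul_eq_zero h this) i

/-- Analytic functions which are independent at one point are generically independent. -/
theorem generically_linearIndependent (hn : 2 ≤ n) {ι : Type*} [Fintype ι]
    {f : ι → Phase n → ℝ} (hf : ∀ i, ContDiff ℝ ω (f i)) {x₀ : Phase n}
    (hx₀ : x₀ ∈ cotangentSphere n) (h₀ : LinearIndependent ℝ fun i => differential (f i) x₀) :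
    Generically n fun x => LinearIndependent ℝ fun i => differential (f i) x := by
  classical
  obtain ⟨w, hw⟩ := exists_dual_of_linearIndependent h₀
  -- The test vectors dual at `x₀` are projected to the tangent space at `x`. The determinant is
  -- therefore analytic in `x` and equals 1 at `x₀`, and wherever it is nonzero the differentials
  -- are independent.
  let M : Phase n → Matrix ι ι ℝ := fun x => Matrix.of fun i j =>
    fderiv ℝ (f i) x (tangentProj x (w j))
  have hM : ContDiff ℝ ω fun x => (M x).det := by
    simp only [Matrix.det_apply, M, Matrix.of_apply]
    refine ContDiff.sum fun σ _ => ContDiff.const_smul _ (contDiff_prod fun i _ => ?_)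
    exact ((hf _).fderiv_right (m := ω) le_top).clm_apply (contDiff_tangentProj _)
  refine (generically_ne_zero hn hM hx₀ ?_).mono fun x hx h => ?_
  · have : M x₀ = 1 := by
      ext i j
      have := hw i j
      simp only [differential, LinearMap.domRestrict_apply] at this
      simp only [M, Matrix.of_apply, tangentProj_eq_self (w j).2]
      rw [Matrix.one_apply]
      exact this
    rw [this, Matrix.det_one]
    exact one_ne_zero
  · refine linearIndependent_of_det_ne_zero (fun j => ⟨tangentProj x (w j), tangentProj_mem hx _⟩) ?_
    exact h

end Tangent


/-! ### Hamiltonian vector fields -/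

section Sharp

variable {n : ℕ} {s : ℝ} {κ : Matrix (Fin n) (Fin n) ℝ}

theorem twistedForm_swap (hκ : κᵀ = -κ) (w w' : Phase n) :
    twistedForm s κ w w' = -twistedForm s κ w' w := by
  have h := dotProduct_mulVec_skew hκ w.1 w'.1
  rw [dotProduct_comm (κ *ᵥ w.1)] at h
  simp only [twistedForm, h, dotProduct_comm w.2, dotProduct_comm w.1 w'.2]
  ring

theorem twistedForm_add_right (w a b : Phase n) :
    twistedForm s κ w (a + b) = twistedForm s κ w a + twistedForm s κ w b := by
  simp only [twistedForm, Prod.fst_add, Prod.snd_add, dotProduct_add, Matrix.mulVec_add]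
  ring

theorem twistedForm_smul_right (w a : Phase n) (c : ℝ) :
    twistedForm s κ w (c • a) = c * twistedForm s κ w a := by
  simp only [twistedForm, Prod.smul_fst, Prod.smul_snd, dotProduct_smul, Matrix.mulVec_smul,
    smul_eq_mul]
  ring

theorem twistedForm_sum_right {ι : Type*} (t : Finset ι) (w : Phase n) (a : ι → Phase n) :
    twistedForm s κ w (∑ i ∈ t, a i) = ∑ i ∈ t, twistedForm s κ w (a i) := by
  classical
  induction t using Finset.induction_on with
  | empty => simp [twistedForm]
  | insert i t hi ih => rw [Finset.sum_insert hi, Finset.sum_insert hi, twistedForm_add_right, ih]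

theorem twistedForm_add_left (w a b : Phase n) :
    twistedForm s κ (a + b) w = twistedForm s κ a w + twistedForm s κ b w := by
  simp only [twistedForm, Prod.fst_add, Prod.snd_add, add_dotProduct]
  ring

theorem twistedForm_smul_left (w a : Phase n) (c : ℝ) :
    twistedForm s κ (c • a) w = c * twistedForm s κ a w := by
  simp only [twistedForm, Prod.smul_fst, Prod.smul_snd, smul_dotProduct, smul_eq_mul]
  ring

theorem twistedForm_sum_left {ι : Type*} (t : Finset ι) (w : Phase n) (a : ι → Phase n) :
    twistedForm s κ (∑ i ∈ t, a i) w = ∑ i ∈ t, twistedForm s κ (a i) w := by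
  classical
  induction t using Finset.induction_on with
  | empty => simp [twistedForm]
  | insert i t hi ih => rw [Finset.sum_insert hi, Finset.sum_insert hi, twistedForm_add_left, ih]

/-- The twisted symplectic form is nondegenerate on `T*Sⁿ⁻¹`. -/
theorem eq_zero_of_twistedForm {x Z : Phase n} (hx : x ∈ cotangentSphere n)
    (hZ : Z ∈ tangentSpace x) (h : ∀ w ∈ tangentSpace x, twistedForm s κ w Z = 0) : Z = 0 := by
  obtain ⟨h1, h2⟩ := hx
  simp only [phi1, phi2] at h1 h2
  obtain ⟨hZ1, hZ2⟩ := hZ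
  have hu : Z.1 = 0 := by
    have := h (0, Z.1) ⟨by simp, by simp [hZ1]⟩
    simp only [twistedForm, zero_dotProduct, sub_zero, mul_zero, add_zero] at this
    exact dotProduct_self_eq_zero.1 this
  have hv : Z.2 = 0 := by
    rw [hu] at hZ2
    simp only [dotProduct_zero, zero_add] at hZ2
    -- The multiple of `γ` in the second slot makes the test vector tangent. It does not contribute
    -- to the form because the position part of `Z` is already zero.
    have := h (Z.2, -(x.2 ⬝ᵥ Z.2) • x.1) ⟨hZ2, by simp [h1]⟩
    simp only [twistedForm, hu, dotProduct_zero, Matrix.mulVec_zero, mul_zero, add_zero,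
      zero_sub, neg_eq_zero] at this
    exact dotProduct_self_eq_zero.1 this
  exact Prod.ext hu hv

theorem fderiv_eq_dPos_add_dMom (f : Phase n → ℝ) (x w : Phase n) :
    fderiv ℝ f x w = dPos f x ⬝ᵥ w.1 + dMom f x ⬝ᵥ w.2 := by
  have hw : w = ∑ i, w.1 i • ((Pi.single i 1, 0) : Phase n)
      + ∑ i, w.2 i • ((0, Pi.single i 1) : Phase n) := by
    ext k <;> simp [Prod.fst_sum, Prod.snd_sum, Finset.sum_apply, Pi.single_apply]
  conv_lhs => rw [hw]
  simp only [map_add, map_sum, map_smul, smul_eq_mul, dPos, dMom, dotProduct, mul_comm]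

/-- The vector on the right is the Hamiltonian vector of `g` for the twisted form on the ambient
space. It is corrected to a tangent vector in `hamiltonianField`. -/
theorem magneticBracket_eq_fderiv (f g : Phase n → ℝ) (x : Phase n) :
    magneticBracket s κ f g x = fderiv ℝ f x (dMom g x, -dPos g x + s • (κ *ᵥ dMom g x)) := by
  rw [fderiv_eq_dPos_add_dMom]
  simp only [magneticBracket, dotProduct, Matrix.mulVec, Pi.add_apply, Pi.neg_apply, Pi.smul_apply,
    smul_eq_mul, mul_add, mul_neg, Finset.sum_sub_distrib, Finset.sum_add_distrib, Finset.mul_sum]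
  have h : ∀ i j, s * (κ i j * dMom f x i * dMom g x j)
      = dMom f x i * (s * (κ i j * dMom g x j)) := fun i j => by ring
  simp only [Finset.sum_neg_distrib, h]
  ring

theorem fderiv_phi1 (x w : Phase n) : fderiv ℝ phi1 x w = 2 * (x.1 ⬝ᵥ w.1) := by
  have hd : ContDiff ℝ 1 (phi1 (n := n)) := contDiff_dotProduct contDiff_fst contDiff_fst
  refine fderiv_apply_eq_of_hasDerivAt (hd.differentiable one_ne_zero x) ?_
  have h := hasDerivAt_fst (hasDerivAt_line x w)
  refine (hasDerivAt_dotProduct h h).congr_deriv ?_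
  simp only [zero_smul, add_zero, dotProduct_comm w.1 x.1]
  ring

theorem fderiv_phi2 (x w : Phase n) : fderiv ℝ phi2 x w = x.2 ⬝ᵥ w.1 + x.1 ⬝ᵥ w.2 := by
  have hd : ContDiff ℝ 1 (phi2 (n := n)) := contDiff_dotProduct contDiff_snd contDiff_fst
  refine fderiv_apply_eq_of_hasDerivAt (hd.differentiable one_ne_zero x) ?_
  have h := hasDerivAt_line x w
  refine (hasDerivAt_dotProduct (hasDerivAt_snd h) (hasDerivAt_fst h)).congr_deriv ?_
  simp only [zero_smul, add_zero, dotProduct_comm w.2 x.1]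
  ring

theorem dPos_phi1 (x : Phase n) : dPos phi1 x = (2 : ℝ) • x.1 := by
  ext i
  simp [dPos, fderiv_phi1]

theorem dMom_phi1 (x : Phase n) : dMom phi1 x = 0 := by
  ext i
  simp [dMom, fderiv_phi1]

theorem dPos_phi2 (x : Phase n) : dPos phi2 x = x.2 := by
  ext i
  simp [dPos, fderiv_phi2]

theorem dMom_phi2 (x : Phase n) : dMom phi2 x = x.1 := by
  ext i
  simp [dMom, fderiv_phi2]


/-- The Hamiltonian vector field of `g` on `T*Sⁿ⁻¹`. -/
noncomputable def hamiltonianField (s : ℝ) (κ : Matrix (Fin n) (Fin n) ℝ) (g : Phase n → ℝ) (x : Phase n) :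
    Phase n :=
  (dMom g x, -dPos g x + s • (κ *ᵥ dMom g x))
    + (dPos g x ⬝ᵥ x.1 + dMom g x ⬝ᵥ (-x.2 + s • (κ *ᵥ x.1))) • ((0, x.1) : Phase n)
    - (dMom g x ⬝ᵥ x.1) • ((x.1, -x.2 + s • (κ *ᵥ x.1)) : Phase n)

theorem hamiltonianField_mem (hκ : κᵀ = -κ) (g : Phase n → ℝ) {x : Phase n}
    (hx : x ∈ cotangentSphere n) : hamiltonianField s κ g x ∈ tangentSpace x := by
  obtain ⟨h1, h2⟩ := hx
  simp only [phi1, phi2] at h1 h2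
  have h3 := dotProduct_mulVec_skew hκ x.1 (dMom g x)
  have h4 := dotProduct_mulVec_self_skew hκ x.1
  rw [dotProduct_comm (κ *ᵥ x.1)] at h3
  constructor
  · simp [hamiltonianField, h1, dotProduct_comm x.1 (dMom g x)]
  · simp only [hamiltonianField, Prod.fst_add, Prod.snd_add, Prod.fst_sub, Prod.snd_sub,
      Prod.smul_fst, Prod.smul_snd, dotProduct_add, dotProduct_sub, dotProduct_smul,
      dotProduct_neg, smul_eq_mul, h1, h2, h3, h4, dotProduct_zero,
      dotProduct_comm x.2 (dMom g x), dotProduct_comm x.1 (dPos g x), dotProduct_comm x.1 x.2]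
    ring

/-- The two correction terms are multiples of the ambient Hamiltonian vectors of the constraints.
These pair with a tangent vector to the derivative of a constraint along it, which is zero. -/
theorem twistedForm_hamiltonianField (g : Phase n → ℝ) {x w : Phase n}
    (hw : w ∈ tangentSpace x) :
    twistedForm s κ w (hamiltonianField s κ g x) = fderiv ℝ g x w := by
  obtain ⟨h1, h2⟩ := hw
  rw [dotProduct_comm] at h1
  rw [fderiv_eq_dPos_add_dMom]
  simp only [hamiltonianField, twistedForm, Prod.fst_add, Prod.snd_add, Prod.fst_sub, Prod.snd_sub,
      Prod.smul_fst, Prod.smul_snd, dotProduct_add, dotProduct_sub, dotProduct_smul,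
      dotProduct_neg, smul_eq_mul, h1, dotProduct_zero, Matrix.mulVec_add, Matrix.mulVec_sub,
      Matrix.mulVec_smul, Matrix.mulVec_zero]
  rw [dotProduct_comm w.1 (dPos g x), dotProduct_comm w.2 (dMom g x), dotProduct_comm w.1 x.2,
    dotProduct_comm w.2 x.1]
  linear_combination (-(dMom g x ⬝ᵥ x.1)) * h2

/-- On the constraint set the bracket of `phi1` and `phi2` is 2, so the quotient in the Dirac
bracket becomes exactly the correction built into `hamiltonianField`. -/
theorem diracBracket_eq_hamiltonianField (f g : Phase n → ℝ) {x : Phase n}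
    (hx : x ∈ cotangentSphere n) :
    diracBracket s κ f g x = fderiv ℝ f x (hamiltonianField s κ g x) := by
  obtain ⟨h1, h2⟩ := hx
  simp only [phi1, phi2] at h1 h2
  simp only [diracBracket, magneticBracket_eq_fderiv, dPos_phi1, dMom_phi1, dPos_phi2, dMom_phi2,
    hamiltonianField, map_add, map_sub, map_smul]
  simp only [fderiv_eq_dPos_add_dMom, dPos_phi1, dMom_phi1, zero_dotProduct, dotProduct_zero,
    Matrix.mulVec_zero, smul_zero, add_zero, smul_dotProduct, dotProduct_neg,
    dotProduct_smul, h1, smul_eq_mul, dotProduct_add]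
  ring

/-- This allows the explicit vectors `flowField` and `rotate A` to be used in place of
`hamiltonianField`. Two uses of skewness move the derivative of `f` onto any tangent representative
of the differential of `g`. -/
theorem diracBracket_eq_fderiv (hκ : κᵀ = -κ) {f g : Phase n → ℝ} {x Z : Phase n}
    (hx : x ∈ cotangentSphere n) (hZ : Z ∈ tangentSpace x)
    (hg : ∀ w ∈ tangentSpace x, fderiv ℝ g x w = twistedForm s κ w Z) :
    diracBracket s κ f g x = fderiv ℝ f x Z := by
  have hf := hamiltonianField_mem (s := s) hκ f hx
  have hgm := hamiltonianField_mem (s := s) hκ g hx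
  rw [diracBracket_eq_hamiltonianField f g hx, ← twistedForm_hamiltonianField f hgm,
    ← twistedForm_hamiltonianField f hZ, twistedForm_swap hκ, twistedForm_hamiltonianField g hf,
    hg _ hf, twistedForm_swap hκ, neg_neg]

theorem diracBracket_swap (hκ : κᵀ = -κ) (f g : Phase n → ℝ) {x : Phase n}
    (hx : x ∈ cotangentSphere n) : diracBracket s κ f g x = -diracBracket s κ g f x := by
  have hf := hamiltonianField_mem (s := s) hκ f hx
  have hgm := hamiltonianField_mem (s := s) hκ g hx
  rw [diracBracket_eq_hamiltonianField f g hx, diracBracket_eq_hamiltonianField g f hx,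
    ← twistedForm_hamiltonianField f hgm, ← twistedForm_hamiltonianField g hf,
    twistedForm_swap hκ]

/-- Functions with linearly independent Hamiltonian vectors have independent differentials. -/
theorem linearIndependent_differential {ι : Type*} [Fintype ι] {f : ι → Phase n → ℝ}
    {Z : ι → Phase n} {x : Phase n} (hx : x ∈ cotangentSphere n) (hZ : ∀ i, Z i ∈ tangentSpace x)
    (hf : ∀ i, ∀ w ∈ tangentSpace x, fderiv ℝ (f i) x w = twistedForm s κ w (Z i))
    (h : LinearIndependent ℝ Z) : LinearIndependent ℝ fun i => differential (f i) x := by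
  rw [Fintype.linearIndependent_iff] at h ⊢
  intro g hg
  refine h g (eq_zero_of_twistedForm (s := s) (κ := κ) hx
    (Submodule.sum_mem _ fun i _ => Submodule.smul_mem _ _ (hZ i)) fun w hw => ?_)
  have := LinearMap.congr_fun hg ⟨w, hw⟩
  simp only [differential, LinearMap.sum_apply, LinearMap.smul_apply, LinearMap.domRestrict_apply,
    ContinuousLinearMap.coe_coe, smul_eq_mul, LinearMap.zero_apply] at this
  rw [twistedForm_sum_right, ← this]
  exact Finset.sum_congr rfl fun i _ => by rw [twistedForm_smul_right, hf i w hw]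

end Sharp


/-! ### The first integrals -/

section Integrals

variable {n : ℕ} {m s : ℝ} {κ : Matrix (Fin n) (Fin n) ℝ}

/-- The infinitesimal rotation `(γ, p) ↦ (Aγ, Ap)`. -/
def rotate (A : Matrix (Fin n) (Fin n) ℝ) (x : Phase n) : Phase n := (A *ᵥ x.1, A *ᵥ x.2)

/-- The gauge Noether integral of the rotations generated by `A`. -/
noncomputable def gaugeNoether (s : ℝ) (κ A : Matrix (Fin n) (Fin n) ℝ) (x : Phase n) : ℝ :=
  x.2 ⬝ᵥ (A *ᵥ x.1) + s / 2 * (x.1 ⬝ᵥ (A *ᵥ (κ *ᵥ x.1)))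

/-- The integral `J = (s² / m²) |κp|² - μ²`. -/
noncomputable def fieldIntegral (m s : ℝ) (κ : Matrix (Fin n) (Fin n) ℝ) (x : Phase n) : ℝ :=
  s ^ 2 / m ^ 2 * ((κ *ᵥ x.2) ⬝ᵥ (κ *ᵥ x.2)) - multiplier m s κ x ^ 2

/-- The skew-symmetric matrices which commute with the field. -/
def IsSymmetry (κ A : Matrix (Fin n) (Fin n) ℝ) : Prop := Aᵀ = -A ∧ A * κ = κ * A

theorem isSymmetry_self (hκ : κᵀ = -κ) : IsSymmetry κ κ := ⟨hκ, rfl⟩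

theorem IsSymmetry.commutator {A B : Matrix (Fin n) (Fin n) ℝ} (hA : IsSymmetry κ A)
    (hB : IsSymmetry κ B) : IsSymmetry κ (A * B - B * A) := by
  obtain ⟨hA, hA'⟩ := hA
  obtain ⟨hB, hB'⟩ := hB
  constructor
  · rw [Matrix.transpose_sub, Matrix.transpose_mul, Matrix.transpose_mul, hA, hB]
    noncomm_ring
  · rw [sub_mul, mul_sub, Matrix.mul_assoc, Matrix.mul_assoc, hB', hA', ← Matrix.mul_assoc,
      ← Matrix.mul_assoc, hB', hA', Matrix.mul_assoc, Matrix.mul_assoc]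

theorem contDiff_hamiltonian : ContDiff ℝ ω (hamiltonian (n := n) m) :=
  contDiff_const.mul (contDiff_dotProduct contDiff_snd contDiff_snd)

theorem contDiff_multiplier : ContDiff ℝ ω (multiplier m s κ) :=
  contDiff_const.mul ((contDiff_const.mul (contDiff_dotProduct contDiff_snd
    (contDiff_mulVec κ contDiff_fst))).sub (contDiff_dotProduct contDiff_snd contDiff_snd))

theorem contDiff_fieldIntegral : ContDiff ℝ ω (fieldIntegral m s κ) :=
  (contDiff_const.mul (contDiff_dotProduct (contDiff_mulVec κ contDiff_snd)
    (contDiff_mulVec κ contDiff_snd))).sub (contDiff_multiplier.pow 2)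

theorem contDiff_gaugeNoether (A : Matrix (Fin n) (Fin n) ℝ) :
    ContDiff ℝ ω (gaugeNoether s κ A) :=
  (contDiff_dotProduct contDiff_snd (contDiff_mulVec A contDiff_fst)).add
    (contDiff_const.mul (contDiff_dotProduct contDiff_fst
      (contDiff_mulVec A (contDiff_mulVec κ contDiff_fst))))

theorem contDiff_flowField : ContDiff ℝ ω (flowField m s κ) := by
  unfold flowField
  exact (contDiff_snd.const_smul _).prodMk
    (((contDiff_mulVec κ contDiff_snd).const_smul _).add (contDiff_multiplier.smul contDiff_fst))

theorem differentiable_of_contDiff_omega {f : Phase n → ℝ} (hf : ContDiff ℝ ω f) :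
    Differentiable ℝ f := hf.differentiable (by simp)

theorem fderiv_hamiltonian (x w : Phase n) :
    fderiv ℝ (hamiltonian m) x w = 1 / m * (x.2 ⬝ᵥ w.2) := by
  refine fderiv_apply_eq_of_hasDerivAt (differentiable_of_contDiff_omega contDiff_hamiltonian x) ?_
  have h := hasDerivAt_snd (hasDerivAt_line x w)
  refine ((hasDerivAt_dotProduct h h).const_mul (1 / (2 * m))).congr_deriv ?_
  simp only [zero_smul, add_zero, dotProduct_comm w.2 x.2]
  field_simp
  ring

theorem fderiv_gaugeNoether (A : Matrix (Fin n) (Fin n) ℝ) (x w : Phase n) :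
    fderiv ℝ (gaugeNoether s κ A) x w = w.2 ⬝ᵥ (A *ᵥ x.1) + x.2 ⬝ᵥ (A *ᵥ w.1)
      + s / 2 * (w.1 ⬝ᵥ (A *ᵥ (κ *ᵥ x.1)) + x.1 ⬝ᵥ (A *ᵥ (κ *ᵥ w.1))) := by
  refine fderiv_apply_eq_of_hasDerivAt (differentiable_of_contDiff_omega (contDiff_gaugeNoether A) x) ?_
  have h := hasDerivAt_line x w
  have h1 := hasDerivAt_fst h
  refine ((hasDerivAt_dotProduct (hasDerivAt_snd h) (hasDerivAt_mulVec A h1)).add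
    ((hasDerivAt_dotProduct h1 (hasDerivAt_mulVec A (hasDerivAt_mulVec κ h1))).const_mul
      (s / 2))).congr_deriv ?_
  simp only [zero_smul, add_zero]

theorem fderiv_multiplier (x w : Phase n) :
    fderiv ℝ (multiplier m s κ) x w = 1 / m * (s * (w.2 ⬝ᵥ (κ *ᵥ x.1) + x.2 ⬝ᵥ (κ *ᵥ w.1))
      - 2 * (x.2 ⬝ᵥ w.2)) := by
  refine fderiv_apply_eq_of_hasDerivAt (differentiable_of_contDiff_omega contDiff_multiplier x) ?_
  have h := hasDerivAt_line x w
  have h2 := hasDerivAt_snd h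
  refine ((((hasDerivAt_dotProduct h2 (hasDerivAt_mulVec κ (hasDerivAt_fst h))).const_mul s).sub
    (hasDerivAt_dotProduct h2 h2)).const_mul (1 / m)).congr_deriv ?_
  simp only [zero_smul, add_zero, dotProduct_comm w.2 x.2]
  ring

theorem fderiv_fieldIntegral (x w : Phase n) :
    fderiv ℝ (fieldIntegral m s κ) x w = 2 * (s ^ 2 / m ^ 2 * ((κ *ᵥ x.2) ⬝ᵥ (κ *ᵥ w.2))
      - multiplier m s κ x * fderiv ℝ (multiplier m s κ) x w) := by
  refine fderiv_apply_eq_of_hasDerivAt (differentiable_of_contDiff_omega contDiff_fieldIntegral x) ?_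
  have h := hasDerivAt_line x w
  have h2 := hasDerivAt_mulVec κ (hasDerivAt_snd h)
  have h3 := hasDerivAt_comp_curve (differentiable_of_contDiff_omega
    (contDiff_multiplier (m := m) (s := s) (κ := κ))) h
  refine (((hasDerivAt_dotProduct h2 h2).const_mul (s ^ 2 / m ^ 2)).sub
    (h3.pow 2)).congr_deriv ?_
  simp only [zero_smul, add_zero, dotProduct_comm (κ *ᵥ w.2)]
  ring

theorem flowField_mem_tangentSpace (hκ : κᵀ = -κ) {x : Phase n} (hx : x ∈ cotangentSphere n) :
    flowField m s κ x ∈ tangentSpace x := by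
  obtain ⟨h1, h2⟩ := hx
  simp only [phi1, phi2] at h1 h2
  have h3 := dotProduct_mulVec_skew hκ x.1 x.2
  rw [dotProduct_comm (κ *ᵥ x.1)] at h3
  constructor
  · simp [flowField, dotProduct_comm x.1 x.2, h2]
  · simp only [flowField, multiplier, dotProduct_add, dotProduct_smul, smul_eq_mul, h1, h3]
    ring

/-- The magnetic force cancels the `κ` term of the form, and the constraint force μγ pairs to zero
with tangent vectors. So the flow is the Hamiltonian flow of `H`. -/
theorem fderiv_hamiltonian_eq_twistedForm {x w : Phase n} (hw : w ∈ tangentSpace x) :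
    fderiv ℝ (hamiltonian m) x w = twistedForm s κ w (flowField m s κ x) := by
  rw [fderiv_hamiltonian]
  have h1 := hw.1
  rw [dotProduct_comm] at h1
  simp only [twistedForm, flowField, dotProduct_add, dotProduct_smul, smul_eq_mul, h1,
    Matrix.mulVec_smul, dotProduct_comm w.2 x.2]
  ring

theorem IsSymmetry.rotate_mem {A : Matrix (Fin n) (Fin n) ℝ} (hA : Aᵀ = -A) (x : Phase n) :
    rotate A x ∈ tangentSpace x := by
  have h := dotProduct_mulVec_skew hA x.1 x.2
  rw [dotProduct_comm (A *ᵥ x.1)] at h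
  exact ⟨dotProduct_mulVec_self_skew hA x.1, by simp only [rotate]; linarith⟩

/-- Since `A` and `κ` are skew and commute, `Aκ` is symmetric. The derivative of the quadratic gauge
term is then the full magnetic part of the twisted form, which is what the factor `s / 2` is for. -/
theorem fderiv_gaugeNoether_eq_twistedForm (hκ : κᵀ = -κ) {A : Matrix (Fin n) (Fin n) ℝ}
    (hA : IsSymmetry κ A) (x w : Phase n) :
    fderiv ℝ (gaugeNoether s κ A) x w = twistedForm s κ w (rotate A x) := by
  rw [fderiv_gaugeNoether]
  have h1 := dotProduct_mulVec_skew hA.1 x.2 w.1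
  have h2 : x.1 ⬝ᵥ (A *ᵥ (κ *ᵥ w.1)) = w.1 ⬝ᵥ (A *ᵥ (κ *ᵥ x.1)) := by
    rw [dotProduct_mulVec_skew hA.1, dotProduct_mulVec_skew hκ, neg_neg,
      mulVec_comm_of_commute hA.2, dotProduct_comm]
  rw [h1, h2, dotProduct_comm (A *ᵥ x.2) w.1, mulVec_comm_of_commute hA.2]
  simp only [twistedForm, rotate]
  ring

theorem fderiv_hamiltonian_rotate {A : Matrix (Fin n) (Fin n) ℝ} (hA : Aᵀ = -A) (x : Phase n) :
    fderiv ℝ (hamiltonian m) x (rotate A x) = 0 := by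
  rw [fderiv_hamiltonian]
  simp [rotate, dotProduct_mulVec_self_skew hA]

theorem fderiv_multiplier_rotate {A : Matrix (Fin n) (Fin n) ℝ}
    (hA : IsSymmetry κ A) (x : Phase n) : fderiv ℝ (multiplier m s κ) x (rotate A x) = 0 := by
  rw [fderiv_multiplier]
  simp only [rotate]
  rw [dotProduct_mulVec_self_skew hA.1, ← mulVec_comm_of_commute hA.2, dotProduct_mulVec_skew hA.1 x.2]
  ring

theorem fderiv_fieldIntegral_rotate {A : Matrix (Fin n) (Fin n) ℝ}
    (hA : IsSymmetry κ A) (x : Phase n) : fderiv ℝ (fieldIntegral m s κ) x (rotate A x) = 0 := by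
  rw [fderiv_fieldIntegral, fderiv_multiplier_rotate hA]
  simp only [rotate]
  rw [← mulVec_comm_of_commute hA.2, dotProduct_mulVec_self_skew hA.1]
  ring

/-- The moment map is equivariant without a cocycle: brackets of gauge Noether integrals are again
gauge Noether integrals, of commutators. This is what closes the algebra. -/
theorem fderiv_gaugeNoether_rotate {A B : Matrix (Fin n) (Fin n) ℝ}
    (hA : IsSymmetry κ A) (x : Phase n) :
    fderiv ℝ (gaugeNoether s κ B) x (rotate A x) = gaugeNoether s κ (B * A - A * B) x := by
  rw [fderiv_gaugeNoether]
  simp only [rotate, gaugeNoether, Matrix.sub_mulVec, ← Matrix.mulVec_mulVec, dotProduct_sub]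
  rw [← mulVec_comm_of_commute hA.2, dotProduct_mulVec_skew hA.1 x.2, dotProduct_mulVec_skew hA.1 x.1]
  ring

theorem isFirstIntegral_hamiltonian (hκ : κᵀ = -κ) :
    IsFirstIntegral m s κ (hamiltonian m) := fun x hx => by
  have h := fderiv_hamiltonian_eq_twistedForm (s := s) (κ := κ) (m := m)
    (flowField_mem_tangentSpace (m := m) (s := s) hκ hx)
  have h' := twistedForm_swap (s := s) hκ (flowField m s κ x) (flowField m s κ x)
  linarith

/-- Noether's theorem: by skewness of the form, the derivative of Φ_A along the flow is minus the
derivative of `H` along the rotation. -/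
theorem isFirstIntegral_gaugeNoether (hκ : κᵀ = -κ) {A : Matrix (Fin n) (Fin n) ℝ}
    (hA : IsSymmetry κ A) : IsFirstIntegral m s κ (gaugeNoether s κ A) := fun x hx => by
  rw [fderiv_gaugeNoether_eq_twistedForm hκ hA, twistedForm_swap hκ,
    ← fderiv_hamiltonian_eq_twistedForm (IsSymmetry.rotate_mem hA.1 x),
    fderiv_hamiltonian_rotate hA.1, neg_zero]

theorem fderiv_multiplier_flowField (hκ : κᵀ = -κ) {x : Phase n} (hx : x ∈ cotangentSphere n) :
    fderiv ℝ (multiplier m s κ) x (flowField m s κ x)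
      = s ^ 2 / m ^ 2 * ((κ *ᵥ x.2) ⬝ᵥ (κ *ᵥ x.1)) := by
  have h2 := hx.2
  simp only [phi2] at h2
  rw [fderiv_multiplier]
  simp only [flowField, Matrix.mulVec_smul, add_dotProduct, dotProduct_add, smul_dotProduct,
    dotProduct_smul, smul_eq_mul, h2, dotProduct_mulVec_self_skew hκ]
  ring

/-- Since κp is orthogonal to κ(κp), only the constraint force changes |κp|², at rate 2μ⟨κp, κγ⟩. On
the other hand μ' = (s²/m²)⟨κp, κγ⟩, so the two terms of `J` change at the same rate. -/
theorem isFirstIntegral_fieldIntegral (hκ : κᵀ = -κ) :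
    IsFirstIntegral m s κ (fieldIntegral m s κ) := fun x hx => by
  rw [fderiv_fieldIntegral, fderiv_multiplier_flowField hκ hx]
  simp only [flowField, Matrix.mulVec_add, Matrix.mulVec_smul, dotProduct_add,
    dotProduct_smul, smul_eq_mul, dotProduct_mulVec_self_skew hκ]
  ring

theorem diracBracket_hamiltonian (hκ : κᵀ = -κ) (f : Phase n → ℝ) {x : Phase n}
    (hx : x ∈ cotangentSphere n) :
    diracBracket s κ f (hamiltonian m) x = fderiv ℝ f x (flowField m s κ x) :=
  diracBracket_eq_fderiv hκ hx (flowField_mem_tangentSpace hκ hx)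
    fun _ hw => fderiv_hamiltonian_eq_twistedForm hw

theorem diracBracket_gaugeNoether (hκ : κᵀ = -κ) (f : Phase n → ℝ)
    {A : Matrix (Fin n) (Fin n) ℝ} (hA : IsSymmetry κ A) {x : Phase n}
    (hx : x ∈ cotangentSphere n) :
    diracBracket s κ f (gaugeNoether s κ A) x = fderiv ℝ f x (rotate A x) :=
  diracBracket_eq_fderiv hκ hx (IsSymmetry.rotate_mem hA.1 x)
    fun w _ => fderiv_gaugeNoether_eq_twistedForm hκ hA x w

end Integrals

/-! ### The algebra of first integrals -/

section Algebra

variable {n : ℕ} {m s : ℝ} {κ : Matrix (Fin n) (Fin n) ℝ}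

/-- The generating integrals: `H`, `J` and the gauge Noether integrals. -/
def generators (m s : ℝ) (κ : Matrix (Fin n) (Fin n) ℝ) : Set (Phase n → ℝ) :=
  {f | f = hamiltonian m ∨ f = fieldIntegral m s κ ∨ ∃ A, IsSymmetry κ A ∧ f = gaugeNoether s κ A}

/-- The algebra generated by `H`, `J` and the gauge Noether integrals. -/
def integralAlgebra (m s : ℝ) (κ : Matrix (Fin n) (Fin n) ℝ) : Subalgebra ℝ (Phase n → ℝ) :=
  Algebra.adjoin ℝ (generators m s κ)

theorem hamiltonian_mem_integralAlgebra : hamiltonian m ∈ integralAlgebra m s κ :=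
  Algebra.subset_adjoin (Or.inl rfl)

theorem fieldIntegral_mem_integralAlgebra : fieldIntegral m s κ ∈ integralAlgebra m s κ :=
  Algebra.subset_adjoin (Or.inr (Or.inl rfl))

theorem gaugeNoether_mem_integralAlgebra {A : Matrix (Fin n) (Fin n) ℝ} (hA : IsSymmetry κ A) :
    gaugeNoether s κ A ∈ integralAlgebra m s κ :=
  Algebra.subset_adjoin (Or.inr (Or.inr ⟨A, hA, rfl⟩))

theorem contDiff_of_mem_integralAlgebra {f : Phase n → ℝ} (hf : f ∈ integralAlgebra m s κ) :
    ContDiff ℝ ω f := by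
  induction hf using Algebra.adjoin_induction with
  | mem f hf =>
    rcases hf with rfl | rfl | ⟨A, -, rfl⟩
    · exact contDiff_hamiltonian
    · exact contDiff_fieldIntegral
    · exact contDiff_gaugeNoether A
  | algebraMap r => exact contDiff_const
  | add f g _ _ hf hg => exact hf.add hg
  | mul f g _ _ hf hg => exact hf.mul hg

theorem differentiable_of_mem_integralAlgebra {f : Phase n → ℝ}
    (hf : f ∈ integralAlgebra m s κ) : Differentiable ℝ f :=
  differentiable_of_contDiff_omega (contDiff_of_mem_integralAlgebra hf)

/-- By the Leibniz rule, annihilation by a tangent direction passes from the generators to the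
algebra. It serves with the flow vector, and with the Hamiltonian vector of any fixed function. -/
theorem fderiv_eq_zero_of_generators {x Z : Phase n}
    (h : ∀ f ∈ generators m s κ, fderiv ℝ f x Z = 0) {f : Phase n → ℝ}
    (hf : f ∈ integralAlgebra m s κ) : fderiv ℝ f x Z = 0 := by
  induction hf using Algebra.adjoin_induction with
  | mem f hf => exact h f hf
  | algebraMap r =>
    have : fderiv ℝ (algebraMap ℝ (Phase n → ℝ) r) x = 0 := fderiv_const_apply r
    simp [this]
  | add f g hf' hg' hf hg =>
    rw [fderiv_add (differentiable_of_mem_integralAlgebra hf' x)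
      (differentiable_of_mem_integralAlgebra hg' x)]
    simp [hf, hg]
  | mul f g hf' hg' hf hg =>
    rw [fderiv_mul (differentiable_of_mem_integralAlgebra hf' x)
      (differentiable_of_mem_integralAlgebra hg' x)]
    simp [hf, hg]

theorem isFirstIntegral_of_mem_integralAlgebra (hκ : κᵀ = -κ) {f : Phase n → ℝ}
    (hf : f ∈ integralAlgebra m s κ) : IsFirstIntegral m s κ f := fun x hx => by
  refine fderiv_eq_zero_of_generators (fun f hf => ?_) hf
  rcases hf with rfl | rfl | ⟨A, hA, rfl⟩
  · exact isFirstIntegral_hamiltonian hκ x hx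
  · exact isFirstIntegral_fieldIntegral hκ x hx
  · exact isFirstIntegral_gaugeNoether hκ hA x hx

/-- Only the generators need checking, and there the bracket is a conservation law, skewness, or the
invariance of `J` under rotations. -/
theorem diracBracket_fieldIntegral (hκ : κᵀ = -κ) {f : Phase n → ℝ}
    (hf : f ∈ integralAlgebra m s κ) {x : Phase n} (hx : x ∈ cotangentSphere n) :
    diracBracket s κ f (fieldIntegral m s κ) x = 0 := by
  rw [diracBracket_eq_hamiltonianField _ _ hx]
  refine fderiv_eq_zero_of_generators (fun f hf => ?_) hf
  rw [← diracBracket_eq_hamiltonianField _ _ hx, diracBracket_swap hκ _ _ hx, neg_eq_zero]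
  rcases hf with rfl | rfl | ⟨A, hA, rfl⟩
  · rw [diracBracket_hamiltonian hκ _ hx, isFirstIntegral_fieldIntegral hκ x hx]
  · have := diracBracket_swap (s := s) hκ (fieldIntegral m s κ) (fieldIntegral m s κ) hx
    linarith
  · rw [diracBracket_gaugeNoether hκ _ hA hx, fderiv_fieldIntegral_rotate hA]

/-- A member of the algebra is central if it is invariant under the symmetries. -/
theorem diracBracket_eq_zero_of_invariant (hκ : κᵀ = -κ) {f g : Phase n → ℝ}
    (hf : f ∈ integralAlgebra m s κ) (hg : g ∈ integralAlgebra m s κ) {x : Phase n}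
    (hx : x ∈ cotangentSphere n)
    (h : ∀ A, IsSymmetry κ A → fderiv ℝ f x (rotate A x) = 0) : diracBracket s κ f g x = 0 := by
  rw [diracBracket_swap hκ _ _ hx, neg_eq_zero, diracBracket_eq_hamiltonianField _ _ hx]
  refine fderiv_eq_zero_of_generators (fun g hg => ?_) hg
  rw [← diracBracket_eq_hamiltonianField _ _ hx, diracBracket_swap hκ _ _ hx, neg_eq_zero]
  rcases hg with rfl | rfl | ⟨A, hA, rfl⟩
  · rw [diracBracket_hamiltonian hκ _ hx, isFirstIntegral_of_mem_integralAlgebra hκ hf x hx]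
  · exact diracBracket_fieldIntegral hκ hf hx
  · rw [diracBracket_gaugeNoether hκ _ hA hx, h A hA]

theorem exists_diracBracket_of_generators {g : Phase n → ℝ}
    (h : ∀ f ∈ generators m s κ, ∃ k ∈ integralAlgebra m s κ, ∀ x ∈ cotangentSphere n,
      diracBracket s κ f g x = k x) {f : Phase n → ℝ} (hf : f ∈ integralAlgebra m s κ) :
    ∃ k ∈ integralAlgebra m s κ, ∀ x ∈ cotangentSphere n, diracBracket s κ f g x = k x := by
  induction hf using Algebra.adjoin_induction with
  | mem f hf => exact h f hf
  | algebraMap r =>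
    refine ⟨0, Subalgebra.zero_mem _, fun x hx => ?_⟩
    have : fderiv ℝ (algebraMap ℝ (Phase n → ℝ) r) x = 0 := fderiv_const_apply r
    rw [diracBracket_eq_hamiltonianField _ _ hx, this]
    simp
  | add f₁ f₂ h1 h2 ih1 ih2 =>
    obtain ⟨k1, hk1, hk1'⟩ := ih1
    obtain ⟨k2, hk2, hk2'⟩ := ih2
    refine ⟨k1 + k2, Subalgebra.add_mem _ hk1 hk2, fun x hx => ?_⟩
    rw [diracBracket_eq_hamiltonianField _ _ hx, fderiv_add
      (differentiable_of_mem_integralAlgebra h1 x) (differentiable_of_mem_integralAlgebra h2 x),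
      Pi.add_apply, ← hk1' x hx, ← hk2' x hx]
    simp only [diracBracket_eq_hamiltonianField _ _ hx]
    rfl
  | mul f₁ f₂ h1 h2 ih1 ih2 =>
    obtain ⟨k1, hk1, hk1'⟩ := ih1
    obtain ⟨k2, hk2, hk2'⟩ := ih2
    refine ⟨f₁ * k2 + f₂ * k1, Subalgebra.add_mem _ (Subalgebra.mul_mem _ h1 hk2)
      (Subalgebra.mul_mem _ h2 hk1), fun x hx => ?_⟩
    rw [diracBracket_eq_hamiltonianField _ _ hx, fderiv_mul
      (differentiable_of_mem_integralAlgebra h1 x) (differentiable_of_mem_integralAlgebra h2 x),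
      Pi.add_apply, Pi.mul_apply, Pi.mul_apply, ← hk1' x hx, ← hk2' x hx]
    simp only [diracBracket_eq_hamiltonianField _ _ hx]
    rfl

/-- The bracket is a derivation in each argument, so closure reduces to pairs of generators. Only
two gauge Noether integrals can have a nonzero bracket. -/
theorem exists_diracBracket (hκ : κᵀ = -κ) {f g : Phase n → ℝ} (hf : f ∈ integralAlgebra m s κ)
    (hg : g ∈ integralAlgebra m s κ) :
    ∃ k ∈ integralAlgebra m s κ, ∀ x ∈ cotangentSphere n, diracBracket s κ f g x = k x := by
  have hsymm : ∀ f g : Phase n → ℝ,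
      (∃ k ∈ integralAlgebra m s κ, ∀ x ∈ cotangentSphere n, diracBracket s κ f g x = k x) →
      ∃ k ∈ integralAlgebra m s κ, ∀ x ∈ cotangentSphere n, diracBracket s κ g f x = k x := by
    rintro f g ⟨k, hk, hk'⟩
    exact ⟨-k, Subalgebra.neg_mem _ hk, fun x hx => by
      rw [diracBracket_swap hκ _ _ hx, hk' x hx, Pi.neg_apply]⟩
  refine exists_diracBracket_of_generators (fun f hf => hsymm _ _ ?_) hf
  refine exists_diracBracket_of_generators (fun g hg => ?_) hg
  rcases hf with rfl | rfl | ⟨A, hA, rfl⟩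
  · exact ⟨0, Subalgebra.zero_mem _, fun x hx => by
      rw [diracBracket_hamiltonian hκ _ hx,
        isFirstIntegral_of_mem_integralAlgebra hκ (Algebra.subset_adjoin hg) x hx, Pi.zero_apply]⟩
  · exact ⟨0, Subalgebra.zero_mem _, fun x hx =>
      diracBracket_fieldIntegral hκ (Algebra.subset_adjoin hg) hx⟩
  · rcases hg with rfl | rfl | ⟨B, hB, rfl⟩
    · exact ⟨0, Subalgebra.zero_mem _, fun x hx => by
        rw [diracBracket_gaugeNoether hκ _ hA hx, fderiv_hamiltonian_rotate hA.1, Pi.zero_apply]⟩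
    · exact ⟨0, Subalgebra.zero_mem _, fun x hx => by
        rw [diracBracket_gaugeNoether hκ _ hA hx, fderiv_fieldIntegral_rotate hA, Pi.zero_apply]⟩
    · exact ⟨_, gaugeNoether_mem_integralAlgebra (hB.commutator hA), fun x hx => by
        rw [diracBracket_gaugeNoether hκ _ hA hx, fderiv_gaugeNoether_rotate hA]⟩

theorem finrank_tangentSpace {x : Phase n} (hx : x ∈ cotangentSphere n) :
    Module.finrank ℝ (tangentSpace x) = 2 * (n - 1) := by
  obtain ⟨h1, h2⟩ := hx
  simp only [phi1, phi2] at h1 h2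
  let L : Phase n →ₗ[ℝ] ℝ × ℝ :=
    { toFun := fun w => (x.1 ⬝ᵥ w.1, x.2 ⬝ᵥ w.1 + x.1 ⬝ᵥ w.2)
      map_add' := fun a b => by
        simp only [Prod.fst_add, Prod.snd_add, dotProduct_add, Prod.mk_add_mk, Prod.mk.injEq,
          true_and]
        ring
      map_smul' := fun c a => by
        simp only [Prod.smul_fst, Prod.smul_snd, dotProduct_smul, smul_eq_mul, RingHom.id_apply,
          Prod.smul_mk, Prod.mk.injEq, true_and]
        ring }
  have hker : LinearMap.ker L = tangentSpace x := by
    ext w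
    simp [L, mem_tangentSpace]
  have hsurj : LinearMap.range L = ⊤ := by
    rw [LinearMap.range_eq_top]
    rintro ⟨a, b⟩
    refine ⟨(a • x.1, b • x.1), ?_⟩
    simp [L, h1, h2]
  have h := LinearMap.finrank_range_add_finrank_ker L
  rw [hker, hsurj, finrank_top] at h
  simp only [Module.finrank_prod, Module.finrank_self, Module.finrank_fintype_fun_eq_card,
    Fintype.card_fin] at h
  omega

/-- The contraction of the twisted symplectic form with a tangent vector. -/
def contraction (s : ℝ) (κ : Matrix (Fin n) (Fin n) ℝ) (x : Phase n) :
    tangentSpace x →ₗ[ℝ] Module.Dual ℝ (tangentSpace x) where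
  toFun Z :=
    { toFun := fun w => twistedForm s κ w Z
      map_add' := fun _ _ => twistedForm_add_left _ _ _
      map_smul' := fun _ _ => twistedForm_smul_left _ _ _ }
  map_add' _ _ := LinearMap.ext fun _ => twistedForm_add_right _ _ _
  map_smul' _ _ := LinearMap.ext fun _ => twistedForm_smul_right _ _ _

/-- The Hamiltonian vector of a central element is annihilated by every differential of the algebra,
and contraction with the form recovers the differential from it. So the dimension of `W` is at most
the codimension of `V`. The given independent families bound both dimensions from below, and as
their sizes add up to the full dimension, all inequalities are equalities. -/
theorem dindAt_and_ddimAt {ι ι' : Type*} [Fintype ι] [Fintype ι'] (hκ : κᵀ = -κ)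
    {𝓕 : Subalgebra ℝ (Phase n → ℝ)} {x : Phase n} (hx : x ∈ cotangentSphere n)
    {f : ι → Phase n → ℝ} (hf : ∀ i, f i ∈ 𝓕)
    (hfi : LinearIndependent ℝ fun i => differential (f i) x)
    {g : ι' → Phase n → ℝ} (hg : ∀ i, g i ∈ 𝓕)
    (hgc : ∀ i, ∀ k ∈ 𝓕, diracBracket s κ (g i) k x = 0)
    (hgi : LinearIndependent ℝ fun i => differential (g i) x)
    (hcard : Fintype.card ι + Fintype.card ι' = 2 * (n - 1)) :
    dindAt s κ 𝓕 x = Fintype.card ι' ∧ ddimAt 𝓕 x + dindAt s κ 𝓕 x = 2 * (n - 1) := by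
  set V : Submodule ℝ (Module.Dual ℝ (tangentSpace x)) :=
    Submodule.span ℝ {ξ | ∃ f ∈ 𝓕, ξ = differential f x} with hV
  set W : Submodule ℝ (Module.Dual ℝ (tangentSpace x)) := Submodule.span ℝ
    {ξ | ∃ f ∈ 𝓕, (∀ g ∈ 𝓕, diracBracket s κ f g x = 0) ∧ ξ = differential f x} with hW
  have h1 : Fintype.card ι ≤ Module.finrank ℝ V := by
    rw [← finrank_span_eq_card hfi]
    refine Submodule.finrank_mono (Submodule.span_le.2 ?_)
    rintro _ ⟨i, rfl⟩
    exact Submodule.subset_span ⟨f i, hf i, rfl⟩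
  have h2 : Fintype.card ι' ≤ Module.finrank ℝ W := by
    rw [← finrank_span_eq_card hgi]
    refine Submodule.finrank_mono (Submodule.span_le.2 ?_)
    rintro _ ⟨i, rfl⟩
    exact Submodule.subset_span ⟨g i, hg i, hgc i, rfl⟩
  have h3 : W ≤ V.dualCoannihilator.map (contraction s κ x) := by
    refine Submodule.span_le.2 ?_
    rintro _ ⟨k, hk, hkc, rfl⟩
    refine ⟨⟨hamiltonianField s κ k x, hamiltonianField_mem hκ k hx⟩, ?_, ?_⟩
    · rw [SetLike.mem_coe, Submodule.mem_dualCoannihilator]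
      intro φ hφ
      induction hφ using Submodule.span_induction with
      | mem φ hφ =>
        obtain ⟨l, hl, rfl⟩ := hφ
        have := hkc l hl
        rw [diracBracket_swap hκ _ _ hx, neg_eq_zero, diracBracket_eq_hamiltonianField _ _ hx] at this
        exact this
      | zero => rfl
      | add a b _ _ ha hb => rw [LinearMap.add_apply, ha, hb, add_zero]
      | smul c a _ ha => rw [LinearMap.smul_apply, ha, smul_zero]
    · ext w
      exact twistedForm_hamiltonianField k w.2
  have h4 : Module.finrank ℝ W ≤ Module.finrank ℝ V.dualCoannihilator :=
    (Submodule.finrank_mono h3).trans (Submodule.finrank_map_le _ _)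
  have h5 := Subspace.finrank_add_finrank_dualCoannihilator_eq V
  rw [finrank_tangentSpace hx] at h5
  change Module.finrank ℝ W = _ ∧ Module.finrank ℝ V + Module.finrank ℝ W = _
  omega

/-- Completeness of the algebra generated by `H`, `J` and the gauge Noether integrals. -/
theorem isCompleteAlgebra_integralAlgebra {ι ι' : Type*} [Fintype ι] [Fintype ι'] (hκ : κᵀ = -κ)
    {f : ι → Phase n → ℝ} (hf : ∀ i, f i ∈ integralAlgebra m s κ)
    (hfi : Generically n fun x => LinearIndependent ℝ fun i => differential (f i) x)
    {g : ι' → Phase n → ℝ} (hg : ∀ i, g i ∈ integralAlgebra m s κ)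
    (hgc : ∀ i x A, IsSymmetry κ A → fderiv ℝ (g i) x (rotate A x) = 0)
    (hgi : Generically n fun x => LinearIndependent ℝ fun i => differential (g i) x)
    (hcard : Fintype.card ι + Fintype.card ι' = 2 * (n - 1)) :
    IsCompleteAlgebra m s κ (Fintype.card ι') (integralAlgebra m s κ) where
  smooth _ hf := (contDiff_of_mem_integralAlgebra hf).of_le le_top
  integral _ hf := isFirstIntegral_of_mem_integralAlgebra hκ hf
  hamiltonian_mem := hamiltonian_mem_integralAlgebra
  bracket_mem _ hf _ hg := exists_diracBracket hκ hf hg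
  complete := (hfi.and hgi).mono fun x hx h => dindAt_and_ddimAt hκ hx hf h.1 hg
    (fun i _ hk => diracBracket_eq_zero_of_invariant hκ (hg i) hk hx (hgc i x)) h.2 hcard

end Algebra


/-! ### Bounded solutions of a one-dimensional Newton equation -/

section Newton

open Filter Topology

/-- The mean value theorem on `[t, t + 1]` provides points going to infinity at which the derivative
equals `f (t + 1) - f t`, and this difference tends to 0. -/
theorem eq_zero_of_tendsto_of_tendsto_deriv {f f' : ℝ → ℝ} {a b : ℝ}
    (hf : ∀ t, HasDerivAt f (f' t) t) (ha : Tendsto f atTop (𝓝 a))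
    (hb : Tendsto f' atTop (𝓝 b)) : b = 0 := by
  have h : ∀ t : ℝ, ∃ ξ, t ≤ ξ ∧ f' ξ = f (t + 1) - f t := fun t => by
    obtain ⟨ξ, hξ, h⟩ := exists_hasDerivAt_eq_slope f f' (lt_add_one t)
      (fun x _ => (hf x).continuousAt.continuousWithinAt) (fun x _ => hf x)
    exact ⟨ξ, hξ.1.le, by rw [h]; simp⟩
  choose ξ hξ h using h
  have h1 : Tendsto (fun t => f' (ξ t)) atTop (𝓝 b) :=
    hb.comp (tendsto_atTop_mono hξ tendsto_id)
  have h2 : Tendsto (fun t => f (t + 1) - f t) atTop (𝓝 (a - a)) :=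
    (ha.comp (tendsto_atTop_add_const_right _ _ tendsto_id)).sub ha
  rw [sub_self] at h2
  exact tendsto_nhds_unique (h1.congr h) h2

variable {m a b c d : ℝ} {ρ v : ℝ → ℝ}

/-- `(ρ, v)` is a motion in `[0, 1]` with `ρ' = 2v / m`, on the curve `v² = P(ρ)` with the cubic
polynomial `P = aρ³ + bρ² + cρ + d`. -/
structure IsCubicMotion (m a b c d : ℝ) (ρ v : ℝ → ℝ) : Prop where
  deriv_pos : ∀ t, HasDerivAt ρ (2 * v t / m) t
  deriv_vel : ∀ t, HasDerivAt v ((3 * a * ρ t ^ 2 + 2 * b * ρ t + c) / m) t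
  energy : ∀ t, v t ^ 2 = a * ρ t ^ 3 + b * ρ t ^ 2 + c * ρ t + d
  mem : ∀ t, ρ t ∈ Set.Icc (0 : ℝ) 1

theorem IsCubicMotion.reflect (h : IsCubicMotion m a b c d ρ v) (t₀ : ℝ) :
    IsCubicMotion m a b c d (fun t => ρ (t₀ - t)) (fun t => -v (t₀ - t)) where
  deriv_pos t := by
    refine ((h.deriv_pos (t₀ - t)).comp t ((hasDerivAt_id t).const_sub t₀)).congr_deriv ?_
    ring
  deriv_vel t := by
    refine (((h.deriv_vel (t₀ - t)).comp t ((hasDerivAt_id t).const_sub t₀)).neg).congr_deriv ?_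
    ring
  energy t := by rw [neg_sq, h.energy]
  mem t := h.mem _

/-- The vector field is quadratic in ρ, hence not globally Lipschitz. Both motions stay in the strip
with ρ in [0, 1], where it is. -/
theorem IsCubicMotion.unique {ρ' v' : ℝ → ℝ} (h : IsCubicMotion m a b c d ρ v)
    (h' : IsCubicMotion m a b c d ρ' v') {t₀ : ℝ} (h1 : ρ t₀ = ρ' t₀) (h2 : v t₀ = v' t₀) (t : ℝ) :
    ρ t = ρ' t ∧ v t = v' t := by
  -- The sum of one Lipschitz constant per component; `6 * |a| + 2 * |b|` bounds the difference
  -- quotient of P' when both arguments lie in [0, 1].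
  let K : ℝ := |2 / m| + (6 * |a| + 2 * |b|) * |1 / m|
  have hK : 0 ≤ K := by positivity
  have hlip : LipschitzOnWith K.toNNReal
      (fun x : ℝ × ℝ => (2 * x.2 / m, (3 * a * x.1 ^ 2 + 2 * b * x.1 + c) / m))
      (Set.Icc (0 : ℝ) 1 ×ˢ Set.univ) := by
    refine LipschitzOnWith.of_dist_le_mul fun x hx y hy => ?_
    rw [Real.coe_toNNReal _ hK, Prod.dist_eq, Prod.dist_eq, Real.dist_eq, Real.dist_eq,
      Real.dist_eq, Real.dist_eq]
    have hm0 : 0 ≤ max |x.1 - y.1| |x.2 - y.2| := le_max_of_le_left (abs_nonneg _)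
    refine max_le ?_ ?_
    · calc |2 * x.2 / m - 2 * y.2 / m| = |2 / m| * |x.2 - y.2| := by
            rw [← abs_mul]; congr 1; ring
        _ ≤ K * max |x.1 - y.1| |x.2 - y.2| := by
            refine mul_le_mul ?_ (le_max_right _ _) (abs_nonneg _) hK
            exact le_add_of_nonneg_right (by positivity)
    · have hb : |3 * a * (x.1 + y.1) + 2 * b| ≤ 6 * |a| + 2 * |b| := by
        refine (abs_add_le _ _).trans ?_
        rw [abs_mul, abs_mul, abs_mul, abs_of_nonneg (by norm_num : (0 : ℝ) ≤ 3),
          abs_of_nonneg (by norm_num : (0 : ℝ) ≤ 2),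
          abs_of_nonneg (add_nonneg hx.1.1 hy.1.1)]
        nlinarith [hx.1.2, hy.1.2, abs_nonneg a]
      calc |(3 * a * x.1 ^ 2 + 2 * b * x.1 + c) / m - (3 * a * y.1 ^ 2 + 2 * b * y.1 + c) / m|
          = |3 * a * (x.1 + y.1) + 2 * b| * |1 / m| * |x.1 - y.1| := by
            rw [← abs_mul, ← abs_mul]; congr 1; ring
        _ ≤ K * max |x.1 - y.1| |x.2 - y.2| := by
            refine mul_le_mul ?_ (le_max_left _ _) (abs_nonneg _) hK
            refine (mul_le_mul_of_nonneg_right hb (abs_nonneg _)).trans ?_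
            exact le_add_of_nonneg_left (abs_nonneg _)
  have key : (fun t => (ρ t, v t)) = fun t => (ρ' t, v' t) :=
    ODE_solution_unique_univ (t₀ := t₀)
      (v := fun _ x => (2 * x.2 / m, (3 * a * x.1 ^ 2 + 2 * b * x.1 + c) / m))
      (fun _ => hlip) (fun t => ⟨(h.deriv_pos t).prodMk (h.deriv_vel t), h.mem t, trivial⟩)
      (fun t => ⟨(h'.deriv_pos t).prodMk (h'.deriv_vel t), h'.mem t, trivial⟩)
      (Prod.ext h1 h2)
  have := congrFun key t
  exact ⟨congrArg Prod.fst this, congrArg Prod.snd this⟩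

/-- Without a turning point `v` keeps its sign, so ρ is monotone and bounded and converges to some
L. Then ρ' and `v'` converge as well and their limits must vanish, which makes L a multiple root of
P. The excluded case is the separatrix motion. -/
theorem IsCubicMotion.exists_turning_point (hm : 0 < m) (h : IsCubicMotion m a b c d ρ v)
    (hP : ∀ r, a * r ^ 3 + b * r ^ 2 + c * r + d = 0 → 3 * a * r ^ 2 + 2 * b * r + c ≠ 0) :
    ∃ t, 0 ≤ t ∧ v t = 0 := by
  by_contra! hne
  have hρc : Continuous ρ := continuous_iff_continuousAt.2 fun t => (h.deriv_pos t).continuousAt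
  have hvc : Continuous v := continuous_iff_continuousAt.2 fun t => (h.deriv_vel t).continuousAt
  have hsign : (∀ t, 0 ≤ t → 0 < v t) ∨ (∀ t, 0 ≤ t → v t < 0) := by
    by_contra! hcon
    obtain ⟨⟨t, ht, hvt⟩, u, hu, hvu⟩ := hcon
    obtain ⟨w, hw, hw0⟩ := isPreconnected_Ici.intermediate_value (s := Set.Ici (0 : ℝ)) ht hu
      hvc.continuousOn ⟨hvt, hvu⟩
    exact hne w hw hw0
  have hlim : ∃ L, Tendsto ρ atTop (𝓝 L) := by
    rcases hsign with hs | hs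
    · have hmono : MonotoneOn ρ (Set.Ici 0) := by
        refine monotoneOn_of_deriv_nonneg (convex_Ici 0) hρc.continuousOn
          (fun t _ => (h.deriv_pos t).differentiableAt.differentiableWithinAt) fun t ht => ?_
        rw [interior_Ici] at ht
        rw [(h.deriv_pos t).deriv]
        have := hs t ht.le
        positivity
      have hmono' : Monotone fun t => ρ (max t 0) := fun x y hxy =>
        hmono (le_max_right x 0) (le_max_right y 0) (max_le_max_right 0 hxy)
      rcases tendsto_atTop_of_monotone hmono' with h1 | ⟨L, hL⟩
      · obtain ⟨t, ht⟩ := (h1.eventually_gt_atTop 1).exists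
        exact absurd (h.mem _).2 ht.not_ge
      · refine ⟨L, hL.congr' ?_⟩
        filter_upwards [eventually_ge_atTop 0] with t ht
        rw [max_eq_left ht]
    · have hmono : AntitoneOn ρ (Set.Ici 0) := by
        refine antitoneOn_of_deriv_nonpos (convex_Ici 0) hρc.continuousOn
          (fun t _ => (h.deriv_pos t).differentiableAt.differentiableWithinAt) fun t ht => ?_
        rw [interior_Ici] at ht
        rw [(h.deriv_pos t).deriv]
        have := hs t ht.le
        exact div_nonpos_of_nonpos_of_nonneg (by linarith) hm.le
      have hmono' : Antitone fun t => ρ (max t 0) := fun x y hxy =>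
        hmono (le_max_right x 0) (le_max_right y 0) (max_le_max_right 0 hxy)
      rcases tendsto_atTop_of_antitone hmono' with h1 | ⟨L, hL⟩
      · obtain ⟨t, ht⟩ := (h1.eventually_lt_atBot 0).exists
        exact absurd (h.mem _).1 ht.not_ge
      · refine ⟨L, hL.congr' ?_⟩
        filter_upwards [eventually_ge_atTop 0] with t ht
        rw [max_eq_left ht]
  obtain ⟨L, hL⟩ := hlim
  have hP1 : Tendsto (fun t => a * ρ t ^ 3 + b * ρ t ^ 2 + c * ρ t + d) atTop
      (𝓝 (a * L ^ 3 + b * L ^ 2 + c * L + d)) :=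
    ((((hL.pow 3).const_mul a).add ((hL.pow 2).const_mul b)).add (hL.const_mul c)).add_const d
  have hP2 : Tendsto (fun t => (3 * a * ρ t ^ 2 + 2 * b * ρ t + c) / m) atTop
      (𝓝 ((3 * a * L ^ 2 + 2 * b * L + c) / m)) :=
    ((((hL.pow 2).const_mul (3 * a)).add (hL.const_mul (2 * b))).add_const c).div_const m
  have hsq : Tendsto (fun t => Real.sqrt (v t ^ 2)) atTop
      (𝓝 (Real.sqrt (a * L ^ 3 + b * L ^ 2 + c * L + d))) := by
    simp only [h.energy]
    exact (Real.continuous_sqrt.tendsto _).comp hP1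
  have hv : ∃ ε : ℝ, ε ≠ 0 ∧
      Tendsto v atTop (𝓝 (ε * Real.sqrt (a * L ^ 3 + b * L ^ 2 + c * L + d))) := by
    rcases hsign with hs | hs
    · refine ⟨1, one_ne_zero, ((hsq.const_mul 1).congr' ?_)⟩
      filter_upwards [eventually_ge_atTop 0] with t ht
      rw [Real.sqrt_sq (hs t ht).le, one_mul]
    · refine ⟨-1, by norm_num, ((hsq.const_mul (-1)).congr' ?_)⟩
      filter_upwards [eventually_ge_atTop 0] with t ht
      rw [Real.sqrt_sq_eq_abs, abs_of_neg (hs t ht)]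
      ring
  obtain ⟨ε, hε, hv⟩ := hv
  -- As ρ converges, the limit of its derivative is zero, so P(L) = 0. The same argument for `v`
  -- below gives P'(L) = 0.
  have h0 := eq_zero_of_tendsto_of_tendsto_deriv h.deriv_pos hL ((hv.const_mul 2).div_const m)
  have h00 : Real.sqrt (a * L ^ 3 + b * L ^ 2 + c * L + d) = 0 := by
    simpa [hε, hm.ne'] using h0
  have hPL : a * L ^ 3 + b * L ^ 2 + c * L + d = 0 := by
    refine le_antisymm (Real.sqrt_eq_zero'.1 h00) (ge_of_tendsto hP1 (Eventually.of_forall fun t => ?_))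
    rw [← h.energy]
    positivity
  have h1 := eq_zero_of_tendsto_of_tendsto_deriv h.deriv_vel hv hP2
  refine hP L hPL ?_
  rcases div_eq_zero_iff.1 h1 with h1 | h1
  · exact h1
  · exact absurd h1 hm.ne'

/-- If the cubic polynomial has no multiple root, the motion is periodic. -/
theorem IsCubicMotion.exists_period (hm : 0 < m) (h : IsCubicMotion m a b c d ρ v)
    (hP : ∀ r, a * r ^ 3 + b * r ^ 2 + c * r + d = 0 → 3 * a * r ^ 2 + 2 * b * r + c ≠ 0)
    (h0 : v 0 ≠ 0) : ∃ T, 0 < T ∧ ∀ t, ρ (t + T) = ρ t ∧ v (t + T) = v t := by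
  obtain ⟨t₁, ht₁, hv₁⟩ := h.exists_turning_point hm hP
  obtain ⟨t₂, ht₂, hv₂⟩ := (h.reflect 0).exists_turning_point hm hP
  have hv₂' : v (-t₂) = 0 := by simpa using hv₂
  -- At a turning time the reflected motion has the same initial data, so by uniqueness the motion
  -- is symmetric about that time.
  have key : ∀ t₀, v t₀ = 0 → ∀ t, ρ (2 * t₀ - t) = ρ t ∧ v (2 * t₀ - t) = -v t := by
    intro t₀ hv t
    have e : 2 * t₀ - t₀ = t₀ := by ring
    have := (h.reflect (2 * t₀)).unique h (t₀ := t₀) (by simp only [e]) (by simp [e, hv]) t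
    exact ⟨this.1, by rw [← this.2, neg_neg]⟩
  have hpos : 0 < t₁ := lt_of_le_of_ne ht₁ fun h => h0 (by subst h; exact hv₁)
  -- The composition of the reflections about the turning times `t₁` and `-t₂` is a translation by
  -- twice their distance. It is nontrivial because `v 0 ≠ 0` excludes `t₁ = 0`.
  refine ⟨2 * (t₁ + t₂), by positivity, fun t => ?_⟩
  have e : t + 2 * (t₁ + t₂) = 2 * t₁ - (2 * -t₂ - t) := by ring
  rw [e, (key t₁ hv₁ _).1, (key t₁ hv₁ _).2, (key _ hv₂' _).1, (key _ hv₂' _).2, neg_neg]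
  exact ⟨rfl, rfl⟩

/-- A cubic polynomial with nonzero discriminant has no multiple root. -/
theorem cubic_no_multiple_root
    (h : b ^ 2 * c ^ 2 - 4 * a * c ^ 3 - 4 * b ^ 3 * d - 27 * a ^ 2 * d ^ 2 + 18 * a * b * c * d ≠ 0)
    (r : ℝ) (h0 : a * r ^ 3 + b * r ^ 2 + c * r + d = 0) : 3 * a * r ^ 2 + 2 * b * r + c ≠ 0 := by
  intro h1
  apply h
  have hd : d = -(a * r ^ 3 + b * r ^ 2 + c * r) := by linarith
  have hc : c = -(3 * a * r ^ 2 + 2 * b * r) := by linarith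
  subst hd
  rw [hc]
  ring

end Newton

/-! ### Motions -/

section Motion

variable {n : ℕ} {m s : ℝ} {κ : Matrix (Fin n) (Fin n) ℝ} {c d : ℝ → Phase n}

theorem IsMotion.eq_of_isFirstIntegral (hc : IsMotion m s κ c) {f : Phase n → ℝ}
    (hf : Differentiable ℝ f) (hi : IsFirstIntegral m s κ f) (t t' : ℝ) : f (c t) = f (c t') := by
  refine is_const_of_deriv_eq_zero (f := fun t => f (c t))
    (fun t => (hasDerivAt_comp_curve hf (hc t).2).differentiableAt) (fun t => ?_) t t'
  rw [(hasDerivAt_comp_curve hf (hc t).2).deriv, hi _ (hc t).1]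

theorem IsMotion.shift (hc : IsMotion m s κ c) (t₀ : ℝ) : IsMotion m s κ fun t => c (t + t₀) :=
  fun t => ⟨(hc _).1, HasDerivAt.comp_add_const t t₀ (hc (t + t₀)).2⟩

theorem IsMotion.continuous (hc : IsMotion m s κ c) : Continuous c :=
  continuous_iff_continuousAt.2 fun t => (hc t).2.continuousAt

/-- Bootstrapping: the derivative of a motion is a smooth function of the motion, so each order of
differentiability yields the next. -/
theorem IsMotion.contDiff (hc : IsMotion m s κ c) : ContDiff ℝ ∞ c := by
  have hd : deriv c = fun t => flowField m s κ (c t) := funext fun t => (hc t).2.deriv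
  have hX : ContDiff ℝ ∞ (flowField m s κ) := contDiff_flowField.of_le le_top
  rw [contDiff_infty]
  intro k
  induction k with
  | zero => exact contDiff_zero.2 hc.continuous
  | succ k ih =>
    rw [show ((k + 1 : ℕ) : WithTop ℕ∞) = (k : WithTop ℕ∞) + 1 by push_cast; rfl,
      contDiff_succ_iff_deriv]
    refine ⟨fun t => (hc t).2.differentiableAt, by simp, ?_⟩
    rw [hd]
    exact (hX.of_le (by exact_mod_cast le_top)).comp ih

theorem exists_cutoff (R : ℝ) :
    ∃ χ : Phase n → ℝ, ContDiff ℝ ∞ χ ∧ HasCompactSupport χ ∧ ∀ x, ‖x‖ ≤ R → χ x = 1 := by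
  let χ : ContDiffBump (0 : Phase n) := ⟨|R| + 1, |R| + 2, by positivity, by linarith⟩
  refine ⟨χ, χ.contDiff, χ.hasCompactSupport, fun x hx => χ.one_of_mem_closedBall ?_⟩
  rw [mem_closedBall_zero_iff]
  change ‖x‖ ≤ |R| + 1
  linarith [le_abs_self R]

theorem norm_le_of_dotProduct_le {v : Fin n → ℝ} {R : ℝ} (hR : 0 ≤ R) (h : v ⬝ᵥ v ≤ R ^ 2) :
    ‖v‖ ≤ R := by
  rw [pi_norm_le_iff_of_nonneg hR]
  intro i
  rw [Real.norm_eq_abs]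
  refine abs_le_of_sq_le_sq ?_ hR
  refine le_trans ?_ h
  rw [sq]
  exact Finset.single_le_sum (f := fun i => v i * v i) (fun i _ => mul_self_nonneg _)
    (Finset.mem_univ i)

theorem norm_le_of_mem {x : Phase n} (hx : x ∈ cotangentSphere n) : ‖x‖ ≤ 1 + x.2 ⬝ᵥ x.2 := by
  have h1 := hx.1
  simp only [phi1] at h1
  have h2 := dotProduct_self_nonneg' x.2
  refine norm_prod_le_iff.2 ⟨?_, ?_⟩
  · exact (norm_le_of_dotProduct_le zero_le_one (by rw [h1]; norm_num)).trans (by linarith)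
  · exact norm_le_of_dotProduct_le (by linarith) (by nlinarith)

theorem IsMotion.dotProduct_eq (hm : 0 < m) (hκ : κᵀ = -κ) (hc : IsMotion m s κ c) (t t' : ℝ) :
    (c t).2 ⬝ᵥ (c t).2 = (c t').2 ⬝ᵥ (c t').2 := by
  have := hc.eq_of_isFirstIntegral (differentiable_of_contDiff_omega contDiff_hamiltonian)
    (isFirstIntegral_hamiltonian hκ) t t'
  simp only [hamiltonian] at this
  have h2 : 1 / (2 * m) ≠ 0 := by positivity
  exact mul_left_cancel₀ h2 this

/-- Conservation of ⟨p, p⟩ keeps both motions in one ball. There the flow field agrees with its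
product with a cutoff, which is globally Lipschitz. -/
theorem IsMotion.unique (hm : 0 < m) (hκ : κᵀ = -κ) (hc : IsMotion m s κ c)
    (hd : IsMotion m s κ d) {t₀ : ℝ} (h : c t₀ = d t₀) : c = d := by
  obtain ⟨χ, hχ, hχc, hχ1⟩ := exists_cutoff (n := n) (1 + (c t₀).2 ⬝ᵥ (c t₀).2)
  have hX : ContDiff ℝ ∞ (flowField m s κ) := contDiff_flowField.of_le le_top
  obtain ⟨K, hK⟩ := ContDiff.lipschitzWith_of_hasCompactSupport
    (hχc.smul_right (f' := flowField m s κ)) (hχ.smul hX) (by simp)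
  have key : ∀ {e : ℝ → Phase n}, IsMotion m s κ e → e t₀ = c t₀ → ∀ t,
      HasDerivAt e (χ (e t) • flowField m s κ (e t)) t := by
    intro e he h0 t
    rw [hχ1, one_smul]
    · exact (he t).2
    · rw [← h0, he.dotProduct_eq hm hκ t₀ t]
      exact norm_le_of_mem (he t).1
  exact ODE_solution_unique_univ (v := fun _ x => χ x • flowField m s κ x) (s := fun _ => Set.univ)
    (fun _ => hK.lipschitzOnWith) (fun t => ⟨key hc rfl t, trivial⟩)
    (fun t => ⟨key hd h.symm t, trivial⟩) h

open scoped Manifold in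
-- A compactly supported field is bounded and globally Lipschitz, so Picard–Lindelöf yields
-- solutions over the same time interval from every point. A uniform existence time extends them to
-- all times.
theorem exists_integralCurve {E : Type*} [NormedAddCommGroup E] [NormedSpace ℝ E]
    [CompleteSpace E] {X : E → E} (hX : ContDiff ℝ ∞ X) (hXc : HasCompactSupport X) (x : E) :
    ∃ c : ℝ → E, c 0 = x ∧ ∀ t, HasDerivAt c (X (c t)) t := by
  obtain ⟨K, hK⟩ := ContDiff.lipschitzWith_of_hasCompactSupport hXc hX (by simp)
  obtain ⟨C, hC⟩ := hXc.exists_bound_of_continuous hX.continuous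
  have hC0 : 0 ≤ C := (norm_nonneg _).trans (hC x)
  have hloc : ∀ x : E, ∃ c : ℝ → E, c 0 = x ∧
      IsMIntegralCurveOn (I := 𝓘(ℝ, E)) (M := E) c X (Set.Ioo (-1) 1) := by
    intro x
    -- The ball around `x` is given the radius `C`, the bound of the field, so that no solution can
    -- leave it within time 1.
    have hpl : IsPicardLindelof (fun _ => X) (⟨0, by norm_num, by norm_num⟩ : Set.Icc (-1 : ℝ) 1) x
        C.toNNReal 0 C.toNNReal K :=
      IsPicardLindelof.of_time_independent
        (fun y _ => by rw [Real.coe_toNNReal _ hC0]; exact hC y) hK.lipschitzOnWith (by simp)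
    obtain ⟨c, hc0, hc⟩ := hpl.exists_eq_forall_mem_Icc_hasDerivWithinAt (x := x) (by simp)
    refine ⟨c, hc0, fun t ht => ?_⟩
    have h := (hc t (Set.Ioo_subset_Icc_self ht)).mono Set.Ioo_subset_Icc_self
    exact h.hasFDerivWithinAt.hasMFDerivWithinAt
  have hsec : ContMDiff 𝓘(ℝ, E) (𝓘(ℝ, E)).tangent 1
      (fun x => (⟨x, X x⟩ : TangentBundle 𝓘(ℝ, E) E)) :=
    contMDiff_vectorSpace_iff_contDiff.2 (hX.of_le (by exact_mod_cast le_top))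
  obtain ⟨c, hc0, hc⟩ := exists_isMIntegralCurve_of_isMIntegralCurveOn hsec one_pos hloc x
  refine ⟨c, hc0, fun t => ?_⟩
  have h : HasFDerivAt c (ContinuousLinearMap.toSpanSingleton ℝ (X (c t))) t :=
    hasMFDerivAt_iff_hasFDerivAt.1 (hc t)
  simpa using h.hasDerivAt

/-- The field cut off outside a ball has a global solution. It remains on T*Sⁿ⁻¹ and conserves ⟨p,
p⟩, hence never leaves the region where the cutoff is 1, and so solves the original equation. -/
theorem exists_isMotion (hm : 0 < m) (hκ : κᵀ = -κ) {x : Phase n} (hx : x ∈ cotangentSphere n) :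
    ∃ c, c 0 = x ∧ IsMotion m s κ c := by
  obtain ⟨χ, hχ, hχc, hχ1⟩ := exists_cutoff (n := n) (1 + x.2 ⬝ᵥ x.2)
  have hX : ContDiff ℝ ∞ (flowField m s κ) := contDiff_flowField.of_le le_top
  obtain ⟨c, hc0, hc⟩ := exists_integralCurve (hχ.smul hX)
    (hχc.smul_right (f' := flowField m s κ)) x
  have hcc : Continuous c := continuous_iff_continuousAt.2 fun t => (hc t).continuousAt
  have hmc : Continuous (multiplier m s κ) := contDiff_multiplier.continuous
  have hmem : ∀ t, c t ∈ cotangentSphere n := by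
    obtain ⟨C1, hC1⟩ := hχc.exists_bound_of_continuous hχ.continuous
    obtain ⟨C2, hC2⟩ := (hχc.mul_right (f' := multiplier m s κ)).exists_bound_of_continuous
      (hχ.continuous.mul hmc)
    have hC10 : 0 ≤ C1 := (norm_nonneg _).trans (hC1 x)
    have hC20 : 0 ≤ C2 := (norm_nonneg _).trans (hC2 x)
    have hK0 : 0 ≤ C1 * |2 / m| + C2 := by positivity
    -- Along the solution the defects of the two constraints satisfy a homogeneous linear system
    -- with bounded coefficients. They vanish at time 0, so they vanish always.
    have hd : ∀ t, HasDerivAt (fun t => (phi1 (c t) - 1, phi2 (c t)))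
        (χ (c t) * (2 / m) * phi2 (c t),
          χ (c t) * multiplier m s κ (c t) * (phi1 (c t) - 1)) t := by
      intro t
      have h1 := hasDerivAt_fst (hc t)
      have h2 := hasDerivAt_snd (hc t)
      refine HasDerivAt.prodMk ?_ ?_
      · refine ((hasDerivAt_dotProduct h1 h1).sub_const 1).congr_deriv ?_
        simp only [Pi.smul_apply', flowField, phi2, Prod.smul_fst, dotProduct_smul, smul_dotProduct,
          smul_eq_mul, dotProduct_comm (c t).1 (c t).2]
        ring
      · refine (hasDerivAt_dotProduct h2 h1).congr_deriv ?_
        have h3 := dotProduct_mulVec_skew hκ (c t).2 (c t).1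
        simp only [Pi.smul_apply', flowField, phi1, Prod.smul_fst, Prod.smul_snd, dotProduct_smul,
          smul_dotProduct, add_dotProduct, smul_eq_mul, multiplier]
        linear_combination (χ (c t) * s / m) * h3
    have key := ODE_solution_unique_univ (t₀ := 0) (K := (C1 * |2 / m| + C2).toNNReal)
      (v := fun t (u : ℝ × ℝ) => (χ (c t) * (2 / m) * u.2,
        χ (c t) * multiplier m s κ (c t) * u.1)) (s := fun _ => Set.univ)
      (f := fun t => (phi1 (c t) - 1, phi2 (c t))) (g := fun _ => (0, 0)) ?_
      (fun t => ⟨hd t, trivial⟩) (fun t => ⟨?_, trivial⟩) ?_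
    · intro t
      have := congrFun key t
      simp only [Prod.mk.injEq, sub_eq_zero] at this
      exact this
    · intro t
      refine LipschitzOnWith.of_dist_le_mul fun u _ w _ => ?_
      rw [Real.coe_toNNReal _ hK0, Prod.dist_eq, Prod.dist_eq, Real.dist_eq, Real.dist_eq,
        Real.dist_eq, Real.dist_eq]
      have e1 : |χ (c t)| ≤ C1 := hC1 (c t)
      have e2 : |χ (c t) * multiplier m s κ (c t)| ≤ C2 := hC2 (c t)
      refine max_le ?_ ?_
      · rw [← mul_sub, abs_mul, abs_mul]
        refine mul_le_mul ?_ (le_max_right _ _) (abs_nonneg _) hK0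
        exact (mul_le_mul_of_nonneg_right e1 (abs_nonneg _)).trans (le_add_of_nonneg_right hC20)
      · rw [← mul_sub, abs_mul]
        refine mul_le_mul ?_ (le_max_left _ _) (abs_nonneg _) hK0
        exact e2.trans (le_add_of_nonneg_left (by positivity))
    · simpa using! hasDerivAt_const t ((0 : ℝ), (0 : ℝ))
    · have h1 := hx.1
      have h2 := hx.2
      simp [hc0, h1, h2]
  have henergy : ∀ t, (c t).2 ⬝ᵥ (c t).2 = x.2 ⬝ᵥ x.2 := by
    have hd : ∀ t, HasDerivAt (fun t => (c t).2 ⬝ᵥ (c t).2) 0 t := fun t => by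
      have h2 := hasDerivAt_snd (hc t)
      refine (hasDerivAt_dotProduct h2 h2).congr_deriv ?_
      have h3 := dotProduct_mulVec_self_skew hκ (c t).2
      have h4 := (hmem t).2
      simp only [phi2] at h4
      simp only [Pi.smul_apply', flowField, Prod.smul_snd, dotProduct_smul, dotProduct_add,
        smul_dotProduct, add_dotProduct, smul_eq_mul, h3, h4, dotProduct_comm (c t).1 (c t).2,
        dotProduct_comm (κ *ᵥ (c t).2) (c t).2]
      ring
    intro t
    rw [is_const_of_deriv_eq_zero (fun t => (hd t).differentiableAt) (fun t => (hd t).deriv) t 0, hc0]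
  refine ⟨c, hc0, fun t => ⟨hmem t, ?_⟩⟩
  have h := hc t
  simp only [Pi.smul_apply'] at h
  rwa [hχ1, one_smul] at h
  rw [← henergy t]
  exact norm_le_of_mem (hmem t)

end Motion


/-! ### Orthogonal symmetries -/

section Orthogonal

variable {n : ℕ} {m s : ℝ} {κ U : Matrix (Fin n) (Fin n) ℝ}

theorem mulVec_dotProduct_mulVec (hU : Uᵀ * U = 1) (u v : Fin n → ℝ) :
    (U *ᵥ u) ⬝ᵥ (U *ᵥ v) = u ⬝ᵥ v := by
  rw [Matrix.dotProduct_mulVec, ← Matrix.mulVec_transpose, Matrix.mulVec_mulVec, hU,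
    Matrix.one_mulVec]

theorem rotate_mem_cotangentSphere (hU : Uᵀ * U = 1) {x : Phase n} (hx : x ∈ cotangentSphere n) :
    rotate U x ∈ cotangentSphere n := by
  obtain ⟨h1, h2⟩ := hx
  simp only [phi1, phi2] at h1 h2
  exact ⟨by simp only [phi1, rotate, mulVec_dotProduct_mulVec hU, h1],
    by simp only [phi2, rotate, mulVec_dotProduct_mulVec hU, h2]⟩

theorem hamiltonian_rotate (hU : Uᵀ * U = 1) (x : Phase n) :
    hamiltonian m (rotate U x) = hamiltonian m x := by
  simp only [hamiltonian, rotate, mulVec_dotProduct_mulVec hU]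

theorem multiplier_rotate (hU : Uᵀ * U = 1) (hc : U * κ = κ * U) (x : Phase n) :
    multiplier m s κ (rotate U x) = multiplier m s κ x := by
  simp only [multiplier, rotate, ← mulVec_comm_of_commute hc, mulVec_dotProduct_mulVec hU]

theorem fieldIntegral_rotate (hU : Uᵀ * U = 1) (hc : U * κ = κ * U) (x : Phase n) :
    fieldIntegral m s κ (rotate U x) = fieldIntegral m s κ x := by
  simp only [fieldIntegral, multiplier_rotate hU hc]
  simp only [rotate, ← mulVec_comm_of_commute hc, mulVec_dotProduct_mulVec hU]

theorem gaugeNoether_rotate (hc : U * κ = κ * U) (A : Matrix (Fin n) (Fin n) ℝ) (x : Phase n) :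
    gaugeNoether s κ A (rotate U x) = gaugeNoether s κ (Uᵀ * A * U) x := by
  have h : ∀ u v : Fin n → ℝ, (U *ᵥ u) ⬝ᵥ v = u ⬝ᵥ (Uᵀ *ᵥ v) := fun u v => by
    rw [Matrix.dotProduct_mulVec, Matrix.vecMul_transpose]
  simp only [gaugeNoether, rotate, h, ← mulVec_comm_of_commute hc, Matrix.mulVec_mulVec,
    Matrix.mul_assoc]

theorem flowField_rotate (hU : Uᵀ * U = 1) (hc : U * κ = κ * U) (x : Phase n) :
    flowField m s κ (rotate U x) = rotate U (flowField m s κ x) := by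
  simp only [flowField, multiplier_rotate hU hc]
  simp only [rotate, Matrix.mulVec_add, Matrix.mulVec_smul, mulVec_comm_of_commute hc]

theorem IsSymmetry.conj {A : Matrix (Fin n) (Fin n) ℝ} (hA : IsSymmetry κ A) (hκ : κᵀ = -κ)
    (hc : U * κ = κ * U) : IsSymmetry κ (Uᵀ * A * U) := by
  have hc' : Uᵀ * κ = κ * Uᵀ := by
    have := congrArg Matrix.transpose hc
    rw [Matrix.transpose_mul, Matrix.transpose_mul, hκ, neg_mul, mul_neg, neg_inj] at this
    exact this.symm
  refine ⟨?_, ?_⟩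
  · rw [Matrix.transpose_mul, Matrix.transpose_mul, hA.1, Matrix.transpose_transpose,
      Matrix.mul_assoc, neg_mul, mul_neg]
  · rw [Matrix.mul_assoc, hc, ← Matrix.mul_assoc, Matrix.mul_assoc Uᵀ, hA.2, ← Matrix.mul_assoc,
      hc', Matrix.mul_assoc, Matrix.mul_assoc, Matrix.mul_assoc]

theorem hasDerivAt_rotate (U : Matrix (Fin n) (Fin n) ℝ) {c : ℝ → Phase n} {c' : Phase n} {t : ℝ}
    (h : HasDerivAt c c' t) : HasDerivAt (fun t => rotate U (c t)) (rotate U c') t :=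
  (hasDerivAt_mulVec U (hasDerivAt_fst h)).prodMk (hasDerivAt_mulVec U (hasDerivAt_snd h))

theorem IsMotion.rotate {c : ℝ → Phase n} (hc : IsMotion m s κ c) (hU : Uᵀ * U = 1)
    (hUκ : U * κ = κ * U) : IsMotion m s κ fun t => rotate U (c t) := fun t =>
  ⟨rotate_mem_cotangentSphere hU (hc t).1, by
    rw [flowField_rotate hU hUκ]; exact hasDerivAt_rotate U (hc t).2⟩

end Orthogonal

/-! ### Frames of planes and their rotations -/

section Frame

variable {n q : ℕ} {m s : ℝ} {κ : Matrix (Fin n) (Fin n) ℝ}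

/-- Orthonormal pairs `(eⱼ, fⱼ)` which span mutually orthogonal planes, invariant under `κ`. -/
structure IsFrame (κ : Matrix (Fin n) (Fin n) ℝ) (e f : Fin q → Fin n → ℝ) (k : Fin q → ℝ) :
    Prop where
  ee : ∀ i j, e i ⬝ᵥ e j = if i = j then 1 else 0
  ff : ∀ i j, f i ⬝ᵥ f j = if i = j then 1 else 0
  ef : ∀ i j, e i ⬝ᵥ f j = 0
  map_e : ∀ j, κ *ᵥ e j = -(k j) • f j
  map_f : ∀ j, κ *ᵥ f j = k j • e j

/-- The generator `f eᵀ - e fᵀ` of the rotations of the plane spanned by `e` and `f`. -/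
def planeGen (e f : Fin n → ℝ) : Matrix (Fin n) (Fin n) ℝ :=
  Matrix.vecMulVec f e - Matrix.vecMulVec e f

theorem vecMulVec_mulVec_eq (a b u : Fin n → ℝ) :
    Matrix.vecMulVec a b *ᵥ u = (b ⬝ᵥ u) • a := by
  ext i
  simp only [Matrix.mulVec, Matrix.vecMulVec_apply, dotProduct, Pi.smul_apply, smul_eq_mul,
    Finset.sum_mul]
  exact Finset.sum_congr rfl fun j _ => by ring

theorem planeGen_mulVec (e f u : Fin n → ℝ) :
    planeGen e f *ᵥ u = (e ⬝ᵥ u) • f - (f ⬝ᵥ u) • e := by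
  rw [planeGen, Matrix.sub_mulVec, vecMulVec_mulVec_eq, vecMulVec_mulVec_eq]

theorem planeGen_transpose (e f : Fin n → ℝ) : (planeGen e f)ᵀ = -planeGen e f := by
  simp [planeGen, Matrix.transpose_sub, Matrix.transpose_vecMulVec]

theorem ext_mulVec {A B : Matrix (Fin n) (Fin n) ℝ} (h : ∀ u, A *ᵥ u = B *ᵥ u) : A = B :=
  Matrix.mulVec_injective (funext h)

theorem IsFrame.isSymmetry {e f : Fin q → Fin n → ℝ} {k : Fin q → ℝ} (hF : IsFrame κ e f k)
    (hκ : κᵀ = -κ) (j : Fin q) : IsSymmetry κ (planeGen (e j) (f j)) := by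
  refine ⟨planeGen_transpose _ _, ext_mulVec fun u => ?_⟩
  simp only [← Matrix.mulVec_mulVec, planeGen_mulVec, Matrix.mulVec_sub, Matrix.mulVec_smul,
    hF.map_e, hF.map_f, dotProduct_mulVec_skew hκ, smul_dotProduct, smul_eq_mul]
  module

/-- The rotation by the angles `2πβⱼ` in the planes of the frame. -/
noncomputable def frameRotation (e f : Fin q → Fin n → ℝ) (β : Fin q → ℝ) :
    Matrix (Fin n) (Fin n) ℝ :=
  1 + ∑ j, ((Real.cos (2 * Real.pi * β j) - 1) •
      (Matrix.vecMulVec (e j) (e j) + Matrix.vecMulVec (f j) (f j))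
    + Real.sin (2 * Real.pi * β j) • planeGen (e j) (f j))

theorem frameRotation_mulVec (e f : Fin q → Fin n → ℝ) (β : Fin q → ℝ) (u : Fin n → ℝ) :
    frameRotation e f β *ᵥ u = u + ∑ j,
      ((Real.cos (2 * Real.pi * β j) - 1) • ((e j ⬝ᵥ u) • e j + (f j ⬝ᵥ u) • f j)
        + Real.sin (2 * Real.pi * β j) • ((e j ⬝ᵥ u) • f j - (f j ⬝ᵥ u) • e j)) := by
  rw [frameRotation, Matrix.add_mulVec, Matrix.one_mulVec, Matrix.sum_mulVec]
  congr 1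
  refine Finset.sum_congr rfl fun j _ => ?_
  rw [Matrix.add_mulVec, Matrix.smul_mulVec, Matrix.smul_mulVec, planeGen_mulVec,
    Matrix.add_mulVec, vecMulVec_mulVec_eq, vecMulVec_mulVec_eq]

variable {e f : Fin q → Fin n → ℝ} {k : Fin q → ℝ}

theorem IsFrame.dot_e (hF : IsFrame κ e f k) (β : Fin q → ℝ) (u : Fin n → ℝ) (j : Fin q) :
    e j ⬝ᵥ (frameRotation e f β *ᵥ u) = Real.cos (2 * Real.pi * β j) * (e j ⬝ᵥ u)
      - Real.sin (2 * Real.pi * β j) * (f j ⬝ᵥ u) := by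
  rw [frameRotation_mulVec]
  simp only [dotProduct_add, dotProduct_sum, dotProduct_smul, dotProduct_sub, hF.ee, hF.ef,
    smul_eq_mul, mul_zero, add_zero, zero_sub, mul_ite, mul_one, mul_neg]
  rw [Finset.sum_add_distrib]
  simp only [Finset.sum_ite_eq, Finset.mem_univ, if_true, Finset.sum_neg_distrib]
  ring

theorem IsFrame.dot_f (hF : IsFrame κ e f k) (β : Fin q → ℝ) (u : Fin n → ℝ) (j : Fin q) :
    f j ⬝ᵥ (frameRotation e f β *ᵥ u) = Real.sin (2 * Real.pi * β j) * (e j ⬝ᵥ u)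
      + Real.cos (2 * Real.pi * β j) * (f j ⬝ᵥ u) := by
  have hfe : ∀ i, f j ⬝ᵥ e i = 0 := fun i => by rw [dotProduct_comm, hF.ef]
  rw [frameRotation_mulVec]
  simp only [dotProduct_add, dotProduct_sum, dotProduct_smul, dotProduct_sub, hF.ff, hfe,
    smul_eq_mul, mul_zero, zero_add, sub_zero, mul_ite, mul_one]
  rw [Finset.sum_add_distrib]
  simp only [Finset.sum_ite_eq, Finset.mem_univ, if_true]
  ring

theorem IsFrame.mul (hF : IsFrame κ e f k) (β β' : Fin q → ℝ) :
    frameRotation e f β * frameRotation e f β' = frameRotation e f (β + β') := by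
  refine ext_mulVec fun u => ?_
  rw [← Matrix.mulVec_mulVec, frameRotation_mulVec e f β]
  simp only [hF.dot_e, hF.dot_f]
  rw [frameRotation_mulVec, frameRotation_mulVec, add_assoc, ← Finset.sum_add_distrib]
  congr 1
  refine Finset.sum_congr rfl fun j _ => ?_
  simp only [Pi.add_apply, mul_add, Real.cos_add, Real.sin_add]
  module

theorem frameRotation_zero : frameRotation e f 0 = 1 := by
  simp [frameRotation]

theorem frameRotation_transpose (β : Fin q → ℝ) :
    (frameRotation e f β)ᵀ = frameRotation e f (-β) := by
  simp only [frameRotation, Matrix.transpose_add, Matrix.transpose_one, Matrix.transpose_sum,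
    Matrix.transpose_smul, planeGen_transpose, Matrix.transpose_vecMulVec, Pi.neg_apply, mul_neg,
    Real.cos_neg, Real.sin_neg, smul_neg, neg_smul]

theorem IsFrame.orthogonal (hF : IsFrame κ e f k) (β : Fin q → ℝ) :
    (frameRotation e f β)ᵀ * frameRotation e f β = 1 := by
  rw [frameRotation_transpose, hF.mul, neg_add_cancel, frameRotation_zero]

theorem IsFrame.commute (hF : IsFrame κ e f k) (hκ : κᵀ = -κ) (β : Fin q → ℝ) :
    frameRotation e f β * κ = κ * frameRotation e f β := by
  refine ext_mulVec fun u => ?_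
  rw [← Matrix.mulVec_mulVec, ← Matrix.mulVec_mulVec, frameRotation_mulVec, frameRotation_mulVec,
    Matrix.mulVec_add, Matrix.mulVec_sum]
  congr 1
  refine Finset.sum_congr rfl fun j _ => ?_
  simp only [Matrix.mulVec_add, Matrix.mulVec_sub, Matrix.mulVec_smul, hF.map_e, hF.map_f,
    dotProduct_mulVec_skew hκ, smul_dotProduct, smul_eq_mul]
  module

theorem frameRotation_add_int (β : Fin q → ℝ) (l : Fin q → ℤ) :
    frameRotation e f (fun j => β j + l j) = frameRotation e f β := by
  have h : ∀ j, 2 * Real.pi * (β j + l j) = 2 * Real.pi * β j + l j * (2 * Real.pi) :=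
    fun j => by ring
  simp only [frameRotation, h, Real.cos_add_int_mul_two_pi, Real.sin_add_int_mul_two_pi]

theorem rotate_rotate (A B : Matrix (Fin n) (Fin n) ℝ) (x : Phase n) :
    rotate A (rotate B x) = rotate (A * B) x := by
  simp only [rotate, Matrix.mulVec_mulVec]

theorem rotate_one (x : Phase n) : rotate 1 x = x := by
  simp only [rotate, Matrix.one_mulVec]

/-- The rotations act freely on points with nonzero components in all planes. -/
theorem IsFrame.exists_int_of_rotate_eq (hF : IsFrame κ e f k) {x : Phase n} {j : Fin q}
    (hx : rotate (planeGen (e j) (f j)) x ≠ 0) {β : Fin q → ℝ}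
    (h : rotate (frameRotation e f β) x = x) : ∃ l : ℤ, β j = l := by
  have hcos : Real.cos (2 * Real.pi * β j) = 1 := by
    have key : ∀ u : Fin n → ℝ, planeGen (e j) (f j) *ᵥ u ≠ 0 → frameRotation e f β *ᵥ u = u →
        Real.cos (2 * Real.pi * β j) = 1 := by
      intro u hu hr
      have h1 := hF.dot_e β u j
      have h2 := hF.dot_f β u j
      rw [hr] at h1 h2
      have h3 : (e j ⬝ᵥ u) ^ 2 + (f j ⬝ᵥ u) ^ 2 ≠ 0 := by
        intro h0
        apply hu
        have ha : e j ⬝ᵥ u = 0 := by nlinarith [sq_nonneg (e j ⬝ᵥ u), sq_nonneg (f j ⬝ᵥ u)]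
        have hb : f j ⬝ᵥ u = 0 := by nlinarith [sq_nonneg (e j ⬝ᵥ u), sq_nonneg (f j ⬝ᵥ u)]
        rw [planeGen_mulVec, ha, hb, zero_smul, zero_smul, sub_zero]
      -- The inner product of the component with its rotated copy is cos times its squared length. A
      -- fixed nonzero component therefore forces cos = 1.
      have h4 : (Real.cos (2 * Real.pi * β j) - 1) * ((e j ⬝ᵥ u) ^ 2 + (f j ⬝ᵥ u) ^ 2) = 0 := by
        linear_combination (-(e j ⬝ᵥ u)) * h1 - (f j ⬝ᵥ u) * h2
      rcases mul_eq_zero.1 h4 with h5 | h5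
      · linarith
      · exact absurd h5 h3
    by_cases h1 : planeGen (e j) (f j) *ᵥ x.1 = 0
    · by_cases h2 : planeGen (e j) (f j) *ᵥ x.2 = 0
      · exact absurd (Prod.ext h1 h2) hx
      · exact key _ h2 (congrArg Prod.snd h)
    · exact key _ h1 (congrArg Prod.fst h)
  obtain ⟨l, hl⟩ := (Real.cos_eq_one_iff _).1 hcos
  refine ⟨l, ?_⟩
  have := Real.pi_pos
  have h2 : (2 * Real.pi) * (β j - l) = 0 := by linear_combination -hl
  rcases mul_eq_zero.1 h2 with h3 | h3
  · exact absurd h3 (by positivity)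
  · linarith

theorem hasDerivAt_frameRotation_mulVec (δ : Fin q → ℝ) {d : ℝ → Fin n → ℝ} {d' : Fin n → ℝ}
    (hd : HasDerivAt d d' 0) :
    HasDerivAt (fun t : ℝ => frameRotation e f (t • δ) *ᵥ d t)
      (d' + ∑ j, (2 * Real.pi * δ j) • (planeGen (e j) (f j) *ᵥ d 0)) 0 := by
  simp only [frameRotation_mulVec, planeGen_mulVec]
  refine hd.add (HasDerivAt.fun_sum fun j _ => ?_)
  have hang : HasDerivAt (fun t : ℝ => 2 * Real.pi * (t • δ) j) (2 * Real.pi * δ j) 0 := by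
    have := ((hasDerivAt_id (0 : ℝ)).mul_const (δ j)).const_mul (2 * Real.pi)
    simpa using this
  have he := hasDerivAt_dotProduct (hasDerivAt_const (0 : ℝ) (e j)) hd
  have hf := hasDerivAt_dotProduct (hasDerivAt_const (0 : ℝ) (f j)) hd
  refine (((hang.cos.sub_const 1).smul ((he.smul_const (e j)).add (hf.smul_const (f j)))).add
    (hang.sin.smul ((he.smul_const (f j)).sub (hf.smul_const (e j))))).congr_deriv ?_
  simp only [zero_smul, Pi.zero_apply, mul_zero, Real.cos_zero, Real.sin_zero, sub_self,
    neg_zero, zero_mul, zero_add, one_mul, add_zero]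
  rfl

theorem hasDerivAt_frameRotation (δ : Fin q → ℝ) {d : ℝ → Phase n} {d' : Phase n}
    (hd : HasDerivAt d d' 0) :
    HasDerivAt (fun t : ℝ => rotate (frameRotation e f (t • δ)) (d t))
      (d' + ∑ j, (2 * Real.pi * δ j) • rotate (planeGen (e j) (f j)) (d 0)) 0 := by
  refine ((hasDerivAt_frameRotation_mulVec δ (hasDerivAt_fst hd)).prodMk
    (hasDerivAt_frameRotation_mulVec δ (hasDerivAt_snd hd))).congr_deriv ?_
  ext i <;> simp [rotate, Prod.fst_sum, Prod.snd_sum]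

theorem contDiff_frameRotation {E : Type*} [NormedAddCommGroup E] [NormedSpace ℝ E]
    {β : E → Fin q → ℝ} {d : E → Phase n} (hβ : ContDiff ℝ ∞ β) (hd : ContDiff ℝ ∞ d) :
    ContDiff ℝ ∞ fun θ => rotate (frameRotation e f (β θ)) (d θ) := by
  have key : ∀ {u : E → Fin n → ℝ}, ContDiff ℝ ∞ u →
      ContDiff ℝ ∞ fun θ => frameRotation e f (β θ) *ᵥ u θ := by
    intro u hu
    simp only [frameRotation_mulVec]
    refine hu.add (ContDiff.sum fun j _ => ?_)
    have hang : ContDiff ℝ ∞ fun θ => 2 * Real.pi * β θ j :=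
      contDiff_const.mul (contDiff_pi.1 hβ j)
    have he := contDiff_dotProduct (contDiff_const (c := e j)) hu
    have hf := contDiff_dotProduct (contDiff_const (c := f j)) hu
    exact ((hang.cos.sub contDiff_const).smul ((he.smul contDiff_const).add
      (hf.smul contDiff_const))).add (hang.sin.smul ((he.smul contDiff_const).sub
      (hf.smul contDiff_const)))
  exact (key hd.fst).prodMk (key hd.snd)

/-- Components of distinct planes are independent. -/
theorem IsFrame.eq_zero_of_sum (hF : IsFrame κ e f k) {x : Phase n} {a : Fin q → ℝ}
    (h : ∑ j, a j • rotate (planeGen (e j) (f j)) x = 0) (j : Fin q) :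
    a j • rotate (planeGen (e j) (f j)) x = 0 := by
  have hfe : ∀ i j, f i ⬝ᵥ e j = 0 := fun i j => by rw [dotProduct_comm, hF.ef]
  have key : ∀ u : Fin n → ℝ, ∑ j, a j • (planeGen (e j) (f j) *ᵥ u) = 0 →
      a j • (planeGen (e j) (f j) *ᵥ u) = 0 := by
    intro u hu
    have h1 := congrArg (fun v => e j ⬝ᵥ v) hu
    have h2 := congrArg (fun v => f j ⬝ᵥ v) hu
    simp only [planeGen_mulVec, dotProduct_sum, dotProduct_smul, dotProduct_sub, hF.ee, hF.ef,
      hF.ff, hfe, smul_eq_mul, mul_zero, zero_sub, sub_zero, mul_ite, mul_one, dotProduct_zero,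
      mul_neg, Finset.sum_neg_distrib, Finset.sum_ite_eq, Finset.mem_univ, if_true,
      neg_eq_zero] at h1 h2
    rw [planeGen_mulVec, smul_sub, smul_smul, smul_smul, h1, h2, zero_smul, zero_smul, sub_zero]
  have h1 := key x.1 (by simpa [rotate, Prod.fst_sum] using congrArg Prod.fst h)
  have h2 := key x.2 (by simpa [rotate, Prod.snd_sum] using congrArg Prod.snd h)
  exact Prod.ext h1 h2

theorem twistedForm_rotate_rotate (hκ : κᵀ = -κ) {A B : Matrix (Fin n) (Fin n) ℝ}
    (hA : IsSymmetry κ A) (hB : IsSymmetry κ B) (hAB : A * B = B * A) (x : Phase n) :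
    twistedForm s κ (rotate A x) (rotate B x) = 0 := by
  rw [← fderiv_gaugeNoether_eq_twistedForm hκ hB, fderiv_gaugeNoether_rotate hA, hAB, sub_self]
  simp [gaugeNoether]

theorem twistedForm_rotate_flowField {A : Matrix (Fin n) (Fin n) ℝ} (hA : Aᵀ = -A)
    (x : Phase n) : twistedForm s κ (rotate A x) (flowField m s κ x) = 0 := by
  rw [← fderiv_hamiltonian_eq_twistedForm (IsSymmetry.rotate_mem hA x), fderiv_hamiltonian_rotate hA]

theorem IsFrame.planeGen_commute (hF : IsFrame κ e f k) (i j : Fin q) :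
    planeGen (e i) (f i) * planeGen (e j) (f j) = planeGen (e j) (f j) * planeGen (e i) (f i) := by
  have hfe : ∀ i j, f i ⬝ᵥ e j = 0 := fun i j => by rw [dotProduct_comm, hF.ef]
  by_cases hij : i = j
  · rw [hij]
  refine ext_mulVec fun u => ?_
  simp only [← Matrix.mulVec_mulVec, planeGen_mulVec, dotProduct_sub, dotProduct_smul, hF.ee, hF.ff,
    hF.ef, hfe, if_neg hij, if_neg (Ne.symm hij), smul_eq_mul, mul_zero, sub_zero, zero_smul]

theorem IsFrame.rotate_planeGen_frameRotation (hF : IsFrame κ e f k) (j : Fin q) (β : Fin q → ℝ)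
    (x : Phase n) : rotate (planeGen (e j) (f j)) (rotate (frameRotation e f β) x)
      = rotate (frameRotation e f β) (rotate (planeGen (e j) (f j)) x) := by
  have hfe : ∀ i j, f i ⬝ᵥ e j = 0 := fun i j => by rw [dotProduct_comm, hF.ef]
  rw [rotate_rotate, rotate_rotate]
  congr 1
  refine ext_mulVec fun u => ?_
  rw [← Matrix.mulVec_mulVec, ← Matrix.mulVec_mulVec, planeGen_mulVec, hF.dot_e, hF.dot_f,
    frameRotation_mulVec, planeGen_mulVec]
  simp only [dotProduct_sub, dotProduct_smul, hF.ee, hF.ff, hF.ef, hfe, smul_eq_mul, mul_zero,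
    sub_zero, zero_sub, mul_ite, mul_one]
  rw [Finset.sum_eq_single j (fun i _ hi => by simp [hi]) (by simp)]
  simp only [if_true]
  module

end Frame


/-! ### Invariant tori -/

section Torus

variable {n q : ℕ} {m s : ℝ} {κ : Matrix (Fin n) (Fin n) ℝ} {e f : Fin q → Fin n → ℝ}
  {k : Fin q → ℝ}

/-- Rotating a motion by a frame rotation whose angles increase linearly. -/
theorem hasDerivAt_frameRotation_line (hF : IsFrame κ e f k) (β δ : Fin q → ℝ)
    {d : ℝ → Phase n} {d' : Phase n} (hd : HasDerivAt d d' 0) :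
    HasDerivAt (fun t : ℝ => rotate (frameRotation e f (β + t • δ)) (d t))
      (rotate (frameRotation e f β) d' + ∑ j, (2 * Real.pi * δ j) •
        rotate (planeGen (e j) (f j)) (rotate (frameRotation e f β) (d 0))) 0 := by
  have h := hasDerivAt_frameRotation (e := e) (f := f) δ (hasDerivAt_rotate (frameRotation e f β) hd)
  simpa only [rotate_rotate, hF.mul, add_comm _ β] using h

/-- `H` and the Φ's of the planes commute pairwise, so the span of their Hamiltonian vectors is
isotropic. The tangent spaces of all the tori below lie in such spans. -/
theorem IsFrame.twistedForm_eq_zero (hκ : κᵀ = -κ) (hF : IsFrame κ e f k) (a a' : Fin q → ℝ)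
    (b b' : ℝ) (y : Phase n) :
    twistedForm s κ (b • flowField m s κ y + ∑ j, a j • rotate (planeGen (e j) (f j)) y)
      (b' • flowField m s κ y + ∑ j, a' j • rotate (planeGen (e j) (f j)) y) = 0 := by
  have h1 : ∀ i j, twistedForm s κ (rotate (planeGen (e i) (f i)) y)
      (rotate (planeGen (e j) (f j)) y) = 0 := fun i j =>
    twistedForm_rotate_rotate hκ (hF.isSymmetry hκ i) (hF.isSymmetry hκ j) (hF.planeGen_commute i j) y
  have h2 : ∀ j, twistedForm s κ (rotate (planeGen (e j) (f j)) y) (flowField m s κ y) = 0 :=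
    fun j => twistedForm_rotate_flowField (planeGen_transpose _ _) y
  have h3 : ∀ j, twistedForm s κ (flowField m s κ y) (rotate (planeGen (e j) (f j)) y) = 0 :=
    fun j => by rw [twistedForm_swap hκ, h2, neg_zero]
  have h4 : twistedForm s κ (flowField m s κ y) (flowField m s κ y) = 0 := by
    have := twistedForm_swap (s := s) hκ (flowField m s κ y) (flowField m s κ y)
    linarith
  simp only [twistedForm_add_left, twistedForm_add_right, twistedForm_sum_left,
    twistedForm_sum_right, twistedForm_smul_left, twistedForm_smul_right, h1, h2, h3, h4, mul_zero,
    Finset.sum_const_zero, add_zero]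

theorem rotate_zero (U : Matrix (Fin n) (Fin n) ℝ) : rotate U (0 : Phase n) = 0 := by
  simp [rotate]

theorem rotate_sum_smul (U : Matrix (Fin n) (Fin n) ℝ) (a : Fin q → ℝ) (y : Fin q → Phase n) :
    rotate U (∑ j, a j • y j) = ∑ j, a j • rotate U (y j) := by
  ext i <;> simp [rotate, Prod.fst_sum, Prod.snd_sum, Matrix.mulVec_sum, Matrix.mulVec_smul]

/-- If the flow at `y` is an infinitesimal rotation, the motion through `y` is a rotation. -/
theorem IsFrame.isMotion_of_flowField_eq (hκ : κᵀ = -κ) (hF : IsFrame κ e f k) {y : Phase n}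
    (hy : y ∈ cotangentSphere n) {a : Fin q → ℝ}
    (h : flowField m s κ y = ∑ j, (2 * Real.pi * a j) • rotate (planeGen (e j) (f j)) y)
    (β : Fin q → ℝ) : IsMotion m s κ fun t => rotate (frameRotation e f (β + t • a)) y := by
  intro t
  refine ⟨rotate_mem_cotangentSphere (hF.orthogonal _) hy, ?_⟩
  have h0 := hasDerivAt_frameRotation_line hF (β + t • a) a (hasDerivAt_const (0 : ℝ) y)
  have h1 : HasDerivAt (fun u : ℝ => u - t) 1 t := (hasDerivAt_id t).sub_const t
  have h2 := HasDerivAt.scomp (h := fun u : ℝ => u - t) t (by simpa only [sub_self] using h0) h1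
  simp only [Function.comp_def] at h2
  have h3 : ∀ u : ℝ, β + t • a + (u - t) • a = β + u • a := fun u => by module
  simp only [h3, one_smul] at h2
  refine h2.congr_deriv ?_
  rw [flowField_rotate (hF.orthogonal _) (hF.commute hκ _), h]
  rw [rotate_sum_smul, rotate_zero, zero_add]
  simp only [hF.rotate_planeGen_frameRotation]

/-- The torus swept out by the rotations of a relative equilibrium. -/
theorem IsFrame.isQuasiPeriodicTorus_of_flowField_eq (hκ : κᵀ = -κ) (hF : IsFrame κ e f k)
    {x : Phase n} (hx : x ∈ cotangentSphere n) {a : Fin q → ℝ}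
    (h : flowField m s κ x = ∑ j, (2 * Real.pi * a j) • rotate (planeGen (e j) (f j)) x)
    (hfree : ∀ j, rotate (planeGen (e j) (f j)) x ≠ 0) :
    IsQuasiPeriodicTorus m s κ (fun θ => rotate (frameRotation e f θ) x) a := by
  have hsm : ContDiff ℝ ∞ fun θ => rotate (frameRotation e f θ) x :=
    contDiff_frameRotation contDiff_id contDiff_const
  have hder : ∀ θ v, fderiv ℝ (fun θ => rotate (frameRotation e f θ) x) θ v
      = ∑ j, (2 * Real.pi * v j) • rotate (planeGen (e j) (f j)) (rotate (frameRotation e f θ) x) := by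
    intro θ v
    have h1 := hasDerivAt_frameRotation_line hF θ v (hasDerivAt_const (0 : ℝ) x)
    have h2 : HasDerivAt (fun t : ℝ => θ + t • v) v 0 := by
      simpa using ((hasDerivAt_id (0 : ℝ)).smul_const v).const_add θ
    have h3 := (hsm.differentiable (by simp) (θ + (0 : ℝ) • v)).hasFDerivAt.comp_hasDerivAt 0 h2
    have h4 := h3.unique h1
    rwa [rotate_zero, zero_add, zero_smul, add_zero] at h4
  have hfree' : ∀ θ j, rotate (planeGen (e j) (f j)) (rotate (frameRotation e f θ) x) ≠ 0 := by
    intro θ j h0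
    apply hfree j
    rw [hF.rotate_planeGen_frameRotation] at h0
    have h1 := congrArg (rotate (frameRotation e f θ)ᵀ) h0
    rw [rotate_rotate, hF.orthogonal, rotate_one] at h1
    rw [h1]
    simp [rotate]
  refine ⟨hsm, fun θ => rotate_mem_cotangentSphere (hF.orthogonal _) hx, fun θ θ' => ⟨?_, ?_⟩,
    fun θ => ?_, fun θ u v => ?_, fun θ => hF.isMotion_of_flowField_eq hκ hx h θ⟩
  · intro heq
    have h1 := congrArg (rotate (frameRotation e f (-θ))) heq
    simp only [rotate_rotate, hF.mul, neg_add_cancel, frameRotation_zero, rotate_one] at h1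
    have h2 : ∀ j, ∃ l : ℤ, (-θ + θ') j = l := fun j =>
      hF.exists_int_of_rotate_eq (hfree j) h1.symm
    choose l hl using h2
    exact ⟨l, fun i => by rw [← hl i]; simp⟩
  · rintro ⟨l, hl⟩
    have : θ' = fun j => θ j + l j := funext hl
    simp only [this, frameRotation_add_int]
  · rw [injective_iff_map_eq_zero]
    intro v hv
    rw [hder] at hv
    ext j
    have h1 := hF.eq_zero_of_sum hv j
    rcases smul_eq_zero.1 h1 with h2 | h2
    · have := Real.pi_pos.ne'
      simpa [this] using h2
    · exact absurd h2 (hfree' θ j)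
  · rw [hder, hder]
    simpa using hF.twistedForm_eq_zero (s := s) (m := m) hκ (fun j => 2 * Real.pi * u j)
      (fun j => 2 * Real.pi * v j) 0 0 (rotate (frameRotation e f θ) x)

/-- Two motions which differ by a rotation at some times do so at all times. -/
theorem IsFrame.rotate_shift (hm : 0 < m) (hκ : κᵀ = -κ) (hF : IsFrame κ e f k) {c : ℝ → Phase n}
    (hc : IsMotion m s κ c) {t₁ t₂ : ℝ} {β : Fin q → ℝ}
    (h : c t₁ = rotate (frameRotation e f β) (c t₂)) (t : ℝ) :
    c (t + t₁) = rotate (frameRotation e f β) (c (t + t₂)) := by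
  have h1 := hc.shift t₁
  have h2 := (hc.shift t₂).rotate (hF.orthogonal β) (hF.commute hκ β)
  exact congrFun (h1.unique hm hκ h2 (t₀ := 0) (by simpa using h)) t

theorem IsFrame.rotate_neg (hF : IsFrame κ e f k) {x y : Phase n} {β : Fin q → ℝ}
    (h : x = rotate (frameRotation e f β) y) : y = rotate (frameRotation e f (-β)) x := by
  rw [h, rotate_rotate, hF.mul, neg_add_cancel, frameRotation_zero, rotate_one]

/-- The torus swept out by the rotations of a motion that is periodic up to rotations. -/
theorem IsFrame.exists_isQuasiPeriodicTorus (hm : 0 < m) (hκ : κᵀ = -κ) (hF : IsFrame κ e f k)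
    {c : ℝ → Phase n} (hc : IsMotion m s κ c)
    (hfree : ∀ j, rotate (planeGen (e j) (f j)) (c 0) ≠ 0)
    {ρ : Phase n → ℝ} (hρ : Differentiable ℝ ρ)
    (hρinv : ∀ β y, ρ (rotate (frameRotation e f β) y) = ρ y)
    (hρ0 : fderiv ℝ ρ (c 0) (flowField m s κ (c 0)) ≠ 0)
    (hper : ∃ t₁ t₂, t₁ ≠ t₂ ∧ ∃ β, c t₁ = rotate (frameRotation e f β) (c t₂)) :
    ∃ (φ : (Fin (q + 1) → ℝ) → Phase n) (freq : Fin (q + 1) → ℝ),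
      IsQuasiPeriodicTorus m s κ φ freq ∧ c 0 ∈ Set.range φ ∧
      ∀ θ, ∃ β t, φ θ = rotate (frameRotation e f β) (c t) := by
  -- The rotation-invariant function ρ really varies along the motion. This is what separates the
  -- flow direction from the rotations throughout the proof.
  have hconst : ¬ ∀ t, ρ (c t) = ρ (c 0) := by
    intro h
    have h1 := hasDerivAt_comp_curve hρ (hc 0).2
    simp only [h] at h1
    exact hρ0 (h1.unique (hasDerivAt_const _ _))
  -- The return times: those at which the motion is a rotation of its initial point. They form a
  -- group because the rotations commute with the flow and with each other.
  let G : AddSubgroup ℝ :=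
    { carrier := {t | ∃ β, c t = rotate (frameRotation e f β) (c 0)}
      zero_mem' := ⟨0, by rw [frameRotation_zero, rotate_one]⟩
      add_mem' := by
        rintro t u ⟨β, hβ⟩ ⟨β', hβ'⟩
        refine ⟨β + β', ?_⟩
        have := hF.rotate_shift hm hκ hc hβ' t
        rw [this, add_zero, hβ, rotate_rotate, hF.mul, add_comm β']
      neg_mem' := by
        rintro t ⟨β, hβ⟩
        refine ⟨-β, ?_⟩
        have := hF.rotate_shift hm hκ hc hβ (-t)
        rw [neg_add_cancel, add_zero] at this
        exact hF.rotate_neg this }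
  -- At return times ρ has its initial value. If these times were dense, ρ would be constant, so the
  -- group is cyclic, with a generator `T`.
  have hnd : ¬ Dense (G : Set ℝ) := by
    intro hd
    apply hconst
    have hcl : IsClosed {t | ρ (c t) = ρ (c 0)} :=
      isClosed_eq (hρ.continuous.comp hc.continuous) continuous_const
    have hsub : (G : Set ℝ) ⊆ {t | ρ (c t) = ρ (c 0)} := by
      rintro t ⟨β, hβ⟩
      rw [Set.mem_ofPred_eq, hβ, hρinv]
    intro t
    exact hcl.closure_subset_iff.2 hsub (hd t)
  obtain ⟨T, hT⟩ := (AddSubgroup.dense_or_cyclic G).resolve_left hnd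
  rw [← AddSubgroup.zmultiples_eq_closure] at hT
  -- By `hper` the difference of two distinct times is a return time, so the group is not trivial.
  have hT0 : T ≠ 0 := by
    rintro rfl
    obtain ⟨t₁, t₂, hne, β, hβ⟩ := hper
    have h1 : t₁ - t₂ ∈ G := ⟨β, by
      have := hF.rotate_shift hm hκ hc hβ (-t₂)
      rwa [neg_add_cancel, neg_add_eq_sub] at this⟩
    rw [hT, AddSubgroup.zmultiples_zero_eq_bot, AddSubgroup.mem_bot] at h1
    exact hne (by linarith)
  obtain ⟨α, hα⟩ : T ∈ G := hT ▸ AddSubgroup.mem_zmultiples T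
  have hα1 : ∀ t, c (t + T) = rotate (frameRotation e f α) (c t) := fun t => by
    simpa using hF.rotate_shift hm hκ hc hα t
  have hαl : ∀ (l : ℤ) t, c (t + l * T) = rotate (frameRotation e f ((l : ℝ) • α)) (c t) := by
    intro l
    induction l using Int.induction_on with
    | zero => intro t; simp [frameRotation_zero, rotate_one]
    | succ i ih =>
      intro t
      have e1 : t + ((i : ℤ) + 1 : ℤ) * T = t + T + (i : ℤ) * T := by push_cast; ring
      rw [e1, ih, hα1, rotate_rotate, hF.mul]
      congr 2
      push_cast
      module
    | pred i ih =>
      intro t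
      have e1 : t + (-(i : ℤ) - 1 : ℤ) * T = t - T + (-(i : ℤ) : ℤ) * T := by push_cast; ring
      have e2 := hF.rotate_neg (hα1 (t - T))
      rw [sub_add_cancel] at e2
      rw [e1, ih, e2, rotate_rotate, hF.mul]
      congr 2
      push_cast
      module
  -- The zeroth angle measures time in units of `T`; the other angles rotate the planes. Subtracting
  -- `θ 0 * α j` undoes the rotation α acquired in one return time, so that the parametrization has
  -- period 1 in every angle.
  let A : (Fin (q + 1) → ℝ) → Fin q → ℝ := fun θ j => θ j.succ - θ 0 * α j
  let φ : (Fin (q + 1) → ℝ) → Phase n := fun θ => rotate (frameRotation e f (A θ)) (c (T * θ 0))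
  have hAadd : ∀ (θ v : Fin (q + 1) → ℝ) (t : ℝ), A (θ + t • v) = A θ + t • A v := by
    intro θ v t
    ext j
    simp only [A, Pi.add_apply, Pi.smul_apply, smul_eq_mul]
    ring
  have hA : ContDiff ℝ ∞ A := by
    rw [contDiff_pi]
    intro j
    exact (contDiff_apply ℝ ℝ j.succ).sub ((contDiff_apply ℝ ℝ 0).mul contDiff_const)
  have hsm : ContDiff ℝ ∞ φ := contDiff_frameRotation hA
    (hc.contDiff.comp (contDiff_const.mul (contDiff_apply ℝ ℝ 0)))
  have hder : ∀ θ v, fderiv ℝ φ θ v = (T * v 0) • flowField m s κ (φ θ)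
      + ∑ j, (2 * Real.pi * A v j) • rotate (planeGen (e j) (f j)) (φ θ) := by
    intro θ v
    have h0 : HasDerivAt (fun t : ℝ => c (T * (θ 0 + t * v 0)))
        ((T * v 0) • flowField m s κ (c (T * θ 0))) 0 := by
      have e1 : HasDerivAt (fun t : ℝ => T * (θ 0 + t * v 0)) (T * v 0) 0 := by
        simpa using (((hasDerivAt_id (0 : ℝ)).mul_const (v 0)).const_add (θ 0)).const_mul T
      have e2 := (hc (T * (θ 0 + 0 * v 0))).2
      have := e2.scomp (0 : ℝ) e1
      simpa using! this
    have h1 := hasDerivAt_frameRotation_line hF (A θ) (A v) h0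
    have h2 : HasDerivAt (fun t : ℝ => θ + t • v) v 0 := by
      simpa using ((hasDerivAt_id (0 : ℝ)).smul_const v).const_add θ
    have h3 := (hsm.differentiable (by simp) (θ + (0 : ℝ) • v)).hasFDerivAt.comp_hasDerivAt 0 h2
    have h3' : HasDerivAt (fun t : ℝ => rotate (frameRotation e f (A θ + t • A v))
        (c (T * (θ 0 + t * v 0)))) (fderiv ℝ φ (θ + (0 : ℝ) • v) v) 0 := by
      refine h3.congr_of_eventuallyEq (Filter.Eventually.of_forall fun t => ?_)
      simp only [Function.comp_apply, φ, hAadd, Pi.add_apply, Pi.smul_apply, smul_eq_mul]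
    have h4 := h3'.unique h1
    rw [zero_smul, add_zero] at h4
    rw [h4, zero_mul, add_zero]
    congr 1
    change _ = (T * v 0) • flowField m s κ (rotate _ _)
    rw [flowField_rotate (hF.orthogonal _) (hF.commute hκ _)]
    ext i <;> simp [rotate, Matrix.mulVec_smul]
  have hfree' : ∀ θ j, rotate (planeGen (e j) (f j)) (φ θ) ≠ 0 := by
    intro θ j h0
    -- If the generator of plane `j` killed the point, the half turn in that plane would fix it, and
    -- after transport back along the motion it would fix `c 0`. Freeness there would make -1/2 an
    -- integer.
    have h1 : rotate (frameRotation e f (Pi.single j (1 / 2))) (φ θ) = φ θ := by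
      have key : ∀ u : Fin n → ℝ, planeGen (e j) (f j) *ᵥ u = 0 →
          frameRotation e f (Pi.single j (1 / 2)) *ᵥ u = u := by
        intro u hu
        have hfe : ∀ i j, f i ⬝ᵥ e j = 0 := fun i j => by rw [dotProduct_comm, hF.ef]
        have a1 := congrArg (fun v => e j ⬝ᵥ v) hu
        have a2 := congrArg (fun v => f j ⬝ᵥ v) hu
        simp only [planeGen_mulVec, dotProduct_sub, dotProduct_smul, hF.ee, hF.ef, hF.ff, hfe,
          smul_eq_mul, mul_zero, zero_sub, sub_zero, if_true, mul_one, dotProduct_zero,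
          neg_eq_zero] at a1 a2
        rw [frameRotation_mulVec]
        rw [Finset.sum_eq_single j (fun i _ hi => by simp [hi]) (by simp), a1, a2]
        simp
      exact Prod.ext (key _ (congrArg Prod.fst h0)) (key _ (congrArg Prod.snd h0))
    simp only [φ, rotate_rotate, hF.mul] at h1
    have h2 := hF.rotate_neg h1.symm
    rw [rotate_rotate, hF.mul] at h2
    have e3 : -(Pi.single j (1 / 2 : ℝ) + A θ) + A θ = -Pi.single j (1 / 2 : ℝ) := by abel
    rw [e3] at h2
    have h3 := hF.rotate_shift hm hκ hc h2 (-(T * θ 0))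
    rw [neg_add_cancel] at h3
    obtain ⟨l, hl⟩ := hF.exists_int_of_rotate_eq (hfree j) h3.symm
    simp only [Pi.neg_apply, Pi.single_eq_same] at hl
    have : (2 * l : ℤ) = -1 := by
      have : (2 * l : ℝ) = -1 := by rw [← hl]; norm_num
      exact_mod_cast this
    omega
  refine ⟨φ, Fin.cons (1 / T) (fun j => α j / T), ⟨hsm, fun θ => ?_, fun θ θ' => ⟨?_, ?_⟩,
    fun θ => ?_, fun θ u v => ?_, fun θ => ?_⟩, ⟨0, ?_⟩, fun θ => ⟨A θ, T * θ 0, rfl⟩⟩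
  · exact rotate_mem_cotangentSphere (hF.orthogonal _) (hc _).1
  · intro heq
    have h1 : c (T * θ 0) = rotate (frameRotation e f (-A θ + A θ')) (c (T * θ' 0)) := by
      have := hF.rotate_neg (y := c (T * θ 0)) (β := A θ) (x := φ θ) rfl
      rw [this, heq]
      simp only [φ, rotate_rotate, hF.mul]
    -- Equal points on the torus lie over times that differ by a return time, i.e. by a multiple of
    -- `T`. Once this is removed, the remaining angles differ by integers because the rotations act
    -- freely.
    have h2 : T * θ 0 - T * θ' 0 ∈ G := ⟨-A θ + A θ', by
      have := hF.rotate_shift hm hκ hc h1 (-(T * θ' 0))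
      rwa [neg_add_cancel, neg_add_eq_sub] at this⟩
    rw [hT, AddSubgroup.mem_zmultiples_iff] at h2
    obtain ⟨l, hl⟩ := h2
    rw [zsmul_eq_mul] at hl
    have hl0 : θ 0 - θ' 0 = l := by
      have : T * (θ 0 - θ' 0 - l) = 0 := by linear_combination -hl
      rcases mul_eq_zero.1 this with h | h
      · exact absurd h hT0
      · linarith
    have h3 : c (T * θ 0) = rotate (frameRotation e f ((l : ℝ) • α)) (c (T * θ' 0)) := by
      rw [← hαl]
      congr 1
      linarith
    rw [h3] at h1
    have h4 := hF.rotate_neg h1.symm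
    rw [rotate_rotate, hF.mul] at h4
    have h5 := hF.rotate_shift hm hκ hc h4 (-(T * θ' 0))
    rw [neg_add_cancel] at h5
    have h6 : ∀ j, ∃ i : ℤ, (-((l : ℝ) • α) + (-A θ + A θ')) j = i := fun j =>
      hF.exists_int_of_rotate_eq (hfree j) h5.symm
    choose i hi using h6
    refine ⟨Fin.cons (-l) (fun j => i j), fun j => ?_⟩
    refine Fin.cases ?_ (fun j => ?_) j
    · simp only [Fin.cons_zero]
      push_cast
      linarith
    · simp only [Fin.cons_succ]
      rw [← hi j]
      simp only [A, Pi.add_apply, Pi.neg_apply, Pi.smul_apply, smul_eq_mul, ← hl0]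
      ring
  · rintro ⟨l, hl⟩
    simp only [φ]
    have e1 : T * θ' 0 = T * θ 0 + l 0 * T := by rw [hl]; ring
    rw [e1, hαl, rotate_rotate, hF.mul]
    have e2 : A θ' + (l 0 : ℝ) • α = fun j => A θ j + (l j.succ : ℝ) := by
      ext j
      simp only [A, Pi.add_apply, Pi.smul_apply, smul_eq_mul, hl]
      ring
    rw [e2, frameRotation_add_int (A θ) (fun j => l j.succ)]
  · rw [injective_iff_map_eq_zero]
    intro v hv
    rw [hder] at hv
    have hv0 : v 0 = 0 := by
      -- Otherwise the flow vector at this point would be an infinitesimal rotation, the whole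
      -- motion would be an orbit of rotations, and ρ would be constant along it.
      by_contra hne
      apply hconst
      have hb : T * v 0 ≠ 0 := mul_ne_zero hT0 hne
      have hflow : flowField m s κ (φ θ) = ∑ j, (2 * Real.pi * (-(T * v 0)⁻¹ * A v j)) •
          rotate (planeGen (e j) (f j)) (φ θ) := by
        have h1 := congrArg (fun z => (T * v 0)⁻¹ • z) hv
        simp only [smul_add, smul_smul, inv_mul_cancel₀ hb, one_smul, smul_zero,
          Finset.smul_sum] at h1
        rw [eq_neg_of_add_eq_zero_left h1, ← Finset.sum_neg_distrib]
        refine Finset.sum_congr rfl fun j _ => ?_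
        rw [← neg_smul]
        congr 1
        ring
      have hmot := hF.isMotion_of_flowField_eq hκ
        (rotate_mem_cotangentSphere (hF.orthogonal _) (hc (T * θ 0)).1) hflow 0
      have hmot2 := (hc.shift (T * θ 0)).rotate (hF.orthogonal (A θ)) (hF.commute hκ (A θ))
      have heq := hmot2.unique hm hκ hmot (t₀ := 0) (by
        simp [frameRotation_zero, rotate_one])
      have hval : ∀ t, ρ (c (t + T * θ 0)) = ρ (c (T * θ 0)) := by
        intro t
        have h1 := congrArg ρ (congrFun heq t)
        simp only [hρinv] at h1
        rw [h1]
      intro t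
      have h1 := hval (t - T * θ 0)
      have h2 := hval (0 - T * θ 0)
      rw [sub_add_cancel] at h1 h2
      rw [h1, h2]
    rw [hv0, mul_zero, zero_smul, zero_add] at hv
    have hvs : ∀ j : Fin q, v j.succ = 0 := by
      intro j
      have h1 := hF.eq_zero_of_sum hv j
      rcases smul_eq_zero.1 h1 with h2 | h2
      · have := Real.pi_pos.ne'
        simpa [this, A, hv0] using h2
      · exact absurd h2 (hfree' θ j)
    ext j
    exact Fin.cases hv0 hvs j
  · rw [hder, hder]
    exact hF.twistedForm_eq_zero hκ _ _ _ _ _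
  · have h1 := (hc.shift (T * θ 0)).rotate (hF.orthogonal (A θ)) (hF.commute hκ (A θ))
    convert h1 using 2 with t
    simp only [φ]
    -- With these frequencies the zeroth angle advances time at unit speed, and the contributions of
    -- α to the rotation angles cancel.
    have e1 : T * (θ + t • (Fin.cons (1 / T) (fun j => α j / T) : Fin (q + 1) → ℝ)) 0
        = t + T * θ 0 := by
      simp only [Pi.add_apply, Pi.smul_apply, Fin.cons_zero, smul_eq_mul]
      field_simp
      ring
    have e2 : A (θ + t • (Fin.cons (1 / T) (fun j => α j / T) : Fin (q + 1) → ℝ)) = A θ := by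
      rw [hAadd]
      ext j
      simp only [A, Pi.add_apply, Pi.smul_apply, Fin.cons_zero, Fin.cons_succ, smul_eq_mul]
      field_simp
      ring
    rw [e1, e2]
  · have : A 0 = 0 := by ext j; simp [A]
    simp only [φ, this, frameRotation_zero, rotate_one, Pi.zero_apply, mul_zero]

/-- If the moment of `x` is carried by the planes of the frame, the members of the algebra are
constant on the rotations of the motion through `x`. -/
theorem IsFrame.eq_of_mem_integralAlgebra (hκ : κᵀ = -κ) (hF : IsFrame κ e f k)
    {c : ℝ → Phase n} (hc : IsMotion m s κ c)
    (hadapted : ∀ A, IsSymmetry κ A → gaugeNoether s κ A (c 0)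
      = ∑ j, (f j ⬝ᵥ (A *ᵥ e j)) * gaugeNoether s κ (planeGen (e j) (f j)) (c 0))
    (β : Fin q → ℝ) (t : ℝ) {F : Phase n → ℝ} (hFm : F ∈ integralAlgebra m s κ) :
    F (rotate (frameRotation e f β) (c t)) = F (c 0) := by
  have hU := hF.orthogonal β
  have hUκ := hF.commute hκ β
  induction hFm using Algebra.adjoin_induction with
  | mem F hFg =>
    have hmem : F ∈ integralAlgebra m s κ := Algebra.subset_adjoin hFg
    have hconst := hc.eq_of_isFirstIntegral (differentiable_of_mem_integralAlgebra hmem)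
      (isFirstIntegral_of_mem_integralAlgebra hκ hmem) t 0
    rcases hFg with rfl | rfl | ⟨A, hA, rfl⟩
    · rw [hamiltonian_rotate hU, hconst]
    · rw [fieldIntegral_rotate hU hUκ, hconst]
    · have hmem' := gaugeNoether_mem_integralAlgebra (m := m) (s := s) (hA.conj hκ hUκ)
      rw [gaugeNoether_rotate hUκ, hc.eq_of_isFirstIntegral
        (differentiable_of_mem_integralAlgebra hmem')
        (isFirstIntegral_of_mem_integralAlgebra hκ hmem') t 0, hadapted _ (hA.conj hκ hUκ),
        hadapted _ hA]
      -- By adaptedness only the entries of `A` within the planes matter. Conjugation by a rotation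
      -- of a plane does not change the single entry of a skew-symmetric matrix there, by sin² +
      -- cos² = 1.
      refine Finset.sum_congr rfl fun j _ => ?_
      congr 1
      have hfe : ∀ i j, f i ⬝ᵥ e j = 0 := fun i j => by rw [dotProduct_comm, hF.ef]
      have hUe : frameRotation e f β *ᵥ e j
          = Real.cos (2 * Real.pi * β j) • e j + Real.sin (2 * Real.pi * β j) • f j := by
        rw [frameRotation_mulVec]
        rw [Finset.sum_eq_single j (fun i _ hi => by simp [hF.ee, hfe, hi]) (by simp)]
        simp only [hF.ee, hfe, if_true]
        module
      have hUf : frameRotation e f β *ᵥ f j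
          = Real.cos (2 * Real.pi * β j) • f j - Real.sin (2 * Real.pi * β j) • e j := by
        rw [frameRotation_mulVec]
        rw [Finset.sum_eq_single j (fun i _ hi => by simp [hF.ff, hF.ef, hi]) (by simp)]
        simp only [hF.ff, hF.ef, if_true]
        module
      have h1 : f j ⬝ᵥ (((frameRotation e f β)ᵀ * A * frameRotation e f β) *ᵥ e j)
          = (frameRotation e f β *ᵥ f j) ⬝ᵥ (A *ᵥ (frameRotation e f β *ᵥ e j)) := by
        rw [← Matrix.mulVec_mulVec, ← Matrix.mulVec_mulVec, Matrix.dotProduct_mulVec (f j),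
          Matrix.vecMul_transpose]
      have h2 : e j ⬝ᵥ (A *ᵥ f j) = -(f j ⬝ᵥ (A *ᵥ e j)) := by
        rw [dotProduct_mulVec_skew hA.1, dotProduct_comm]
      rw [h1, hUe, hUf]
      simp only [Matrix.mulVec_add, Matrix.mulVec_smul, dotProduct_add, sub_dotProduct,
        smul_dotProduct, dotProduct_smul, smul_eq_mul, h2, dotProduct_mulVec_self_skew hA.1]
      have := Real.sin_sq_add_cos_sq (2 * Real.pi * β j)
      linear_combination (f j ⬝ᵥ (A *ᵥ e j)) * this
  | algebraMap r => rfl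
  | add F G _ _ h1 h2 => rw [Pi.add_apply, Pi.add_apply, h1, h2]
  | mul F G _ _ h1 h2 => rw [Pi.mul_apply, Pi.mul_apply, h1, h2]

end Torus


/-! ### Fields with two eigenvalues and the reduced motion -/

section Splitting

variable {n : ℕ} {m s ka kb : ℝ} {κ Q : Matrix (Fin n) (Fin n) ℝ}

/-- `κ² = -ka²` on the range of the orthogonal projection `Q` and `κ² = -kb²` on its kernel. -/
structure IsSplitting (κ Q : Matrix (Fin n) (Fin n) ℝ) (ka kb : ℝ) : Prop where
  skew : κᵀ = -κ
  symm : Qᵀ = Q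
  idem : Q * Q = Q
  commute : Q * κ = κ * Q
  sq : κ * κ = -(ka ^ 2) • Q - kb ^ 2 • (1 - Q)
  ne : ka ^ 2 ≠ kb ^ 2

theorem IsSplitting.mulVec_sq (h : IsSplitting κ Q ka kb) (u : Fin n → ℝ) :
    κ *ᵥ (κ *ᵥ u) = -(ka ^ 2) • (Q *ᵥ u) - kb ^ 2 • (u - Q *ᵥ u) := by
  rw [Matrix.mulVec_mulVec, h.sq, Matrix.sub_mulVec, Matrix.smul_mulVec, Matrix.smul_mulVec,
    Matrix.sub_mulVec, Matrix.one_mulVec]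

theorem IsSplitting.dotProduct_proj (h : IsSplitting κ Q ka kb) (u v : Fin n → ℝ) :
    u ⬝ᵥ (Q *ᵥ v) = (Q *ᵥ u) ⬝ᵥ v := by
  rw [Matrix.dotProduct_mulVec, ← Matrix.mulVec_transpose, h.symm]

theorem IsSplitting.proj_proj (h : IsSplitting κ Q ka kb) (u : Fin n → ℝ) :
    Q *ᵥ (Q *ᵥ u) = Q *ᵥ u := by
  rw [Matrix.mulVec_mulVec, h.idem]

theorem IsSplitting.proj_field (h : IsSplitting κ Q ka kb) (u : Fin n → ℝ) :
    Q *ᵥ (κ *ᵥ u) = κ *ᵥ (Q *ᵥ u) :=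
  mulVec_comm_of_commute h.commute u

/-- Whatever commutes with the field commutes with the projection. -/
theorem IsSplitting.proj_comm (h : IsSplitting κ Q ka kb) {A : Matrix (Fin n) (Fin n) ℝ}
    (hA : A * κ = κ * A) (u : Fin n → ℝ) : A *ᵥ (Q *ᵥ u) = Q *ᵥ (A *ᵥ u) := by
  have h1 : A *ᵥ (κ *ᵥ (κ *ᵥ u)) = κ *ᵥ (κ *ᵥ (A *ᵥ u)) := by
    rw [mulVec_comm_of_commute hA, mulVec_comm_of_commute hA]
  rw [h.mulVec_sq, h.mulVec_sq] at h1
  simp only [Matrix.mulVec_sub, Matrix.mulVec_smul] at h1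
  have h2 : (kb ^ 2 - ka ^ 2) • (A *ᵥ (Q *ᵥ u)) = (kb ^ 2 - ka ^ 2) • (Q *ᵥ (A *ᵥ u)) := by
    have : ∀ a b c : Fin n → ℝ, -(ka ^ 2) • a - kb ^ 2 • (c - a) = -(ka ^ 2) • b - kb ^ 2 • (c - b) →
        (kb ^ 2 - ka ^ 2) • a = (kb ^ 2 - ka ^ 2) • b := by
      intro a b c habc
      ext i
      have := congrFun habc i
      simp only [Pi.sub_apply, Pi.smul_apply, smul_eq_mul] at this ⊢
      linarith
    exact this _ _ _ h1
  have hne : kb ^ 2 - ka ^ 2 ≠ 0 := fun h0 => h.ne (by linarith)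
  exact smul_right_injective _ hne h2

theorem IsSplitting.isSymmetry (h : IsSplitting κ Q ka kb) : IsSymmetry κ (κ * Q) := by
  refine ⟨?_, ?_⟩
  · rw [Matrix.transpose_mul, h.symm, h.skew, mul_neg, h.commute]
  · rw [Matrix.mul_assoc, h.commute]

/-- The gauge momentum `p - (s / 2) κγ`. -/
noncomputable def gaugeMomentum (s : ℝ) (κ : Matrix (Fin n) (Fin n) ℝ) (x : Phase n) :
    Fin n → ℝ := x.2 - (s / 2) • (κ *ᵥ x.1)

/-- In terms of the gauge momentum the integral is the usual moment, bilinear in position and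
momentum. This is the form in which adapted frames are chosen. -/
theorem gaugeNoether_eq (hκ : κᵀ = -κ) {A : Matrix (Fin n) (Fin n) ℝ} (hA : IsSymmetry κ A)
    (x : Phase n) : gaugeNoether s κ A x = gaugeMomentum s κ x ⬝ᵥ (A *ᵥ x.1) := by
  have h := dotProduct_mulVec_skew hκ x.1 (A *ᵥ x.1)
  simp only [gaugeNoether, gaugeMomentum, sub_dotProduct, smul_dotProduct, smul_eq_mul,
    mulVec_comm_of_commute hA.2, h]
  ring

/-- The squared length of the projection of the position. -/
def projPos (Q : Matrix (Fin n) (Fin n) ℝ) (x : Phase n) : ℝ := x.1 ⬝ᵥ (Q *ᵥ x.1)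

/-- The radial momentum of the projection. -/
def projVel (Q : Matrix (Fin n) (Fin n) ℝ) (x : Phase n) : ℝ := x.2 ⬝ᵥ (Q *ᵥ x.1)

/-- The value of `m μ` extrapolated to `projPos = 0`. -/
noncomputable def reducedMult (s kb : ℝ) (κ : Matrix (Fin n) (Fin n) ℝ) (x : Phase n) : ℝ :=
  s * gaugeNoether s κ κ x + s ^ 2 / 2 * kb ^ 2 - x.2 ⬝ᵥ x.2

/-- The linear coefficient of the cubic polynomial which governs the reduced motion. -/
noncomputable def reducedLin (s ka kb : ℝ) (κ Q : Matrix (Fin n) (Fin n) ℝ) (x : Phase n) : ℝ :=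
  x.2 ⬝ᵥ (Q *ᵥ x.2) - reducedMult s kb κ x * projPos Q x
    - s ^ 2 * (ka ^ 2 - kb ^ 2) / 4 * projPos Q x ^ 2 - s * gaugeNoether s κ (κ * Q) x

/-- The constant coefficient of the cubic polynomial which governs the reduced motion. -/
noncomputable def reducedConst (s ka kb : ℝ) (κ Q : Matrix (Fin n) (Fin n) ℝ) (x : Phase n) : ℝ :=
  projVel Q x ^ 2 - (s ^ 2 * (ka ^ 2 - kb ^ 2) / 4 * projPos Q x ^ 3
    + (reducedMult s kb κ x - s ^ 2 * ka ^ 2 / 4) * projPos Q x ^ 2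
    + reducedLin s ka kb κ Q x * projPos Q x)

/-- The discriminant of the cubic polynomial which governs the reduced motion. -/
noncomputable def reducedDisc (s ka kb : ℝ) (κ Q : Matrix (Fin n) (Fin n) ℝ) (x : Phase n) : ℝ :=
  let a := s ^ 2 * (ka ^ 2 - kb ^ 2) / 4
  let b := reducedMult s kb κ x - s ^ 2 * ka ^ 2 / 4
  let c := reducedLin s ka kb κ Q x
  let d := reducedConst s ka kb κ Q x
  b ^ 2 * c ^ 2 - 4 * a * c ^ 3 - 4 * b ^ 3 * d - 27 * a ^ 2 * d ^ 2 + 18 * a * b * c * d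

theorem contDiff_projPos : ContDiff ℝ ω (projPos Q) :=
  contDiff_dotProduct contDiff_fst (contDiff_mulVec Q contDiff_fst)

theorem contDiff_projVel : ContDiff ℝ ω (projVel Q) :=
  contDiff_dotProduct contDiff_snd (contDiff_mulVec Q contDiff_fst)

theorem contDiff_reducedDisc : ContDiff ℝ ω (reducedDisc s ka kb κ Q) := by
  have h0 := contDiff_projPos (Q := Q)
  have h1 := contDiff_projVel (Q := Q)
  have h2 : ContDiff ℝ ω (reducedMult s kb κ) :=
    ((contDiff_const.mul (contDiff_gaugeNoether κ)).add contDiff_const).sub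
      (contDiff_dotProduct contDiff_snd contDiff_snd)
  have h3 : ContDiff ℝ ω (reducedLin s ka kb κ Q) :=
    (((contDiff_dotProduct contDiff_snd (contDiff_mulVec Q contDiff_snd)).sub (h2.mul h0)).sub
      (contDiff_const.mul (h0.pow 2))).sub (contDiff_const.mul (contDiff_gaugeNoether _))
  have h4 : ContDiff ℝ ω (reducedConst s ka kb κ Q) :=
    (h1.pow 2).sub (((contDiff_const.mul (h0.pow 3)).add
      ((h2.sub contDiff_const).mul (h0.pow 2))).add (h3.mul h0))
  unfold reducedDisc
  fun_prop

/-- The value ⟨γ, κ²γ⟩ is affine in ρ when |γ| = 1, and s⟨p, κγ⟩ differs from a first integral only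
by a multiple of it. So along a motion μ depends on ρ alone. -/
theorem IsSplitting.multiplier_eq (hm : 0 < m) (h : IsSplitting κ Q ka kb) {x : Phase n}
    (hx : x ∈ cotangentSphere n) : m * multiplier m s κ x
      = reducedMult s kb κ x + s ^ 2 * (ka ^ 2 - kb ^ 2) / 2 * projPos Q x := by
  have h1 := hx.1
  simp only [phi1] at h1
  simp only [multiplier, reducedMult, gaugeNoether, projPos, h.mulVec_sq, dotProduct_sub,
    dotProduct_smul, smul_eq_mul, h1]
  field_simp
  ring

theorem IsSplitting.gaugeNoether_proj (h : IsSplitting κ Q ka kb) (x : Phase n) :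
    gaugeNoether s κ (κ * Q) x = x.2 ⬝ᵥ (κ *ᵥ (Q *ᵥ x.1)) - s / 2 * ka ^ 2 * projPos Q x := by
  simp only [gaugeNoether, projPos, ← Matrix.mulVec_mulVec, h.proj_field, h.mulVec_sq, h.proj_proj,
    sub_self, smul_zero, sub_zero, dotProduct_smul, smul_eq_mul]
  ring

theorem IsSplitting.projPos_mem (h : IsSplitting κ Q ka kb) {x : Phase n}
    (hx : x ∈ cotangentSphere n) : projPos Q x ∈ Set.Icc (0 : ℝ) 1 := by
  have h1 := hx.1
  simp only [phi1] at h1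
  have h2 : projPos Q x = (Q *ᵥ x.1) ⬝ᵥ (Q *ᵥ x.1) := by
    rw [projPos, ← h.dotProduct_proj, h.proj_proj]
  have h3 : 1 - projPos Q x = (x.1 - Q *ᵥ x.1) ⬝ᵥ (x.1 - Q *ᵥ x.1) := by
    simp only [sub_dotProduct, dotProduct_sub, h1, ← h2]
    rw [← h.dotProduct_proj, ← projPos]
    ring
  have h4 := dotProduct_self_nonneg' (Q *ᵥ x.1)
  have h5 := dotProduct_self_nonneg' (x.1 - Q *ᵥ x.1)
  exact ⟨by linarith, by linarith⟩

variable {c : ℝ → Phase n}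

theorem IsSplitting.hasDerivAt_projPos (h : IsSplitting κ Q ka kb) (hc : IsMotion m s κ c)
    (t : ℝ) : HasDerivAt (fun t => projPos Q (c t)) (2 * projVel Q (c t) / m) t := by
  have h1 := hasDerivAt_fst (hc t).2
  refine (hasDerivAt_dotProduct h1 (hasDerivAt_mulVec Q h1)).congr_deriv ?_
  simp only [flowField, projVel, Matrix.mulVec_smul, smul_dotProduct, dotProduct_smul, smul_eq_mul,
    h.dotProduct_proj (c t).1, dotProduct_comm (Q *ᵥ (c t).1)]
  ring

/-- The magnetic force does no work on the `Q`-part either, since `Q` commutes with `κ`. Only the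
constraint force contributes. -/
theorem IsSplitting.hasDerivAt_projEnergy (h : IsSplitting κ Q ka kb) (hc : IsMotion m s κ c)
    (t : ℝ) : HasDerivAt (fun t => (c t).2 ⬝ᵥ (Q *ᵥ (c t).2))
      (2 * multiplier m s κ (c t) * projVel Q (c t)) t := by
  have h1 := hasDerivAt_snd (hc t).2
  refine (hasDerivAt_dotProduct h1 (hasDerivAt_mulVec Q h1)).congr_deriv ?_
  have h2 : (c t).2 ⬝ᵥ (Q *ᵥ (κ *ᵥ (c t).2)) = 0 := by
    have h3 := dotProduct_mulVec_self_skew h.isSymmetry.1 (c t).2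
    rwa [← Matrix.mulVec_mulVec, ← h.proj_field] at h3
  have h3 : (κ *ᵥ (c t).2) ⬝ᵥ (Q *ᵥ (c t).2) = 0 := by
    rw [dotProduct_comm, ← h.dotProduct_proj, h2]
  simp only [flowField, projVel, Matrix.mulVec_smul, Matrix.mulVec_add, add_dotProduct,
    dotProduct_add, smul_dotProduct, dotProduct_smul, smul_eq_mul, h2, h3,
    h.dotProduct_proj (c t).1, dotProduct_comm (Q *ᵥ (c t).1)]
  ring

/-- The multiplier is affine in ρ, so the energy of the `Q`-part integrates to a quadratic
polynomial in ρ, and Φ for `κQ` removes the remaining magnetic term. This closes the equation for ρ.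
Its right side is the derivative of a cubic polynomial, whose constant term is the last integration
constant. -/
theorem IsSplitting.isCubicMotion (hm : 0 < m) (h : IsSplitting κ Q ka kb)
    (hc : IsMotion m s κ c) :
    IsCubicMotion m (s ^ 2 * (ka ^ 2 - kb ^ 2) / 4) (reducedMult s kb κ (c 0) - s ^ 2 * ka ^ 2 / 4)
      (reducedLin s ka kb κ Q (c 0)) (reducedConst s ka kb κ Q (c 0))
      (fun t => projPos Q (c t)) (fun t => projVel Q (c t)) ∧
    ∀ t, (c t).2 ⬝ᵥ (Q *ᵥ (c t).2) = reducedLin s ka kb κ Q (c 0)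
      + reducedMult s kb κ (c 0) * projPos Q (c t)
      + s ^ 2 * (ka ^ 2 - kb ^ 2) / 4 * projPos Q (c t) ^ 2 + s * gaugeNoether s κ (κ * Q) (c 0) := by
  have hN : ∀ t, gaugeNoether s κ (κ * Q) (c t) = gaugeNoether s κ (κ * Q) (c 0) := fun t =>
    hc.eq_of_isFirstIntegral (differentiable_of_contDiff_omega (contDiff_gaugeNoether _))
      (isFirstIntegral_gaugeNoether h.skew h.isSymmetry) t 0
  have hM : ∀ t, reducedMult s kb κ (c t) = reducedMult s kb κ (c 0) := fun t => by
    have h1 := hc.eq_of_isFirstIntegral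
      (differentiable_of_contDiff_omega (contDiff_gaugeNoether (s := s) κ))
      (isFirstIntegral_gaugeNoether h.skew (isSymmetry_self h.skew)) t 0
    have h2 := hc.dotProduct_eq hm h.skew t 0
    simp only [reducedMult, h1, h2]
  have hμ : ∀ t, m * multiplier m s κ (c t) = reducedMult s kb κ (c 0)
      + s ^ 2 * (ka ^ 2 - kb ^ 2) / 2 * projPos Q (c t) := fun t => by
    rw [h.multiplier_eq hm (hc t).1, hM]
  have hL : ∀ t, reducedLin s ka kb κ Q (c t) = reducedLin s ka kb κ Q (c 0) := by
    have hd : ∀ t, HasDerivAt (fun t => reducedLin s ka kb κ Q (c t)) 0 t := by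
      intro t
      have e : (fun t => reducedLin s ka kb κ Q (c t)) = fun t => (c t).2 ⬝ᵥ (Q *ᵥ (c t).2)
          - reducedMult s kb κ (c 0) * projPos Q (c t)
          - s ^ 2 * (ka ^ 2 - kb ^ 2) / 4 * projPos Q (c t) ^ 2
          - s * gaugeNoether s κ (κ * Q) (c 0) := by
        funext t
        rw [reducedLin, hM, hN]
      rw [e]
      have h1 := h.hasDerivAt_projPos hc t
      refine ((((h.hasDerivAt_projEnergy hc t).sub (h1.const_mul _)).sub
        ((h1.pow 2).const_mul _)).sub_const _).congr_deriv ?_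
      have h2 := hμ t
      field_simp
      linear_combination (8 * projVel Q (c t)) * h2
    exact fun t => is_const_of_deriv_eq_zero (fun t => (hd t).differentiableAt)
      (fun t => (hd t).deriv) t 0
  have hE : ∀ t, (c t).2 ⬝ᵥ (Q *ᵥ (c t).2) = reducedLin s ka kb κ Q (c 0)
      + reducedMult s kb κ (c 0) * projPos Q (c t)
      + s ^ 2 * (ka ^ 2 - kb ^ 2) / 4 * projPos Q (c t) ^ 2
      + s * gaugeNoether s κ (κ * Q) (c 0) := by
    intro t
    have := hL t
    rw [reducedLin, hM, hN] at this
    linarith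
  have hV : ∀ t, HasDerivAt (fun t => projVel Q (c t))
      ((3 * (s ^ 2 * (ka ^ 2 - kb ^ 2) / 4) * projPos Q (c t) ^ 2
        + 2 * (reducedMult s kb κ (c 0) - s ^ 2 * ka ^ 2 / 4) * projPos Q (c t)
        + reducedLin s ka kb κ Q (c 0)) / m) t := by
    intro t
    have h1 := hasDerivAt_snd (hc t).2
    have h2 := hasDerivAt_mulVec Q (hasDerivAt_fst (hc t).2)
    refine (hasDerivAt_dotProduct h1 h2).congr_deriv ?_
    -- Conservation of Φ for `κQ` expresses the magnetic force on the radial momentum by ρ.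
    have e1 : (κ *ᵥ (c t).2) ⬝ᵥ (Q *ᵥ (c t).1)
        = -(gaugeNoether s κ (κ * Q) (c 0) + s / 2 * ka ^ 2 * projPos Q (c t)) := by
      rw [← hN t, h.gaugeNoether_proj, dotProduct_mulVec_skew h.skew]
      ring
    have e2 := hμ t
    have e3 : (c t).1 ⬝ᵥ (Q *ᵥ (c t).1) = projPos Q (c t) := rfl
    simp only [flowField, Matrix.mulVec_smul, add_dotProduct, smul_dotProduct, dotProduct_smul,
      smul_eq_mul, e1, e3, hE t]
    field_simp
    linear_combination (8 * projPos Q (c t)) * e2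
  refine ⟨⟨h.hasDerivAt_projPos hc, hV, ?_, fun t => h.projPos_mem (hc t).1⟩, hE⟩
  have hd : ∀ t, HasDerivAt (fun t => projVel Q (c t) ^ 2
      - (s ^ 2 * (ka ^ 2 - kb ^ 2) / 4 * projPos Q (c t) ^ 3
        + (reducedMult s kb κ (c 0) - s ^ 2 * ka ^ 2 / 4) * projPos Q (c t) ^ 2
        + reducedLin s ka kb κ Q (c 0) * projPos Q (c t))) 0 t := by
    intro t
    have h1 := h.hasDerivAt_projPos hc t
    refine (((hV t).pow 2).sub ((((h1.pow 3).const_mul _).add ((h1.pow 2).const_mul _)).add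
      (h1.const_mul _))).congr_deriv ?_
    field_simp
    ring
  intro t
  have h1 := is_const_of_deriv_eq_zero (fun t => (hd t).differentiableAt)
    (fun t => (hd t).deriv) t 0
  rw [reducedConst]
  linarith

/-- The reduced motion is periodic for nonzero discriminant. -/
theorem IsSplitting.exists_period (hm : 0 < m) (h : IsSplitting κ Q ka kb)
    (hc : IsMotion m s κ c) (hv : projVel Q (c 0) ≠ 0) (hd : reducedDisc s ka kb κ Q (c 0) ≠ 0) :
    ∃ T, 0 < T ∧ ∀ t, projPos Q (c (t + T)) = projPos Q (c t) ∧
      projVel Q (c (t + T)) = projVel Q (c t) :=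
  (h.isCubicMotion hm hc).1.exists_period hm (cubic_no_multiple_root hd) hv

theorem IsSplitting.fderiv_projPos_flowField (h : IsSplitting κ Q ka kb)
    (hc : IsMotion m s κ c) (t : ℝ) :
    fderiv ℝ (projPos Q) (c t) (flowField m s κ (c t)) = 2 * projVel Q (c t) / m :=
  (hasDerivAt_comp_curve (differentiable_of_contDiff_omega contDiff_projPos) (hc t).2).unique
    (h.hasDerivAt_projPos hc t)

theorem IsSplitting.projPos_rotate (h : IsSplitting κ Q ka kb) {U : Matrix (Fin n) (Fin n) ℝ}
    (hU : Uᵀ * U = 1) (hUκ : U * κ = κ * U) (x : Phase n) :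
    projPos Q (rotate U x) = projPos Q x := by
  simp only [projPos, rotate, ← h.proj_comm hUκ, mulVec_dotProduct_mulVec hU]

/-- The role of the rotation-invariant function that varies along the motion is played by ρ =
`projPos Q`, whose velocity is nonzero by `hv`. -/
theorem IsSplitting.exists_torus {q : ℕ} {e f : Fin q → Fin n → ℝ} {k : Fin q → ℝ} (hm : 0 < m)
    (h : IsSplitting κ Q ka kb) (hF : IsFrame κ e f k) (hc : IsMotion m s κ c)
    (hv : projVel Q (c 0) ≠ 0) (hfree : ∀ j, rotate (planeGen (e j) (f j)) (c 0) ≠ 0)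
    (hadapted : ∀ A, IsSymmetry κ A → gaugeNoether s κ A (c 0)
      = ∑ j, (f j ⬝ᵥ (A *ᵥ e j)) * gaugeNoether s κ (planeGen (e j) (f j)) (c 0))
    (hper : ∃ t₁ t₂, t₁ ≠ t₂ ∧ ∃ β, c t₁ = rotate (frameRotation e f β) (c t₂)) :
    ∃ (φ : (Fin (q + 1) → ℝ) → Phase n) (freq : Fin (q + 1) → ℝ),
      IsQuasiPeriodicTorus m s κ φ freq ∧ c 0 ∈ Set.range φ ∧
      ∀ F ∈ integralAlgebra m s κ, ∀ θ, F (φ θ) = F (c 0) := by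
  obtain ⟨φ, freq, h1, h2, h3⟩ := hF.exists_isQuasiPeriodicTorus hm h.skew hc hfree
    (differentiable_of_contDiff_omega (contDiff_projPos (Q := Q)))
    (fun β y => h.projPos_rotate (hF.orthogonal β) (hF.commute h.skew β) y)
    (by rw [h.fderiv_projPos_flowField hc]; exact div_ne_zero (mul_ne_zero two_ne_zero hv) hm.ne')
    hper
  refine ⟨φ, freq, h1, h2, fun F hFm θ => ?_⟩
  obtain ⟨β, t, hθ⟩ := h3 θ
  rw [hθ]
  exact hF.eq_of_mem_integralAlgebra h.skew hc hadapted β t hFm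

/-! Generic conditions on the reduced motion. -/

theorem IsSplitting.generically_projVel (hn : 2 ≤ n) (h : IsSplitting κ Q ka kb)
    {a b : Fin n → ℝ} (ha : Q *ᵥ a = a) (hb : Q *ᵥ b = 0) (haa : a ⬝ᵥ a = 1) (hbb : b ⬝ᵥ b = 1) :
    Generically n fun x => projVel Q x ≠ 0 := by
  have hab : a ⬝ᵥ b = 0 := by rw [← ha, ← h.dotProduct_proj, hb, dotProduct_zero]
  have hba : b ⬝ᵥ a = 0 := by rw [dotProduct_comm, hab]
  refine generically_ne_zero hn contDiff_projVel
    (x₀ := ((3 / 5 : ℝ) • a + (4 / 5 : ℝ) • b, (4 / 5 : ℝ) • a - (3 / 5 : ℝ) • b)) ⟨?_, ?_⟩ ?_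
  · simp only [phi1, add_dotProduct, dotProduct_add, smul_dotProduct, dotProduct_smul, smul_eq_mul,
      haa, hbb, hab, hba]
    norm_num
  · simp only [phi2, sub_dotProduct, dotProduct_add, smul_dotProduct, dotProduct_smul, smul_eq_mul,
      haa, hbb, hab, hba]
    norm_num
  · simp only [projVel, Matrix.mulVec_add, Matrix.mulVec_smul, ha, hb, smul_zero, add_zero,
      sub_dotProduct, smul_dotProduct, dotProduct_smul, smul_eq_mul, haa, hba]
    norm_num

theorem IsSplitting.generically_reducedDisc (hn : 2 ≤ n) (hs : s ≠ 0) (hka : ka ≠ 0)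
    (h : IsSplitting κ Q ka kb)
    {a b : Fin n → ℝ} (ha : Q *ᵥ a = a) (hb : Q *ᵥ b = 0) (haa : a ⬝ᵥ a = 1) (hbb : b ⬝ᵥ b = 1) :
    Generically n fun x => reducedDisc s ka kb κ Q x ≠ 0 := by
  have hab : a ⬝ᵥ b = 0 := by rw [← ha, ← h.dotProduct_proj, hb, dotProduct_zero]
  have hκ : a ⬝ᵥ (κ *ᵥ b) = 0 := by
    rw [← ha, ← h.dotProduct_proj, h.proj_field, hb, Matrix.mulVec_zero, dotProduct_zero]
  -- At this point ρ and its velocity vanish, so the constant coefficient is 0 and the discriminant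
  -- is c²(b² - 4ac). The momentum `s * ka` along `a` makes it s⁸ka⁶(9ka²/16 + kb²), which is
  -- positive whichever of ka², kb² is larger.
  refine generically_ne_zero hn contDiff_reducedDisc (x₀ := (b, (s * ka) • a)) ⟨hbb, ?_⟩ ?_
  · simp only [phi2, smul_dotProduct, hab, smul_zero]
  · have h1 : projPos Q (b, (s * ka) • a) = 0 := by simp [projPos, hb]
    have h2 : projVel Q (b, (s * ka) • a) = 0 := by simp [projVel, hb]
    have h3 : gaugeNoether s κ (κ * Q) (b, (s * ka) • a) = 0 := by
      rw [h.gaugeNoether_proj, h1]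
      simp [hb]
    have h4 : reducedMult s kb κ (b, (s * ka) • a) = -(s ^ 2 * ka ^ 2) := by
      simp only [reducedMult, gaugeNoether, h.mulVec_sq, hb, smul_zero, smul_dotProduct,
        hκ, dotProduct_sub, dotProduct_smul, dotProduct_zero, smul_eq_mul, haa, hbb]
      ring
    have h5 : reducedLin s ka kb κ Q (b, (s * ka) • a) = s ^ 2 * ka ^ 2 := by
      simp only [reducedLin, h1, h3, Matrix.mulVec_smul, ha, smul_dotProduct, dotProduct_smul, haa,
        smul_eq_mul]
      ring
    have h6 : reducedConst s ka kb κ Q (b, (s * ka) • a) = 0 := by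
      simp only [reducedConst, h1, h2]
      ring
    simp only [reducedDisc, h4, h5, h6]
    have h7 : 0 < s ^ 2 := by positivity
    have h8 : 0 < ka ^ 2 := by positivity
    have h9 : 0 < s ^ 8 * ka ^ 6 * (9 / 16 * ka ^ 2 + kb ^ 2) := by positivity
    refine ne_of_gt (h9.trans_le (le_of_eq ?_))
    ring

end Splitting


/-! ### Rotations joining two points of phase space -/

theorem exists_cos_sin_eq {c d : ℝ} (h : c ^ 2 + d ^ 2 = 1) :
    ∃ β : ℝ, Real.cos (2 * Real.pi * β) = c ∧ Real.sin (2 * Real.pi * β) = d := by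
  have hz : ‖(⟨c, d⟩ : ℂ)‖ = 1 := by
    rw [Complex.norm_def, Complex.normSq_mk, show c * c + d * d = 1 by linarith, Real.sqrt_one]
  have hz0 : (⟨c, d⟩ : ℂ) ≠ 0 := fun h0 => by rw [h0, norm_zero] at hz; exact zero_ne_one hz
  have hpi := Real.pi_pos.ne'
  refine ⟨Complex.arg ⟨c, d⟩ / (2 * Real.pi), ?_, ?_⟩
  · rw [mul_div_cancel₀ _ (by positivity), Complex.cos_arg hz0, hz, div_one]
  · rw [mul_div_cancel₀ _ (by positivity), Complex.sin_arg, hz, div_one]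

/-- Two pairs of vectors of the plane, the first ones nonzero, with the same inner products are
related by a rotation if they have the same orientation. -/
theorem exists_rotation_eq {a b p q a' b' p' q' : ℝ} (h0 : a ^ 2 + b ^ 2 ≠ 0)
    (h1 : a' ^ 2 + b' ^ 2 = a ^ 2 + b ^ 2) (h2 : p' * a' + q' * b' = p * a + q * b)
    (h3 : q' * a' - p' * b' = q * a - p * b) :
    ∃ β : ℝ, a' = Real.cos (2 * Real.pi * β) * a - Real.sin (2 * Real.pi * β) * b ∧
      b' = Real.sin (2 * Real.pi * β) * a + Real.cos (2 * Real.pi * β) * b ∧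
      p' = Real.cos (2 * Real.pi * β) * p - Real.sin (2 * Real.pi * β) * q ∧
      q' = Real.sin (2 * Real.pi * β) * p + Real.cos (2 * Real.pi * β) * q := by
  -- Cosine and sine are the normalized inner product and determinant of the old and the new first
  -- vectors, which have equal length.
  obtain ⟨β, hc, hd⟩ := exists_cos_sin_eq (c := (a * a' + b * b') / (a ^ 2 + b ^ 2))
    (d := (a * b' - b * a') / (a ^ 2 + b ^ 2)) (by
      field_simp
      linear_combination (a ^ 2 + b ^ 2) * h1)
  refine ⟨β, ?_, ?_, ?_, ?_⟩ <;> rw [hc, hd] <;> field_simp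
  · ring
  · ring
  · linear_combination (-p') * h1 + a' * h2 - b' * h3
  · linear_combination (-q') * h1 + b' * h2 + a' * h3

section Return

variable {n q : ℕ} {m s : ℝ} {κ : Matrix (Fin n) (Fin n) ℝ} {e f : Fin q → Fin n → ℝ}
  {k : Fin q → ℝ}

/-- The part of a vector orthogonal to the planes of a frame. -/
def frameRemainder (e f : Fin q → Fin n → ℝ) (u : Fin n → ℝ) : Fin n → ℝ :=
  u - ∑ j, ((e j ⬝ᵥ u) • e j + (f j ⬝ᵥ u) • f j)

theorem eq_frameRotation_mulVec {β : Fin q → ℝ} {u u' : Fin n → ℝ}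
    (he : ∀ j, e j ⬝ᵥ u' = Real.cos (2 * Real.pi * β j) * (e j ⬝ᵥ u)
      - Real.sin (2 * Real.pi * β j) * (f j ⬝ᵥ u))
    (hf : ∀ j, f j ⬝ᵥ u' = Real.sin (2 * Real.pi * β j) * (e j ⬝ᵥ u)
      + Real.cos (2 * Real.pi * β j) * (f j ⬝ᵥ u))
    (hr : frameRemainder e f u' = frameRemainder e f u) : u' = frameRotation e f β *ᵥ u := by
  have h1 : u' = frameRemainder e f u' + ∑ j, ((e j ⬝ᵥ u') • e j + (f j ⬝ᵥ u') • f j) := by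
    rw [frameRemainder, sub_add_cancel]
  rw [h1, hr, frameRotation_mulVec, frameRemainder, sub_add, sub_eq_add_neg, neg_sub,
    ← Finset.sum_sub_distrib]
  congr 1
  refine Finset.sum_congr rfl fun j _ => ?_
  rw [he, hf]
  module

/-- The squared length of the component of the position in a plane. -/
def planeSq (e f : Fin n → ℝ) (x : Phase n) : ℝ := (e ⬝ᵥ x.1) ^ 2 + (f ⬝ᵥ x.1) ^ 2

/-- The radial momentum in a plane. -/
def planeVel (e f : Fin n → ℝ) (x : Phase n) : ℝ :=
  (e ⬝ᵥ x.2) * (e ⬝ᵥ x.1) + (f ⬝ᵥ x.2) * (f ⬝ᵥ x.1)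

theorem IsFrame.gaugeNoether_planeGen (hF : IsFrame κ e f k) (hκ : κᵀ = -κ) (j : Fin q)
    (x : Phase n) : gaugeNoether s κ (planeGen (e j) (f j)) x
      = (f j ⬝ᵥ x.2) * (e j ⬝ᵥ x.1) - (e j ⬝ᵥ x.2) * (f j ⬝ᵥ x.1)
        + s * k j / 2 * planeSq (e j) (f j) x := by
  simp only [gaugeNoether, planeGen_mulVec, dotProduct_sub, dotProduct_smul, smul_eq_mul,
    dotProduct_mulVec_skew hκ, hF.map_e, hF.map_f, smul_dotProduct, planeSq,
    dotProduct_comm x.2 (e j), dotProduct_comm x.2 (f j), dotProduct_comm x.1 (e j),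
    dotProduct_comm x.1 (f j)]
  ring

/-- In each plane, equal Φ and equal length of the position give equal angular momentum. Together
with the radial momentum this fixes position and momentum up to a common rotation. The parts off the
planes are not moved by any rotation and must agree. -/
theorem IsFrame.exists_eq_rotate (hF : IsFrame κ e f k) (hκ : κᵀ = -κ) {x x' : Phase n}
    (h0 : ∀ j, planeSq (e j) (f j) x ≠ 0)
    (h1 : ∀ j, planeSq (e j) (f j) x' = planeSq (e j) (f j) x)
    (h2 : ∀ j, planeVel (e j) (f j) x' = planeVel (e j) (f j) x)
    (h3 : ∀ j, gaugeNoether s κ (planeGen (e j) (f j)) x'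
      = gaugeNoether s κ (planeGen (e j) (f j)) x)
    (hr1 : frameRemainder e f x'.1 = frameRemainder e f x.1)
    (hr2 : frameRemainder e f x'.2 = frameRemainder e f x.2) :
    ∃ β, x' = rotate (frameRotation e f β) x := by
  have key : ∀ j, ∃ β : ℝ, _ := fun j => exists_rotation_eq (h0 j) (h1 j) (h2 j) (by
    have := h3 j
    rw [hF.gaugeNoether_planeGen hκ, hF.gaugeNoether_planeGen hκ, h1 j] at this
    exact add_right_cancel this)
  choose β hβ using key
  exact ⟨β, Prod.ext (eq_frameRotation_mulVec (fun j => (hβ j).1) (fun j => (hβ j).2.1) hr1)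
    (eq_frameRotation_mulVec (fun j => (hβ j).2.2.1) (fun j => (hβ j).2.2.2) hr2)⟩

theorem IsMotion.gaugeNoether_eq {c : ℝ → Phase n} (hc : IsMotion m s κ c) (hκ : κᵀ = -κ)
    {A : Matrix (Fin n) (Fin n) ℝ} (hA : IsSymmetry κ A) (t t' : ℝ) :
    gaugeNoether s κ A (c t) = gaugeNoether s κ A (c t') :=
  hc.eq_of_isFirstIntegral (differentiable_of_contDiff_omega (contDiff_gaugeNoether A))
    (isFirstIntegral_gaugeNoether hκ hA) t t'

theorem rotate_planeGen_ne_zero {e f : Fin n → ℝ} {x : Phase n} (hee : e ⬝ᵥ e = 1)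
    (hff : f ⬝ᵥ f = 1) (hef : e ⬝ᵥ f = 0) (h : planeSq e f x ≠ 0) :
    rotate (planeGen e f) x ≠ 0 := by
  intro h0
  have h1 : planeGen e f *ᵥ x.1 = 0 := congrArg Prod.fst h0
  rw [planeGen_mulVec] at h1
  have h2 := congrArg (fun u => e ⬝ᵥ u) h1
  have h3 := congrArg (fun u => f ⬝ᵥ u) h1
  simp only [dotProduct_sub, dotProduct_smul, hee, hff, hef, dotProduct_comm f e, smul_eq_mul,
    dotProduct_zero] at h2 h3
  apply h
  rw [planeSq, show f ⬝ᵥ x.1 = 0 by linarith, show e ⬝ᵥ x.1 = 0 by linarith]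
  ring

/-- Skew-symmetric matrices restricted to a plane. -/
theorem dotProduct_mulVec_of_plane {A : Matrix (Fin n) (Fin n) ℝ} (hA : Aᵀ = -A)
    (e f : Fin n → ℝ) (a b a' b' : ℝ) :
    (a' • e + b' • f) ⬝ᵥ (A *ᵥ (a • e + b • f)) = (f ⬝ᵥ (A *ᵥ e)) * (b' * a - a' * b) := by
  have h : e ⬝ᵥ (A *ᵥ f) = -(f ⬝ᵥ (A *ᵥ e)) := by
    rw [dotProduct_mulVec_skew hA, dotProduct_comm]
  simp only [Matrix.mulVec_add, Matrix.mulVec_smul, dotProduct_add, add_dotProduct,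
    smul_dotProduct, dotProduct_smul, smul_eq_mul, h, dotProduct_mulVec_self_skew hA]
  ring

end Return


/-! ### Tori for fields of rank two -/

section RankTwo

variable {n : ℕ} {m s ka kb : ℝ} {κ Q : Matrix (Fin n) (Fin n) ℝ} {c : ℝ → Phase n}

/-- A symmetry commutes with κ², hence with `Q`, so there are no mixed terms. -/
theorem IsSplitting.gaugeNoether_split (h : IsSplitting κ Q ka kb) {A : Matrix (Fin n) (Fin n) ℝ}
    (hA : IsSymmetry κ A) (x : Phase n) : gaugeNoether s κ A x
      = (Q *ᵥ gaugeMomentum s κ x) ⬝ᵥ (A *ᵥ (Q *ᵥ x.1))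
        + (gaugeMomentum s κ x - Q *ᵥ gaugeMomentum s κ x) ⬝ᵥ (A *ᵥ (x.1 - Q *ᵥ x.1)) := by
  rw [gaugeNoether_eq h.skew hA]
  simp only [Matrix.mulVec_sub, h.proj_comm hA.2, sub_dotProduct, dotProduct_sub,
    ← h.dotProduct_proj, h.proj_proj]
  ring

/-- The Gram-Schmidt basis of two independent vectors. -/
theorem exists_orthonormal_pair {w y : Fin n → ℝ}
    (h : (w ⬝ᵥ w) * (y ⬝ᵥ y) - (w ⬝ᵥ y) ^ 2 ≠ 0) :
    ∃ (e f : Fin n → ℝ) (a b η : ℝ), e ⬝ᵥ e = 1 ∧ f ⬝ᵥ f = 1 ∧ e ⬝ᵥ f = 0 ∧ a ≠ 0 ∧ η ≠ 0 ∧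
      w = a • e ∧ y = b • e + η • f := by
  have hw : w ⬝ᵥ w ≠ 0 := by
    intro h0
    have : w = 0 := dotProduct_self_eq_zero.1 h0
    simp [this] at h
  have hw' : 0 < w ⬝ᵥ w := lt_of_le_of_ne (dotProduct_self_nonneg' w) hw.symm
  set a := Real.sqrt (w ⬝ᵥ w) with ha
  have ha0 : a ≠ 0 := (Real.sqrt_pos.2 hw').ne'
  have haa : a * a = w ⬝ᵥ w := Real.mul_self_sqrt hw'.le
  set d := y - ((w ⬝ᵥ y) / (w ⬝ᵥ w)) • w with hd
  have hdd : d ⬝ᵥ d ≠ 0 := by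
    intro h0
    apply h
    simp only [hd, sub_dotProduct, dotProduct_sub, smul_dotProduct, dotProduct_smul, smul_eq_mul,
      dotProduct_comm y w] at h0
    field_simp at h0
    linarith
  have hwd : w ⬝ᵥ d = 0 := by
    simp only [hd, dotProduct_sub, dotProduct_smul, smul_eq_mul]
    field_simp
    ring
  have hd' : 0 < d ⬝ᵥ d := lt_of_le_of_ne (dotProduct_self_nonneg' d) hdd.symm
  set η := Real.sqrt (d ⬝ᵥ d) with hη
  have hη0 : η ≠ 0 := (Real.sqrt_pos.2 hd').ne'
  have hηη : η * η = d ⬝ᵥ d := Real.mul_self_sqrt hd'.le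
  refine ⟨a⁻¹ • w, η⁻¹ • d, a, (w ⬝ᵥ y) / a, η, ?_, ?_, ?_, ha0, hη0, ?_, ?_⟩
  · simp only [smul_dotProduct, dotProduct_smul, smul_eq_mul, ← haa]
    field_simp
  · simp only [smul_dotProduct, dotProduct_smul, smul_eq_mul, ← hηη]
    field_simp
  · simp only [smul_dotProduct, dotProduct_smul, smul_eq_mul, hwd, mul_zero]
  · rw [smul_smul, mul_inv_cancel₀ ha0, one_smul]
  · rw [smul_smul, smul_smul, mul_inv_cancel₀ hη0, one_smul, hd, ← haa, ← div_eq_mul_inv,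
      div_div, add_sub_cancel]

theorem mulVec_eq_zero_of_mul_eq (hκQ : κ * Q = κ) {u : Fin n → ℝ}
    (hu : Q *ᵥ u = 0) : κ *ᵥ u = 0 := by
  rw [← hκQ, ← Matrix.mulVec_mulVec, hu, Matrix.mulVec_zero]

theorem isSymmetry_planeGen_of_mulVec_eq_zero (hκ : κᵀ = -κ) {u v : Fin n → ℝ} (hu : κ *ᵥ u = 0)
    (hv : κ *ᵥ v = 0) : IsSymmetry κ (planeGen u v) := by
  refine ⟨planeGen_transpose _ _, ext_mulVec fun w => ?_⟩
  simp only [← Matrix.mulVec_mulVec, planeGen_mulVec, dotProduct_mulVec_skew hκ, hu, hv,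
    zero_dotProduct, neg_zero, zero_smul, Matrix.mulVec_sub, Matrix.mulVec_smul, smul_zero]

theorem gaugeNoether_planeGen_of_mulVec_eq_zero (hκ : κᵀ = -κ) {u v : Fin n → ℝ}
    (hu : κ *ᵥ u = 0) (hv : κ *ᵥ v = 0) (x : Phase n) : gaugeNoether s κ (planeGen u v) x
      = (v ⬝ᵥ x.2) * (u ⬝ᵥ x.1) - (u ⬝ᵥ x.2) * (v ⬝ᵥ x.1) := by
  simp only [gaugeNoether, planeGen_mulVec, dotProduct_sub, dotProduct_smul, smul_eq_mul,
    dotProduct_mulVec_skew hκ, hu, hv, zero_dotProduct, dotProduct_comm x.2 u,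
    dotProduct_comm x.2 v]
  ring

theorem IsSplitting.projPos_ne_zero (h : IsSplitting κ Q ka kb) {x : Phase n}
    (hv : projVel Q x ≠ 0) : projPos Q x ≠ 0 := by
  intro h0
  rw [projPos, ← h.proj_proj, h.dotProduct_proj] at h0
  apply hv
  rw [projVel, dotProduct_self_eq_zero.1 h0, dotProduct_zero]

theorem IsSplitting.one_sub_projPos_ne_zero (h : IsSplitting κ Q ka kb) {x : Phase n}
    (hx : x ∈ cotangentSphere n) (hv : projVel Q x ≠ 0) : 1 - projPos Q x ≠ 0 := by
  intro h0
  have h1 : (x.1 - Q *ᵥ x.1) ⬝ᵥ (x.1 - Q *ᵥ x.1) = 0 := by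
    rw [← h0, ← hx.1, phi1, projPos, sub_dotProduct, dotProduct_sub, dotProduct_sub,
      ← h.dotProduct_proj, ← h.dotProduct_proj, h.proj_proj]
    ring
  have h2 := sub_eq_zero.1 (dotProduct_self_eq_zero.1 h1)
  apply hv
  rw [projVel, ← h2]
  exact hx.2

/-- On the kernel of the field the force is central, so this part of the motion stays in the plane
of its initial position and momentum. That plane is the second plane of the frame; its share of |γ|²
is 1 - ρ, and its radial momentum is opposite to that of the first. -/
theorem IsSplitting.exists_torus_of_rank_two (hm : 0 < m) (h : IsSplitting κ Q ka 0)
    (hκQ : κ * Q = κ) {e₀ f₀ : Fin n → ℝ} (hQ : ∀ u, Q *ᵥ u = (e₀ ⬝ᵥ u) • e₀ + (f₀ ⬝ᵥ u) • f₀)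
    (he₀ : e₀ ⬝ᵥ e₀ = 1) (hf₀ : f₀ ⬝ᵥ f₀ = 1) (hef₀ : e₀ ⬝ᵥ f₀ = 0) (hκe : κ *ᵥ e₀ = -ka • f₀)
    (hκf : κ *ᵥ f₀ = ka • e₀) (hc : IsMotion m s κ c)
    (hv : projVel Q (c 0) ≠ 0) (hd : reducedDisc s ka 0 κ Q (c 0) ≠ 0)
    (hg : (((c 0).1 - Q *ᵥ (c 0).1) ⬝ᵥ ((c 0).1 - Q *ᵥ (c 0).1))
      * (((c 0).2 - Q *ᵥ (c 0).2) ⬝ᵥ ((c 0).2 - Q *ᵥ (c 0).2))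
      - (((c 0).1 - Q *ᵥ (c 0).1) ⬝ᵥ ((c 0).2 - Q *ᵥ (c 0).2)) ^ 2 ≠ 0) :
    ∃ (φ : (Fin 3 → ℝ) → Phase n) (freq : Fin 3 → ℝ),
      IsQuasiPeriodicTorus m s κ φ freq ∧ c 0 ∈ Set.range φ ∧
      ∀ F ∈ integralAlgebra m s κ, ∀ θ, F (φ θ) = F (c 0) := by
  obtain ⟨e₁, f₁, a, b, η, he₁, hf₁, hef₁, ha, hη, hw, hy⟩ := exists_orthonormal_pair hg
  have hQe₁ : Q *ᵥ e₁ = 0 := by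
    have h1 : e₁ = a⁻¹ • ((c 0).1 - Q *ᵥ (c 0).1) := by
      rw [hw, smul_smul, inv_mul_cancel₀ ha, one_smul]
    rw [h1, Matrix.mulVec_smul, Matrix.mulVec_sub, h.proj_proj, sub_self, smul_zero]
  have hQf₁ : Q *ᵥ f₁ = 0 := by
    have h1 : f₁ = η⁻¹ • (((c 0).2 - Q *ᵥ (c 0).2) - b • e₁) := by
      rw [hy, add_sub_cancel_left, smul_smul, inv_mul_cancel₀ hη, one_smul]
    rw [h1, Matrix.mulVec_smul, Matrix.mulVec_sub, Matrix.mulVec_sub, h.proj_proj, sub_self,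
      Matrix.mulVec_smul, hQe₁, smul_zero, sub_zero, smul_zero]
  have hQe₀ : Q *ᵥ e₀ = e₀ := by
    rw [hQ, he₀, dotProduct_comm f₀, hef₀, one_smul, zero_smul, add_zero]
  have hQf₀ : Q *ᵥ f₀ = f₀ := by rw [hQ, hf₀, hef₀, one_smul, zero_smul, zero_add]
  have horth : ∀ {u v : Fin n → ℝ}, Q *ᵥ u = u → Q *ᵥ v = 0 → u ⬝ᵥ v = 0 := fun hu hv => by
    rw [← hu, ← h.dotProduct_proj, hv, dotProduct_zero]
  have hκ0 : ∀ {u : Fin n → ℝ}, Q *ᵥ u = 0 → κ *ᵥ u = 0 := fun hu => mulVec_eq_zero_of_mul_eq hκQ hu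
  have hF : IsFrame κ ![e₀, e₁] ![f₀, f₁] ![ka, 0] := by
    constructor
    · intro i j
      fin_cases i <;> fin_cases j <;>
        simp [he₀, he₁, horth hQe₀ hQe₁, dotProduct_comm e₁ e₀]
    · intro i j
      fin_cases i <;> fin_cases j <;>
        simp [hf₀, hf₁, horth hQf₀ hQf₁, dotProduct_comm f₁ f₀]
    · intro i j
      fin_cases i <;> fin_cases j <;>
        simp [hef₀, hef₁, horth hQe₀ hQf₁, horth hQf₀ hQe₁, dotProduct_comm e₁ f₀]
    · intro j
      fin_cases j <;> simp [hκe, hκ0 hQe₁]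
    · intro j
      fin_cases j <;> simp [hκf, hκ0 hQf₁]
  have hsq₀ : ∀ x : Phase n, planeSq e₀ f₀ x = projPos Q x := fun x => by
    simp only [planeSq, projPos, hQ, dotProduct_add, dotProduct_smul, smul_eq_mul,
      dotProduct_comm x.1 e₀, dotProduct_comm x.1 f₀]
    ring
  have hvel₀ : ∀ x : Phase n, planeVel e₀ f₀ x = projVel Q x := fun x => by
    simp only [planeVel, projVel, hQ, dotProduct_add, dotProduct_smul, smul_eq_mul,
      dotProduct_comm x.2 e₀, dotProduct_comm x.2 f₀]
    ring
  have hγ0 : ∀ {u : Fin n → ℝ}, Q *ᵥ u = 0 → u ⬝ᵥ (c 0).1 = a * (u ⬝ᵥ e₁) := by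
    intro u hu
    have h1 : u ⬝ᵥ ((c 0).1 - Q *ᵥ (c 0).1) = u ⬝ᵥ (c 0).1 := by
      rw [dotProduct_sub, h.dotProduct_proj, hu, zero_dotProduct, sub_zero]
    rw [← h1, hw, dotProduct_smul, smul_eq_mul]
  have hp0 : ∀ {u : Fin n → ℝ}, Q *ᵥ u = 0 →
      u ⬝ᵥ (c 0).2 = b * (u ⬝ᵥ e₁) + η * (u ⬝ᵥ f₁) := by
    intro u hu
    have h1 : u ⬝ᵥ ((c 0).2 - Q *ᵥ (c 0).2) = u ⬝ᵥ (c 0).2 := by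
      rw [dotProduct_sub, h.dotProduct_proj, hu, zero_dotProduct, sub_zero]
    rw [← h1, hy, dotProduct_add, dotProduct_smul, dotProduct_smul, smul_eq_mul, smul_eq_mul]
  -- the motion in the kernel of the field stays in a plane
  have hplane : ∀ t, ∀ {u : Fin n → ℝ}, Q *ᵥ u = 0 → e₁ ⬝ᵥ u = 0 → f₁ ⬝ᵥ u = 0 →
      u ⬝ᵥ (c t).1 = 0 ∧ u ⬝ᵥ (c t).2 = 0 := by
    intro t u hu he hf
    rw [dotProduct_comm] at he hf
    -- All components of the angular momentum in the kernel are conserved. Initially it is the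
    -- multiple η a of e₁ ∧ f₁.
    have key : ∀ {v w : Fin n → ℝ}, Q *ᵥ v = 0 → Q *ᵥ w = 0 →
        (w ⬝ᵥ (c t).2) * (v ⬝ᵥ (c t).1) - (v ⬝ᵥ (c t).2) * (w ⬝ᵥ (c t).1)
        = (b * (w ⬝ᵥ e₁) + η * (w ⬝ᵥ f₁)) * (a * (v ⬝ᵥ e₁))
          - (b * (v ⬝ᵥ e₁) + η * (v ⬝ᵥ f₁)) * (a * (w ⬝ᵥ e₁)) := by
      intro v w hv hw
      rw [← hp0 hw, ← hp0 hv, ← hγ0 hw, ← hγ0 hv,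
        ← gaugeNoether_planeGen_of_mulVec_eq_zero (s := s) h.skew (hκ0 hv) (hκ0 hw),
        ← gaugeNoether_planeGen_of_mulVec_eq_zero (s := s) h.skew (hκ0 hv) (hκ0 hw)]
      exact hc.gaugeNoether_eq h.skew
        (isSymmetry_planeGen_of_mulVec_eq_zero h.skew (hκ0 hv) (hκ0 hw)) t 0
    have h1 := key hu hQe₁
    have h2 := key hu hQf₁
    have h3 := key hQe₁ hQf₁
    rw [he, hf] at h1 h2
    rw [he₁, hef₁, hf₁, dotProduct_comm f₁ e₁, hef₁] at h3
    -- The three conserved components allow Cramer's rule: both scalar products, multiplied by η a,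
    -- are combinations of quantities that vanish.
    have hne : η * a ≠ 0 := mul_ne_zero hη ha
    constructor
    · refine (mul_eq_zero.1 ?_).resolve_left hne
      linear_combination (-(u ⬝ᵥ (c t).1)) * h3 - (f₁ ⬝ᵥ (c t).1) * h1 + (e₁ ⬝ᵥ (c t).1) * h2
    · refine (mul_eq_zero.1 ?_).resolve_left hne
      linear_combination (-(u ⬝ᵥ (c t).2)) * h3 + (e₁ ⬝ᵥ (c t).2) * h2 - (f₁ ⬝ᵥ (c t).2) * h1
  have hrem : ∀ t, ∀ w, (w = (c t).1 ∨ w = (c t).2) →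
      frameRemainder ![e₀, e₁] ![f₀, f₁] w = 0 := by
    intro t w hw
    set u := frameRemainder ![e₀, e₁] ![f₀, f₁] w with hu
    have hu' : u = w - Q *ᵥ w - (e₁ ⬝ᵥ w) • e₁ - (f₁ ⬝ᵥ w) • f₁ := by
      rw [hu, frameRemainder, Fin.sum_univ_two, hQ]
      simp only [Matrix.cons_val_zero, Matrix.cons_val_one]
      abel
    have h1 : Q *ᵥ u = 0 := by
      rw [hu', Matrix.mulVec_sub, Matrix.mulVec_sub, Matrix.mulVec_sub, h.proj_proj,
        Matrix.mulVec_smul, Matrix.mulVec_smul, hQe₁, hQf₁]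
      simp
    have h2 : e₁ ⬝ᵥ u = 0 := by
      rw [hu', dotProduct_sub, dotProduct_sub, dotProduct_sub, h.dotProduct_proj, hQe₁,
        dotProduct_smul, dotProduct_smul, he₁, hef₁]
      simp
    have h3 : f₁ ⬝ᵥ u = 0 := by
      rw [hu', dotProduct_sub, dotProduct_sub, dotProduct_sub, h.dotProduct_proj, hQf₁,
        dotProduct_smul, dotProduct_smul, hf₁, dotProduct_comm f₁ e₁, hef₁]
      simp
    have h4 : u ⬝ᵥ w = 0 := by
      rcases hw with rfl | rfl
      · exact (hplane t h1 h2 h3).1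
      · exact (hplane t h1 h2 h3).2
    apply dotProduct_self_eq_zero.1
    nth_rewrite 2 [hu']
    rw [dotProduct_sub, dotProduct_sub, dotProduct_sub, h.dotProduct_proj, h1, h4,
      dotProduct_smul, dotProduct_smul, dotProduct_comm u, h2, dotProduct_comm u, h3]
    simp
  have hsplit : ∀ t, ∀ u w, (u = (c t).1 ∨ u = (c t).2) →
      (e₁ ⬝ᵥ w) * (e₁ ⬝ᵥ u) + (f₁ ⬝ᵥ w) * (f₁ ⬝ᵥ u) = w ⬝ᵥ u - w ⬝ᵥ (Q *ᵥ u) := by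
    intro t u w hu
    have h1 := congrArg (fun y => w ⬝ᵥ y) (hrem t u hu)
    simp only [frameRemainder, Fin.sum_univ_two, Matrix.cons_val_zero, Matrix.cons_val_one,
      dotProduct_sub, dotProduct_add, dotProduct_smul, smul_eq_mul, dotProduct_zero] at h1
    rw [hQ]
    simp only [dotProduct_add, dotProduct_smul, smul_eq_mul, dotProduct_comm e₁ w,
      dotProduct_comm f₁ w]
    linarith
  have hsq₁ : ∀ t, planeSq e₁ f₁ (c t) = 1 - projPos Q (c t) := fun t => by
    have h1 := hsplit t _ (c t).1 (Or.inl rfl)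
    have h2 : (c t).1 ⬝ᵥ (c t).1 = 1 := (hc t).1.1
    rw [h2] at h1
    rw [planeSq, projPos, ← h1]
    ring
  have hvel₁ : ∀ t, planeVel e₁ f₁ (c t) = -projVel Q (c t) := fun t => by
    have h1 := hsplit t _ (c t).2 (Or.inl rfl)
    have h2 : (c t).2 ⬝ᵥ (c t).1 = 0 := (hc t).1.2
    rw [h2] at h1
    rw [planeVel, projVel, h1]
    ring
  have hne : ∀ j, planeSq (![e₀, e₁] j) (![f₀, f₁] j) (c 0) ≠ 0 := by
    intro j
    fin_cases j
    · simpa [hsq₀] using h.projPos_ne_zero hv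
    · simpa [hsq₁] using h.one_sub_projPos_ne_zero (hc 0).1 hv
  refine h.exists_torus hm hF hc hv (fun j => rotate_planeGen_ne_zero (by simp [hF.ee])
    (by simp [hF.ff]) (hF.ef j j) (hne j)) ?_ ?_
  · intro A hA
    have hP : gaugeMomentum s κ (c 0) - Q *ᵥ gaugeMomentum s κ (c 0)
        = (c 0).2 - Q *ᵥ (c 0).2 := by
      have : κ *ᵥ (c 0).1 - Q *ᵥ (κ *ᵥ (c 0).1) = 0 := by
        rw [h.proj_field, Matrix.mulVec_mulVec, hκQ, sub_self]
      rw [gaugeMomentum, Matrix.mulVec_sub, Matrix.mulVec_smul, sub_sub_sub_comm, ← smul_sub, this,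
        smul_zero, sub_zero]
    rw [h.gaugeNoether_split hA, hP, hw, hy, hQ, hQ]
    have h1 := dotProduct_mulVec_of_plane hA.1 e₁ f₁ a 0 b η
    rw [zero_smul, add_zero] at h1
    rw [h1, dotProduct_mulVec_of_plane hA.1, Fin.sum_univ_two]
    rw [gaugeNoether_eq h.skew (hF.isSymmetry h.skew 0)]
    simp only [Matrix.cons_val_one, Matrix.cons_val_zero]
    rw [gaugeNoether_planeGen_of_mulVec_eq_zero h.skew (hκ0 hQe₁) (hκ0 hQf₁), hγ0 hQe₁, hγ0 hQf₁,
      hp0 hQe₁, hp0 hQf₁, he₁, hf₁, hef₁, dotProduct_comm f₁ e₁, hef₁, planeGen_mulVec,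
      dotProduct_sub, dotProduct_smul, dotProduct_smul, dotProduct_comm _ e₀,
      dotProduct_comm _ f₀]
    simp only [smul_eq_mul]
    ring
  · obtain ⟨T, hT, hper⟩ := h.exists_period hm hc hv hd
    refine ⟨T, 0, hT.ne', ?_⟩
    obtain ⟨h1, h2⟩ := hper 0
    rw [zero_add] at h1 h2
    refine hF.exists_eq_rotate (s := s) h.skew hne ?_ ?_
      (fun j => hc.gaugeNoether_eq h.skew (hF.isSymmetry h.skew j) T 0) ?_ ?_
    · intro j
      fin_cases j
      · simp [hsq₀, h1]
      · simp [hsq₁, h1]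
    · intro j
      fin_cases j
      · simp [hvel₀, h2]
      · simp [hvel₁, h2]
    · rw [hrem T _ (Or.inl rfl), hrem 0 _ (Or.inl rfl)]
    · rw [hrem T _ (Or.inr rfl), hrem 0 _ (Or.inr rfl)]

end RankTwo


/-! ### Frames adapted to a point -/

section Adapted

variable {n : ℕ} {m s ka kb : ℝ} {κ Q : Matrix (Fin n) (Fin n) ℝ}

theorem IsSplitting.field_field (h : IsSplitting κ Q ka kb) {u : Fin n → ℝ} (hu : Q *ᵥ u = u) :
    κ *ᵥ (κ *ᵥ u) = -(ka ^ 2) • u := by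
  rw [h.mulVec_sq, hu, sub_self, smul_zero, sub_zero]

theorem IsSplitting.field_dot_field (h : IsSplitting κ Q ka kb) {u : Fin n → ℝ} (hu : Q *ᵥ u = u)
    (v : Fin n → ℝ) : (κ *ᵥ u) ⬝ᵥ (κ *ᵥ v) = ka ^ 2 * (u ⬝ᵥ v) := by
  rw [dotProduct_mulVec_skew h.skew, h.field_field hu, smul_dotProduct, smul_eq_mul]
  ring

/-- On the range of `Q` the matrix κ/ka is an orthogonal complex structure. The hypotheses say that
`u` and `v` are Hermitian orthogonal, so each spans with its image an invariant plane, and these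
planes are orthogonal. -/
theorem IsSplitting.exists_frame (h : IsSplitting κ Q ka kb) (hka : ka ≠ 0) {u v : Fin n → ℝ}
    (hu : Q *ᵥ u = u) (hv : Q *ᵥ v = v) (hu0 : u ⬝ᵥ u ≠ 0) (hv0 : v ⬝ᵥ v ≠ 0) (huv : u ⬝ᵥ v = 0)
    (hκuv : (κ *ᵥ u) ⬝ᵥ v = 0) :
    ∃ (e f : Fin 2 → Fin n → ℝ) (a b : ℝ), IsFrame κ e f (fun _ => ka) ∧
      (∀ j, Q *ᵥ e j = e j) ∧ (∀ j, Q *ᵥ f j = f j) ∧ a ≠ 0 ∧ b ≠ 0 ∧ u = a • e 0 ∧ v = b • e 1 ∧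
      (κ *ᵥ u) = -(ka * a) • f 0 ∧ (κ *ᵥ v) = -(ka * b) • f 1 := by
  have hup : 0 < u ⬝ᵥ u := lt_of_le_of_ne (dotProduct_self_nonneg' u) hu0.symm
  have hvp : 0 < v ⬝ᵥ v := lt_of_le_of_ne (dotProduct_self_nonneg' v) hv0.symm
  set a := Real.sqrt (u ⬝ᵥ u) with ha
  set b := Real.sqrt (v ⬝ᵥ v) with hb
  have ha0 : a ≠ 0 := (Real.sqrt_pos.2 hup).ne'
  have hb0 : b ≠ 0 := (Real.sqrt_pos.2 hvp).ne'
  have haa : u ⬝ᵥ u = a * a := (Real.mul_self_sqrt hup.le).symm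
  have hbb : v ⬝ᵥ v = b * b := (Real.mul_self_sqrt hvp.le).symm
  have hself : ∀ w : Fin n → ℝ, w ⬝ᵥ (κ *ᵥ w) = 0 := dotProduct_mulVec_self_skew h.skew
  have h1 : u ⬝ᵥ (κ *ᵥ v) = 0 := by rw [dotProduct_mulVec_skew h.skew, hκuv, neg_zero]
  have h2 : v ⬝ᵥ (κ *ᵥ u) = 0 := by rw [dotProduct_comm, hκuv]
  have h3 : v ⬝ᵥ u = 0 := by rw [dotProduct_comm, huv]
  refine ⟨![a⁻¹ • u, b⁻¹ • v], ![-(ka * a)⁻¹ • (κ *ᵥ u), -(ka * b)⁻¹ • (κ *ᵥ v)], a, b,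
    ⟨?_, ?_, ?_, ?_, ?_⟩, ?_, ?_, ha0, hb0, ?_, ?_, ?_, ?_⟩
  · intro i j
    fin_cases i <;> fin_cases j <;> simp [haa, hbb, huv, h3] <;> field_simp
  · intro i j
    fin_cases i <;> fin_cases j <;>
      simp [haa, hbb, huv, h3, h.field_dot_field hu, h.field_dot_field hv] <;> field_simp
  · intro i j
    fin_cases i <;> fin_cases j <;> simp [h1, h2, hself]
  · intro j
    fin_cases j <;> simp [Matrix.mulVec_smul, smul_smul] <;> congr 1 <;> field_simp
  · intro j
    fin_cases j <;> simp [Matrix.mulVec_neg, Matrix.mulVec_smul, h.field_field hu, h.field_field hv,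
      smul_smul] <;> congr 1 <;> field_simp
  · intro j
    fin_cases j <;> simp [Matrix.mulVec_smul, hu, hv]
  · intro j
    fin_cases j <;> simp [Matrix.mulVec_neg, Matrix.mulVec_smul, h.proj_field, hu, hv]
  · simp [smul_smul, ha0]
  · simp [smul_smul, hb0]
  · simp only [Matrix.cons_val_zero, smul_smul]
    rw [neg_mul_neg, mul_inv_cancel₀ (mul_ne_zero hka ha0), one_smul]
  · simp only [Matrix.cons_val_one, Matrix.cons_val_zero, smul_smul]
    rw [neg_mul_neg, mul_inv_cancel₀ (mul_ne_zero hka hb0), one_smul]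

/-- Two vectors in a complex space are carried by two orthogonal complex lines, in which they are
related by rotations with opposite angles. -/
theorem IsSplitting.exists_adapted (h : IsSplitting κ Q ka kb) (hka : ka ≠ 0) {z w : Fin n → ℝ}
    (hz : Q *ᵥ z = z) (hw : Q *ᵥ w = w)
    (hg : ka ^ 2 * ((z ⬝ᵥ z) * (w ⬝ᵥ w) - (z ⬝ᵥ w) ^ 2) - ((κ *ᵥ z) ⬝ᵥ w) ^ 2 ≠ 0) :
    ∃ (e f : Fin 2 → Fin n → ℝ) (a b l η : ℝ), IsFrame κ e f (fun _ => ka) ∧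
      (∀ j, Q *ᵥ e j = e j) ∧ (∀ j, Q *ᵥ f j = f j) ∧ a ≠ 0 ∧ b ≠ 0 ∧ η ≠ 0 ∧
      z = a • e 0 + b • e 1 ∧
      w = (l * a) • e 0 + (l * b) • e 1 + (η * a) • f 0 - (η * b) • f 1 := by
  have hρ : z ⬝ᵥ z ≠ 0 := by
    intro h0
    have : z = 0 := dotProduct_self_eq_zero.1 h0
    simp [this] at hg
  have hρ' : 0 < z ⬝ᵥ z := lt_of_le_of_ne (dotProduct_self_nonneg' z) hρ.symm
  -- Removing the real projection along `z` leaves a vector `d` which is real-orthogonal to `z`.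
  set l := (z ⬝ᵥ w) / (z ⬝ᵥ z) with hl
  set d := w - l • z with hd
  have hzd : z ⬝ᵥ d = 0 := by
    simp only [hd, dotProduct_sub, dotProduct_smul, smul_eq_mul, hl]
    field_simp
    ring
  have hdd : (z ⬝ᵥ z) * (d ⬝ᵥ d) = (z ⬝ᵥ z) * (w ⬝ᵥ w) - (z ⬝ᵥ w) ^ 2 := by
    simp only [hd, dotProduct_sub, sub_dotProduct, dotProduct_smul, smul_dotProduct, smul_eq_mul,
      hl, dotProduct_comm w z]
    field_simp
    ring
  have hκd : (κ *ᵥ z) ⬝ᵥ w = (κ *ᵥ z) ⬝ᵥ d := by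
    rw [hd, dotProduct_sub, dotProduct_smul, dotProduct_comm _ z,
      dotProduct_mulVec_self_skew h.skew, smul_zero, sub_zero]
  rw [← hdd, hκd] at hg
  have hd0 : d ⬝ᵥ d ≠ 0 := by
    intro h0
    have : d = 0 := dotProduct_self_eq_zero.1 h0
    simp [this] at hg
  have hd' : 0 < d ⬝ᵥ d := lt_of_le_of_ne (dotProduct_self_nonneg' d) hd0.symm
  have hQd : Q *ᵥ d = d := by rw [hd, Matrix.mulVec_sub, Matrix.mulVec_smul, hz, hw]
  set η := Real.sqrt ((d ⬝ᵥ d) / (z ⬝ᵥ z)) with hη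
  have hη0 : η ≠ 0 := (Real.sqrt_pos.2 (by positivity)).ne'
  have hηη : η * η = (d ⬝ᵥ d) / (z ⬝ᵥ z) := Real.mul_self_sqrt (by positivity)
  -- The image of `d` under the complex structure, scaled by the choice of η to the length of `z`.
  -- As `d` is orthogonal to `z`, the Hermitian product of `z` and `u` is real.
  set u := (η * ka)⁻¹ • (κ *ᵥ d) with hu
  have hηρ : d ⬝ᵥ d = η * η * (z ⬝ᵥ z) := by
    rw [hηη]
    field_simp
  have huu : u ⬝ᵥ u = z ⬝ᵥ z := by
    rw [hu, smul_dotProduct, dotProduct_smul, h.field_dot_field hQd, smul_eq_mul, smul_eq_mul, hηρ]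
    field_simp
  have hκu : κ *ᵥ u = -(ka / η) • d := by
    rw [hu, Matrix.mulVec_smul, h.field_field hQd, smul_smul]
    congr 1
    field_simp
  have hzu : (κ *ᵥ z) ⬝ᵥ d = -(η * ka) * (z ⬝ᵥ u) := by
    rw [hu, dotProduct_smul, dotProduct_mulVec_skew h.skew, smul_eq_mul]
    field_simp
  have hκzu : (κ *ᵥ z) ⬝ᵥ u = 0 := by
    rw [hu, dotProduct_smul, h.field_dot_field hz, hzd, mul_zero, smul_zero]
  have hQu : Q *ᵥ u = u := by rw [hu, Matrix.mulVec_smul, h.proj_field, hQd]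
  have hne : (z ⬝ᵥ z) ^ 2 - (z ⬝ᵥ u) ^ 2 ≠ 0 := by
    intro h0
    apply hg
    rw [hzu, hηρ]
    linear_combination (ka ^ 2 * η ^ 2) * h0
  have h1 : z ⬝ᵥ z + z ⬝ᵥ u ≠ 0 := fun h0 => hne (by linear_combination (z ⬝ᵥ z - z ⬝ᵥ u) * h0)
  have h2 : z ⬝ᵥ z - z ⬝ᵥ u ≠ 0 := fun h0 => hne (by linear_combination (z ⬝ᵥ z + z ⬝ᵥ u) * h0)
  have hκuz : (κ *ᵥ u) ⬝ᵥ z = 0 := by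
    rw [hκu, smul_dotProduct, dotProduct_comm, hzd, smul_zero]
  have hκuu : (κ *ᵥ u) ⬝ᵥ u = 0 := by
    rw [dotProduct_comm, dotProduct_mulVec_self_skew h.skew]
  have hκzz : (κ *ᵥ z) ⬝ᵥ z = 0 := by
    rw [dotProduct_comm, dotProduct_mulVec_self_skew h.skew]
  -- With |z| = |u| and a real Hermitian product, `z + u` and `z - u` are Hermitian orthogonal. They
  -- are nonzero because `hg` makes `z` and `u` independent, and on their complex lines `d` acts
  -- with opposite signs relative to `z`.
  obtain ⟨e, f, a, b, hF, hQe, hQf, ha, hb, he0, he1, hf0, hf1⟩ := h.exists_frame hka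
    (u := (1 / 2 : ℝ) • (z + u)) (v := (1 / 2 : ℝ) • (z - u))
    (by rw [Matrix.mulVec_smul, Matrix.mulVec_add, hz, hQu])
    (by rw [Matrix.mulVec_smul, Matrix.mulVec_sub, hz, hQu])
    (by
      simp only [smul_dotProduct, dotProduct_smul, add_dotProduct, dotProduct_add, smul_eq_mul,
        dotProduct_comm u z, huu]
      intro h0
      exact h1 (by linear_combination 2 * h0))
    (by
      simp only [smul_dotProduct, dotProduct_smul, sub_dotProduct, dotProduct_sub, smul_eq_mul,
        dotProduct_comm u z, huu]
      intro h0
      exact h2 (by linear_combination 2 * h0))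
    (by
      simp only [smul_dotProduct, dotProduct_smul, add_dotProduct, dotProduct_sub, smul_eq_mul,
        dotProduct_comm u z, huu]
      ring)
    (by
      simp only [Matrix.mulVec_smul, Matrix.mulVec_add, smul_dotProduct, dotProduct_smul,
        add_dotProduct, dotProduct_sub, smul_eq_mul, hκzu, hκuz, hκuu, hκzz]
      ring)
  refine ⟨e, f, a, b, l, η, hF, hQe, hQf, ha, hb, hη0, ?_, ?_⟩
  · rw [← he0, ← he1]
    module
  · have hzz : z = a • e 0 + b • e 1 := by
      rw [← he0, ← he1]
      module
    have hdη : d = (η * a) • f 0 - (η * b) • f 1 := by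
      have h3 : d = -(η / ka) • (κ *ᵥ ((1 / 2 : ℝ) • (z + u)) - κ *ᵥ ((1 / 2 : ℝ) • (z - u))) := by
        rw [← Matrix.mulVec_sub, show (1 / 2 : ℝ) • (z + u) - (1 / 2 : ℝ) • (z - u) = u by module,
          hκu, smul_smul]
        have : -(η / ka) * -(ka / η) = 1 := by field_simp
        rw [this, one_smul]
      rw [h3, hf0, hf1, smul_sub, smul_smul, smul_smul]
      congr 2 <;> field_simp
    have hwd : w = l • z + d := by rw [hd, add_sub_cancel]
    rw [hwd, hdη, show l • z = l • (a • e 0 + b • e 1) by rw [← hzz]]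
    module

/-- For a frame adapted to a point, the components of the moment off the planes vanish. -/
theorem IsFrame.dotProduct_mulVec_adapted {e f : Fin 2 → Fin n → ℝ} (hka : ka ≠ 0)
    (hF : IsFrame κ e f (fun _ => ka)) {A : Matrix (Fin n) (Fin n) ℝ} (hA : IsSymmetry κ A)
    (hκ : κᵀ = -κ) (a b l η : ℝ) :
    ((l * a) • e 0 + (l * b) • e 1 + (η * a) • f 0 - (η * b) • f 1) ⬝ᵥ
      (A *ᵥ (a • e 0 + b • e 1))
    = (f 0 ⬝ᵥ (A *ᵥ e 0)) * (η * a ^ 2) + (f 1 ⬝ᵥ (A *ᵥ e 1)) * (-(η * b ^ 2)) := by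
  have h1 : e 1 ⬝ᵥ (A *ᵥ e 0) = -(e 0 ⬝ᵥ (A *ᵥ e 1)) := by
    rw [dotProduct_mulVec_skew hA.1, dotProduct_comm]
  have h2 : f 0 ⬝ᵥ (A *ᵥ e 1) = f 1 ⬝ᵥ (A *ᵥ e 0) := by
    -- A symmetry is complex linear and skew, i.e. skew-Hermitian, which relates its entries between
    -- the two lines.
    refine mul_left_cancel₀ hka ?_
    have h3 : ka • f 0 = -(κ *ᵥ e 0) := by rw [hF.map_e]; module
    have h4 : ka * (f 0 ⬝ᵥ (A *ᵥ e 1)) = e 0 ⬝ᵥ (κ *ᵥ (A *ᵥ e 1)) := by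
      rw [← smul_eq_mul, ← smul_dotProduct, h3, neg_dotProduct, dotProduct_mulVec_skew hκ]
    rw [h4, ← mulVec_comm_of_commute hA.2, hF.map_e, Matrix.mulVec_smul, dotProduct_smul,
      dotProduct_mulVec_skew hA.1, dotProduct_comm, smul_eq_mul]
    ring
  simp only [Matrix.mulVec_add, Matrix.mulVec_smul, dotProduct_add, sub_dotProduct, add_dotProduct,
    smul_dotProduct, dotProduct_smul, smul_eq_mul, dotProduct_mulVec_self_skew hA.1, h1, h2]
  ring

/-- The nondegeneracy of the pair formed by the projections of the position and of the gauge
momentum. -/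
noncomputable def complexGram (s ka : ℝ) (κ Q : Matrix (Fin n) (Fin n) ℝ) (x : Phase n) : ℝ :=
  ka ^ 2 * (((Q *ᵥ x.1) ⬝ᵥ (Q *ᵥ x.1)) * ((Q *ᵥ gaugeMomentum s κ x) ⬝ᵥ
    (Q *ᵥ gaugeMomentum s κ x)) - ((Q *ᵥ x.1) ⬝ᵥ (Q *ᵥ gaugeMomentum s κ x)) ^ 2)
    - ((κ *ᵥ (Q *ᵥ x.1)) ⬝ᵥ (Q *ᵥ gaugeMomentum s κ x)) ^ 2

theorem contDiff_complexGram : ContDiff ℝ ω (complexGram s ka κ Q) := by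
  have h1 : ContDiff ℝ ω fun x : Phase n => Q *ᵥ x.1 := contDiff_mulVec Q contDiff_fst
  have h2 : ContDiff ℝ ω fun x : Phase n => Q *ᵥ gaugeMomentum s κ x :=
    contDiff_mulVec Q (contDiff_snd.sub (ContDiff.const_smul (s / 2) (contDiff_mulVec κ contDiff_fst)))
  exact (contDiff_const.mul (((contDiff_dotProduct h1 h1).mul (contDiff_dotProduct h2 h2)).sub
    ((contDiff_dotProduct h1 h2).pow 2))).sub
    ((contDiff_dotProduct (contDiff_mulVec κ h1) h2).pow 2)

theorem IsSplitting.generically_complexGram (hn : 2 ≤ n) (h : IsSplitting κ Q ka kb) (hka : ka ≠ 0)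
    {a b : Fin n → ℝ} (ha : Q *ᵥ a = a) (hb : Q *ᵥ b = b) (haa : a ⬝ᵥ a = 1) (hbb : b ⬝ᵥ b = 1)
    (hab : a ⬝ᵥ b = 0) (hκab : (κ *ᵥ a) ⬝ᵥ b = 0) :
    Generically n fun x => complexGram s ka κ Q x ≠ 0 := by
  have hba : b ⬝ᵥ a = 0 := by rw [dotProduct_comm, hab]
  -- For Hermitian orthonormal `a`, `b` the gauge shift of the momentum is imaginary along `a` and
  -- drops out of the complex Gram determinant, leaving the value ka².
  refine generically_ne_zero hn contDiff_complexGram (x₀ := (a, b)) ⟨haa, hba⟩ ?_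
  have h1 : a ⬝ᵥ (κ *ᵥ a) = 0 := dotProduct_mulVec_self_skew h.skew a
  have h2 : b ⬝ᵥ (κ *ᵥ a) = 0 := by rw [dotProduct_comm, hκab]
  simp only [complexGram, gaugeMomentum, Matrix.mulVec_sub, Matrix.mulVec_smul, h.proj_field, ha,
    hb, dotProduct_sub, sub_dotProduct, dotProduct_smul, smul_dotProduct, h.field_dot_field ha,
    haa, hbb, hab, hκab, h1, h2, smul_eq_mul]
  intro h0
  have : ka ^ 2 ≠ 0 := pow_ne_zero 2 hka
  apply this
  linear_combination h0

end Adapted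


/-! ### Tori for fields of rank four and for complex structures -/

section RankFour

variable {n : ℕ} {m s ka kb : ℝ} {κ Q : Matrix (Fin n) (Fin n) ℝ} {c : ℝ → Phase n}

theorem dotProduct_gaugeMomentum (hκ : κᵀ = -κ) (u : Fin n → ℝ) (x : Phase n) :
    u ⬝ᵥ gaugeMomentum s κ x = u ⬝ᵥ x.2 + s / 2 * ((κ *ᵥ u) ⬝ᵥ x.1) := by
  rw [gaugeMomentum, dotProduct_sub, dotProduct_smul, dotProduct_mulVec_skew hκ, smul_eq_mul]
  ring

/-- The symmetries of a frame which interchange two planes of the same strength. -/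
theorem IsFrame.isSymmetry_real {q : ℕ} {e f : Fin q → Fin n → ℝ} {k : Fin q → ℝ}
    (hF : IsFrame κ e f k) (hκ : κᵀ = -κ) {i j : Fin q} (hk : k i = k j) :
    IsSymmetry κ (planeGen (e i) (e j) + planeGen (f i) (f j)) := by
  refine ⟨by rw [Matrix.transpose_add, planeGen_transpose, planeGen_transpose, neg_add],
    ext_mulVec fun u => ?_⟩
  simp only [← Matrix.mulVec_mulVec, Matrix.add_mulVec, planeGen_mulVec, Matrix.mulVec_sub,
    Matrix.mulVec_add, Matrix.mulVec_smul, hF.map_e, hF.map_f, dotProduct_mulVec_skew hκ,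
    smul_dotProduct, smul_eq_mul, hk]
  module

theorem IsFrame.isSymmetry_imag {q : ℕ} {e f : Fin q → Fin n → ℝ} {k : Fin q → ℝ}
    (hF : IsFrame κ e f k) (hκ : κᵀ = -κ) {i j : Fin q} (hk : k i = k j) :
    IsSymmetry κ (planeGen (e i) (f j) - planeGen (f i) (e j)) := by
  refine ⟨by rw [Matrix.transpose_sub, planeGen_transpose, planeGen_transpose]; abel,
    ext_mulVec fun u => ?_⟩
  simp only [← Matrix.mulVec_mulVec, Matrix.sub_mulVec, planeGen_mulVec, Matrix.mulVec_sub,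
    Matrix.mulVec_smul, hF.map_e, hF.map_f, dotProduct_mulVec_skew hκ,
    smul_dotProduct, smul_eq_mul, hk]
  module

/-- A projection of rank four is the sum of the projections to two orthogonal planes. -/
theorem IsSplitting.proj_eq_of_trace (h : IsSplitting κ Q ka kb) (htr : Q.trace = 4)
    {e f : Fin 2 → Fin n → ℝ} (hF : IsFrame κ e f (fun _ => ka)) (hQe : ∀ j, Q *ᵥ e j = e j)
    (hQf : ∀ j, Q *ᵥ f j = f j) (u : Fin n → ℝ) :
    Q *ᵥ u = ∑ j, ((e j ⬝ᵥ u) • e j + (f j ⬝ᵥ u) • f j) := by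
  set S : Matrix (Fin n) (Fin n) ℝ :=
    ∑ j, (Matrix.vecMulVec (e j) (e j) + Matrix.vecMulVec (f j) (f j)) with hS
  have hSu : ∀ u, S *ᵥ u = ∑ j, ((e j ⬝ᵥ u) • e j + (f j ⬝ᵥ u) • f j) := fun u => by
    rw [hS, Matrix.sum_mulVec]
    simp only [Matrix.add_mulVec, vecMulVec_mulVec_eq]
  have hfe : ∀ i j, f i ⬝ᵥ e j = 0 := fun i j => by rw [dotProduct_comm, hF.ef]
  have hSe : ∀ j, S *ᵥ e j = e j := fun j => by
    rw [hSu]; simp [hF.ee, hfe]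
  have hSf : ∀ j, S *ᵥ f j = f j := fun j => by
    rw [hSu]; simp [hF.ff, hF.ef]
  have hSS : S * S = S := ext_mulVec fun u => by
    rw [← Matrix.mulVec_mulVec]
    nth_rewrite 2 [hSu]
    rw [Matrix.mulVec_sum]
    simp only [Matrix.mulVec_add, Matrix.mulVec_smul, hSe, hSf, ← hSu]
  have hQS : Q * S = S := ext_mulVec fun u => by
    rw [← Matrix.mulVec_mulVec, hSu, Matrix.mulVec_sum]
    simp only [Matrix.mulVec_add, Matrix.mulVec_smul, hQe, hQf]
  have hSt : Sᵀ = S := by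
    rw [hS, Matrix.transpose_sum]
    simp only [Matrix.transpose_add, Matrix.transpose_vecMulVec]
  have hSQ : S * Q = S := by
    have := congrArg Matrix.transpose hQS
    rwa [Matrix.transpose_mul, h.symm, hSt] at this
  have hStr : S.trace = 4 := by
    rw [hS, Matrix.trace_sum]
    simp only [Matrix.trace_add, Matrix.trace_vecMulVec, hF.ee, hF.ff]
    norm_num
  -- The range of `S` lies in that of `Q`, so `Q - S` is again an orthogonal projection. Its squared
  -- Frobenius norm is its trace, 4 - 4 = 0.
  have hzero : Q - S = 0 := by
    have h1 : ((Q - S)ᵀ * (Q - S)).trace = 0 := by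
      rw [Matrix.transpose_sub, h.symm, hSt, Matrix.sub_mul, Matrix.mul_sub, Matrix.mul_sub, h.idem,
        hQS, hSQ, hSS, sub_self, sub_zero, Matrix.trace_sub, htr, hStr, sub_self]
    have h2 := (Matrix.trace_conjTranspose_mul_self_eq_zero_iff (A := Q - S)).1
      (by rwa [Matrix.conjTranspose_eq_transpose_of_trivial])
    exact h2
  rw [sub_eq_zero.1 hzero, hSu]

/-- The integrals attached to two complex lines fix the shares of the lines in the position and
in the radial momentum. -/
theorem complex_lines_identities {E₀ F₀ E₁ F₁ P₀ R₀ P₁ R₁ : ℝ}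
    (h1 : E₀ * P₁ - E₁ * P₀ + F₀ * R₁ - F₁ * R₀ = 0)
    (h2 : E₀ * R₁ - F₁ * P₀ - F₀ * P₁ + E₁ * R₀ = 0) :
    (E₀ ^ 2 + F₀ ^ 2) * (R₁ * E₁ - P₁ * F₁) + (E₁ ^ 2 + F₁ ^ 2) * (R₀ * E₀ - P₀ * F₀) = 0 ∧
    (E₀ ^ 2 + F₀ ^ 2) * (P₁ * E₁ + R₁ * F₁) - (E₁ ^ 2 + F₁ ^ 2) * (P₀ * E₀ + R₀ * F₀) = 0 := by
  constructor
  · linear_combination (E₀ * E₁ + F₀ * F₁) * h2 + (F₀ * E₁ - E₀ * F₁) * h1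
  · linear_combination (E₀ * E₁ + F₀ * F₁) * h1 - (F₀ * E₁ - E₀ * F₁) * h2

/-- The conserved moments of the two lines are in the ratio a² : -b², so `h1` forces the ratio a² :
b² on the squared lengths, and `h2` carries it over to the radial momenta. -/
theorem shares_eq {a b η ρ v r₀ r₁ v₀ v₁ φ₀ φ₁ : ℝ} (ha : a ≠ 0) (hη : η ≠ 0) (hρ : ρ ≠ 0)
    (hr : r₀ + r₁ = ρ) (hv : v₀ + v₁ = v) (h1 : r₀ * φ₁ + r₁ * φ₀ = 0) (h2 : r₀ * v₁ - r₁ * v₀ = 0)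
    (h3 : φ₀ = η * a ^ 2) (h4 : φ₁ = -(η * b ^ 2)) :
    r₀ = ρ * a ^ 2 / (a ^ 2 + b ^ 2) ∧ r₁ = ρ * b ^ 2 / (a ^ 2 + b ^ 2) ∧
    v₀ = v * a ^ 2 / (a ^ 2 + b ^ 2) ∧ v₁ = v * b ^ 2 / (a ^ 2 + b ^ 2) := by
  have hab : a ^ 2 + b ^ 2 ≠ 0 := by positivity
  have h5 : r₁ * a ^ 2 - r₀ * b ^ 2 = 0 := by
    refine (mul_eq_zero.1 (?_ : η * _ = 0)).resolve_left hη
    rw [h3, h4] at h1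
    linear_combination h1
  have h6 : r₀ * (a ^ 2 + b ^ 2) = ρ * a ^ 2 := by linear_combination a ^ 2 * hr - h5
  have h7 : r₁ * (a ^ 2 + b ^ 2) = ρ * b ^ 2 := by linear_combination b ^ 2 * hr + h5
  have h8 : v₁ * a ^ 2 - v₀ * b ^ 2 = 0 := by
    refine (mul_eq_zero.1 (?_ : ρ * _ = 0)).resolve_left hρ
    linear_combination (a ^ 2 + b ^ 2) * h2 - v₁ * h6 + v₀ * h7
  refine ⟨?_, ?_, ?_, ?_⟩ <;> rw [eq_div_iff hab]
  · exact h6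
  · exact h7
  · linear_combination a ^ 2 * hv - h8
  · linear_combination b ^ 2 * hv + h8

/-- The data of a frame adapted to the initial point of a motion. -/
structure IsAdapted (s ka : ℝ) (κ Q : Matrix (Fin n) (Fin n) ℝ) (x : Phase n)
    (e f : Fin 2 → Fin n → ℝ) (a b l η : ℝ) : Prop where
  frame : IsFrame κ e f (fun _ => ka)
  proj_e : ∀ j, Q *ᵥ e j = e j
  proj_f : ∀ j, Q *ᵥ f j = f j
  ha : a ≠ 0
  hb : b ≠ 0
  hη : η ≠ 0
  pos : Q *ᵥ x.1 = a • e 0 + b • e 1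
  mom : Q *ᵥ gaugeMomentum s κ x
    = (l * a) • e 0 + (l * b) • e 1 + (η * a) • f 0 - (η * b) • f 1

theorem IsSplitting.exists_isAdapted (h : IsSplitting κ Q ka kb) (hka : ka ≠ 0) {x : Phase n}
    (hx : complexGram s ka κ Q x ≠ 0) : ∃ e f a b l η, IsAdapted s ka κ Q x e f a b l η := by
  obtain ⟨e, f, a, b, l, η, h1, h2, h3, h4, h5, h6, h7, h8⟩ :=
    h.exists_adapted hka (h.proj_proj x.1) (h.proj_proj (gaugeMomentum s κ x)) hx
  exact ⟨e, f, a, b, l, η, h1, h2, h3, h4, h5, h6, h7, h8⟩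

variable {x : Phase n} {e f : Fin 2 → Fin n → ℝ} {a b l η : ℝ}

theorem IsAdapted.coordinates (h : IsSplitting κ Q ka kb) (hx : IsAdapted s ka κ Q x e f a b l η) :
    e 0 ⬝ᵥ x.1 = a ∧ e 1 ⬝ᵥ x.1 = b ∧ f 0 ⬝ᵥ x.1 = 0 ∧ f 1 ⬝ᵥ x.1 = 0 ∧
    e 0 ⬝ᵥ gaugeMomentum s κ x = l * a ∧ e 1 ⬝ᵥ gaugeMomentum s κ x = l * b ∧
    f 0 ⬝ᵥ gaugeMomentum s κ x = η * a ∧ f 1 ⬝ᵥ gaugeMomentum s κ x = -(η * b) := by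
  have hF := hx.frame
  have hfe : ∀ i j, f i ⬝ᵥ e j = 0 := fun i j => by rw [dotProduct_comm, hF.ef]
  have he : ∀ j u, e j ⬝ᵥ u = e j ⬝ᵥ (Q *ᵥ u) := fun j u => by
    rw [h.dotProduct_proj, hx.proj_e]
  have hf : ∀ j u, f j ⬝ᵥ u = f j ⬝ᵥ (Q *ᵥ u) := fun j u => by
    rw [h.dotProduct_proj, hx.proj_f]
  refine ⟨?_, ?_, ?_, ?_, ?_, ?_, ?_, ?_⟩
  · rw [he, hx.pos]; simp [hF.ee]
  · rw [he, hx.pos]; simp [hF.ee]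
  · rw [hf, hx.pos]; simp [hfe]
  · rw [hf, hx.pos]; simp [hfe]
  · rw [he, hx.mom]; simp [hF.ee, hF.ef]
  · rw [he, hx.mom]; simp [hF.ee, hF.ef]
  · rw [hf, hx.mom]; simp [hfe, hF.ff]
  · rw [hf, hx.mom]; simp [hfe, hF.ff]

theorem IsFrame.gaugeNoether_planeGen' {q : ℕ} {e f : Fin q → Fin n → ℝ} {k : Fin q → ℝ}
    (hF : IsFrame κ e f k) (hκ : κᵀ = -κ) (j : Fin q) (x : Phase n) :
    gaugeNoether s κ (planeGen (e j) (f j)) x = (f j ⬝ᵥ gaugeMomentum s κ x) * (e j ⬝ᵥ x.1)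
      - (e j ⬝ᵥ gaugeMomentum s κ x) * (f j ⬝ᵥ x.1) := by
  rw [gaugeNoether_eq hκ (hF.isSymmetry hκ j), planeGen_mulVec]
  simp only [dotProduct_sub, dotProduct_smul, smul_eq_mul, dotProduct_comm (gaugeMomentum s κ x) (e j),
    dotProduct_comm (gaugeMomentum s κ x) (f j)]
  ring

theorem IsFrame.planeVel_eq {q : ℕ} {e f : Fin q → Fin n → ℝ} {k : Fin q → ℝ}
    (hF : IsFrame κ e f k) (hκ : κᵀ = -κ) (j : Fin q) (x : Phase n) :
    planeVel (e j) (f j) x = (e j ⬝ᵥ gaugeMomentum s κ x) * (e j ⬝ᵥ x.1)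
      + (f j ⬝ᵥ gaugeMomentum s κ x) * (f j ⬝ᵥ x.1) := by
  rw [planeVel, dotProduct_gaugeMomentum hκ, dotProduct_gaugeMomentum hκ, hF.map_e, hF.map_f,
    smul_dotProduct, smul_dotProduct, smul_eq_mul, smul_eq_mul]
  ring

/-- In an adapted frame the two integrals that mix the complex lines are zero at time 0, hence
always. By `complex_lines_identities` the lines then keep constant shares of ρ and of the radial
momentum. -/
theorem IsAdapted.shares (h : IsSplitting κ Q ka kb) (htr : Q.trace = 4) (hc : IsMotion m s κ c)
    (hx : IsAdapted s ka κ Q (c 0) e f a b l η) {t : ℝ} (ht : projPos Q (c t) ≠ 0) :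
    planeSq (e 0) (f 0) (c t) = projPos Q (c t) * a ^ 2 / (a ^ 2 + b ^ 2) ∧
    planeSq (e 1) (f 1) (c t) = projPos Q (c t) * b ^ 2 / (a ^ 2 + b ^ 2) ∧
    planeVel (e 0) (f 0) (c t) = projVel Q (c t) * a ^ 2 / (a ^ 2 + b ^ 2) ∧
    planeVel (e 1) (f 1) (c t) = projVel Q (c t) * b ^ 2 / (a ^ 2 + b ^ 2) := by
  have hF := hx.frame
  obtain ⟨g1, g2, g3, g4, g5, g6, g7, g8⟩ := hx.coordinates h
  have hQ := h.proj_eq_of_trace htr hF hx.proj_e hx.proj_f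
  have hre := hF.isSymmetry_real h.skew (i := 0) (j := 1) rfl
  have him := hF.isSymmetry_imag h.skew (i := 0) (j := 1) rfl
  have e1 := hc.gaugeNoether_eq h.skew hre t 0
  have e2 := hc.gaugeNoether_eq h.skew him t 0
  rw [MagneticSphere.gaugeNoether_eq h.skew hre, MagneticSphere.gaugeNoether_eq h.skew hre] at e1
  rw [MagneticSphere.gaugeNoether_eq h.skew him, MagneticSphere.gaugeNoether_eq h.skew him] at e2
  have e3 := hc.gaugeNoether_eq h.skew (hF.isSymmetry h.skew 0) t 0
  have e4 := hc.gaugeNoether_eq h.skew (hF.isSymmetry h.skew 1) t 0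
  rw [hF.gaugeNoether_planeGen' h.skew, hF.gaugeNoether_planeGen' h.skew] at e3 e4
  have hcomm : ∀ (t : ℝ) (u : Fin n → ℝ), gaugeMomentum s κ (c t) ⬝ᵥ u
      = u ⬝ᵥ gaugeMomentum s κ (c t) := fun t u => dotProduct_comm _ _
  have hcomm1 : ∀ j, (c t).1 ⬝ᵥ e j = e j ⬝ᵥ (c t).1 ∧ (c t).1 ⬝ᵥ f j = f j ⬝ᵥ (c t).1 :=
    fun j => ⟨dotProduct_comm _ _, dotProduct_comm _ _⟩
  simp only [Matrix.add_mulVec, Matrix.sub_mulVec, planeGen_mulVec, add_dotProduct,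
    sub_dotProduct, smul_dotProduct, smul_eq_mul, hcomm, g1, g2, g3, g4, g5, g6, g7, g8]
    at e1 e2 e3 e4
  obtain ⟨i1, i2⟩ := complex_lines_identities (E₀ := e 0 ⬝ᵥ (c t).1) (F₀ := f 0 ⬝ᵥ (c t).1)
    (E₁ := e 1 ⬝ᵥ (c t).1) (F₁ := f 1 ⬝ᵥ (c t).1) (P₀ := e 0 ⬝ᵥ gaugeMomentum s κ (c t))
    (R₀ := f 0 ⬝ᵥ gaugeMomentum s κ (c t)) (P₁ := e 1 ⬝ᵥ gaugeMomentum s κ (c t))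
    (R₁ := f 1 ⬝ᵥ gaugeMomentum s κ (c t)) (by linear_combination e1) (by linear_combination e2)
  rw [hF.planeVel_eq (s := s) h.skew, hF.planeVel_eq (s := s) h.skew]
  refine shares_eq hx.ha hx.hη ht ?_ ?_ i1 i2 (by linear_combination e3) (by linear_combination e4)
  · rw [projPos, hQ, Fin.sum_univ_two]
    simp only [dotProduct_add, dotProduct_smul, smul_eq_mul, (hcomm1 _).1, (hcomm1 _).2]
    rw [planeSq, planeSq]
    ring
  · have hpv : projVel Q (c t) = gaugeMomentum s κ (c t) ⬝ᵥ (Q *ᵥ (c t).1) := by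
      have h1 : (κ *ᵥ (c t).1) ⬝ᵥ (Q *ᵥ (c t).1) = 0 := by
        rw [← h.proj_proj, h.dotProduct_proj, h.proj_field, dotProduct_comm,
          dotProduct_mulVec_self_skew h.skew]
      rw [gaugeMomentum, sub_dotProduct, smul_dotProduct, h1, smul_zero, sub_zero, projVel]
    rw [hpv, hQ, Fin.sum_univ_two]
    simp only [add_dotProduct, smul_dotProduct, smul_eq_mul, hcomm]
    ring

end RankFour


/-! ### Relative periodicity when the distinguished eigenspace has dimension four, and the case of a
complex structure -/

section RankFourTori

variable {n : ℕ} {m s ka kb : ℝ} {κ Q : Matrix (Fin n) (Fin n) ℝ} {c : ℝ → Phase n}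
  {e f : Fin 2 → Fin n → ℝ} {a b l η : ℝ}

theorem IsAdapted.planeSq_ne_zero {x : Phase n} (h : IsSplitting κ Q ka kb)
    (hx : IsAdapted s ka κ Q x e f a b l η) :
    planeSq (e 0) (f 0) x ≠ 0 ∧ planeSq (e 1) (f 1) x ≠ 0 := by
  obtain ⟨g1, g2, g3, g4, -⟩ := hx.coordinates h
  constructor
  · rw [planeSq, g1, g3]
    simpa using hx.ha
  · rw [planeSq, g2, g4]
    simpa using hx.hb

theorem IsAdapted.dotProduct_mulVec (h : IsSplitting κ Q ka kb) (hka : ka ≠ 0) {x : Phase n}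
    (hx : IsAdapted s ka κ Q x e f a b l η) {A : Matrix (Fin n) (Fin n) ℝ} (hA : IsSymmetry κ A) :
    (Q *ᵥ gaugeMomentum s κ x) ⬝ᵥ (A *ᵥ (Q *ᵥ x.1))
    = (f 0 ⬝ᵥ (A *ᵥ e 0)) * gaugeNoether s κ (planeGen (e 0) (f 0)) x
      + (f 1 ⬝ᵥ (A *ᵥ e 1)) * gaugeNoether s κ (planeGen (e 1) (f 1)) x := by
  obtain ⟨g1, g2, g3, g4, g5, g6, g7, g8⟩ := hx.coordinates h
  rw [hx.pos, hx.mom, hx.frame.dotProduct_mulVec_adapted hka hA h.skew,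
    hx.frame.gaugeNoether_planeGen' h.skew, hx.frame.gaugeNoether_planeGen' h.skew, g1, g2, g3,
    g4, g5, g6, g7, g8]
  ring

theorem IsAdapted.shares_eq (h : IsSplitting κ Q ka kb) (htr : Q.trace = 4) (hc : IsMotion m s κ c)
    (hx : IsAdapted s ka κ Q (c 0) e f a b l η) {t t' : ℝ} (ht : projPos Q (c t) ≠ 0)
    (hp : projPos Q (c t') = projPos Q (c t)) (hv : projVel Q (c t') = projVel Q (c t)) (j : Fin 2) :
    planeSq (e j) (f j) (c t') = planeSq (e j) (f j) (c t) ∧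
    planeVel (e j) (f j) (c t') = planeVel (e j) (f j) (c t) := by
  have h1 := hx.shares h htr hc ht
  have h2 := hx.shares h htr hc (t := t') (by rwa [hp])
  fin_cases j
  · exact ⟨by simp only [Fin.zero_eta, h1.1, h2.1, hp],
      by simp only [Fin.zero_eta, h1.2.2.1, h2.2.2.1, hv]⟩
  · exact ⟨by simp only [Fin.mk_one, h1.2.1, h2.2.1, hp],
      by simp only [Fin.mk_one, h1.2.2.2, h2.2.2.2, hv]⟩

/-- Among three times with the same reduced state, the coordinate in a one-dimensional kernel
agrees at two. -/
theorem exists_ne_eq_of_sq_eq {w : Fin 3 → ℝ} (h : ∀ i, w i ^ 2 = w 0 ^ 2) :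
    ∃ i j, i < j ∧ w i = w j := by
  rcases sq_eq_sq_iff_eq_or_eq_neg.1 (h 1) with h1 | h1
  · exact ⟨0, 1, by decide, h1.symm⟩
  rcases sq_eq_sq_iff_eq_or_eq_neg.1 (h 2) with h2 | h2
  · exact ⟨0, 2, by decide, h2.symm⟩
  · exact ⟨1, 2, by decide, h1.trans h2.symm⟩

/-- The complement of the range of `Q` is a line, on which the reduced state determines the
coordinate only up to sign, and rotations of the planes cannot change that sign. Among three
consecutive returns of the reduced state the sign agrees at two. -/
theorem IsSplitting.exists_torus_of_corank_one (hm : 0 < m) (h : IsSplitting κ Q ka kb)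
    (hka : ka ≠ 0) (htr : Q.trace = 4) {d : Fin n → ℝ}
    (hd1 : ∀ u, u - Q *ᵥ u = (d ⬝ᵥ u) • d) (hc : IsMotion m s κ c)
    (hv : projVel Q (c 0) ≠ 0) (hd : reducedDisc s ka kb κ Q (c 0) ≠ 0)
    (hg : complexGram s ka κ Q (c 0) ≠ 0) :
    ∃ (φ : (Fin 3 → ℝ) → Phase n) (freq : Fin 3 → ℝ),
      IsQuasiPeriodicTorus m s κ φ freq ∧ c 0 ∈ Set.range φ ∧
      ∀ F ∈ integralAlgebra m s κ, ∀ θ, F (φ θ) = F (c 0) := by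
  obtain ⟨e, f, a, b, l, η, hx⟩ := h.exists_isAdapted hka hg
  have hF := hx.frame
  obtain ⟨hs0, hs1⟩ := hx.planeSq_ne_zero h
  have hQ := h.proj_eq_of_trace htr hF hx.proj_e hx.proj_f
  have hne : ∀ j, planeSq (e j) (f j) (c 0) ≠ 0 := by
    intro j
    fin_cases j
    · exact hs0
    · exact hs1
  refine h.exists_torus hm hF hc hv (fun j => rotate_planeGen_ne_zero (by simp [hF.ee])
    (by simp [hF.ff]) (hF.ef j j) (hne j)) ?_ ?_
  · intro A hA
    rw [h.gaugeNoether_split hA, hx.dotProduct_mulVec h hka hA, hd1, hd1, Matrix.mulVec_smul,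
      dotProduct_smul, smul_dotProduct, dotProduct_mulVec_self_skew hA.1, smul_zero, smul_zero,
      add_zero, Fin.sum_univ_two]
  · obtain ⟨T, hT, hper⟩ := h.exists_period hm hc hv hd
    have hst : ∀ i : Fin 3, projPos Q (c (i.val * T)) = projPos Q (c 0) ∧
        projVel Q (c (i.val * T)) = projVel Q (c 0) := by
      have h1 := hper 0
      have h2 := hper T
      rw [zero_add] at h1
      intro i
      fin_cases i
      · simp
      · simpa using h1
      · have : ((2 : ℕ) : ℝ) * T = T + T := by push_cast; ring
        simp only [this]
        exact ⟨h2.1.trans h1.1, h2.2.trans h1.2⟩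
    have hpos : ∀ t, (d ⬝ᵥ (c t).1) ^ 2 = 1 - projPos Q (c t) := by
      intro t
      have h1 : (c t).1 ⬝ᵥ (c t).1 = 1 := (hc t).1.1
      rw [← h1, projPos, ← dotProduct_sub, hd1, dotProduct_smul, dotProduct_comm _ d, smul_eq_mul]
      ring
    have hvel : ∀ t, (d ⬝ᵥ (c t).1) * (d ⬝ᵥ (c t).2) = -projVel Q (c t) := by
      intro t
      have h1 : (c t).2 ⬝ᵥ (c t).1 = 0 := (hc t).1.2
      have h2 : (c t).2 ⬝ᵥ ((c t).1 - Q *ᵥ (c t).1) = -projVel Q (c t) := by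
        rw [dotProduct_sub, h1, zero_sub, projVel]
      rw [← h2, hd1, dotProduct_smul, dotProduct_comm _ d, smul_eq_mul]
    obtain ⟨i, j, hij, hw⟩ := exists_ne_eq_of_sq_eq (w := fun i => d ⬝ᵥ (c (i.val * T)).1)
      (fun i => by simp only [hpos, (hst i).1, (hst 0).1])
    have hP : projPos Q (c (i.val * T)) ≠ 0 := by
      rw [(hst i).1]; exact h.projPos_ne_zero hv
    -- The product of the two kernel coordinates is minus the radial velocity, which is nonzero at
    -- these times. So equal positions on the line force equal momenta.
    have hvw : d ⬝ᵥ (c (j.val * T)).2 = d ⬝ᵥ (c (i.val * T)).2 := by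
      have h1 := hvel (i.val * T)
      have h2 := hvel (j.val * T)
      rw [(hst i).2, ← (hst j).2, ← h2] at h1
      rw [hw] at h1
      refine (mul_left_cancel₀ ?_ h1).symm
      intro h0
      rw [h0, (hst j).2, zero_mul] at h2
      exact hv (by linarith)
    have hsh := hx.shares_eq h htr hc hP ((hst j).1.trans (hst i).1.symm)
      ((hst j).2.trans (hst i).2.symm)
    have hrem : ∀ u, frameRemainder e f u = (d ⬝ᵥ u) • d := fun u => by
      rw [frameRemainder, ← hQ, hd1]
    refine ⟨j.val * T, i.val * T, fun h0 => ?_, ?_⟩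
    · have := mul_right_cancel₀ hT.ne' h0
      exact hij.ne' (Fin.ext (by exact_mod_cast this))
    · refine hF.exists_eq_rotate (s := s) h.skew ?_ (fun j => (hsh j).1) (fun j => (hsh j).2)
        (fun i => hc.gaugeNoether_eq h.skew (hF.isSymmetry h.skew i) _ _) ?_ ?_
      · have hab : a ^ 2 + b ^ 2 ≠ 0 := by
          have := hx.ha
          positivity
        have h1 := hx.shares h htr hc hP
        intro j
        fin_cases j
        · simp only [Fin.zero_eta, h1.1]
          exact div_ne_zero (mul_ne_zero hP (pow_ne_zero 2 hx.ha)) hab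
        · simp only [Fin.mk_one, h1.2.1]
          exact div_ne_zero (mul_ne_zero hP (pow_ne_zero 2 hx.hb)) hab
      · rw [hrem, hrem]
        exact congrArg (· • d) hw.symm
      · rw [hrem, hrem, hvw]

/-- The complement of the range of `Q` is an invariant plane and serves as the third plane of the
frame, with share 1 - ρ. All shares are then functions of the reduced state, so one period suffices.
-/
theorem IsSplitting.exists_torus_of_corank_two (hm : 0 < m) (h : IsSplitting κ Q ka kb)
    (hka : ka ≠ 0) (htr : Q.trace = 4) {e₂ f₂ : Fin n → ℝ}
    (hQ2 : ∀ u, u - Q *ᵥ u = (e₂ ⬝ᵥ u) • e₂ + (f₂ ⬝ᵥ u) • f₂)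
    (he₂ : e₂ ⬝ᵥ e₂ = 1) (hf₂ : f₂ ⬝ᵥ f₂ = 1) (hef₂ : e₂ ⬝ᵥ f₂ = 0) (hκe : κ *ᵥ e₂ = -kb • f₂)
    (hκf : κ *ᵥ f₂ = kb • e₂) (hc : IsMotion m s κ c)
    (hv : projVel Q (c 0) ≠ 0) (hd : reducedDisc s ka kb κ Q (c 0) ≠ 0)
    (hg : complexGram s ka κ Q (c 0) ≠ 0) :
    ∃ (φ : (Fin 4 → ℝ) → Phase n) (freq : Fin 4 → ℝ),
      IsQuasiPeriodicTorus m s κ φ freq ∧ c 0 ∈ Set.range φ ∧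
      ∀ F ∈ integralAlgebra m s κ, ∀ θ, F (φ θ) = F (c 0) := by
  obtain ⟨e, f, a, b, l, η, hx⟩ := h.exists_isAdapted hka hg
  have hF := hx.frame
  obtain ⟨hs0, hs1⟩ := hx.planeSq_ne_zero h
  have hQ := h.proj_eq_of_trace htr hF hx.proj_e hx.proj_f
  have hQe₂ : Q *ᵥ e₂ = 0 := by
    have h1 := hQ2 e₂
    rw [he₂, dotProduct_comm f₂, hef₂, one_smul, zero_smul, add_zero] at h1
    simpa using h1
  have hQf₂ : Q *ᵥ f₂ = 0 := by
    have h1 := hQ2 f₂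
    rw [hf₂, hef₂, one_smul, zero_smul, zero_add] at h1
    simpa using h1
  have horth : ∀ {u v : Fin n → ℝ}, Q *ᵥ u = u → Q *ᵥ v = 0 → u ⬝ᵥ v = 0 ∧ v ⬝ᵥ u = 0 :=
    fun {u v} hu hv => by
      have : u ⬝ᵥ v = 0 := by rw [← hu, ← h.dotProduct_proj, hv, dotProduct_zero]
      exact ⟨this, by rw [dotProduct_comm, this]⟩
  have o1 := fun j => horth (hx.proj_e j) hQe₂
  have o2 := fun j => horth (hx.proj_f j) hQf₂
  have o3 := fun j => horth (hx.proj_e j) hQf₂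
  have o4 := fun j => horth (hx.proj_f j) hQe₂
  have hF3 : IsFrame κ ![e 0, e 1, e₂] ![f 0, f 1, f₂] ![ka, ka, kb] := by
    constructor
    · intro i j
      fin_cases i <;> fin_cases j <;> simp [hF.ee, he₂, o1]
    · intro i j
      fin_cases i <;> fin_cases j <;> simp [hF.ff, hf₂, o2]
    · intro i j
      fin_cases i <;> fin_cases j <;> simp [hF.ef, hef₂, o3, o4]
    · intro j
      fin_cases j <;> simp [hF.map_e, hκe]
    · intro j
      fin_cases j <;> simp [hF.map_f, hκf]
  have hsq₂ : ∀ t, planeSq e₂ f₂ (c t) = 1 - projPos Q (c t) := fun t => by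
    have h1 : (c t).1 ⬝ᵥ (c t).1 = 1 := (hc t).1.1
    rw [← h1, projPos, ← dotProduct_sub, hQ2, dotProduct_add, dotProduct_smul, dotProduct_smul,
      dotProduct_comm _ e₂, dotProduct_comm _ f₂, smul_eq_mul, smul_eq_mul, planeSq]
    ring
  have hvel₂ : ∀ t, planeVel e₂ f₂ (c t) = -projVel Q (c t) := fun t => by
    have h1 : (c t).2 ⬝ᵥ (c t).1 = 0 := (hc t).1.2
    have h2 : (c t).2 ⬝ᵥ ((c t).1 - Q *ᵥ (c t).1) = -projVel Q (c t) := by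
      rw [dotProduct_sub, h1, zero_sub, projVel]
    rw [← h2, hQ2, dotProduct_add, dotProduct_smul, dotProduct_smul,
      dotProduct_comm _ e₂, dotProduct_comm _ f₂, smul_eq_mul, smul_eq_mul, planeVel]
    ring
  have hne : ∀ j, planeSq (![e 0, e 1, e₂] j) (![f 0, f 1, f₂] j) (c 0) ≠ 0 := by
    intro j
    fin_cases j
    · exact hs0
    · exact hs1
    · simpa [hsq₂] using h.one_sub_projPos_ne_zero (hc 0).1 hv
  refine h.exists_torus hm hF3 hc hv (fun j => rotate_planeGen_ne_zero (by simp [hF3.ee])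
    (by simp [hF3.ff]) (hF3.ef j j) (hne j)) ?_ ?_
  · intro A hA
    rw [h.gaugeNoether_split hA, hx.dotProduct_mulVec h hka hA, hQ2, hQ2,
      dotProduct_mulVec_of_plane hA.1, Fin.sum_univ_three]
    have h3 := hF3.gaugeNoether_planeGen' (s := s) h.skew 2 (c 0)
    simp only [Matrix.cons_val_zero, Matrix.cons_val_one, Matrix.cons_val] at h3 ⊢
    rw [h3]
  · obtain ⟨T, hT, hper⟩ := h.exists_period hm hc hv hd
    refine ⟨T, 0, hT.ne', ?_⟩
    obtain ⟨h1, h2⟩ := hper 0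
    rw [zero_add] at h1 h2
    have hsh := hx.shares_eq h htr hc (h.projPos_ne_zero hv) h1 h2
    have hrem : ∀ u, frameRemainder ![e 0, e 1, e₂] ![f 0, f 1, f₂] u = 0 := fun u => by
      have h3 := hQ2 u
      rw [hQ, Fin.sum_univ_two] at h3
      rw [frameRemainder, Fin.sum_univ_three]
      simp only [Matrix.cons_val_zero, Matrix.cons_val_one, Matrix.cons_val]
      rw [← sub_sub, h3, sub_self]
    refine hF3.exists_eq_rotate (s := s) h.skew hne ?_ ?_
      (fun j => hc.gaugeNoether_eq h.skew (hF3.isSymmetry h.skew j) T 0) (by rw [hrem, hrem])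
      (by rw [hrem, hrem])
    · intro j
      fin_cases j
      · exact (hsh 0).1
      · exact (hsh 1).1
      · simp [hsq₂, h1]
    · intro j
      fin_cases j
      · exact (hsh 0).2
      · exact (hsh 1).2
      · simp [hvel₂, h2]

/-- For a complex structure, the motions are orbits of one-parameter groups of rotations. -/
theorem IsSplitting.exists_torus_of_eq_one (hm : 0 < m) (h : IsSplitting κ 1 ka kb)
    (hka : ka ≠ 0) {x : Phase n} (hxm : x ∈ cotangentSphere n)
    (hg : complexGram s ka κ 1 x ≠ 0) :
    ∃ (φ : (Fin 2 → ℝ) → Phase n) (freq : Fin 2 → ℝ),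
      IsQuasiPeriodicTorus m s κ φ freq ∧ x ∈ Set.range φ ∧
      ∀ F ∈ integralAlgebra m s κ, ∀ θ, F (φ θ) = F x := by
  obtain ⟨e, f, a, b, l, η, hx⟩ := h.exists_isAdapted hka hg
  have hF := hx.frame
  have hfe : ∀ i j, f i ⬝ᵥ e j = 0 := fun i j => by rw [dotProduct_comm, hF.ef]
  obtain ⟨hs0, hs1⟩ := hx.planeSq_ne_zero h
  have hpos := hx.pos
  have hmom := hx.mom
  rw [Matrix.one_mulVec] at hpos hmom
  -- The two constraints in adapted coordinates: |γ| = 1 is this identity, and ⟨p, γ⟩ = 0 gives `l =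
  -- 0` next, so that position and momentum have no radial relation left.
  have hab : a ^ 2 + b ^ 2 = 1 := by
    have h1 : x.1 ⬝ᵥ x.1 = 1 := hxm.1
    rw [hpos] at h1
    simp only [add_dotProduct, dotProduct_add, smul_dotProduct, dotProduct_smul, hF.ee,
      smul_eq_mul] at h1
    simp only [if_true, zero_ne_one, one_ne_zero, if_false] at h1
    linear_combination h1
  have hl : l = 0 := by
    have h1 : gaugeMomentum s κ x ⬝ᵥ x.1 = 0 := by
      have h2 : x.2 ⬝ᵥ x.1 = 0 := hxm.2
      rw [gaugeMomentum, sub_dotProduct, smul_dotProduct, dotProduct_comm (κ *ᵥ x.1),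
        dotProduct_mulVec_self_skew h.skew, h2, smul_zero, sub_zero]
    rw [hmom, hpos] at h1
    simp only [add_dotProduct, sub_dotProduct, dotProduct_add, smul_dotProduct, dotProduct_smul,
      hF.ee, hfe, smul_eq_mul] at h1
    simp only [if_true, zero_ne_one, one_ne_zero, if_false] at h1
    linear_combination h1 - l * hab
  -- The angular velocities, up to the factor 1/m, in the two planes: opposite rotations ±η shifted
  -- by the same Larmor term. The value of μ below makes both rotations solve the equations of
  -- motion.
  set w₀ := η - s * ka / 2 with hw₀
  set w₁ := -η - s * ka / 2 with hw₁
  have hp : x.2 = (w₀ * a) • f 0 + (w₁ * b) • f 1 := by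
    have h1 : x.2 = gaugeMomentum s κ x + (s / 2) • (κ *ᵥ x.1) := by
      rw [gaugeMomentum, sub_add_cancel]
    rw [h1, hmom, hpos, hl, Matrix.mulVec_add, Matrix.mulVec_smul, Matrix.mulVec_smul, hF.map_e,
      hF.map_e, hw₀, hw₁]
    module
  have hκp : κ *ᵥ x.2 = (ka * w₀ * a) • e 0 + (ka * w₁ * b) • e 1 := by
    rw [hp, Matrix.mulVec_add, Matrix.mulVec_smul, Matrix.mulVec_smul, hF.map_f, hF.map_f]
    module
  have hμ : multiplier m s κ x = -(η ^ 2 - s ^ 2 * ka ^ 2 / 4) / m := by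
    have h1 : x.2 ⬝ᵥ (κ *ᵥ x.1) = -(ka * w₀ * a ^ 2 + ka * w₁ * b ^ 2) := by
      rw [dotProduct_mulVec_skew h.skew, hκp, hpos]
      simp only [add_dotProduct, dotProduct_add, smul_dotProduct, dotProduct_smul, hF.ee,
        smul_eq_mul]
      simp only [if_true, zero_ne_one, one_ne_zero, if_false]
      ring
    have h2 : x.2 ⬝ᵥ x.2 = w₀ ^ 2 * a ^ 2 + w₁ ^ 2 * b ^ 2 := by
      rw [hp]
      simp only [add_dotProduct, dotProduct_add, smul_dotProduct, dotProduct_smul, hF.ff,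
        smul_eq_mul]
      simp only [if_true, zero_ne_one, one_ne_zero, if_false]
      ring
    rw [multiplier, h1, h2, hw₀, hw₁]
    field_simp
    linear_combination (4 * (s ^ 2 * ka ^ 2 - 4 * η ^ 2)) * hab
  set α : Fin 2 → ℝ := ![w₀ / m / (2 * Real.pi), w₁ / m / (2 * Real.pi)] with hα
  have hpi := Real.pi_pos.ne'
  have hflow : flowField m s κ x
      = ∑ j, (2 * Real.pi * α j) • rotate (planeGen (e j) (f j)) x := by
    have hα0 : 2 * Real.pi * α 0 = w₀ / m := by
      simp only [hα, Matrix.cons_val_zero]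
      field_simp
    have hα1 : 2 * Real.pi * α 1 = w₁ / m := by
      simp only [hα, Matrix.cons_val_one, Matrix.cons_val_zero]
      field_simp
    obtain ⟨g1, g2, g3, g4, -⟩ := hx.coordinates h
    have he : ∀ u : Fin n → ℝ, ∀ j, planeGen (e j) (f j) *ᵥ u = (e j ⬝ᵥ u) • f j - (f j ⬝ᵥ u) • e j :=
      fun u j => planeGen_mulVec _ _ _
    have p1 : e 0 ⬝ᵥ x.2 = 0 := by rw [hp]; simp [hF.ef]
    have p2 : e 1 ⬝ᵥ x.2 = 0 := by rw [hp]; simp [hF.ef]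
    have p3 : f 0 ⬝ᵥ x.2 = w₀ * a := by rw [hp]; simp [hF.ff]
    have p4 : f 1 ⬝ᵥ x.2 = w₁ * b := by rw [hp]; simp [hF.ff]
    rw [Fin.sum_univ_two, hα0, hα1]
    refine Prod.ext ?_ ?_
    · simp only [flowField, rotate, Prod.fst_add, Prod.smul_fst, he, g1, g2, g3, g4]
      rw [hp]
      simp only [zero_smul, sub_zero, smul_add, smul_smul]
      congr 2 <;> ring
    · simp only [flowField, rotate, Prod.snd_add, Prod.smul_snd, he, p1, p2, p3, p4]
      rw [hκp, hμ, hpos]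
      simp only [zero_smul, zero_sub, smul_add, smul_smul, ← neg_smul]
      have q1 : s / m * (ka * w₀ * a) + -(η ^ 2 - s ^ 2 * ka ^ 2 / 4) / m * a
          = w₀ / m * -(w₀ * a) := by
        rw [hw₀]
        field_simp
        ring
      have q2 : s / m * (ka * w₁ * b) + -(η ^ 2 - s ^ 2 * ka ^ 2 / 4) / m * b
          = w₁ / m * -(w₁ * b) := by
        rw [hw₁]
        field_simp
        ring
      rw [← q1, ← q2]
      module
  have hne : ∀ j, planeSq (e j) (f j) x ≠ 0 := by
    intro j
    fin_cases j
    · exact hs0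
    · exact hs1
  have htorus := hF.isQuasiPeriodicTorus_of_flowField_eq h.skew hxm hflow
    (fun j => rotate_planeGen_ne_zero (by simp [hF.ee]) (by simp [hF.ff]) (hF.ef j j) (hne j))
  obtain ⟨c, hc0, hc⟩ := exists_isMotion hm h.skew hxm
  refine ⟨_, α, htorus, ⟨0, by simp only [frameRotation_zero, rotate_one]⟩, fun F hFm θ => ?_⟩
  have h1 := hF.eq_of_mem_integralAlgebra h.skew hc (fun A hA => ?_) θ 0 hFm
  · rwa [hc0] at h1
  · rw [hc0, Fin.sum_univ_two, ← hx.dotProduct_mulVec h hka hA, gaugeNoether_eq h.skew hA,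
      Matrix.one_mulVec, Matrix.one_mulVec]

end RankFourTori


/-! ### Degrees in the momenta -/

section Degree

variable {n : ℕ} {m s : ℝ} {κ : Matrix (Fin n) (Fin n) ℝ} {f g : Phase n → ℝ} {d d' : ℕ}

/-- `f` is a polynomial of degree at most `d` in the momenta. -/
def HasMomentumDegreeLE (d : ℕ) (f : Phase n → ℝ) : Prop :=
  ∃ P : MvPolynomial (Fin n) (MvPolynomial (Fin n) ℝ), P.totalDegree ≤ d ∧
    ∀ x : Phase n, f x = MvPolynomial.eval x.2 (MvPolynomial.map (MvPolynomial.eval x.1) P)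

theorem HasMomentumDegreeLE.exists_eq (h : HasMomentumDegreeLE d f) :
    ∃ d' ≤ d, HasMomentumDegree d' f := by
  obtain ⟨P, hP, hf⟩ := h
  exact ⟨_, hP, P, rfl, hf⟩

theorem HasMomentumDegreeLE.mono (h : HasMomentumDegreeLE d f) (hd : d ≤ d') :
    HasMomentumDegreeLE d' f := by
  obtain ⟨P, hP, hf⟩ := h
  exact ⟨P, hP.trans hd, hf⟩

theorem HasMomentumDegreeLE.add (hf : HasMomentumDegreeLE d f) (hg : HasMomentumDegreeLE d g) :
    HasMomentumDegreeLE d fun x => f x + g x := by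
  obtain ⟨P, hP, hf⟩ := hf
  obtain ⟨R, hR, hg⟩ := hg
  exact ⟨P + R, (MvPolynomial.totalDegree_add _ _).trans (max_le hP hR),
    fun x => by simp only [map_add, hf, hg]⟩

theorem HasMomentumDegreeLE.mul (hf : HasMomentumDegreeLE d f) (hg : HasMomentumDegreeLE d' g) :
    HasMomentumDegreeLE (d + d') fun x => f x * g x := by
  obtain ⟨P, hP, hf⟩ := hf
  obtain ⟨R, hR, hg⟩ := hg
  exact ⟨P * R, (MvPolynomial.totalDegree_mul _ _).trans (add_le_add hP hR),
    fun x => by simp only [map_mul, hf, hg]⟩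

theorem HasMomentumDegreeLE.sum {ι : Type*} (S : Finset ι) {f : ι → Phase n → ℝ}
    (h : ∀ i, HasMomentumDegreeLE d (f i)) : HasMomentumDegreeLE d fun x => ∑ i ∈ S, f i x := by
  choose P hP hf using h
  refine ⟨∑ i ∈ S, P i, MvPolynomial.totalDegree_finsetSum_le fun i _ => hP i, fun x => ?_⟩
  simp only [map_sum, hf]

theorem hasMomentumDegreeLE_pos (q : MvPolynomial (Fin n) ℝ) :
    HasMomentumDegreeLE 0 fun x : Phase n => MvPolynomial.eval x.1 q :=
  ⟨MvPolynomial.C q, by simp, fun x => by simp⟩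

theorem hasMomentumDegreeLE_const (a : ℝ) : HasMomentumDegreeLE 0 fun _ : Phase n => a := by
  simpa using hasMomentumDegreeLE_pos (n := n) (MvPolynomial.C a)

theorem HasMomentumDegreeLE.const_mul (a : ℝ) (h : HasMomentumDegreeLE d f) :
    HasMomentumDegreeLE d fun x => a * f x := by
  simpa using (hasMomentumDegreeLE_const a).mul h

theorem HasMomentumDegreeLE.sub (hf : HasMomentumDegreeLE d f) (hg : HasMomentumDegreeLE d g) :
    HasMomentumDegreeLE d fun x => f x - g x := by
  simpa [sub_eq_add_neg] using hf.add (hg.const_mul (-1))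

theorem hasMomentumDegreeLE_fst (i : Fin n) : HasMomentumDegreeLE 0 fun x : Phase n => x.1 i := by
  simpa using hasMomentumDegreeLE_pos (MvPolynomial.X (R := ℝ) i)

theorem hasMomentumDegreeLE_snd (i : Fin n) : HasMomentumDegreeLE 1 fun x : Phase n => x.2 i :=
  ⟨MvPolynomial.X i, by simp, fun x => by simp⟩

theorem HasMomentumDegreeLE.mulVec (A : Matrix (Fin n) (Fin n) ℝ) {u : Phase n → Fin n → ℝ}
    (h : ∀ i, HasMomentumDegreeLE d fun x => u x i) (i : Fin n) :
    HasMomentumDegreeLE d fun x => (A *ᵥ u x) i :=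
  HasMomentumDegreeLE.sum Finset.univ fun j => (h j).const_mul (A i j)

theorem HasMomentumDegreeLE.dotProduct {u v : Phase n → Fin n → ℝ}
    (hu : ∀ i, HasMomentumDegreeLE d fun x => u x i)
    (hv : ∀ i, HasMomentumDegreeLE d' fun x => v x i) :
    HasMomentumDegreeLE (d + d') fun x => u x ⬝ᵥ v x :=
  HasMomentumDegreeLE.sum Finset.univ fun i => (hu i).mul (hv i)

theorem hasMomentumDegreeLE_hamiltonian : HasMomentumDegreeLE 2 (hamiltonian (n := n) m) :=
  (HasMomentumDegreeLE.dotProduct hasMomentumDegreeLE_snd hasMomentumDegreeLE_snd).const_mul _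

theorem hasMomentumDegreeLE_gaugeNoether (A : Matrix (Fin n) (Fin n) ℝ) :
    HasMomentumDegreeLE 1 (gaugeNoether s κ A) :=
  (HasMomentumDegreeLE.dotProduct hasMomentumDegreeLE_snd
    (HasMomentumDegreeLE.mulVec A hasMomentumDegreeLE_fst)).add
    (((HasMomentumDegreeLE.dotProduct hasMomentumDegreeLE_fst (HasMomentumDegreeLE.mulVec A
      (HasMomentumDegreeLE.mulVec κ hasMomentumDegreeLE_fst))).mono zero_le_one).const_mul _)

/-- The only quartic term of -μ² is -⟨p, p⟩²/m² = -4H², so adding 4H² leaves degree three. -/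
theorem fieldIntegral_add_eq (hm : m ≠ 0) (x : Phase n) :
    fieldIntegral m s κ x + 4 * hamiltonian m x ^ 2 = s ^ 2 / m ^ 2 * ((κ *ᵥ x.2) ⬝ᵥ (κ *ᵥ x.2))
      - s ^ 2 / m ^ 2 * ((x.2 ⬝ᵥ (κ *ᵥ x.1)) * (x.2 ⬝ᵥ (κ *ᵥ x.1)))
      + 2 * s / m ^ 2 * ((x.2 ⬝ᵥ (κ *ᵥ x.1)) * (x.2 ⬝ᵥ x.2)) := by
  simp only [fieldIntegral, multiplier, hamiltonian]
  field_simp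
  ring

theorem hasMomentumDegreeLE_fieldIntegral (hm : m ≠ 0) :
    HasMomentumDegreeLE 3 fun x : Phase n => fieldIntegral m s κ x + 4 * hamiltonian m x ^ 2 := by
  simp only [fieldIntegral_add_eq hm]
  have h1 : HasMomentumDegreeLE 1 fun x : Phase n => x.2 ⬝ᵥ (κ *ᵥ x.1) :=
    HasMomentumDegreeLE.dotProduct hasMomentumDegreeLE_snd
      (HasMomentumDegreeLE.mulVec κ hasMomentumDegreeLE_fst)
  have h2 : HasMomentumDegreeLE 2 fun x : Phase n => (κ *ᵥ x.2) ⬝ᵥ (κ *ᵥ x.2) :=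
    HasMomentumDegreeLE.dotProduct (HasMomentumDegreeLE.mulVec κ hasMomentumDegreeLE_snd)
      (HasMomentumDegreeLE.mulVec κ hasMomentumDegreeLE_snd)
  have h3 : HasMomentumDegreeLE 2 fun x : Phase n => x.2 ⬝ᵥ x.2 :=
    HasMomentumDegreeLE.dotProduct hasMomentumDegreeLE_snd hasMomentumDegreeLE_snd
  exact (((h2.mono (by norm_num)).const_mul _).sub
    (((h1.mul h1).mono (by norm_num)).const_mul _)).add ((h1.mul h3).const_mul _)

/-- The degree is attained if it is attained on a line of momenta. -/
theorem HasMomentumDegreeLE.hasMomentumDegree (h : HasMomentumDegreeLE d f) (γ p : Fin n → ℝ)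
    (r : Polynomial ℝ) (hr : d ≤ r.natDegree) (hf : ∀ t, f (γ, t • p) = r.eval t) :
    HasMomentumDegree d f := by
  obtain ⟨P, hP, hPf⟩ := h
  refine ⟨P, le_antisymm hP (hr.trans ?_), hPf⟩
  set R := MvPolynomial.map (MvPolynomial.eval γ) P with hR
  -- Restriction to the line of momenta substitutes multiples of the variable, which cannot raise
  -- the degree. So the degree of `r` bounds that of `P` from below.
  have h1 : r = MvPolynomial.aeval (fun i => Polynomial.C (p i) * Polynomial.X) R := by
    refine Polynomial.funext fun t => ?_
    rw [← hf, hPf, ← Polynomial.coe_evalRingHom, MvPolynomial.aeval_def, MvPolynomial.hom_eval₂]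
    have h2 : (Polynomial.evalRingHom t).comp (algebraMap ℝ (Polynomial ℝ)) = RingHom.id ℝ :=
      RingHom.ext fun a => by simp
    have h3 : (fun i => Polynomial.evalRingHom t (Polynomial.C (p i) * Polynomial.X)) = t • p :=
      funext fun i => by
        rw [Polynomial.coe_evalRingHom, Polynomial.eval_C_mul, Polynomial.eval_X, Pi.smul_apply,
          smul_eq_mul, mul_comm]
    rw [h2, h3]
    rfl
  have h2 := MvPolynomial.aeval_natDegree_le R (m := P.totalDegree)
    (Finset.sup_mono (MvPolynomial.support_map_subset _ _))
    (fun i => Polynomial.C (p i) * Polynomial.X) (n := 1)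
    (fun i => (Polynomial.natDegree_C_mul_le _ _).trans Polynomial.natDegree_X_le)
  rw [← h1, mul_one] at h2
  exact h2

end Degree


/-! ### Liouville systems -/

section Liouville

variable {n q : ℕ} {m s lam : ℝ} {κ : Matrix (Fin n) (Fin n) ℝ} {e f : Fin q → Fin n → ℝ}
  {k : Fin q → ℝ} {x : Phase n}

theorem vertical_mem_tangentSpace {v : Fin n → ℝ} (hv : x.1 ⬝ᵥ v = 0) :
    ((0, v) : Phase n) ∈ tangentSpace x := ⟨by simp, by simp [hv]⟩

theorem fderiv_gaugeNoether_vertical (A : Matrix (Fin n) (Fin n) ℝ) (v : Fin n → ℝ) :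
    fderiv ℝ (gaugeNoether s κ A) x (0, v) = v ⬝ᵥ (A *ᵥ x.1) := by
  rw [fderiv_gaugeNoether]
  simp

/-- The integral `J + λ H²`. -/
noncomputable def shiftedIntegral (m s lam : ℝ) (κ : Matrix (Fin n) (Fin n) ℝ) (x : Phase n) : ℝ :=
  fieldIntegral m s κ x + lam * hamiltonian m x ^ 2

theorem shiftedIntegral_mem_integralAlgebra :
    shiftedIntegral m s lam κ ∈ integralAlgebra m s κ :=
  Subalgebra.add_mem _ fieldIntegral_mem_integralAlgebra
    (Subalgebra.smul_mem _ (Subalgebra.pow_mem _ hamiltonian_mem_integralAlgebra 2) lam)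

theorem fderiv_shiftedIntegral (x w : Phase n) :
    fderiv ℝ (shiftedIntegral m s lam κ) x w = fderiv ℝ (fieldIntegral m s κ) x w
      + lam * (2 * hamiltonian m x * fderiv ℝ (hamiltonian m) x w) := by
  have h1 := differentiable_of_contDiff_omega (contDiff_fieldIntegral (m := m) (s := s) (κ := κ)) x
  have h2 := differentiable_of_contDiff_omega (contDiff_hamiltonian (m := m) (n := n)) x
  refine fderiv_apply_eq_of_hasDerivAt (differentiable_of_mem_integralAlgebra
    shiftedIntegral_mem_integralAlgebra x) ?_
  have e1 := h1.hasFDerivAt.comp_hasDerivAt_of_eq 0 (hasDerivAt_line x w) (by simp)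
  have e2 := h2.hasFDerivAt.comp_hasDerivAt_of_eq 0 (hasDerivAt_line x w) (by simp)
  refine (e1.add ((e2.pow 2).const_mul lam)).congr_deriv ?_
  simp

/-- Independence of `H`, `J + λ H²` and gauge Noether integrals, tested on vertical vectors. -/
theorem linearIndependent_of_vertical {ι : Type*} [Fintype ι] [DecidableEq ι]
    {A : ι → Matrix (Fin n) (Fin n) ℝ} {w : ι → Fin n → ℝ} {b : ι → ℝ} (hm : 0 < m) (hs : s ≠ 0)
    {v₁ v₂ : Fin n → ℝ} (hw : ∀ j, x.1 ⬝ᵥ w j = 0)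
    (hA : ∀ i j, w j ⬝ᵥ (A i *ᵥ x.1) = if i = j then b j else 0) (hb : ∀ j, b j ≠ 0)
    (hv₁ : x.1 ⬝ᵥ v₁ = 0) (hv₂ : x.1 ⬝ᵥ v₂ = 0) (hA₁ : ∀ j, v₁ ⬝ᵥ (A j *ᵥ x.1) = 0)
    (hA₂ : ∀ j, v₂ ⬝ᵥ (A j *ᵥ x.1) = 0) (hκ₁ : v₁ ⬝ᵥ (κ *ᵥ x.1) = 0) (hκ₂ : v₂ ⬝ᵥ (κ *ᵥ x.1) = 0)
    (hdet : (x.2 ⬝ᵥ v₁) * ((κ *ᵥ x.2) ⬝ᵥ (κ *ᵥ v₂)) - (x.2 ⬝ᵥ v₂) * ((κ *ᵥ x.2) ⬝ᵥ (κ *ᵥ v₁)) ≠ 0) :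
    LinearIndependent ℝ fun i => differential
      ((Sum.elim ![hamiltonian m, shiftedIntegral m s lam κ]
        (fun j => gaugeNoether s κ (A j)) : Fin 2 ⊕ ι → Phase n → ℝ) i) x := by
  rw [Fintype.linearIndependent_iff]
  intro g hg
  have key : ∀ v, x.1 ⬝ᵥ v = 0 → g (Sum.inl 0) * (1 / m * (x.2 ⬝ᵥ v))
      + g (Sum.inl 1) * (2 * (s ^ 2 / m ^ 2 * ((κ *ᵥ x.2) ⬝ᵥ (κ *ᵥ v))
        - multiplier m s κ x * (1 / m * (s * (v ⬝ᵥ (κ *ᵥ x.1)) - 2 * (x.2 ⬝ᵥ v))))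
        + lam * (2 * hamiltonian m x * (1 / m * (x.2 ⬝ᵥ v))))
      + ∑ j, g (Sum.inr j) * (v ⬝ᵥ (A j *ᵥ x.1)) = 0 := by
    intro v hv
    have h1 := LinearMap.congr_fun hg ⟨(0, v), vertical_mem_tangentSpace hv⟩
    rw [Fintype.sum_sum_type, Fin.sum_univ_two] at h1
    simp only [LinearMap.add_apply, LinearMap.smul_apply, LinearMap.sum_apply, Sum.elim_inl,
      Sum.elim_inr, Matrix.cons_val_zero, Matrix.cons_val_one, smul_eq_mul,
      LinearMap.zero_apply] at h1
    simp only [differential, LinearMap.domRestrict_apply, ContinuousLinearMap.coe_coe,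
      fderiv_hamiltonian, fderiv_shiftedIntegral, fderiv_fieldIntegral, fderiv_multiplier,
      fderiv_gaugeNoether_vertical, Matrix.mulVec_zero, dotProduct_zero, add_zero] at h1
    exact h1
  have h1 := key v₁ hv₁
  have h2 := key v₂ hv₂
  simp only [hA₁, hA₂, hκ₁, hκ₂, mul_zero, Finset.sum_const_zero, add_zero, zero_sub] at h1 h2
  have hm' := hm.ne'
  have hb₀ : g (Sum.inl 1) = 0 := by
    have h3 : g (Sum.inl 1) * (2 * (s ^ 2 / m ^ 2) * ((x.2 ⬝ᵥ v₁) * ((κ *ᵥ x.2) ⬝ᵥ (κ *ᵥ v₂))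
        - (x.2 ⬝ᵥ v₂) * ((κ *ᵥ x.2) ⬝ᵥ (κ *ᵥ v₁)))) = 0 := by
      linear_combination (x.2 ⬝ᵥ v₁) * h2 - (x.2 ⬝ᵥ v₂) * h1
    refine (mul_eq_zero.1 h3).resolve_right (mul_ne_zero (by positivity) hdet)
  rw [hb₀, zero_mul, add_zero] at h1 h2
  have ha : g (Sum.inl 0) = 0 := by
    have h3 : g (Sum.inl 0) * (1 / m * ((x.2 ⬝ᵥ v₁) * ((κ *ᵥ x.2) ⬝ᵥ (κ *ᵥ v₂))
        - (x.2 ⬝ᵥ v₂) * ((κ *ᵥ x.2) ⬝ᵥ (κ *ᵥ v₁)))) = 0 := by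
      linear_combination ((κ *ᵥ x.2) ⬝ᵥ (κ *ᵥ v₂)) * h1 - ((κ *ᵥ x.2) ⬝ᵥ (κ *ᵥ v₁)) * h2
    refine (mul_eq_zero.1 h3).resolve_right (mul_ne_zero (by positivity) hdet)
  rintro (i | j)
  · fin_cases i
    · exact ha
    · exact hb₀
  · have h3 := key (w j) (hw j)
    simp only [ha, hb₀, zero_mul, zero_add, hA, mul_ite, mul_zero,
      Finset.sum_ite_eq', Finset.mem_univ, if_true] at h3
    exact (mul_eq_zero.1 h3).resolve_right (hb j)

/-- At a position with no component along the `f j`, the vertical vector `f j` detects exactly the Φ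
of its own plane, while vectors orthogonal to all `f j` detect none of them. -/
theorem IsFrame.linearIndependent_integrals (hF : IsFrame κ e f k) (hm : 0 < m)
    (hs : s ≠ 0) {v₁ v₂ : Fin n → ℝ}
    (hf : ∀ j, f j ⬝ᵥ x.1 = 0) (he : ∀ j, e j ⬝ᵥ x.1 ≠ 0)
    (hv₁ : x.1 ⬝ᵥ v₁ = 0) (hv₂ : x.1 ⬝ᵥ v₂ = 0) (hf₁ : ∀ j, f j ⬝ᵥ v₁ = 0)
    (hf₂ : ∀ j, f j ⬝ᵥ v₂ = 0) (hκ₁ : v₁ ⬝ᵥ (κ *ᵥ x.1) = 0) (hκ₂ : v₂ ⬝ᵥ (κ *ᵥ x.1) = 0)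
    (hdet : (x.2 ⬝ᵥ v₁) * ((κ *ᵥ x.2) ⬝ᵥ (κ *ᵥ v₂)) - (x.2 ⬝ᵥ v₂) * ((κ *ᵥ x.2) ⬝ᵥ (κ *ᵥ v₁)) ≠ 0) :
    LinearIndependent ℝ fun i => differential
      ((Sum.elim ![hamiltonian m, shiftedIntegral m s lam κ]
        (fun j => gaugeNoether s κ (planeGen (e j) (f j))) : Fin 2 ⊕ Fin q → Phase n → ℝ) i) x := by
  have hgen : ∀ j, planeGen (e j) (f j) *ᵥ x.1 = (e j ⬝ᵥ x.1) • f j := fun j => by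
    rw [planeGen_mulVec, hf, zero_smul, sub_zero]
  refine linearIndependent_of_vertical (w := f) (b := fun j => e j ⬝ᵥ x.1) hm hs
    (fun j => by rw [dotProduct_comm, hf]) (fun i j => ?_) he hv₁ hv₂ (fun j => ?_) (fun j => ?_)
    hκ₁ hκ₂ hdet
  · rw [hgen, dotProduct_smul, hF.ff, smul_eq_mul, mul_ite, mul_one, mul_zero]
    rcases eq_or_ne i j with rfl | hij
    · rfl
    · rw [if_neg hij, if_neg hij.symm]
  · rw [hgen, dotProduct_smul, dotProduct_comm v₁, hf₁, smul_zero]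
  · rw [hgen, dotProduct_smul, dotProduct_comm v₂, hf₂, smul_zero]

theorem gaugeNoether_zero (x : Phase n) : gaugeNoether s κ 0 x = 0 := by
  simp [gaugeNoether]

theorem IsFrame.diracBracket_gaugeNoether (hF : IsFrame κ e f k) (hκ : κᵀ = -κ) (i j : Fin q)
    (hx : x ∈ cotangentSphere n) : diracBracket s κ (gaugeNoether s κ (planeGen (e i) (f i)))
      (gaugeNoether s κ (planeGen (e j) (f j))) x = 0 := by
  rw [MagneticSphere.diracBracket_gaugeNoether hκ _ (hF.isSymmetry hκ j) hx,
    fderiv_gaugeNoether_rotate (hF.isSymmetry hκ j), hF.planeGen_commute, sub_self,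
    gaugeNoether_zero]

theorem fderiv_shiftedIntegral_rotate {A : Matrix (Fin n) (Fin n) ℝ} (hA : IsSymmetry κ A)
    (x : Phase n) : fderiv ℝ (shiftedIntegral m s lam κ) x (rotate A x) = 0 := by
  rw [fderiv_shiftedIntegral, fderiv_fieldIntegral_rotate hA, fderiv_hamiltonian_rotate hA.1]
  ring

/-- The condition `q + 3 = n` says that q planes together with `H` and `J + λH²` make n - 1
functions. The first two are central in the algebra, and the Φ's commute because rotations of
orthogonal planes do. -/
theorem IsFrame.isLiouvilleSystem (hF : IsFrame κ e f k) (hκ : κᵀ = -κ) (hn : q + 3 = n)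
    {x₀ : Phase n} (hx₀ : x₀ ∈ cotangentSphere n)
    (h₀ : LinearIndependent ℝ fun i => differential
      ((Sum.elim ![hamiltonian m, shiftedIntegral m s lam κ]
        (fun j => gaugeNoether s κ (planeGen (e j) (f j))) : Fin 2 ⊕ Fin q → Phase n → ℝ) i) x₀) :
    IsLiouvilleSystem m s κ
      (Sum.elim ![hamiltonian m, shiftedIntegral m s lam κ]
        (fun j => gaugeNoether s κ (planeGen (e j) (f j))) : Fin 2 ⊕ Fin q → Phase n → ℝ) := by
  set F : Fin 2 ⊕ Fin q → Phase n → ℝ := Sum.elim ![hamiltonian m, shiftedIntegral m s lam κ]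
    (fun j => gaugeNoether s κ (planeGen (e j) (f j))) with hFdef
  have hmem : ∀ i, F i ∈ integralAlgebra m s κ := by
    rintro (i | j)
    · fin_cases i
      · exact hamiltonian_mem_integralAlgebra
      · exact shiftedIntegral_mem_integralAlgebra
    · exact gaugeNoether_mem_integralAlgebra (hF.isSymmetry hκ j)
  have hinv : ∀ i x A, IsSymmetry κ A → fderiv ℝ (F (Sum.inl i)) x (rotate A x) = 0 := by
    intro i x A hA
    fin_cases i
    · exact fderiv_hamiltonian_rotate hA.1 x
    · exact fderiv_shiftedIntegral_rotate hA x
  refine ⟨by simp only [Fintype.card_sum, Fintype.card_fin]; omega,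
    fun i => (contDiff_of_mem_integralAlgebra (hmem i)).of_le (by simp),
    fun i => isFirstIntegral_of_mem_integralAlgebra hκ (hmem i), ?_,
    generically_linearIndependent (by omega) (fun i => contDiff_of_mem_integralAlgebra (hmem i))
      hx₀ h₀⟩
  rintro (i | i) j x hx
  · exact diracBracket_eq_zero_of_invariant hκ (hmem _) (hmem _) hx fun A hA => hinv i x A hA
  · rcases j with j | j
    · rw [diracBracket_swap hκ _ _ hx, neg_eq_zero]
      exact diracBracket_eq_zero_of_invariant hκ (hmem _) (hmem _) hx fun A hA => hinv j x A hA
    · exact hF.diracBracket_gaugeNoether hκ i j hx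

theorem IsLiouvilleSystem.isLiouvilleIntegrable {ι : Type} [Fintype ι] {F : ι → Phase n → ℝ}
    (h : IsLiouvilleSystem m s κ F) (hH : ∃ i, F i = hamiltonian m)
    (hd : ∀ i, HasMomentumDegreeLE 3 (F i)) : IsLiouvilleIntegrable m s κ := by
  have hcard : Fintype.card ι = n - 1 := by have := h.card; omega
  let σ : Fin (n - 1) ≃ ι := (Fintype.equivFinOfCardEq hcard).symm
  obtain ⟨i, hi⟩ := hH
  refine ⟨fun j => F (σ j), ⟨by rw [Fintype.card_fin, ← hcard]; exact h.card,
    fun j => h.smooth _, fun j => h.integral _, fun i j => h.commute _ _,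
    h.independent.mono fun x _ hx => hx.comp σ σ.injective⟩,
    ⟨σ.symm i, by simp only [Equiv.apply_symm_apply, hi]⟩, fun j => (hd (σ j)).exists_eq⟩

theorem hasMomentumDegreeLE_integrals (hm : m ≠ 0) (i : Fin 2 ⊕ Fin q) : HasMomentumDegreeLE 3
      ((Sum.elim ![hamiltonian m, shiftedIntegral m s 4 κ]
        (fun j => gaugeNoether s κ (planeGen (e j) (f j))) : Fin 2 ⊕ Fin q → Phase n → ℝ) i) := by
  rcases i with i | j
  · fin_cases i
    · exact hasMomentumDegreeLE_hamiltonian.mono (by norm_num)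
    · exact hasMomentumDegreeLE_fieldIntegral hm
  · exact (hasMomentumDegreeLE_gaugeNoether _).mono (by norm_num)

end Liouville


/-! ### Explicit points at which the integrals are independent -/

section Witness

variable {n : ℕ} {m s lam : ℝ} {κ : Matrix (Fin n) (Fin n) ℝ}

theorem IsFrame.exists_linearIndependent_of_kernel {e f : Fin 2 → Fin n → ℝ} {k : Fin 2 → ℝ}
    (hF : IsFrame κ e f k) (hm : 0 < m) (hs : s ≠ 0) (hk : k 0 ≠ 0) {d : Fin n → ℝ}
    (hd : d ⬝ᵥ d = 1) (hed : ∀ j, e j ⬝ᵥ d = 0) (hfd : ∀ j, f j ⬝ᵥ d = 0) (hκd : κ *ᵥ d = 0) :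
    ∃ x ∈ cotangentSphere n, LinearIndependent ℝ fun i => differential
      ((Sum.elim ![hamiltonian m, shiftedIntegral m s lam κ]
        (fun j => gaugeNoether s κ (planeGen (e j) (f j))) : Fin 2 ⊕ Fin 2 → Phase n → ℝ) i) x := by
  have hfe : ∀ i j, f i ⬝ᵥ e j = 0 := fun i j => by rw [dotProduct_comm, hF.ef]
  have hde : ∀ j, d ⬝ᵥ e j = 0 := fun j => by rw [dotProduct_comm, hed]
  have hdf : ∀ j, d ⬝ᵥ f j = 0 := fun j => by rw [dotProduct_comm, hfd]
  -- A rational unit vector with nonzero components along `e 0`, `e 1` and the kernel. With the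
  -- chosen momentum and test vectors the determinant is 2k₀² - k₀² = k₀².
  refine ⟨((2 / 3 : ℝ) • e 0 + (1 / 3 : ℝ) • e 1 + (2 / 3 : ℝ) • d, e 0 - d), ⟨?_, ?_⟩,
    hF.linearIndependent_integrals hm hs (v₁ := e 0 - d) (v₂ := e 0 - (2 : ℝ) • e 1)
    ?_ ?_ ?_ ?_ ?_ ?_ ?_ ?_ ?_⟩
  · simp [phi1, hF.ee, hde, hed, hd]
    norm_num
  · simp [phi2, hF.ee, hde, hed, hd]
  · simp [hfe, hfd]
  · intro j
    fin_cases j <;> simp [hF.ee, hed]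
  · simp [hF.ee, hde, hed, hd]
  · simp [hF.ee, hde]
    norm_num
  · simp [hfe, hfd]
  · simp [hfe]
  · simp [Matrix.mulVec_add, Matrix.mulVec_smul, hF.map_e, hκd, hF.ef, hdf]
  · simp [Matrix.mulVec_add, Matrix.mulVec_smul, hF.map_e, hκd, hF.ef]
  · simp [Matrix.mulVec_sub, Matrix.mulVec_smul, hF.map_e, hκd, hF.ee, hF.ff, hde, hed, hd]
    intro h0
    apply hk
    have : k 0 ^ 2 = 0 := by linear_combination h0
    exact pow_eq_zero_iff two_ne_zero |>.1 this

theorem IsFrame.exists_linearIndependent_of_ne {e f : Fin 3 → Fin n → ℝ} {k : Fin 3 → ℝ}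
    (hF : IsFrame κ e f k) (hm : 0 < m) (hs : s ≠ 0) {i j l : Fin 3} (hij : i ≠ j) (hil : i ≠ l)
    (hjl : j ≠ l) (hk : k i ^ 2 ≠ k j ^ 2) :
    ∃ x ∈ cotangentSphere n, LinearIndependent ℝ fun i => differential
      ((Sum.elim ![hamiltonian m, shiftedIntegral m s lam κ]
        (fun j => gaugeNoether s κ (planeGen (e j) (f j))) : Fin 2 ⊕ Fin 3 → Phase n → ℝ) i) x := by
  have hfe : ∀ i j, f i ⬝ᵥ e j = 0 := fun i j => by rw [dotProduct_comm, hF.ef]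
  -- Here the determinant is 2kᵢ² - (kᵢ² + kⱼ²) = kᵢ² - kⱼ², which explains why two different
  -- strengths are needed.
  refine ⟨((2 / 3 : ℝ) • e i + (2 / 3 : ℝ) • e j + (1 / 3 : ℝ) • e l, e i - e j), ⟨?_, ?_⟩,
    hF.linearIndependent_integrals hm hs (v₁ := e i - e j) (v₂ := e i - (2 : ℝ) • e l)
    ?_ ?_ ?_ ?_ ?_ ?_ ?_ ?_ ?_⟩
  · simp [phi1, hF.ee, hij, hil, hjl, hij.symm, hil.symm, hjl.symm]
    norm_num
  · simp [phi2, hF.ee, hij, hil, hjl, hij.symm]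
  · simp [hfe]
  · intro r
    have hr : r = i ∨ r = j ∨ r = l := by omega
    rcases hr with rfl | rfl | rfl <;>
      simp [hF.ee, hij, hil, hjl, hij.symm, hil.symm, hjl.symm]
  · simp [hF.ee, hij, hij.symm, hil.symm, hjl.symm]
  · simp [hF.ee, hil, hjl, hij.symm, hil.symm]
    norm_num
  · simp [hfe]
  · simp [hfe]
  · simp [Matrix.mulVec_add, Matrix.mulVec_smul, hF.map_e, hF.ef]
  · simp [Matrix.mulVec_add, Matrix.mulVec_smul, hF.map_e, hF.ef]
  · simp [Matrix.mulVec_sub, Matrix.mulVec_smul, hF.map_e, hF.ee, hF.ff, hij, hil, hjl, hij.symm]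
    intro h0
    apply hk
    linear_combination h0

end Witness

/-! ### The field of a complex structure -/

section Casimir

variable {n : ℕ} {m s ka : ℝ} {κ : Matrix (Fin n) (Fin n) ℝ} {x : Phase n}

/-- The symmetries which interchange the first two lines. -/
def realGen (e f : Fin 3 → Fin n → ℝ) : Matrix (Fin n) (Fin n) ℝ :=
  planeGen (e 0) (e 1) + planeGen (f 0) (f 1)

/-- The symmetries which interchange the first two lines, composed with the complex structure. -/
def imagGen (e f : Fin 3 → Fin n → ℝ) : Matrix (Fin n) (Fin n) ℝ :=
  planeGen (e 0) (f 1) - planeGen (f 0) (e 1)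

/-- The Casimir integral of the unitary group of the first two lines. -/
noncomputable def casimir (s : ℝ) (κ : Matrix (Fin n) (Fin n) ℝ) (e f : Fin 3 → Fin n → ℝ)
    (x : Phase n) : ℝ :=
  (gaugeNoether s κ (planeGen (e 0) (f 0)) x - gaugeNoether s κ (planeGen (e 1) (f 1)) x) ^ 2
    + gaugeNoether s κ (realGen e f) x ^ 2 + gaugeNoether s κ (imagGen e f) x ^ 2

variable {e f : Fin 3 → Fin n → ℝ}

theorem IsFrame.isSymmetry_realGen (hF : IsFrame κ e f fun _ => ka) (hκ : κᵀ = -κ) :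
    IsSymmetry κ (realGen e f) :=
  hF.isSymmetry_real hκ rfl

theorem IsFrame.isSymmetry_imagGen (hF : IsFrame κ e f fun _ => ka) (hκ : κᵀ = -κ) :
    IsSymmetry κ (imagGen e f) :=
  hF.isSymmetry_imag hκ rfl

theorem IsFrame.casimir_mem (hF : IsFrame κ e f fun _ => ka) (hκ : κᵀ = -κ) :
    casimir s κ e f ∈ integralAlgebra m s κ :=
  Subalgebra.add_mem _ (Subalgebra.add_mem _ (Subalgebra.pow_mem _ (Subalgebra.sub_mem _
    (gaugeNoether_mem_integralAlgebra (hF.isSymmetry hκ 0))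
    (gaugeNoether_mem_integralAlgebra (hF.isSymmetry hκ 1))) 2)
    (Subalgebra.pow_mem _ (gaugeNoether_mem_integralAlgebra (hF.isSymmetry_realGen hκ)) 2))
    (Subalgebra.pow_mem _ (gaugeNoether_mem_integralAlgebra (hF.isSymmetry_imagGen hκ)) 2)

theorem fderiv_casimir (x w : Phase n) : fderiv ℝ (casimir s κ e f) x w
    = 2 * (gaugeNoether s κ (planeGen (e 0) (f 0)) x - gaugeNoether s κ (planeGen (e 1) (f 1)) x)
        * (fderiv ℝ (gaugeNoether s κ (planeGen (e 0) (f 0))) x w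
          - fderiv ℝ (gaugeNoether s κ (planeGen (e 1) (f 1))) x w)
      + 2 * gaugeNoether s κ (realGen e f) x * fderiv ℝ (gaugeNoether s κ (realGen e f)) x w
      + 2 * gaugeNoether s κ (imagGen e f) x * fderiv ℝ (gaugeNoether s κ (imagGen e f)) x w := by
  have h := fun A => differentiable_of_contDiff_omega (contDiff_gaugeNoether (s := s) (κ := κ) A)
  have e1 := fun A => (h A x).hasFDerivAt.comp_hasDerivAt_of_eq 0 (hasDerivAt_line x w) (by simp)
  refine fderiv_apply_eq_of_hasDerivAt
    (((((h _).sub (h _)).pow 2).add ((h _).pow 2)).add ((h _).pow 2) x) ?_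
  refine ((((e1 _).sub (e1 _)).pow 2).add ((e1 _).pow 2)).add ((e1 _).pow 2) |>.congr_deriv ?_
  simp

/-- With `imagGen_commutator`, this says that rotations of the planes turn the pair formed by
`realGen` and `imagGen`, so the sum of the squares of their integrals is invariant. -/
theorem IsFrame.realGen_commutator {k : Fin 3 → ℝ} (hF : IsFrame κ e f k) (j : Fin 3) :
    realGen e f * planeGen (e j) (f j) - planeGen (e j) (f j) * realGen e f
      = (![1, -1, 0] j : ℝ) • imagGen e f := by
  have hfe : ∀ i j, f i ⬝ᵥ e j = 0 := fun i j => by rw [dotProduct_comm, hF.ef]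
  refine ext_mulVec fun u => ?_
  simp only [realGen, imagGen, Matrix.sub_mulVec, Matrix.add_mulVec, Matrix.smul_mulVec,
    ← Matrix.mulVec_mulVec, planeGen_mulVec, dotProduct_sub, dotProduct_smul, dotProduct_add,
    hF.ee, hF.ff, hF.ef, hfe, smul_eq_mul]
  fin_cases j <;> simp <;> module

theorem IsFrame.imagGen_commutator {k : Fin 3 → ℝ} (hF : IsFrame κ e f k) (j : Fin 3) :
    imagGen e f * planeGen (e j) (f j) - planeGen (e j) (f j) * imagGen e f
      = (![-1, 1, 0] j : ℝ) • realGen e f := by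
  have hfe : ∀ i j, f i ⬝ᵥ e j = 0 := fun i j => by rw [dotProduct_comm, hF.ef]
  refine ext_mulVec fun u => ?_
  simp only [realGen, imagGen, Matrix.sub_mulVec, Matrix.add_mulVec, Matrix.smul_mulVec,
    ← Matrix.mulVec_mulVec, planeGen_mulVec, dotProduct_sub, dotProduct_smul,
    hF.ee, hF.ff, hF.ef, hfe, smul_eq_mul]
  fin_cases j <;> simp <;> module

theorem gaugeNoether_smul (a : ℝ) (A : Matrix (Fin n) (Fin n) ℝ) (x : Phase n) :
    gaugeNoether s κ (a • A) x = a * gaugeNoether s κ A x := by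
  simp only [gaugeNoether, Matrix.smul_mulVec, dotProduct_smul, smul_eq_mul]
  ring

theorem IsFrame.fderiv_casimir_rotate (hF : IsFrame κ e f fun _ => ka) (hκ : κᵀ = -κ) (j : Fin 3)
    (x : Phase n) : fderiv ℝ (casimir s κ e f) x (rotate (planeGen (e j) (f j)) x) = 0 := by
  have hj := hF.isSymmetry hκ j
  rw [fderiv_casimir, fderiv_gaugeNoether_rotate hj, fderiv_gaugeNoether_rotate hj,
    fderiv_gaugeNoether_rotate hj, fderiv_gaugeNoether_rotate hj, hF.realGen_commutator,
    hF.imagGen_commutator, hF.planeGen_commute 0 j, hF.planeGen_commute 1 j, sub_self, sub_self,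
    gaugeNoether_zero, gaugeNoether_smul, gaugeNoether_smul]
  fin_cases j <;> simp <;> ring

/-- At the chosen point the imaginary mixed integral and the Φ's do not contribute to the derivative
of the Casimir in vertical directions orthogonal to the `f j`; the real one, of value -4/3, does.
Two such directions then separate the Casimir from `H`. -/
theorem IsFrame.exists_linearIndependent_casimir (hF : IsFrame κ e f fun _ => ka) (hm : 0 < m) :
    ∃ x ∈ cotangentSphere n, LinearIndependent ℝ fun i => differential
      ((Sum.elim ![hamiltonian m, casimir s κ e f]
        (fun j => gaugeNoether s κ (planeGen (e j) (f j))) : Fin 2 ⊕ Fin 3 → Phase n → ℝ) i) x := by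
  have hfe : ∀ i j, f i ⬝ᵥ e j = 0 := fun i j => by rw [dotProduct_comm, hF.ef]
  set x : Phase n := ((2 / 3 : ℝ) • e 0 + (2 / 3 : ℝ) • e 1 + (1 / 3 : ℝ) • e 2,
    (2 : ℝ) • e 0 - (4 : ℝ) • e 2) with hx
  refine ⟨x, ⟨?_, ?_⟩, ?_⟩
  · simp [hx, phi1, hF.ee]
    norm_num
  · simp [hx, phi2, hF.ee]
    norm_num
  rw [Fintype.linearIndependent_iff]
  intro g hg
  have hN : gaugeNoether s κ (realGen e f) x = -4 / 3 := by
    simp [hx, gaugeNoether, realGen, Matrix.add_mulVec, planeGen_mulVec, Matrix.mulVec_add,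
      Matrix.mulVec_smul, hF.map_e, hF.ee, hF.ef, hfe]
    norm_num
  have hg₀ : ∀ j, e j ⬝ᵥ x.1 = ![2 / 3, 2 / 3, 1 / 3] j := by
    intro j
    fin_cases j <;> simp [hx, hF.ee]
  have hf₀ : ∀ j, f j ⬝ᵥ x.1 = 0 := by
    intro j
    simp [hx, hfe]
  have key : ∀ v, x.1 ⬝ᵥ v = 0 → g (Sum.inl 0) * (1 / m * (x.2 ⬝ᵥ v))
      + g (Sum.inl 1) * fderiv ℝ (casimir s κ e f) x (0, v)
      + ∑ j, g (Sum.inr j) * ((e j ⬝ᵥ x.1) * (f j ⬝ᵥ v)) = 0 := by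
    intro v hv
    have h1 := LinearMap.congr_fun hg ⟨(0, v), vertical_mem_tangentSpace hv⟩
    rw [Fintype.sum_sum_type, Fin.sum_univ_two] at h1
    simp only [LinearMap.add_apply, LinearMap.smul_apply, LinearMap.sum_apply, Sum.elim_inl,
      Sum.elim_inr, Matrix.cons_val_zero, Matrix.cons_val_one, smul_eq_mul,
      LinearMap.zero_apply] at h1
    simp only [differential, LinearMap.domRestrict_apply, ContinuousLinearMap.coe_coe,
      fderiv_hamiltonian, fderiv_gaugeNoether_vertical, 
      planeGen_mulVec, dotProduct_sub, dotProduct_smul, smul_eq_mul, hf₀, zero_mul, sub_zero] at h1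
    rw [← h1]
    simp only [dotProduct_comm v (f _)]
  have hC : ∀ v, (∀ j, f j ⬝ᵥ v = 0) → fderiv ℝ (casimir s κ e f) x (0, v)
      = -16 / 9 * (e 1 ⬝ᵥ v - e 0 ⬝ᵥ v) := by
    intro v hv
    have hv' : ∀ j, v ⬝ᵥ f j = 0 := fun j => by rw [dotProduct_comm, hv]
    rw [fderiv_casimir, hN]
    simp only [fderiv_gaugeNoether_vertical, realGen, imagGen, Matrix.add_mulVec,
      Matrix.sub_mulVec, planeGen_mulVec, dotProduct_sub, dotProduct_add, dotProduct_smul,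
      smul_eq_mul, hv', hf₀, hg₀, dotProduct_comm v (e _)]
    simp
    ring
  have h1 := key (e 0 - e 1) (by simp [hx, hF.ee])
  have h2 := key (e 0 - (2 : ℝ) • e 2) (by simp [hx, hF.ee]; norm_num)
  rw [hC _ (by simp [hfe])] at h1 h2
  have p1 : x.2 ⬝ᵥ (e 0 - e 1) = 2 := by simp [hx, hF.ee]
  have p2 : x.2 ⬝ᵥ (e 0 - (2 : ℝ) • e 2) = 10 := by simp [hx, hF.ee]; norm_num
  rw [p1] at h1
  rw [p2] at h2
  simp only [dotProduct_sub, dotProduct_smul, hF.ee, hfe, smul_eq_mul, mul_zero, sub_zero,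
    Finset.sum_const_zero, add_zero] at h1 h2
  simp at h1 h2
  have hm' := hm.ne'
  have hb : g (Sum.inl 1) = 0 := by linear_combination (5 * h1 - h2) / 16
  have ha : g (Sum.inl 0) = 0 := by
    rw [hb] at h1
    field_simp at h1
    linarith
  rintro (i | j)
  · fin_cases i
    · exact ha
    · exact hb
  · have h3 := key (f j) (by rw [dotProduct_comm, hf₀])
    simp only [ha, hb, zero_mul, zero_add, hF.ff, mul_ite, mul_one, mul_zero,
      Finset.sum_ite_eq', Finset.mem_univ, if_true, hg₀] at h3
    refine (mul_eq_zero.1 h3).resolve_right ?_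
    fin_cases j <;> simp

/-- With equal strengths κ² is scalar, so |κp|² is a multiple of `H` and μ is a function of `H` and
the sum of the Φ's; `J` gives nothing new. The Casimir of the first two lines commutes with every Φ
of the frame. -/
theorem IsFrame.isLiouvilleSystem_casimir (hF : IsFrame κ e f fun _ => ka) (hκ : κᵀ = -κ)
    (hm : 0 < m) (hn : n = 6) : IsLiouvilleSystem m s κ
      (Sum.elim ![hamiltonian m, casimir s κ e f]
        (fun j => gaugeNoether s κ (planeGen (e j) (f j))) : Fin 2 ⊕ Fin 3 → Phase n → ℝ) := by
  obtain ⟨x₀, hx₀, h₀⟩ := hF.exists_linearIndependent_casimir (s := s) hm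
  set F : Fin 2 ⊕ Fin 3 → Phase n → ℝ := Sum.elim ![hamiltonian m, casimir s κ e f]
    (fun j => gaugeNoether s κ (planeGen (e j) (f j))) with hFdef
  have hmem : ∀ i, F i ∈ integralAlgebra m s κ := by
    rintro (i | j)
    · fin_cases i
      · exact hamiltonian_mem_integralAlgebra
      · exact hF.casimir_mem hκ
    · exact gaugeNoether_mem_integralAlgebra (hF.isSymmetry hκ j)
  have hH : ∀ i, ∀ x ∈ cotangentSphere n, diracBracket s κ (F i) (hamiltonian m) x = 0 :=
    fun i x hx => by
      rw [diracBracket_hamiltonian hκ _ hx]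
      exact isFirstIntegral_of_mem_integralAlgebra hκ (hmem i) x hx
  have hΦ : ∀ i j, ∀ x ∈ cotangentSphere n,
      diracBracket s κ (F i) (gaugeNoether s κ (planeGen (e j) (f j))) x = 0 := by
    intro i j x hx
    rcases i with i | i
    · rw [MagneticSphere.diracBracket_gaugeNoether hκ _ (hF.isSymmetry hκ j) hx]
      fin_cases i
      · exact fderiv_hamiltonian_rotate (planeGen_transpose _ _) x
      · exact hF.fderiv_casimir_rotate hκ j x
    · exact hF.diracBracket_gaugeNoether hκ i j hx
  refine ⟨by simp [hn], fun i => (contDiff_of_mem_integralAlgebra (hmem i)).of_le (by simp),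
    fun i => isFirstIntegral_of_mem_integralAlgebra hκ (hmem i), ?_,
    generically_linearIndependent (by omega) (fun i => contDiff_of_mem_integralAlgebra (hmem i))
      hx₀ h₀⟩
  rintro i (j | j) x hx
  · fin_cases j
    · exact hH i x hx
    · rcases i with i | i
      · fin_cases i
        · rw [diracBracket_swap hκ _ _ hx, neg_eq_zero]
          exact hH (Sum.inl 1) x hx
        · have := diracBracket_swap (s := s) hκ (casimir s κ e f) (casimir s κ e f) hx
          exact self_eq_neg.1 this
      · rw [diracBracket_swap hκ _ _ hx, neg_eq_zero]
        exact hΦ (Sum.inl 1) i x hx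
  · exact hΦ i j x hx

theorem hasMomentumDegreeLE_casimir : HasMomentumDegreeLE 3 (casimir s κ e f) := by
  have h := fun A => hasMomentumDegreeLE_gaugeNoether (s := s) (κ := κ) A
  have h2 := ((((h (planeGen (e 0) (f 0))).sub (h (planeGen (e 1) (f 1)))).mul
    ((h (planeGen (e 0) (f 0))).sub (h (planeGen (e 1) (f 1))))).add
    ((h (realGen e f)).mul (h (realGen e f)))).add ((h (imagGen e f)).mul (h (imagGen e f)))
  simp only [← pow_two] at h2
  exact h2.mono (by norm_num)

end Casimir


/-! ### The normal form of a skew-symmetric matrix -/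

section NormalForm

variable {n : ℕ} {m s : ℝ} {κ : Matrix (Fin n) (Fin n) ℝ}

theorem exists_unit_of_ne_zero {u : Fin n → ℝ} (hu : u ≠ 0) :
    ∃ a : ℝ, (a • u) ⬝ᵥ (a • u) = 1 := by
  have h1 : 0 < u ⬝ᵥ u :=
    lt_of_le_of_ne (dotProduct_self_nonneg' u) fun h => hu (dotProduct_self_eq_zero.1 h.symm)
  refine ⟨(Real.sqrt (u ⬝ᵥ u))⁻¹, ?_⟩
  have h2 := Real.mul_self_sqrt h1.le
  have h3 := (Real.sqrt_pos.2 h1).ne'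
  generalize Real.sqrt (u ⬝ᵥ u) = r at h2 h3 ⊢
  rw [smul_dotProduct, dotProduct_smul, smul_eq_mul, smul_eq_mul, ← h2]
  field_simp

theorem exists_unit_orthogonal {ι : Type*} [Fintype ι] (S : ι → Fin n → ℝ)
    (h : Fintype.card ι < n) : ∃ u, u ⬝ᵥ u = 1 ∧ ∀ i, S i ⬝ᵥ u = 0 := by
  have h1 : LinearMap.ker (Matrix.mulVecLin (Matrix.of S)) ≠ ⊥ :=
    LinearMap.ker_ne_bot_of_finrank_lt (by simpa using h)
  obtain ⟨u, hu, hu0⟩ := (Submodule.ne_bot_iff _).1 h1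
  obtain ⟨a, ha⟩ := exists_unit_of_ne_zero hu0
  refine ⟨a • u, ha, fun i => ?_⟩
  have h2 := congrFun (LinearMap.mem_ker.1 hu) i
  rw [dotProduct_smul, show S i ⬝ᵥ u = 0 from h2, smul_zero]

/-- An invariant plane in the orthogonal complement of an invariant subspace, on which the field
is as strong as possible. -/
theorem exists_invariant_plane (hκ : κᵀ = -κ) {ι : Type*} [Fintype ι] (S : ι → Fin n → ℝ)
    (hS : ∀ u, (∀ i, S i ⬝ᵥ u = 0) → ∀ i, S i ⬝ᵥ (κ *ᵥ u) = 0) (h : Fintype.card ι + 2 ≤ n) :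
    ∃ (e f : Fin n → ℝ) (k : ℝ), 0 ≤ k ∧ e ⬝ᵥ e = 1 ∧ f ⬝ᵥ f = 1 ∧ e ⬝ᵥ f = 0 ∧
      (∀ i, S i ⬝ᵥ e = 0) ∧ (∀ i, S i ⬝ᵥ f = 0) ∧ κ *ᵥ e = -k • f ∧ κ *ᵥ f = k • e ∧
      (k = 0 → ∀ u, (∀ i, S i ⬝ᵥ u = 0) → κ *ᵥ u = 0) := by
  have hcont : ∀ A : Matrix (Fin n) (Fin n) ℝ, Continuous fun u => A *ᵥ u := fun A =>
    (contDiff_mulVec (n := n) A contDiff_id (k := 0)).continuous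
  have hdot : ∀ {g g' : (Fin n → ℝ) → Fin n → ℝ}, Continuous g → Continuous g' →
      Continuous fun u => g u ⬝ᵥ g' u := fun h h' => h.dotProduct h'
  set K : Set (Fin n → ℝ) := {u | u ⬝ᵥ u = 1 ∧ ∀ i, S i ⬝ᵥ u = 0} with hK
  have hKc : IsCompact K := by
    refine Metric.isCompact_of_isClosed_isBounded ?_ ?_
    · have h1 : K = {u | u ⬝ᵥ u = 1} ∩ ⋂ i, {u | S i ⬝ᵥ u = 0} := by
        ext u
        simp [hK]
      rw [h1]
      exact (isClosed_eq (hdot continuous_id continuous_id) continuous_const).inter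
        (isClosed_iInter fun i => isClosed_eq (hdot continuous_const continuous_id)
          continuous_const)
    · refine (Metric.isBounded_closedBall (x := (0 : Fin n → ℝ)) (r := 1)).subset fun u hu => ?_
      rw [mem_closedBall_zero_iff, pi_norm_le_iff_of_nonneg zero_le_one]
      intro i
      have h1 : u i * u i ≤ u ⬝ᵥ u :=
        Finset.single_le_sum (f := fun i => u i * u i) (fun i _ => mul_self_nonneg _)
          (Finset.mem_univ i)
      rw [hu.1] at h1
      rw [Real.norm_eq_abs]
      exact abs_le_one_iff_mul_self_le_one.2 h1
  have hKn : K.Nonempty := by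
    obtain ⟨u, h1, h2⟩ := exists_unit_orthogonal S (by omega)
    exact ⟨u, h1, h2⟩
  -- A maximizer of |κu|² on the unit sphere of the complement is an eigenvector of κ², so it spans
  -- with its image an invariant plane. Maximality also shows that the strength vanishes only if the
  -- field does.
  obtain ⟨e, he, hmax⟩ := hKc.exists_isMaxOn hKn
    (f := fun u => (κ *ᵥ u) ⬝ᵥ (κ *ᵥ u)) (hdot (hcont κ) (hcont κ)).continuousOn
  have hmax' : ∀ u, (∀ i, S i ⬝ᵥ u = 0) →
      (κ *ᵥ u) ⬝ᵥ (κ *ᵥ u) ≤ ((κ *ᵥ e) ⬝ᵥ (κ *ᵥ e)) * (u ⬝ᵥ u) := by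
    intro u hu
    by_cases hu0 : u = 0
    · simp [hu0]
    obtain ⟨a, ha⟩ := exists_unit_of_ne_zero hu0
    have h1 : (κ *ᵥ (a • u)) ⬝ᵥ (κ *ᵥ (a • u)) ≤ (κ *ᵥ e) ⬝ᵥ (κ *ᵥ e) :=
      hmax (show a • u ∈ K from ⟨ha, fun i => by rw [dotProduct_smul, hu i, smul_zero]⟩)
    rw [Matrix.mulVec_smul, smul_dotProduct, dotProduct_smul, smul_eq_mul, smul_eq_mul] at h1
    rw [smul_dotProduct, dotProduct_smul, smul_eq_mul, smul_eq_mul] at ha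
    have h2 := mul_le_mul_of_nonneg_right h1 (dotProduct_self_nonneg' u)
    calc (κ *ᵥ u) ⬝ᵥ (κ *ᵥ u) = (a * (a * ((κ *ᵥ u) ⬝ᵥ (κ *ᵥ u)))) * (u ⬝ᵥ u) := by
          linear_combination (-((κ *ᵥ u) ⬝ᵥ (κ *ᵥ u))) * ha
      _ ≤ _ := h2
  obtain ⟨hee, heS⟩ := he
  have hcrit : ∀ u, (∀ i, S i ⬝ᵥ u = 0) → e ⬝ᵥ u = 0 → (κ *ᵥ e) ⬝ᵥ (κ *ᵥ u) = 0 := by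
    intro u hu heu
    have h1 : ∀ t : ℝ, 2 * t * ((κ *ᵥ e) ⬝ᵥ (κ *ᵥ u)) + t ^ 2 * ((κ *ᵥ u) ⬝ᵥ (κ *ᵥ u))
        ≤ t ^ 2 * (((κ *ᵥ e) ⬝ᵥ (κ *ᵥ e)) * (u ⬝ᵥ u)) := by
      intro t
      have h2 := hmax' (e + t • u) fun i => by
        rw [dotProduct_add, dotProduct_smul, heS, hu, smul_zero, add_zero]
      simp only [Matrix.mulVec_add, Matrix.mulVec_smul, dotProduct_add, add_dotProduct,
        dotProduct_smul, smul_dotProduct, smul_eq_mul, hee, heu, dotProduct_comm u e,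
        dotProduct_comm (κ *ᵥ u) (κ *ᵥ e)] at h2
      linarith
    set c := (κ *ᵥ e) ⬝ᵥ (κ *ᵥ u)
    set D := ((κ *ᵥ e) ⬝ᵥ (κ *ᵥ e)) * (u ⬝ᵥ u) - (κ *ᵥ u) ⬝ᵥ (κ *ᵥ u) with hD
    have hD0 : 0 ≤ D := sub_nonneg.2 (hmax' u hu)
    -- The variation inequality reads 2tc ≤ t²D. The value t = c/(D + 1) turns it into c²(D + 2) ≤ 0
    -- without a case distinction on D = 0.
    have h3 := h1 (c / (D + 1))
    have h4 : c ^ 2 * (D + 2) ≤ 0 := by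
      have h5 : 2 * (c / (D + 1)) * c ≤ (c / (D + 1)) ^ 2 * D := by
        rw [hD]
        linarith
      have h6 : 0 < D + 1 := by linarith
      rw [div_pow, mul_div_assoc', div_mul_eq_mul_div, div_mul_eq_mul_div,
        div_le_div_iff₀ h6 (by positivity)] at h5
      have h7 : (c ^ 2 * (D + 2)) * (D + 1) ≤ 0 := by nlinarith
      exact nonpos_of_mul_nonpos_left h7 h6
    have h5 : c ^ 2 ≤ 0 := by nlinarith [sq_nonneg c]
    exact pow_eq_zero_iff two_ne_zero |>.1 (le_antisymm h5 (sq_nonneg c))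
  have hκκ : κ *ᵥ (κ *ᵥ e) = -((κ *ᵥ e) ⬝ᵥ (κ *ᵥ e)) • e := by
    -- The residual of the eigenvalue equation. It is an admissible variation orthogonal to `e`, and
    -- criticality makes it orthogonal to itself.
    set u := κ *ᵥ (κ *ᵥ e) + ((κ *ᵥ e) ⬝ᵥ (κ *ᵥ e)) • e with hu
    have hue : e ⬝ᵥ u = 0 := by
      rw [hu, dotProduct_add, dotProduct_smul, hee, dotProduct_mulVec_skew hκ, smul_eq_mul]
      ring
    have huS : ∀ i, S i ⬝ᵥ u = 0 := fun i => by
      rw [hu, dotProduct_add, dotProduct_smul, heS, hS _ (hS _ heS), smul_zero, add_zero]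
    have h1 := hcrit u huS hue
    rw [dotProduct_mulVec_skew hκ, neg_eq_zero] at h1
    have h2 : u ⬝ᵥ u = 0 := by
      nth_rewrite 1 [hu]
      rw [add_dotProduct, smul_dotProduct, h1, hue, smul_zero, add_zero]
    rw [neg_smul]
    exact eq_neg_of_add_eq_zero_left (dotProduct_self_eq_zero.1 h2)
  -- If the maximum is 0, the field vanishes on the whole complement and any second unit vector
  -- there completes the plane.
  by_cases h0 : (κ *ᵥ e) ⬝ᵥ (κ *ᵥ e) = 0
  · have hzero : ∀ u, (∀ i, S i ⬝ᵥ u = 0) → κ *ᵥ u = 0 := fun u hu => by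
      have h1 := hmax' u hu
      rw [h0, zero_mul] at h1
      exact dotProduct_self_eq_zero.1 (le_antisymm h1 (dotProduct_self_nonneg' _))
    obtain ⟨f, hff, hf⟩ := exists_unit_orthogonal (ι := Option ι) (fun o => o.elim e S)
      (by rw [Fintype.card_option]; omega)
    have hfS : ∀ i, S i ⬝ᵥ f = 0 := fun i => hf (some i)
    exact ⟨e, f, 0, le_rfl, hee, hff, hf none, heS, hfS, by rw [hzero e heS]; simp,
      by rw [hzero f hfS]; simp, fun _ => hzero⟩
  · have hpos : 0 < (κ *ᵥ e) ⬝ᵥ (κ *ᵥ e) :=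
      lt_of_le_of_ne (dotProduct_self_nonneg' _) (Ne.symm h0)
    set k := Real.sqrt ((κ *ᵥ e) ⬝ᵥ (κ *ᵥ e)) with hk
    have hk0 : k ≠ 0 := (Real.sqrt_pos.2 hpos).ne'
    have hkk : k * k = (κ *ᵥ e) ⬝ᵥ (κ *ᵥ e) := Real.mul_self_sqrt hpos.le
    refine ⟨e, -k⁻¹ • (κ *ᵥ e), k, Real.sqrt_nonneg _, hee, ?_, ?_, heS, ?_, ?_, ?_,
      fun h => absurd h hk0⟩
    · rw [smul_dotProduct, dotProduct_smul, ← hkk, smul_eq_mul, smul_eq_mul]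
      field_simp
    · rw [dotProduct_smul, dotProduct_mulVec_self_skew hκ, smul_zero]
    · intro i
      rw [dotProduct_smul, hS _ heS, smul_zero]
    · rw [smul_smul, neg_mul_neg, mul_inv_cancel₀ hk0, one_smul]
    · rw [Matrix.mulVec_smul, hκκ, ← hkk, smul_smul]
      congr 1
      field_simp

/-- The orthogonal complement of vectors with invariant span is invariant. -/
theorem invariant_of_span (hκ : κᵀ = -κ) {ι : Type*} {S : ι → Fin n → ℝ}
    (h : ∀ i, ∃ (j : ι) (a : ℝ), κ *ᵥ S i = a • S j) (u : Fin n → ℝ) (hu : ∀ i, S i ⬝ᵥ u = 0)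
    (i : ι) : S i ⬝ᵥ (κ *ᵥ u) = 0 := by
  obtain ⟨j, a, hj⟩ := h i
  rw [dotProduct_mulVec_skew hκ, hj, smul_dotProduct, hu, smul_zero, neg_zero]

theorem exists_frame_of_odd {κ : Matrix (Fin 5) (Fin 5) ℝ} (hκ : κᵀ = -κ) (h0 : κ ≠ 0) :
    ∃ (e f : Fin 2 → Fin 5 → ℝ) (k : Fin 2 → ℝ) (d : Fin 5 → ℝ), IsFrame κ e f k ∧ k 0 ≠ 0 ∧
      d ⬝ᵥ d = 1 ∧ (∀ j, e j ⬝ᵥ d = 0) ∧ (∀ j, f j ⬝ᵥ d = 0) ∧ κ *ᵥ d = 0 := by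
  -- A skew-symmetric matrix of odd size is singular. Its kernel vector is split off first.
  have hdet : κ.det = 0 := by
    have h1 := congrArg Matrix.det hκ
    rw [Matrix.det_transpose, Matrix.det_neg] at h1
    norm_num at h1
    linarith
  obtain ⟨d', hd0, hd'⟩ := Matrix.exists_mulVec_eq_zero_iff.2 hdet
  obtain ⟨a, ha⟩ := exists_unit_of_ne_zero hd0
  set d := a • d' with hd
  have hκd : κ *ᵥ d = 0 := by rw [hd, Matrix.mulVec_smul, hd', smul_zero]
  have hi : ∀ i : Fin 1, ∃ (j : Fin 1) (a : ℝ), κ *ᵥ ![d] i = a • ![d] j :=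
    fun i => ⟨0, 0, by fin_cases i; simpa using hκd⟩
  obtain ⟨e₀, f₀, k₀, -, he₀, hf₀, hef₀, hSe₀, hSf₀, hκe₀, hκf₀, hz₀⟩ :=
    exists_invariant_plane hκ ![d] (invariant_of_span hκ hi) (by simp)
  have hde₀ : d ⬝ᵥ e₀ = 0 := hSe₀ 0
  have hdf₀ : d ⬝ᵥ f₀ = 0 := hSf₀ 0
  obtain ⟨e₁, f₁, k₁, -, he₁, hf₁, hef₁, hSe₁, hSf₁, hκe₁, hκf₁, -⟩ :=
    exists_invariant_plane hκ ![d, e₀, f₀] (invariant_of_span hκ (by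
      intro i
      fin_cases i
      · exact ⟨0, 0, by simpa using hκd⟩
      · exact ⟨2, -k₀, by simpa using hκe₀⟩
      · exact ⟨1, k₀, by simpa using hκf₀⟩)) (by simp)
  have hde₁ : d ⬝ᵥ e₁ = 0 := hSe₁ 0
  have hdf₁ : d ⬝ᵥ f₁ = 0 := hSf₁ 0
  have h1 : e₀ ⬝ᵥ e₁ = 0 := hSe₁ 1
  have h2 : f₀ ⬝ᵥ e₁ = 0 := hSe₁ 2
  have h3 : e₀ ⬝ᵥ f₁ = 0 := hSf₁ 1
  have h4 : f₀ ⬝ᵥ f₁ = 0 := hSf₁ 2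
  refine ⟨![e₀, e₁], ![f₀, f₁], ![k₀, k₁], d, ⟨?_, ?_, ?_, ?_, ?_⟩, ?_, ha, ?_, ?_, hκd⟩
  · intro i j
    fin_cases i <;> fin_cases j <;> simp [he₀, he₁, h1, dotProduct_comm e₁ e₀]
  · intro i j
    fin_cases i <;> fin_cases j <;> simp [hf₀, hf₁, h4, dotProduct_comm f₁ f₀]
  · intro i j
    fin_cases i <;> fin_cases j <;> simp [hef₀, hef₁, h3, h2, dotProduct_comm e₁ f₀]
  · intro j
    fin_cases j <;> simp [hκe₀, hκe₁]
  · intro j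
    fin_cases j <;> simp [hκf₀, hκf₁]
  -- The first plane has maximal strength on the complement of the kernel vector, so strength 0
  -- would make `κ` vanish altogether.
  · intro hk
    apply h0
    refine ext_mulVec fun u => ?_
    have h5 := hz₀ hk (u - (d ⬝ᵥ u) • d) fun i => by
      fin_cases i
      simp [dotProduct_sub, dotProduct_smul, ha]
    rw [Matrix.mulVec_sub, Matrix.mulVec_smul, hκd, smul_zero, sub_zero] at h5
    rw [h5, Matrix.zero_mulVec]
  · intro j
    fin_cases j <;> simp [dotProduct_comm _ d, hde₀, hde₁]
  · intro j
    fin_cases j <;> simp [dotProduct_comm _ d, hdf₀, hdf₁]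

theorem exists_frame_of_even {κ : Matrix (Fin 6) (Fin 6) ℝ} (hκ : κᵀ = -κ) :
    ∃ (e f : Fin 3 → Fin 6 → ℝ) (k : Fin 3 → ℝ), IsFrame κ e f k ∧ ∀ j, 0 ≤ k j := by
  obtain ⟨e₀, f₀, k₀, hk₀, he₀, hf₀, hef₀, -, -, hκe₀, hκf₀, -⟩ :=
    exists_invariant_plane hκ (![] : Fin 0 → Fin 6 → ℝ) (fun _ _ i => i.elim0) (by simp)
  obtain ⟨e₁, f₁, k₁, hk₁, he₁, hf₁, hef₁, hSe₁, hSf₁, hκe₁, hκf₁, -⟩ :=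
    exists_invariant_plane hκ ![e₀, f₀] (invariant_of_span hκ (by
      intro i
      fin_cases i
      · exact ⟨1, -k₀, by simpa using hκe₀⟩
      · exact ⟨0, k₀, by simpa using hκf₀⟩)) (by simp)
  have h1 : e₀ ⬝ᵥ e₁ = 0 := hSe₁ 0
  have h2 : f₀ ⬝ᵥ e₁ = 0 := hSe₁ 1
  have h3 : e₀ ⬝ᵥ f₁ = 0 := hSf₁ 0
  have h4 : f₀ ⬝ᵥ f₁ = 0 := hSf₁ 1
  obtain ⟨e₂, f₂, k₂, hk₂, he₂, hf₂, hef₂, hSe₂, hSf₂, hκe₂, hκf₂, -⟩ :=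
    exists_invariant_plane hκ ![e₀, f₀, e₁, f₁] (invariant_of_span hκ (by
      intro i
      fin_cases i
      · exact ⟨1, -k₀, by simpa using hκe₀⟩
      · exact ⟨0, k₀, by simpa using hκf₀⟩
      · exact ⟨3, -k₁, by simpa using hκe₁⟩
      · exact ⟨2, k₁, by simpa using hκf₁⟩)) (by simp)
  have g1 : e₀ ⬝ᵥ e₂ = 0 := hSe₂ 0
  have g2 : f₀ ⬝ᵥ e₂ = 0 := hSe₂ 1
  have g3 : e₁ ⬝ᵥ e₂ = 0 := hSe₂ 2
  have g4 : f₁ ⬝ᵥ e₂ = 0 := hSe₂ 3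
  have g5 : e₀ ⬝ᵥ f₂ = 0 := hSf₂ 0
  have g6 : f₀ ⬝ᵥ f₂ = 0 := hSf₂ 1
  have g7 : e₁ ⬝ᵥ f₂ = 0 := hSf₂ 2
  have g8 : f₁ ⬝ᵥ f₂ = 0 := hSf₂ 3
  refine ⟨![e₀, e₁, e₂], ![f₀, f₁, f₂], ![k₀, k₁, k₂], ⟨?_, ?_, ?_, ?_, ?_⟩, ?_⟩
  · intro i j
    fin_cases i <;> fin_cases j <;>
      simp [he₀, he₁, he₂, h1, g1, g3, dotProduct_comm e₁ e₀, dotProduct_comm e₂ e₀,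
        dotProduct_comm e₂ e₁]
  · intro i j
    fin_cases i <;> fin_cases j <;>
      simp [hf₀, hf₁, hf₂, h4, g6, g8, dotProduct_comm f₁ f₀, dotProduct_comm f₂ f₀,
        dotProduct_comm f₂ f₁]
  · intro i j
    fin_cases i <;> fin_cases j <;>
      simp [hef₀, hef₁, hef₂, h2, h3, g2, g4, g5, g7, dotProduct_comm e₁ f₀,
        dotProduct_comm e₂ f₀, dotProduct_comm e₂ f₁]
  · intro j
    fin_cases j <;> simp [hκe₀, hκe₁, hκe₂]
  · intro j
    fin_cases j <;> simp [hκf₀, hκf₁, hκf₂]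
  · intro j
    fin_cases j <;> simp [hk₀, hk₁, hk₂]

theorem isLiouvilleIntegrable_five (hm : 0 < m) (hs : s ≠ 0) {κ : Matrix (Fin 5) (Fin 5) ℝ}
    (hκ : κᵀ = -κ) (h0 : κ ≠ 0) : IsLiouvilleIntegrable m s κ := by
  obtain ⟨e, f, k, d, hF, hk, hd, hed, hfd, hκd⟩ := exists_frame_of_odd hκ h0
  -- The value 4 selects `J + 4H²`, of degree at most three in the momenta; `J` itself is quartic.
  obtain ⟨x, hx, hi⟩ := hF.exists_linearIndependent_of_kernel (lam := 4) hm hs hk hd hed hfd hκd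
  exact (hF.isLiouvilleSystem hκ rfl hx hi).isLiouvilleIntegrable ⟨Sum.inl 0, rfl⟩
    (hasMomentumDegreeLE_integrals hm.ne')

/-- Nonnegativity turns different strengths into different squares, and some pair of planes has
different strengths: 0 and 1, or else 0 and 2. -/
theorem IsFrame.exists_linearIndependent_six {κ : Matrix (Fin n) (Fin n) ℝ}
    {e f : Fin 3 → Fin n → ℝ} {k : Fin 3 → ℝ} {lam : ℝ} (hF : IsFrame κ e f k) (hm : 0 < m)
    (hs : s ≠ 0) (hk0 : ∀ j, 0 ≤ k j) (hk : ¬(k 0 = k 1 ∧ k 1 = k 2)) :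
    ∃ x ∈ cotangentSphere n, LinearIndependent ℝ fun i => differential
      ((Sum.elim ![hamiltonian m, shiftedIntegral m s lam κ]
        (fun j => gaugeNoether s κ (planeGen (e j) (f j))) : Fin 2 ⊕ Fin 3 → Phase n → ℝ) i) x := by
  by_cases h1 : k 0 = k 1
  · refine hF.exists_linearIndependent_of_ne hm hs (i := 0) (j := 2) (l := 1) (by decide)
      (by decide) (by decide) fun h2 => hk ⟨h1, ?_⟩
    rw [← h1]
    exact (pow_left_inj₀ (hk0 0) (hk0 2) two_ne_zero).1 h2
  · exact hF.exists_linearIndependent_of_ne hm hs (i := 0) (j := 1) (l := 2) (by decide)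
      (by decide) (by decide) fun h2 => h1 ((pow_left_inj₀ (hk0 0) (hk0 1) two_ne_zero).1 h2)

theorem isLiouvilleIntegrable_six (hm : 0 < m) (hs : s ≠ 0) {κ : Matrix (Fin 6) (Fin 6) ℝ}
    (hκ : κᵀ = -κ) : IsLiouvilleIntegrable m s κ := by
  obtain ⟨e, f, k, hF, hk0⟩ := exists_frame_of_even hκ
  by_cases hk : k 0 = k 1 ∧ k 1 = k 2
  · have hk' : k = fun _ => k 0 := by
      ext j
      fin_cases j
      · rfl
      · exact hk.1.symm
      · exact (hk.1.trans hk.2).symm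
    rw [hk'] at hF
    refine (hF.isLiouvilleSystem_casimir hκ hm rfl).isLiouvilleIntegrable ⟨Sum.inl 0, rfl⟩ ?_
    rintro (i | j)
    · fin_cases i
      · exact hasMomentumDegreeLE_hamiltonian.mono (by norm_num)
      · exact hasMomentumDegreeLE_casimir
    · exact (hasMomentumDegreeLE_gaugeNoether _).mono (by norm_num)
  · obtain ⟨x, hx, hi⟩ := hF.exists_linearIndependent_six (lam := 4) hm hs hk0 hk
    exact (hF.isLiouvilleSystem hκ rfl hx hi).isLiouvilleIntegrable ⟨Sum.inl 0, rfl⟩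
      (hasMomentumDegreeLE_integrals hm.ne')

end NormalForm


/-! ### Fields in normal form -/

section NormalForm

variable {n : ℕ} {m s : ℝ} {k : Fin (n / 2) → ℝ}

theorem fstIdx_inj {i j : Fin (n / 2)} : fstIdx i = fstIdx j ↔ i = j := by
  simp [fstIdx, Fin.ext_iff]

theorem sndIdx_inj {i j : Fin (n / 2)} : sndIdx i = sndIdx j ↔ i = j := by
  simp [sndIdx, Fin.ext_iff]

theorem fstIdx_ne_sndIdx (i j : Fin (n / 2)) : fstIdx i ≠ sndIdx j := by
  simp only [fstIdx, sndIdx, ne_eq, Fin.mk.injEq]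
  omega

theorem normalForm_transpose (k : Fin (n / 2) → ℝ) : (normalForm n k)ᵀ = -normalForm n k := by
  simp only [normalForm, Matrix.transpose_sum, Matrix.transpose_sub, Matrix.transpose_single,
    ← Finset.sum_neg_distrib, neg_sub]

theorem normalForm_mulVec (k : Fin (n / 2) → ℝ) (u : Fin n → ℝ) :
    normalForm n k *ᵥ u = ∑ i, k i • (u (sndIdx i) • (Pi.single (fstIdx i) 1 : Fin n → ℝ)
      - u (fstIdx i) • Pi.single (sndIdx i) 1) := by
  rw [normalForm, Matrix.sum_mulVec]
  refine Finset.sum_congr rfl fun i _ => ?_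
  rw [Matrix.sub_mulVec, Matrix.single_mulVec, Matrix.single_mulVec, smul_sub, smul_smul, smul_smul]
  simp only [← Pi.single_smul, smul_eq_mul, mul_one]
  rfl

theorem isFrame_normalForm (k : Fin (n / 2) → ℝ) :
    IsFrame (normalForm n k) (fun i => Pi.single (fstIdx i) 1) (fun i => Pi.single (sndIdx i) 1) k where
  ee i j := by simp [Pi.single_apply, fstIdx_inj, eq_comm]
  ff i j := by simp [Pi.single_apply, sndIdx_inj, eq_comm]
  ef i j := by simp [fstIdx_ne_sndIdx]
  map_e j := by
    rw [normalForm_mulVec, Finset.sum_eq_single j]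
    · simp [(fstIdx_ne_sndIdx j j).symm]
    · intro i _ hij
      simp [(fstIdx_ne_sndIdx _ _).symm, fstIdx_inj, hij]
    · simp
  map_f j := by
    rw [normalForm_mulVec, Finset.sum_eq_single j]
    · simp [fstIdx_ne_sndIdx]
    · intro i _ hij
      simp [fstIdx_ne_sndIdx, sndIdx_inj, hij]
    · simp

theorem noether_eq_gaugeNoether (s : ℝ) (k : Fin (n / 2) → ℝ) (i : Fin (n / 2)) :
    noether n s k i = gaugeNoether s (normalForm n k)
      (planeGen (Pi.single (fstIdx i) 1) (Pi.single (sndIdx i) 1)) := by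
  ext x
  rw [(isFrame_normalForm k).gaugeNoether_planeGen (normalForm_transpose k) i x]
  simp only [noether, planeSq, single_one_dotProduct]
  ring

theorem integralJ_eq_fieldIntegral (m s : ℝ) (k : Fin (n / 2) → ℝ) :
    integralJ n m s k = fieldIntegral m s (normalForm n k) := by
  ext x
  have hdot : ∀ u v : Fin n → ℝ, u ⬝ᵥ (normalForm n k *ᵥ v)
      = ∑ i, k i * (v (sndIdx i) * u (fstIdx i) - v (fstIdx i) * u (sndIdx i)) := fun u v => by
    simp only [normalForm_mulVec, dotProduct_sum, dotProduct_smul, dotProduct_sub,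
      dotProduct_single_one, smul_eq_mul]
  have hfst : ∀ i, (normalForm n k *ᵥ x.2) (fstIdx i) = k i * x.2 (sndIdx i) := fun i => by
    rw [← single_one_dotProduct (fstIdx i) (_ *ᵥ _), dotProduct_mulVec_skew (normalForm_transpose k),
      (isFrame_normalForm k).map_e i]
    simp
  have hsnd : ∀ i, (normalForm n k *ᵥ x.2) (sndIdx i) = -(k i * x.2 (fstIdx i)) := fun i => by
    rw [← single_one_dotProduct (sndIdx i) (_ *ᵥ _), dotProduct_mulVec_skew (normalForm_transpose k),
      (isFrame_normalForm k).map_f i]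
    simp
  simp only [integralJ, fieldIntegral, multiplier, hdot, hfst, hsnd, hamiltonian]
  congr 1
  · congr 1
    exact Finset.sum_congr rfl fun i _ => by ring
  · have h1 : ∀ a b : ℝ, s / m * a - 2 * (1 / (2 * m) * b) = 1 / m * (s * a - b) := fun a b => by
      rcases eq_or_ne m 0 with rfl | hm
      · simp
      · field_simp
    rw [h1]
    congr 4
    exact Finset.sum_congr rfl fun i _ => by ring

theorem integrals_eq (m s : ℝ) (k : Fin (n / 2) → ℝ) : integrals n m s k
    = Sum.elim ![hamiltonian m, shiftedIntegral m s 0 (normalForm n k)] (fun j =>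
      gaugeNoether s (normalForm n k) (planeGen (Pi.single (fstIdx j) 1) (Pi.single (sndIdx j) 1))) := by
  have h1 : shiftedIntegral m s 0 (normalForm n k) = integralJ n m s k := by
    ext x
    rw [shiftedIntegral, integralJ_eq_fieldIntegral, zero_mul, add_zero]
  rw [integrals, h1]
  congr 1
  ext1 j
  exact noether_eq_gaugeNoether s k j

/-- The upper bounds hold for any field; a single line of momenta shows that each degree is
attained. For `J + 4H²`, taking position and momentum in the plane of a nonzero strength makes the
quadratic terms cancel and leaves a pure cubic. -/
theorem hasIntegralDegrees (hm : 0 < m) (hs : s ≠ 0) (i₀ : Fin (n / 2)) (hk : k i₀ ≠ 0) :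
    HasIntegralDegrees n m s k := by
  have hm' := hm.ne'
  refine ⟨fun i => ?_, ?_, ?_⟩
  · refine HasMomentumDegreeLE.hasMomentumDegree (noether_eq_gaugeNoether s k i ▸
      hasMomentumDegreeLE_gaugeNoether _) (Pi.single (fstIdx i) 1) (Pi.single (sndIdx i) 1)
      (Polynomial.C 1 * Polynomial.X + Polynomial.C (s * k i / 2))
      (Polynomial.natDegree_linear one_ne_zero).ge fun t => ?_
    simp [noether, (fstIdx_ne_sndIdx i i).symm]
  · refine hasMomentumDegreeLE_hamiltonian.hasMomentumDegree 0 (Pi.single (fstIdx i₀) 1)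
      (Polynomial.C (1 / (2 * m)) * Polynomial.X ^ 2)
      (Polynomial.natDegree_C_mul_X_pow 2 _ (by positivity)).ge fun t => ?_
    simp [hamiltonian]
    left
    ring
  · have h1 : (fun x => integralJ n m s k x + 4 * hamiltonian m x ^ 2)
        = fun x => fieldIntegral m s (normalForm n k) x + 4 * hamiltonian m x ^ 2 := by
      rw [integralJ_eq_fieldIntegral]
    refine HasMomentumDegreeLE.hasMomentumDegree (h1 ▸ hasMomentumDegreeLE_fieldIntegral hm')
      (Pi.single (sndIdx i₀) 1) (Pi.single (fstIdx i₀) 1)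
      (Polynomial.C (2 * s * k i₀ / m ^ 2) * Polynomial.X ^ 3)
      (Polynomial.natDegree_C_mul_X_pow 3 _ (by positivity)).ge fun t => ?_
    have h2 : normalForm n k *ᵥ (Pi.single (fstIdx i₀) 1) = -(k i₀) • Pi.single (sndIdx i₀) 1 :=
      (isFrame_normalForm k).map_e i₀
    have h3 : normalForm n k *ᵥ (Pi.single (sndIdx i₀) 1) = k i₀ • Pi.single (fstIdx i₀) 1 :=
      (isFrame_normalForm k).map_f i₀
    rw [integralJ_eq_fieldIntegral]
    simp only [fieldIntegral, multiplier, hamiltonian, Matrix.mulVec_smul, h2, h3, smul_dotProduct,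
      dotProduct_smul, single_one_dotProduct, Pi.single_eq_same, smul_eq_mul, Polynomial.eval_mul,
      Polynomial.eval_C, Polynomial.eval_pow, Polynomial.eval_X]
    field_simp
    ring

theorem isLiouvilleSystem_five {k : Fin 2 → ℝ} (hm : 0 < m) (hs : s ≠ 0) (hk : k 0 ≠ 0) :
    IsLiouvilleSystem m s (normalForm 5 k) (integrals 5 m s k) := by
  have hF : IsFrame (normalForm 5 k) (q := 2) _ _ _ := isFrame_normalForm (n := 5) k
  have hd : ∀ j : Fin 2, fstIdx (n := 5) j ≠ 4 ∧ sndIdx (n := 5) j ≠ 4 := by decide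
  obtain ⟨x, hx, hli⟩ := hF.exists_linearIndependent_of_kernel (lam := 0) hm hs hk
    (d := Pi.single 4 1) (by simp)
    (fun j => by simp [(hd j).1.symm])
    (fun j => by simp [(hd j).2.symm])
    (by rw [normalForm_mulVec]
        exact Finset.sum_eq_zero fun j _ => by simp [(hd j).1, (hd j).2])
  rw [integrals_eq]
  exact hF.isLiouvilleSystem (normalForm_transpose (n := 5) k) rfl hx hli

theorem isLiouvilleSystem_six {k : Fin 3 → ℝ} (hm : 0 < m) (hs : s ≠ 0) (hk0 : ∀ j, 0 ≤ k j)
    (hk : ¬(k 0 = k 1 ∧ k 1 = k 2)) :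
    IsLiouvilleSystem m s (normalForm 6 k) (integrals 6 m s k) := by
  have hF : IsFrame (normalForm 6 k) (q := 3) _ _ _ := isFrame_normalForm (n := 6) k
  obtain ⟨x, hx, hli⟩ := hF.exists_linearIndependent_six (lam := 0) hm hs hk0 hk
  rw [integrals_eq]
  exact hF.isLiouvilleSystem (normalForm_transpose (n := 6) k) rfl hx hli

end NormalForm


/-! ### Completeness of the algebra of integrals -/

section Completeness

variable {n : ℕ} {m s ka kb : ℝ} {κ Q : Matrix (Fin n) (Fin n) ℝ} {x : Phase n}

theorem linearIndependent_hamiltonian_gaugeNoether {q : ℕ} {B : Fin q → Matrix (Fin n) (Fin n) ℝ}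
    (hκ : κᵀ = -κ) (hx : x ∈ cotangentSphere n) (hB : ∀ i, IsSymmetry κ (B i))
    (h : ∀ (a : ℝ) (g : Fin q → ℝ), a • flowField m s κ x + ∑ i, g i • rotate (B i) x = 0 →
      a = 0 ∧ ∀ i, g i = 0) :
    LinearIndependent ℝ fun i => differential ((Sum.elim (fun _ => hamiltonian m)
      (fun i => gaugeNoether s κ (B i)) : Unit ⊕ Fin q → Phase n → ℝ) i) x := by
  refine linearIndependent_differential (s := s) (κ := κ) (Z := Sum.elim
    (fun _ => flowField m s κ x) (fun i => rotate (B i) x)) hx ?_ ?_ ?_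
  · rintro (_ | i)
    · exact flowField_mem_tangentSpace hκ hx
    · exact IsSymmetry.rotate_mem (hB i).1 x
  · rintro (_ | i) w hw
    · exact fderiv_hamiltonian_eq_twistedForm hw
    · exact fderiv_gaugeNoether_eq_twistedForm hκ (hB i) x w
  · rw [Fintype.linearIndependent_iff]
    intro g hg
    rw [Fintype.sum_sum_type] at hg
    simp only [Sum.elim_inl, Sum.elim_inr, Finset.univ_unique, Finset.sum_singleton] at hg
    obtain ⟨h1, h2⟩ := h _ _ hg
    rintro (_ | i)
    · exact h1
    · exact h2 i

theorem fderiv_gaugeNoether_rotate_of_commute {A B : Matrix (Fin n) (Fin n) ℝ}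
    (hB : IsSymmetry κ B) (hAB : A * B = B * A) (x : Phase n) :
    fderiv ℝ (gaugeNoether s κ A) x (rotate B x) = 0 := by
  rw [fderiv_gaugeNoether_rotate hB, hAB, sub_self, gaugeNoether_zero]

/-- The point `x` witnesses that `H` and q gauge Noether integrals are independent, the point `y`
that r central integrals are. The numbers must satisfy `1 + q + r = 2 * (n - 1)`. -/
theorem isCompleteAlgebra_of_rotations {ι : Type*} [Fintype ι] {q r : ℕ}
    {B : Fin q → Matrix (Fin n) (Fin n) ℝ} {g : ι → Phase n → ℝ} {y : Phase n} (hn : 2 ≤ n)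
    (hκ : κᵀ = -κ) (hx : x ∈ cotangentSphere n) (hB : ∀ i, IsSymmetry κ (B i))
    (h : ∀ (a : ℝ) (g : Fin q → ℝ), a • flowField m s κ x + ∑ i, g i • rotate (B i) x = 0 →
      a = 0 ∧ ∀ i, g i = 0)
    (hg : ∀ i, g i ∈ integralAlgebra m s κ)
    (hgc : ∀ i x A, IsSymmetry κ A → fderiv ℝ (g i) x (rotate A x) = 0)
    (hy : y ∈ cotangentSphere n) (hgi : LinearIndependent ℝ fun i => differential (g i) y)
    (hr : Fintype.card ι = r) (hqr : 1 + q + r = 2 * (n - 1)) :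
    IsCompleteAlgebra m s κ r (integralAlgebra m s κ) := by
  subst hr
  have hf : ∀ i, (Sum.elim (fun _ => hamiltonian m) (fun i => gaugeNoether s κ (B i)) :
      Unit ⊕ Fin q → Phase n → ℝ) i ∈ integralAlgebra m s κ := by
    rintro (_ | i)
    · exact hamiltonian_mem_integralAlgebra
    · exact gaugeNoether_mem_integralAlgebra (hB i)
  exact isCompleteAlgebra_integralAlgebra hκ hf
    (generically_linearIndependent hn (fun i => contDiff_of_mem_integralAlgebra (hf i)) hx
      (linearIndependent_hamiltonian_gaugeNoether hκ hx hB h)) hg hgc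
    (generically_linearIndependent hn (fun i => contDiff_of_mem_integralAlgebra (hg i)) hy hgi)
    (by simpa using hqr)

/-- Completeness when `H`, `J` and gauge Noether integrals of central symmetries are independent. -/
theorem isCompleteAlgebra_of_central {ι : Type*} [Fintype ι] [DecidableEq ι] {q r : ℕ}
    {B : Fin q → Matrix (Fin n) (Fin n) ℝ} {A : ι → Matrix (Fin n) (Fin n) ℝ}
    {w : ι → Fin n → ℝ} {b : ι → ℝ} {v₁ v₂ : Fin n → ℝ} {y : Phase n} (hn : 2 ≤ n)
    (hκ : κᵀ = -κ) (hx : x ∈ cotangentSphere n) (hB : ∀ i, IsSymmetry κ (B i))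
    (h : ∀ (a : ℝ) (g : Fin q → ℝ), a • flowField m s κ x + ∑ i, g i • rotate (B i) x = 0 →
      a = 0 ∧ ∀ i, g i = 0)
    (hAs : ∀ i, IsSymmetry κ (A i)) (hAc : ∀ i C, IsSymmetry κ C → A i * C = C * A i)
    (hm : 0 < m) (hs : s ≠ 0) (hy : y ∈ cotangentSphere n) (hw : ∀ j, y.1 ⬝ᵥ w j = 0)
    (hA : ∀ i j, w j ⬝ᵥ (A i *ᵥ y.1) = if i = j then b j else 0) (hb : ∀ j, b j ≠ 0)
    (hv₁ : y.1 ⬝ᵥ v₁ = 0) (hv₂ : y.1 ⬝ᵥ v₂ = 0) (hA₁ : ∀ j, v₁ ⬝ᵥ (A j *ᵥ y.1) = 0)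
    (hA₂ : ∀ j, v₂ ⬝ᵥ (A j *ᵥ y.1) = 0) (hκ₁ : v₁ ⬝ᵥ (κ *ᵥ y.1) = 0) (hκ₂ : v₂ ⬝ᵥ (κ *ᵥ y.1) = 0)
    (hdet : (y.2 ⬝ᵥ v₁) * ((κ *ᵥ y.2) ⬝ᵥ (κ *ᵥ v₂)) - (y.2 ⬝ᵥ v₂) * ((κ *ᵥ y.2) ⬝ᵥ (κ *ᵥ v₁)) ≠ 0)
    (hr : 2 + Fintype.card ι = r) (hqr : 1 + q + r = 2 * (n - 1)) :
    IsCompleteAlgebra m s κ r (integralAlgebra m s κ) := by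
  refine isCompleteAlgebra_of_rotations hn hκ hx hB h ?_ ?_ hy
    (linearIndependent_of_vertical (s := s) (lam := 0) hm hs hw hA hb hv₁ hv₂ hA₁ hA₂ hκ₁ hκ₂ hdet)
    (by simpa using hr) hqr
  · rintro (i | i)
    · fin_cases i
      · exact hamiltonian_mem_integralAlgebra
      · exact shiftedIntegral_mem_integralAlgebra
    · exact gaugeNoether_mem_integralAlgebra (hAs i)
  · rintro (i | i) z C hC
    · fin_cases i
      · exact fderiv_hamiltonian_rotate hC.1 z
      · exact fderiv_shiftedIntegral_rotate hC z
    · exact fderiv_gaugeNoether_rotate_of_commute hC (hAc i C hC) z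

theorem IsSplitting.isSymmetry_field_proj (h : IsSplitting κ Q ka kb) : IsSymmetry κ (κ * Q) := by
  refine ⟨?_, ?_⟩
  · rw [Matrix.transpose_mul, h.symm, h.skew, Matrix.mul_neg, h.commute]
  · rw [Matrix.mul_assoc, h.commute]

theorem IsSplitting.field_proj_comm (h : IsSplitting κ Q ka kb) {A : Matrix (Fin n) (Fin n) ℝ}
    (hA : IsSymmetry κ A) : κ * Q * A = A * (κ * Q) := by
  have h1 : A * Q = Q * A := ext_mulVec fun u => by
    rw [← Matrix.mulVec_mulVec, ← Matrix.mulVec_mulVec, h.proj_comm hA.2]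
  rw [← Matrix.mul_assoc, hA.2, Matrix.mul_assoc, Matrix.mul_assoc, h1]

/-- A symmetry preserves the two-dimensional kernel of `Q` and is skew there, hence acts on it as a
multiple of the quarter turn. -/
theorem IsSplitting.planeGen_comm (h : IsSplitting κ Q ka kb) {e f : Fin n → ℝ}
    (hQ : ∀ u, u - Q *ᵥ u = (e ⬝ᵥ u) • e + (f ⬝ᵥ u) • f) (he : e ⬝ᵥ e = 1) (hf : f ⬝ᵥ f = 1)
    (hef : e ⬝ᵥ f = 0) {A : Matrix (Fin n) (Fin n) ℝ} (hA : IsSymmetry κ A) :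
    planeGen e f * A = A * planeGen e f := by
  have hfe : f ⬝ᵥ e = 0 := by rw [dotProduct_comm, hef]
  have hQe : Q *ᵥ e = 0 := by
    have := hQ e
    rw [he, hfe, one_smul, zero_smul, add_zero, sub_eq_self] at this
    exact this
  have hQf : Q *ᵥ f = 0 := by
    have := hQ f
    rw [hf, hef, one_smul, zero_smul, zero_add, sub_eq_self] at this
    exact this
  have hee : e ⬝ᵥ (A *ᵥ e) = 0 := dotProduct_mulVec_self_skew hA.1 e
  have hff : f ⬝ᵥ (A *ᵥ f) = 0 := dotProduct_mulVec_self_skew hA.1 f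
  have hef' : e ⬝ᵥ (A *ᵥ f) = -(f ⬝ᵥ (A *ᵥ e)) := by
    rw [dotProduct_mulVec_skew hA.1, dotProduct_comm]
  have hAe : A *ᵥ e = (f ⬝ᵥ (A *ᵥ e)) • f := by
    have := hQ (A *ᵥ e)
    rw [← h.proj_comm hA.2, hQe, Matrix.mulVec_zero, sub_zero, hee, zero_smul, zero_add] at this
    exact this
  have hAf : A *ᵥ f = -(f ⬝ᵥ (A *ᵥ e)) • e := by
    have := hQ (A *ᵥ f)
    rw [← h.proj_comm hA.2, hQf, Matrix.mulVec_zero, sub_zero, hff, zero_smul, add_zero, hef'] at this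
    exact this
  refine ext_mulVec fun u => ?_
  rw [← Matrix.mulVec_mulVec, ← Matrix.mulVec_mulVec, planeGen_mulVec, planeGen_mulVec,
    Matrix.mulVec_sub, Matrix.mulVec_smul, Matrix.mulVec_smul, dotProduct_mulVec_skew hA.1,
    dotProduct_mulVec_skew hA.1 f]
  generalize f ⬝ᵥ (A *ᵥ e) = t at hAe hAf
  rw [hAe, hAf]
  simp only [smul_dotProduct, smul_eq_mul]
  module

theorem linearIndependent_hamiltonian_gaugeNoether_field (hm : 0 < m)
    {v₁ v₂ : Fin n → ℝ} (hv₁ : x.1 ⬝ᵥ v₁ = 0) (hv₂ : x.1 ⬝ᵥ v₂ = 0) (h₁ : x.2 ⬝ᵥ v₁ ≠ 0)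
    (hκ₁ : v₁ ⬝ᵥ (κ *ᵥ x.1) = 0) (h₂ : x.2 ⬝ᵥ v₂ = 0) (hκ₂ : v₂ ⬝ᵥ (κ *ᵥ x.1) ≠ 0) :
    LinearIndependent ℝ fun i => differential
      ((![hamiltonian m, gaugeNoether s κ κ] : Fin 2 → Phase n → ℝ) i) x := by
  rw [Fintype.linearIndependent_iff]
  intro g hg
  have key : ∀ v : Fin n → ℝ, x.1 ⬝ᵥ v = 0 →
      g 0 * (1 / m * (x.2 ⬝ᵥ v)) + g 1 * (v ⬝ᵥ (κ *ᵥ x.1)) = 0 := fun v hv => by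
    have h1 := LinearMap.congr_fun hg ⟨(0, v), vertical_mem_tangentSpace hv⟩
    rw [Fin.sum_univ_two] at h1
    simp only [LinearMap.add_apply, LinearMap.smul_apply, Matrix.cons_val_zero,
      Matrix.cons_val_one, smul_eq_mul, LinearMap.zero_apply] at h1
    simp only [differential, LinearMap.domRestrict_apply, ContinuousLinearMap.coe_coe,
      fderiv_hamiltonian, fderiv_gaugeNoether_vertical] at h1
    exact h1
  have k1 := key v₁ hv₁
  have k2 := key v₂ hv₂
  rw [hκ₁, mul_zero, add_zero] at k1
  rw [h₂, mul_zero, mul_zero, zero_add] at k2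
  have hm' := hm.ne'
  intro i
  fin_cases i
  · exact (mul_eq_zero.1 k1).resolve_right (by positivity)
  · exact (mul_eq_zero.1 k2).resolve_right hκ₂

theorem generically_gram (hn : 2 ≤ n) {a b : Fin n → ℝ} (ha : Q *ᵥ a = 0) (hb : Q *ᵥ b = 0)
    (haa : a ⬝ᵥ a = 1) (hbb : b ⬝ᵥ b = 1) (hab : a ⬝ᵥ b = 0) :
    Generically n fun x => ((x.1 - Q *ᵥ x.1) ⬝ᵥ (x.1 - Q *ᵥ x.1))
      * ((x.2 - Q *ᵥ x.2) ⬝ᵥ (x.2 - Q *ᵥ x.2)) - ((x.1 - Q *ᵥ x.1) ⬝ᵥ (x.2 - Q *ᵥ x.2)) ^ 2 ≠ 0 := by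
  have h1 : ContDiff ℝ ω fun x : Phase n => x.1 - Q *ᵥ x.1 :=
    contDiff_fst.sub (contDiff_mulVec Q contDiff_fst)
  have h2 : ContDiff ℝ ω fun x : Phase n => x.2 - Q *ᵥ x.2 :=
    contDiff_snd.sub (contDiff_mulVec Q contDiff_snd)
  refine generically_ne_zero hn (((contDiff_dotProduct h1 h1).mul (contDiff_dotProduct h2 h2)).sub
    ((contDiff_dotProduct h1 h2).pow 2)) (x₀ := (a, b))
    ⟨haa, by rw [phi2, dotProduct_comm, hab]⟩ ?_
  simp [ha, hb, haa, hbb, hab]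

theorem isNoncommutativelyIntegrable_of_isMotion {r : ℕ} {P : Phase n → Prop} (hm : 0 < m)
    (hκ : κᵀ = -κ) (hF : IsCompleteAlgebra m s κ r (integralAlgebra m s κ)) (hP : Generically n P)
    (h : ∀ c, IsMotion m s κ c → P (c 0) → ∃ (φ : (Fin r → ℝ) → Phase n) (freq : Fin r → ℝ),
      IsQuasiPeriodicTorus m s κ φ freq ∧ c 0 ∈ Set.range φ ∧
      ∀ F ∈ integralAlgebra m s κ, ∀ θ, F (φ θ) = F (c 0)) :
    IsNoncommutativelyIntegrable m s κ r := by
  refine ⟨_, hF, hP.mono fun x hx hPx => ?_⟩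
  obtain ⟨c, rfl, hc⟩ := exists_isMotion (s := s) hm hκ hx
  exact h c hc hPx

end Completeness


/-! ### Degenerate fields in normal form -/

section Five

variable {m s : ℝ} {k : Fin 2 → ℝ}

theorem normalForm_five_mulVec (k : Fin 2 → ℝ) (u : Fin 5 → ℝ) :
    normalForm 5 k *ᵥ u = ![k 0 * u 1, -(k 0 * u 0), k 1 * u 3, -(k 1 * u 2), 0] := by
  have h : normalForm 5 k *ᵥ u = ∑ i : Fin 2, k i • (u (sndIdx (n := 5) i) •
      (Pi.single (fstIdx (n := 5) i) 1 : Fin 5 → ℝ)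
        - u (fstIdx (n := 5) i) • Pi.single (sndIdx (n := 5) i) 1) := normalForm_mulVec (n := 5) k u
  rw [h, Fin.sum_univ_two]
  ext i
  fin_cases i <;> simp [fstIdx, sndIdx, Fin.ext_iff]

theorem isFrame_five (k : Fin 2 → ℝ) : IsFrame (normalForm 5 k)
    (![Pi.single 0 1, Pi.single 2 1] : Fin 2 → Fin 5 → ℝ)
    ![Pi.single 1 1, Pi.single 3 1] k := by
  have h : IsFrame (normalForm 5 k) (q := 2) _ _ _ := isFrame_normalForm (n := 5) k
  convert h using 1 <;> ext1 i <;> fin_cases i <;> rfl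

theorem isSplitting_five_of_eq (hk0 : k 0 ≠ 0) (h01 : k 0 = k 1) :
    IsSplitting (normalForm 5 k) (Matrix.diagonal ![1, 1, 1, 1, 0]) (k 0) 0 where
  skew := normalForm_transpose (n := 5) k
  symm := Matrix.diagonal_transpose _
  idem := ext_mulVec fun u => by
    ext i
    fin_cases i <;> simp [Matrix.mulVec_diagonal]
  commute := ext_mulVec fun u => by
    simp only [← Matrix.mulVec_mulVec, normalForm_five_mulVec]
    ext i
    fin_cases i <;> simp [Matrix.mulVec_diagonal]
  sq := ext_mulVec fun u => by
    simp only [← Matrix.mulVec_mulVec, normalForm_five_mulVec, Matrix.sub_mulVec, Matrix.smul_mulVec]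
    ext i
    fin_cases i <;> simp [Matrix.mulVec_diagonal, ← h01] <;> ring
  ne := by simpa using hk0

theorem isSplitting_five_of_rank_two (hk0 : k 0 ≠ 0) (h1 : k 1 = 0) :
    IsSplitting (normalForm 5 k) (Matrix.diagonal ![1, 1, 0, 0, 0]) (k 0) 0 where
  skew := normalForm_transpose (n := 5) k
  symm := Matrix.diagonal_transpose _
  idem := ext_mulVec fun u => by
    ext i
    fin_cases i <;> simp [Matrix.mulVec_diagonal]
  commute := ext_mulVec fun u => by
    simp only [← Matrix.mulVec_mulVec, normalForm_five_mulVec]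
    ext i
    fin_cases i <;> simp [Matrix.mulVec_diagonal, h1]
  sq := ext_mulVec fun u => by
    simp only [← Matrix.mulVec_mulVec, normalForm_five_mulVec, Matrix.sub_mulVec, Matrix.smul_mulVec]
    ext i
    fin_cases i <;> simp [Matrix.mulVec_diagonal, h1] <;> ring
  ne := by simpa using hk0

/-- The symmetry algebra contains a u(2). Its four integrals and `H` give dimension 5, and `H`, `J`,
Φ_κ span the three central directions: 5 + 3 = 8. -/
theorem isCompleteAlgebra_five_of_eq (hm : 0 < m) (hs : s ≠ 0) (hk0 : k 0 ≠ 0) (h01 : k 0 = k 1) :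
    IsCompleteAlgebra m s (normalForm 5 k) 3 (integralAlgebra m s (normalForm 5 k)) := by
  have hκ := normalForm_transpose (n := 5) k
  have hF := isFrame_five k
  refine isCompleteAlgebra_of_central (q := 4)
    (x := (![1, 0, 0, 0, 0], ![0, 0, 1, 0, 1]))
    (y := (![3 / 5, 0, 0, 0, 4 / 5], ![4 / 5, 0, 1, 0, -(3 / 5)]))
    (B := ![planeGen (Pi.single 0 1) (Pi.single 1 1),
      planeGen (Pi.single 2 1) (Pi.single 3 1),
      planeGen (Pi.single 0 1) (Pi.single 2 1) + planeGen (Pi.single 1 1) (Pi.single 3 1),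
      planeGen (Pi.single 0 1) (Pi.single 3 1) - planeGen (Pi.single 1 1) (Pi.single 2 1)])
    (A := fun _ : Unit => normalForm 5 k) (w := fun _ => ![0, 1, 0, 0, 0])
    (b := fun _ => -(k 0 * (3 / 5)))
    (v₁ := ![4 / 5, 0, 0, 0, -(3 / 5)]) (v₂ := ![0, 0, 1, 0, 0])
    (by norm_num) hκ ?_ ?_ ?_ (fun _ => isSymmetry_self hκ) (fun _ C hC => hC.2.symm) hm hs
    ?_ ?_ ?_ ?_ ?_ ?_ ?_ ?_ ?_ ?_ ?_ rfl rfl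
  · constructor <;> simp [phi1, phi2, dotProduct, Fin.sum_univ_five]
  · intro i
    fin_cases i
    · exact hF.isSymmetry hκ 0
    · exact hF.isSymmetry hκ 1
    · exact hF.isSymmetry_real hκ (i := 0) (j := 1) h01
    · exact hF.isSymmetry_imag hκ (i := 0) (j := 1) h01
  · intro a g hg
    have h1 := congrFun (congrArg Prod.fst hg)
    have h2 := congrFun (congrArg Prod.snd hg)
    simp [flowField, normalForm_five_mulVec, Fin.sum_univ_four, rotate, Matrix.add_mulVec,
      Matrix.sub_mulVec, planeGen_mulVec, Fin.forall_fin_succ, Matrix.vecHead, Matrix.vecTail,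
      Fin.ext_iff] at h1 h2
    clear hg
    simp only [hm.ne', or_false] at h1
    obtain rfl : a = 0 := by simp only [h1]
    simp at h1 h2
    exact ⟨rfl, by simp only [Fin.forall_fin_succ]; simp [h1, h2]⟩
  all_goals simp [normalForm_five_mulVec, dotProduct, Fin.sum_univ_five]
  · constructor <;> simp [phi1, phi2, dotProduct, Fin.sum_univ_five] <;> norm_num
  · exact hk0
  · norm_num
  · rw [← h01]
    ring_nf
    simpa using hk0

/-- The symmetries are the rotations of the field plane and so(3) on the kernel. Their four
integrals and `H` give 5, with the central `H`, `J`, Φ_κ: 5 + 3 = 8. -/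
theorem isCompleteAlgebra_five_of_rank_two (hm : 0 < m) (hs : s ≠ 0) (hk0 : k 0 ≠ 0) (h1 : k 1 = 0) :
    IsCompleteAlgebra m s (normalForm 5 k) 3 (integralAlgebra m s (normalForm 5 k)) := by
  have hκ := normalForm_transpose (n := 5) k
  have hF := isFrame_five k
  have hb : ∀ i, normalForm 5 k *ᵥ ((![Pi.single 2 1, Pi.single 3 1, Pi.single 4 1] : Fin 3 → Fin 5 → ℝ) i) = 0 := by
    intro i
    rw [normalForm_five_mulVec]
    ext j
    fin_cases i <;> fin_cases j <;> simp [h1]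
  refine isCompleteAlgebra_of_central (q := 4)
    (x := (![0, 0, 1, 0, 0], ![1, 0, 0, 1, 0]))
    (y := (![3 / 5, 0, 4 / 5, 0, 0], ![4 / 5, 0, -(3 / 5), 1, 0]))
    (B := ![planeGen (Pi.single 0 1) (Pi.single 1 1),
      planeGen (Pi.single 2 1) (Pi.single 3 1),
      planeGen (Pi.single 2 1) (Pi.single 4 1),
      planeGen (Pi.single 3 1) (Pi.single 4 1)])
    (A := fun _ : Unit => normalForm 5 k) (w := fun _ => ![0, 1, 0, 0, 0])
    (b := fun _ => -(k 0 * (3 / 5)))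
    (v₁ := ![4 / 5, 0, -(3 / 5), 0, 0]) (v₂ := ![0, 0, 0, 1, 0])
    (by norm_num) hκ ?_ ?_ ?_ (fun _ => isSymmetry_self hκ) (fun _ C hC => hC.2.symm) hm hs
    ?_ ?_ ?_ ?_ ?_ ?_ ?_ ?_ ?_ ?_ ?_ rfl rfl
  · constructor <;> simp [phi1, phi2, dotProduct, Fin.sum_univ_five]
  · intro i
    fin_cases i
    · exact hF.isSymmetry hκ 0
    · exact isSymmetry_planeGen_of_mulVec_eq_zero hκ (hb 0) (hb 1)
    · exact isSymmetry_planeGen_of_mulVec_eq_zero hκ (hb 0) (hb 2)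
    · exact isSymmetry_planeGen_of_mulVec_eq_zero hκ (hb 1) (hb 2)
  · intro a g hg
    have h1 := congrFun (congrArg Prod.fst hg)
    have h2 := congrFun (congrArg Prod.snd hg)
    simp [flowField, normalForm_five_mulVec, Fin.sum_univ_four, rotate,
      planeGen_mulVec, Fin.forall_fin_succ, Matrix.vecHead, Matrix.vecTail,
      Fin.ext_iff] at h1 h2
    clear hg
    simp only [hm.ne', or_false] at h1
    obtain rfl : a = 0 := by simp only [h1]
    simp at h1 h2
    exact ⟨rfl, by simp only [Fin.forall_fin_succ]; simp [h1, h2]⟩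
  all_goals simp [normalForm_five_mulVec, dotProduct, Fin.sum_univ_five, h1]
  · constructor <;> simp [phi1, phi2, dotProduct, Fin.sum_univ_five] <;> norm_num
  · exact hk0
  · norm_num
  · exact hk0

end Five


/-! ### Degenerate fields on S⁵ -/

section Six

variable {m s : ℝ} {k : Fin 3 → ℝ}

theorem normalForm_six_mulVec (k : Fin 3 → ℝ) (u : Fin 6 → ℝ) :
    normalForm 6 k *ᵥ u = ![k 0 * u 1, -(k 0 * u 0), k 1 * u 3, -(k 1 * u 2), k 2 * u 5, -(k 2 * u 4)] := by
  have h : normalForm 6 k *ᵥ u = ∑ i : Fin 3, k i • (u (sndIdx (n := 6) i) •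
      (Pi.single (fstIdx (n := 6) i) 1 : Fin 6 → ℝ)
        - u (fstIdx (n := 6) i) • Pi.single (sndIdx (n := 6) i) 1) := normalForm_mulVec (n := 6) k u
  rw [h, Fin.sum_univ_three]
  ext i
  fin_cases i <;> simp [fstIdx, sndIdx, Fin.ext_iff]

theorem isFrame_six (k : Fin 3 → ℝ) : IsFrame (normalForm 6 k)
    (![Pi.single 0 1, Pi.single 2 1, Pi.single 4 1] : Fin 3 → Fin 6 → ℝ)
    ![Pi.single 1 1, Pi.single 3 1, Pi.single 5 1] k := by
  have h : IsFrame (normalForm 6 k) (q := 3) _ _ _ := isFrame_normalForm (n := 6) k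
  convert h using 1 <;> ext1 i <;> fin_cases i <;> rfl

theorem isSplitting_six_of_two_eq (hk : ∀ i, 0 ≤ k i) (h01 : k 0 = k 1) (h12 : k 1 ≠ k 2) :
    IsSplitting (normalForm 6 k) (Matrix.diagonal ![1, 1, 1, 1, 0, 0]) (k 0) (k 2) where
  skew := normalForm_transpose (n := 6) k
  symm := Matrix.diagonal_transpose _
  idem := ext_mulVec fun u => by
    ext i
    fin_cases i <;> simp [Matrix.mulVec_diagonal]
  commute := ext_mulVec fun u => by
    simp only [← Matrix.mulVec_mulVec, normalForm_six_mulVec]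
    ext i
    fin_cases i <;> simp [Matrix.mulVec_diagonal]
  sq := ext_mulVec fun u => by
    simp only [← Matrix.mulVec_mulVec, normalForm_six_mulVec, Matrix.sub_mulVec, Matrix.smul_mulVec]
    ext i
    fin_cases i <;> simp [Matrix.mulVec_diagonal, ← h01] <;> ring
  ne := by 
    -- Strengths are nonnegative, so different strengths give different eigenvalues of κ².
    rw [h01, ne_eq, sq_eq_sq₀ (hk 1) (hk 2)]
    exact h12

theorem isSplitting_six_of_rank_two (hk0 : k 0 ≠ 0) (h1 : k 1 = 0) (h2 : k 2 = 0) :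
    IsSplitting (normalForm 6 k) (Matrix.diagonal ![1, 1, 0, 0, 0, 0]) (k 0) 0 where
  skew := normalForm_transpose (n := 6) k
  symm := Matrix.diagonal_transpose _
  idem := ext_mulVec fun u => by
    ext i
    fin_cases i <;> simp [Matrix.mulVec_diagonal]
  commute := ext_mulVec fun u => by
    simp only [← Matrix.mulVec_mulVec, normalForm_six_mulVec]
    ext i
    fin_cases i <;> simp [Matrix.mulVec_diagonal, h1, h2]
  sq := ext_mulVec fun u => by
    simp only [← Matrix.mulVec_mulVec, normalForm_six_mulVec, Matrix.sub_mulVec, Matrix.smul_mulVec]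
    ext i
    fin_cases i <;> simp [Matrix.mulVec_diagonal, h1, h2] <;> ring
  ne := by simpa using hk0

/-- With `Q = 1` there is no second eigenspace. The value 0 for its strength is a default, which
reduces the inequality of eigenvalues to `k 0 ≠ 0`. -/
theorem isSplitting_six_of_eq (hk0 : k 0 ≠ 0) (h01 : k 0 = k 1) (h12 : k 1 = k 2) :
    IsSplitting (normalForm 6 k) 1 (k 0) 0 where
  skew := normalForm_transpose (n := 6) k
  symm := Matrix.transpose_one
  idem := Matrix.one_mul 1
  commute := by rw [Matrix.one_mul, Matrix.mul_one]
  sq := ext_mulVec fun u => by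
    simp only [← Matrix.mulVec_mulVec, normalForm_six_mulVec, Matrix.sub_mulVec, Matrix.smul_mulVec]
    ext i
    fin_cases i <;> simp [← h12, ← h01] <;> ring
  ne := by simpa using hk0

theorem sub_diagonal_mulVec_six (u : Fin 6 → ℝ) : u - Matrix.diagonal ![1, 1, 1, 1, 0, 0] *ᵥ u
    = ((Pi.single 4 1 : Fin 6 → ℝ) ⬝ᵥ u) • (Pi.single 4 1 : Fin 6 → ℝ)
      + ((Pi.single 5 1 : Fin 6 → ℝ) ⬝ᵥ u) • Pi.single 5 1 := by
  ext i
  fin_cases i <;> simp [Matrix.mulVec_diagonal]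

set_option maxHeartbeats 1000000 in
-- The five generators span u(2) ⊕ u(1). With `H` they give 6, and both summands have a central
-- rotation, so with `H` and `J` there are 4 central directions: 6 + 4 = 10.
theorem isCompleteAlgebra_six_of_two_eq (hm : 0 < m) (hs : s ≠ 0) (hk0 : k 0 ≠ 0) (hk : ∀ i, 0 ≤ k i) (h01 : k 0 = k 1) (h12 : k 1 ≠ k 2) :
    IsCompleteAlgebra m s (normalForm 6 k) 4 (integralAlgebra m s (normalForm 6 k)) := by
  have hκ := normalForm_transpose (n := 6) k
  have hF := isFrame_six k
  have hsp := isSplitting_six_of_two_eq hk h01 h12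
  have hA₀ : ∀ u : Fin 6 → ℝ, (normalForm 6 k * Matrix.diagonal ![1, 1, 1, 1, 0, 0]) *ᵥ u
      = ![k 0 * u 1, -(k 0 * u 0), k 1 * u 3, -(k 1 * u 2), 0, 0] := fun u => by
    rw [← Matrix.mulVec_mulVec, normalForm_six_mulVec]
    simp [Matrix.mulVec_diagonal]
  have hA₁ : ∀ u : Fin 6 → ℝ, planeGen (Pi.single 4 1) (Pi.single 5 1) *ᵥ u
      = ![0, 0, 0, 0, -u 5, u 4] := fun u => by
    ext i
    fin_cases i <;> simp [planeGen_mulVec]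
  refine isCompleteAlgebra_of_central (q := 5)
    (x := (![1, 0, 0, 0, 0, 0], ![0, 0, 1, 0, 1, 0]))
    (y := (![3 / 5, 0, 0, 0, 4 / 5, 0], ![4 / 5, 0, 1, 0, -(3 / 5), 0]))
    (B := ![planeGen (Pi.single 0 1) (Pi.single 1 1),
      planeGen (Pi.single 2 1) (Pi.single 3 1),
      planeGen (Pi.single 4 1) (Pi.single 5 1),
      planeGen (Pi.single 0 1) (Pi.single 2 1) + planeGen (Pi.single 1 1) (Pi.single 3 1),
      planeGen (Pi.single 0 1) (Pi.single 3 1) - planeGen (Pi.single 1 1) (Pi.single 2 1)])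
    (A := ![normalForm 6 k * Matrix.diagonal ![1, 1, 1, 1, 0, 0], planeGen (Pi.single 4 1) (Pi.single 5 1)])
    (w := ![![0, 1, 0, 0, 0, 0], ![0, 0, 0, 0, 0, 1]]) (b := ![-(k 0 * (3 / 5)), 4 / 5])
    (v₁ := ![4 / 5, 0, 0, 0, -(3 / 5), 0]) (v₂ := ![0, 0, 1, 0, 0, 0])
    (by norm_num) hκ ?_ ?_ ?_ ?_ ?_ hm hs
    ?_ ?_ ?_ ?_ ?_ ?_ ?_ ?_ ?_ ?_ ?_ rfl rfl
  · constructor <;> simp [phi1, phi2, dotProduct, Fin.sum_univ_six]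
  · intro i
    fin_cases i
    · exact hF.isSymmetry hκ 0
    · exact hF.isSymmetry hκ 1
    · exact hF.isSymmetry hκ 2
    · exact hF.isSymmetry_real hκ (i := 0) (j := 1) h01
    · exact hF.isSymmetry_imag hκ (i := 0) (j := 1) h01
  · intro a g hg
    have h1 := congrFun (congrArg Prod.fst hg)
    have h2 := congrFun (congrArg Prod.snd hg)
    simp [flowField, normalForm_six_mulVec, Fin.sum_univ_five, rotate, Matrix.add_mulVec,
      Matrix.sub_mulVec, planeGen_mulVec, Fin.forall_fin_succ, Matrix.vecHead, Matrix.vecTail,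
      Fin.ext_iff] at h1 h2
    clear hg
    simp only [hm.ne', or_false] at h1
    obtain rfl : a = 0 := by simp only [h1]
    simp at h1 h2
    exact ⟨rfl, by simp only [Fin.forall_fin_succ]; simp [h1, h2]⟩
  · intro i
    fin_cases i
    · exact hsp.isSymmetry_field_proj
    · exact hF.isSymmetry hκ 2
  · intro i C hC
    fin_cases i
    · exact hsp.field_proj_comm hC
    · exact hsp.planeGen_comm sub_diagonal_mulVec_six (by simp) (by simp) (by simp) hC
  all_goals simp [Fin.forall_fin_two, hA₀, hA₁, normalForm_six_mulVec, dotProduct, Fin.sum_univ_six]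
  · constructor <;> simp [phi1, phi2, dotProduct, Fin.sum_univ_six] <;> norm_num
  · exact hk0
  · norm_num
  · have h1 : k 1 ^ 2 - k 2 ^ 2 ≠ 0 := sub_ne_zero.2 fun h => h12 ((sq_eq_sq₀ (hk 1) (hk 2)).1 h)
    rw [h01]
    intro h2
    exact h1 (by linear_combination (25 / 9 : ℝ) * h2)

set_option maxHeartbeats 1000000 in
-- Seven of the nine generators of u(3) and `H` are independent at the chosen point, which gives 8.
-- The centre is represented by `H` and Φ_κ only, `J` being a function of them on T*S⁵: 8 + 2 = 10.
theorem isCompleteAlgebra_six_of_eq (hm : 0 < m) (hk0 : k 0 ≠ 0) (h01 : k 0 = k 1) (h12 : k 1 = k 2) :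
    IsCompleteAlgebra m s (normalForm 6 k) 2 (integralAlgebra m s (normalForm 6 k)) := by
  have hκ := normalForm_transpose (n := 6) k
  have hF := isFrame_six k
  refine isCompleteAlgebra_of_rotations (q := 7) (g := ![hamiltonian m, gaugeNoether s _ (normalForm 6 k)])
    (x := (![1, 0, 0, 0, 0, 0], ![0, 0, 1, 0, 0, 0]))
    (y := (![1, 0, 0, 0, 0, 0], ![0, 0, 1, 0, 0, 0]))
    (B := ![planeGen (Pi.single 0 1) (Pi.single 1 1),
      planeGen (Pi.single 2 1) (Pi.single 3 1),
      planeGen (Pi.single 0 1) (Pi.single 3 1) - planeGen (Pi.single 1 1) (Pi.single 2 1),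
      planeGen (Pi.single 0 1) (Pi.single 4 1) + planeGen (Pi.single 1 1) (Pi.single 5 1),
      planeGen (Pi.single 0 1) (Pi.single 5 1) - planeGen (Pi.single 1 1) (Pi.single 4 1),
      planeGen (Pi.single 2 1) (Pi.single 4 1) + planeGen (Pi.single 3 1) (Pi.single 5 1),
      planeGen (Pi.single 2 1) (Pi.single 5 1) - planeGen (Pi.single 3 1) (Pi.single 4 1)])
    (by norm_num) hκ ?_ ?_ ?_ ?_ ?_ ?_
    (linearIndependent_hamiltonian_gaugeNoether_field hm (v₁ := ![0, 0, 1, 0, 0, 0]) (v₂ := ![0, 1, 0, 0, 0, 0])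
      ?_ ?_ ?_ ?_ ?_ ?_) rfl rfl
  · constructor <;> simp [phi1, phi2, dotProduct, Fin.sum_univ_six]
  · intro i
    fin_cases i
    · exact hF.isSymmetry hκ 0
    · exact hF.isSymmetry hκ 1
    · exact hF.isSymmetry_imag hκ (i := 0) (j := 1) h01
    · exact hF.isSymmetry_real hκ (i := 0) (j := 2) (h01.trans h12)
    · exact hF.isSymmetry_imag hκ (i := 0) (j := 2) (h01.trans h12)
    · exact hF.isSymmetry_real hκ (i := 1) (j := 2) h12
    · exact hF.isSymmetry_imag hκ (i := 1) (j := 2) h12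
  · intro a g hg
    have h1 := congrFun (congrArg Prod.fst hg)
    have h2 := congrFun (congrArg Prod.snd hg)
    simp [flowField, normalForm_six_mulVec, Fin.sum_univ_seven, rotate, Matrix.add_mulVec,
      Matrix.sub_mulVec, planeGen_mulVec, Fin.forall_fin_succ, Matrix.vecHead, Matrix.vecTail,
      Fin.ext_iff] at h1 h2
    clear hg
    simp only [hm.ne', or_false] at h1
    obtain rfl : a = 0 := by simp only [h1]
    simp at h1 h2
    exact ⟨rfl, by simp only [Fin.forall_fin_succ]; simp [h1, h2]⟩
  · intro i
    fin_cases i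
    · exact hamiltonian_mem_integralAlgebra
    · exact gaugeNoether_mem_integralAlgebra (isSymmetry_self hκ)
  · intro i z C hC
    fin_cases i
    · exact fderiv_hamiltonian_rotate hC.1 z
    · exact fderiv_gaugeNoether_rotate_of_commute hC hC.2.symm z
  all_goals simp [normalForm_six_mulVec, dotProduct, Fin.sum_univ_six]
  · constructor <;> simp [phi1, phi2, dotProduct, Fin.sum_univ_six]
  · exact hk0

set_option maxHeartbeats 1000000 in
-- On the kernel only five of the six generators of so(4) are used, since the angular momentum of
-- one position and one momentum is decomposable. With the rotation of the field plane and `H` this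
-- gives 7, and 7 + 3 = 10.
theorem isCompleteAlgebra_six_of_rank_two (hm : 0 < m) (hs : s ≠ 0) (hk0 : k 0 ≠ 0) (h1 : k 1 = 0) (h2 : k 2 = 0) :
    IsCompleteAlgebra m s (normalForm 6 k) 3 (integralAlgebra m s (normalForm 6 k)) := by
  have hκ := normalForm_transpose (n := 6) k
  have hF := isFrame_six k
  have hb : ∀ i, normalForm 6 k *ᵥ ((![Pi.single 2 1, Pi.single 3 1, Pi.single 4 1, Pi.single 5 1] : Fin 4 → Fin 6 → ℝ) i) = 0 := by
    intro i
    rw [normalForm_six_mulVec]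
    ext j
    fin_cases i <;> fin_cases j <;> simp [h1, h2]
  refine isCompleteAlgebra_of_central (q := 6)
    (x := (![0, 0, 1, 0, 0, 0], ![1, 0, 0, 1, 0, 0]))
    (y := (![3 / 5, 0, 4 / 5, 0, 0, 0], ![4 / 5, 0, -(3 / 5), 1, 0, 0]))
    (B := ![planeGen (Pi.single 0 1) (Pi.single 1 1),
      planeGen (Pi.single 2 1) (Pi.single 3 1),
      planeGen (Pi.single 2 1) (Pi.single 4 1),
      planeGen (Pi.single 2 1) (Pi.single 5 1),
      planeGen (Pi.single 3 1) (Pi.single 4 1),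
      planeGen (Pi.single 3 1) (Pi.single 5 1)])
    (A := fun _ : Unit => normalForm 6 k) (w := fun _ => ![0, 1, 0, 0, 0, 0])
    (b := fun _ => -(k 0 * (3 / 5)))
    (v₁ := ![4 / 5, 0, -(3 / 5), 0, 0, 0]) (v₂ := ![0, 0, 0, 1, 0, 0])
    (by norm_num) hκ ?_ ?_ ?_ (fun _ => isSymmetry_self hκ) (fun _ C hC => hC.2.symm) hm hs
    ?_ ?_ ?_ ?_ ?_ ?_ ?_ ?_ ?_ ?_ ?_ rfl rfl
  · constructor <;> simp [phi1, phi2, dotProduct, Fin.sum_univ_six]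
  · intro i
    fin_cases i
    · exact hF.isSymmetry hκ 0
    · exact isSymmetry_planeGen_of_mulVec_eq_zero hκ (hb 0) (hb 1)
    · exact isSymmetry_planeGen_of_mulVec_eq_zero hκ (hb 0) (hb 2)
    · exact isSymmetry_planeGen_of_mulVec_eq_zero hκ (hb 0) (hb 3)
    · exact isSymmetry_planeGen_of_mulVec_eq_zero hκ (hb 1) (hb 2)
    · exact isSymmetry_planeGen_of_mulVec_eq_zero hκ (hb 1) (hb 3)
  · intro a g hg
    have h1 := congrFun (congrArg Prod.fst hg)
    have h2 := congrFun (congrArg Prod.snd hg)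
    simp [flowField, normalForm_six_mulVec, Fin.sum_univ_six, rotate,
      planeGen_mulVec, Fin.forall_fin_succ, Matrix.vecHead, Matrix.vecTail,
      Fin.ext_iff] at h1 h2
    clear hg
    simp only [hm.ne', or_false] at h1
    obtain rfl : a = 0 := by simp only [h1]
    simp at h1 h2
    exact ⟨rfl, by simp only [Fin.forall_fin_succ]; simp [h1, h2]⟩
  all_goals simp [normalForm_six_mulVec, dotProduct, Fin.sum_univ_six, h1]
  · constructor <;> simp [phi1, phi2, dotProduct, Fin.sum_univ_six] <;> norm_num
  · exact hk0
  · norm_num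
  · exact hk0

end Six


/-! ### Noncommutative integrability in the degenerate cases -/

section NoncommutativeIntegrability

variable {m s : ℝ}

/-- Three generic conditions enter: ρ moves, its cubic has no multiple root, and the `Q`-parts of
position and gauge momentum are independent over the complex numbers, so that an adapted frame
exists. -/
theorem isNoncommutativelyIntegrable_five_of_eq {k : Fin 2 → ℝ} (hm : 0 < m) (hs : s ≠ 0)
    (hk0 : k 0 ≠ 0) (h01 : k 0 = k 1) :
    IsNoncommutativelyIntegrable m s (normalForm 5 k) 3 := by
  have hsp := isSplitting_five_of_eq hk0 h01
  have hF := isFrame_five k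
  refine isNoncommutativelyIntegrable_of_isMotion hm hsp.skew
    (isCompleteAlgebra_five_of_eq hm hs hk0 h01)
    (((hsp.generically_projVel (by norm_num) (a := Pi.single 0 1) (b := Pi.single 4 1)
      (by ext i; fin_cases i <;> simp [Matrix.mulVec_diagonal])
      (by ext i; fin_cases i <;> simp [Matrix.mulVec_diagonal]) (by simp) (by simp)).and
    (hsp.generically_reducedDisc (by norm_num) hs hk0 (a := Pi.single 0 1) (b := Pi.single 4 1)
      (by ext i; fin_cases i <;> simp [Matrix.mulVec_diagonal])
      (by ext i; fin_cases i <;> simp [Matrix.mulVec_diagonal]) (by simp) (by simp))).and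
    (hsp.generically_complexGram (s := s) (by norm_num) hk0
      (a := Pi.single 0 1) (b := Pi.single 2 1) (by ext i; fin_cases i <;> simp [Matrix.mulVec_diagonal]) (by ext i; fin_cases i <;> simp [Matrix.mulVec_diagonal]) (by simp) (by simp) (by simp)
      (by rw [normalForm_five_mulVec]; simp)))
    fun c hc h => ?_
  obtain ⟨⟨hv, hd⟩, hg⟩ := h
  refine hsp.exists_torus_of_corank_one hm hk0 (by simp [Matrix.trace_diagonal, Fin.sum_univ_five]; norm_num)
    (d := Pi.single 4 1) (fun u => ?_) hc hv hd hg
  ext i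
  fin_cases i <;> simp [Matrix.mulVec_diagonal]

/-- The third generic condition is now real independence of the kernel parts of position and
momentum, which span the second plane. -/
theorem isNoncommutativelyIntegrable_five_of_rank_two {k : Fin 2 → ℝ} (hm : 0 < m) (hs : s ≠ 0)
    (hk0 : k 0 ≠ 0) (h1 : k 1 = 0) :
    IsNoncommutativelyIntegrable m s (normalForm 5 k) 3 := by
  have hsp := isSplitting_five_of_rank_two hk0 h1
  have hF := isFrame_five k
  refine isNoncommutativelyIntegrable_of_isMotion hm hsp.skew
    (isCompleteAlgebra_five_of_rank_two hm hs hk0 h1)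
    (((hsp.generically_projVel (by norm_num) (a := Pi.single 0 1) (b := Pi.single 2 1)
      (by ext i; fin_cases i <;> simp [Matrix.mulVec_diagonal])
      (by ext i; fin_cases i <;> simp [Matrix.mulVec_diagonal]) (by simp) (by simp)).and
    (hsp.generically_reducedDisc (by norm_num) hs hk0 (a := Pi.single 0 1) (b := Pi.single 2 1)
      (by ext i; fin_cases i <;> simp [Matrix.mulVec_diagonal])
      (by ext i; fin_cases i <;> simp [Matrix.mulVec_diagonal]) (by simp) (by simp))).and
    (generically_gram (Q := (Matrix.diagonal ![1, 1, 0, 0, 0])) (by norm_num)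
      (a := Pi.single 2 1) (b := Pi.single 3 1) (by ext i; fin_cases i <;> simp [Matrix.mulVec_diagonal]) (by ext i; fin_cases i <;> simp [Matrix.mulVec_diagonal]) (by simp) (by simp) (by simp)))
    fun c hc h => ?_
  obtain ⟨⟨hv, hd⟩, hg⟩ := h
  refine hsp.exists_torus_of_rank_two hm ?_ (e₀ := Pi.single 0 1) (f₀ := Pi.single 1 1)
    (fun u => ?_) (by simp) (by simp) (by simp) (hF.map_e 0) (hF.map_f 0) hc hv hd hg
  · refine ext_mulVec fun u => ?_
    rw [← Matrix.mulVec_mulVec, normalForm_five_mulVec, normalForm_five_mulVec]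
    ext i
    fin_cases i <;> simp [Matrix.mulVec_diagonal, h1]
  · ext i
    fin_cases i <;> simp [Matrix.mulVec_diagonal]

theorem isNoncommutativelyIntegrable_six_of_two_eq {k : Fin 3 → ℝ} (hm : 0 < m) (hs : s ≠ 0)
    (hk0 : k 0 ≠ 0) (hk : ∀ i, 0 ≤ k i) (h01 : k 0 = k 1) (h12 : k 1 ≠ k 2) :
    IsNoncommutativelyIntegrable m s (normalForm 6 k) 4 := by
  have hsp := isSplitting_six_of_two_eq hk h01 h12
  have hF := isFrame_six k
  refine isNoncommutativelyIntegrable_of_isMotion hm hsp.skew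
    (isCompleteAlgebra_six_of_two_eq hm hs hk0 hk h01 h12)
    (((hsp.generically_projVel (by norm_num) (a := Pi.single 0 1) (b := Pi.single 4 1)
      (by ext i; fin_cases i <;> simp [Matrix.mulVec_diagonal])
      (by ext i; fin_cases i <;> simp [Matrix.mulVec_diagonal]) (by simp) (by simp)).and
    (hsp.generically_reducedDisc (by norm_num) hs hk0 (a := Pi.single 0 1) (b := Pi.single 4 1)
      (by ext i; fin_cases i <;> simp [Matrix.mulVec_diagonal])
      (by ext i; fin_cases i <;> simp [Matrix.mulVec_diagonal]) (by simp) (by simp))).and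
    (hsp.generically_complexGram (s := s) (by norm_num) hk0
      (a := Pi.single 0 1) (b := Pi.single 2 1) (by ext i; fin_cases i <;> simp [Matrix.mulVec_diagonal]) (by ext i; fin_cases i <;> simp [Matrix.mulVec_diagonal]) (by simp) (by simp) (by simp)
      (by rw [normalForm_six_mulVec]; simp)))
    fun c hc h => ?_
  obtain ⟨⟨hv, hd⟩, hg⟩ := h
  exact hsp.exists_torus_of_corank_two hm hk0 (by simp [Matrix.trace_diagonal, Fin.sum_univ_six]; norm_num)
    sub_diagonal_mulVec_six (by simp) (by simp) (by simp) (hF.map_e 2) (hF.map_f 2) hc hv hd hg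

/-- Only the adapted frame is needed here; no reduced motion has to be periodic. -/
theorem isNoncommutativelyIntegrable_six_of_eq {k : Fin 3 → ℝ} (hm : 0 < m)
    (hk0 : k 0 ≠ 0) (h01 : k 0 = k 1) (h12 : k 1 = k 2) :
    IsNoncommutativelyIntegrable m s (normalForm 6 k) 2 := by
  have hsp := isSplitting_six_of_eq hk0 h01 h12
  refine isNoncommutativelyIntegrable_of_isMotion hm hsp.skew
    (isCompleteAlgebra_six_of_eq hm hk0 h01 h12)
    (hsp.generically_complexGram (s := s) (by norm_num) hk0 (a := Pi.single 0 1)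
      (b := Pi.single 2 1) (Matrix.one_mulVec _) (Matrix.one_mulVec _) (by simp) (by simp) (by simp)
      (by rw [normalForm_six_mulVec]; simp))
    fun c hc h => hsp.exists_torus_of_eq_one hm hk0 (hc 0).1 h

theorem isNoncommutativelyIntegrable_six_of_rank_two {k : Fin 3 → ℝ} (hm : 0 < m) (hs : s ≠ 0)
    (hk0 : k 0 ≠ 0) (h1 : k 1 = 0) (h2 : k 2 = 0) :
    IsNoncommutativelyIntegrable m s (normalForm 6 k) 3 := by
  have hsp := isSplitting_six_of_rank_two hk0 h1 h2
  have hF := isFrame_six k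
  refine isNoncommutativelyIntegrable_of_isMotion hm hsp.skew
    (isCompleteAlgebra_six_of_rank_two hm hs hk0 h1 h2)
    (((hsp.generically_projVel (by norm_num) (a := Pi.single 0 1) (b := Pi.single 2 1)
      (by ext i; fin_cases i <;> simp [Matrix.mulVec_diagonal])
      (by ext i; fin_cases i <;> simp [Matrix.mulVec_diagonal]) (by simp) (by simp)).and
    (hsp.generically_reducedDisc (by norm_num) hs hk0 (a := Pi.single 0 1) (b := Pi.single 2 1)
      (by ext i; fin_cases i <;> simp [Matrix.mulVec_diagonal])
      (by ext i; fin_cases i <;> simp [Matrix.mulVec_diagonal]) (by simp) (by simp))).and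
    (generically_gram (Q := (Matrix.diagonal ![1, 1, 0, 0, 0, 0])) (by norm_num)
      (a := Pi.single 2 1) (b := Pi.single 3 1) (by ext i; fin_cases i <;> simp [Matrix.mulVec_diagonal]) (by ext i; fin_cases i <;> simp [Matrix.mulVec_diagonal]) (by simp) (by simp) (by simp)))
    fun c hc h => ?_
  obtain ⟨⟨hv, hd⟩, hg⟩ := h
  refine hsp.exists_torus_of_rank_two hm ?_ (e₀ := Pi.single 0 1) (f₀ := Pi.single 1 1)
    (fun u => ?_) (by simp) (by simp) (by simp) (hF.map_e 0) (hF.map_f 0) hc hv hd hg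
  · refine ext_mulVec fun u => ?_
    rw [← Matrix.mulVec_mulVec, normalForm_six_mulVec, normalForm_six_mulVec]
    ext i
    fin_cases i <;> simp [Matrix.mulVec_diagonal, h1, h2]
  · ext i
    fin_cases i <;> simp [Matrix.mulVec_diagonal]

end NoncommutativeIntegrability

end MagneticSphere

/-! ### Assembly of the cases -/

theorem theorem3 (m s : ℝ) (hm : 0 < m) (hs : s ≠ 0) :
    -- Liouville integrability on `T*S⁴` and `T*S⁵` for every nonzero constant field
    (∀ κ : Matrix (Fin 5) (Fin 5) ℝ, κᵀ = -κ → κ ≠ 0 →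
      MagneticSphere.IsLiouvilleIntegrable m s κ) ∧
    (∀ κ : Matrix (Fin 6) (Fin 6) ℝ, κᵀ = -κ → κ ≠ 0 →
      MagneticSphere.IsLiouvilleIntegrable m s κ) ∧
    -- the field in normal form on `S⁴`, `k = (κ₁₂, κ₃₄)`
    (∀ k : Fin 2 → ℝ, (∀ i, 0 ≤ k i) → k 0 ≠ 0 →
      MagneticSphere.HasIntegralDegrees 5 m s k ∧
      MagneticSphere.IsLiouvilleSystem m s (MagneticSphere.normalForm 5 k)
        (MagneticSphere.integrals 5 m s k) ∧
      (k 0 = k 1 →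
        MagneticSphere.IsNoncommutativelyIntegrable m s (MagneticSphere.normalForm 5 k) 3) ∧
      (k 1 = 0 →
        MagneticSphere.IsNoncommutativelyIntegrable m s (MagneticSphere.normalForm 5 k) 3)) ∧
    -- the field in normal form on `S⁵`, `k = (κ₁₂, κ₃₄, κ₅₆)`
    (∀ k : Fin 3 → ℝ, (∀ i, 0 ≤ k i) → k 0 ≠ 0 →
      MagneticSphere.HasIntegralDegrees 6 m s k ∧
      (¬ (k 0 = k 1 ∧ k 1 = k 2) →
        MagneticSphere.IsLiouvilleSystem m s (MagneticSphere.normalForm 6 k)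
          (MagneticSphere.integrals 6 m s k)) ∧
      (k 0 = k 1 → k 1 ≠ k 2 →
        MagneticSphere.IsNoncommutativelyIntegrable m s (MagneticSphere.normalForm 6 k) 4) ∧
      (k 0 = k 1 → k 1 = k 2 →
        MagneticSphere.IsNoncommutativelyIntegrable m s (MagneticSphere.normalForm 6 k) 2) ∧
      (k 1 = 0 → k 2 = 0 →
        MagneticSphere.IsNoncommutativelyIntegrable m s (MagneticSphere.normalForm 6 k) 3)) := by
  open MagneticSphere in
  refine ⟨fun κ hκ h0 => isLiouvilleIntegrable_five hm hs hκ h0,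
    fun κ hκ _ => isLiouvilleIntegrable_six hm hs hκ, fun k hk hk0 => ?_, fun k hk hk0 => ?_⟩
  · exact ⟨hasIntegralDegrees (n := 5) hm hs (0 : Fin 2) hk0, isLiouvilleSystem_five hm hs hk0,
      isNoncommutativelyIntegrable_five_of_eq hm hs hk0,
      isNoncommutativelyIntegrable_five_of_rank_two hm hs hk0⟩
  · exact ⟨hasIntegralDegrees (n := 6) hm hs (0 : Fin 3) hk0, isLiouvilleSystem_six hm hs hk,
      isNoncommutativelyIntegrable_six_of_two_eq hm hs hk0 hk,
      isNoncommutativelyIntegrable_six_of_eq hm hk0,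
      isNoncommutativelyIntegrable_six_of_rank_two hm hs hk0⟩
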